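/- **Theorem.** *Setting.* Let $X$ be a compact complex manifold of dimension $d$ and $D\subset X$ a hypersurface with normal crossings: near every point there are holomorphic coordinates $z=(z_1,\dots,z_d)$, centred at the point, in which $D=\{\prod_{j\in S}z_j=0\}$ for some $S\subset\{1,\dots,d\}$. Let $\omega$ be a quasi-meromorphic form on $X$ with poles along $D$ (written $\omega\in\mathcal E(*\bar*D)$), i.e. $\omega$ is smooth on $X\setminus D$ and locally $\omega=\widetilde\omega/(f\bar g)$ with $\widetilde\omega$ smooth and $f,g$ holomorphic without zeros outside $D$. Suppose $\omega$ has degree $k$, and let $\xi$ be a smooth form of degree $2d-k$ on $X$. Near $x\in X$, in coordinates as above, choose minimal multi-indices $J,K$ such that $z^J\bar z^K\omega$ is smooth, and set $$\kappa_x(\omega)=\#\{j: J_j\ne0\ \text{and}\ K_j\neq 0\},\quad \kappa(\omega)=\max_{x\in X}\kappa_x(\omega),\quad E(\omega)=\{x:\kappa_x(\omega)=\kappa(\omega)\}.$$ It is assumed that $E(\omega)$ is a complex submanifold of $X$ of dimension $n=d-\kappa(\omega)$. *Canonical currents.* Let $s$ be a holomorphic section of a holomorphic line bundle on $X$ with zero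 set $D$, and $|\cdot|$ a smooth hermitian metric on the bundle. If $s=z^I\phi$ near $x$ with $\phi$ holomorphic and non-vanishing (in a local holomorphic frame), let $o_{\omega,x}(s)$ be the product of the $I_j$ over all $j$ with $J_j\ne0$ and $K_j\neq0$, let $o_\omega(s)=\max_{x\in X} o_{\omega,x}(s)$, and assume that $o_{\omega,x}(s)=o_\omega(s)$ for all $x\in E(\omega)$ (for example, $s$ vanishes to order one along $D$). Let $$F(\lambda)=o_\omega(s)\int_X|s|^{2\lambda}\,\omega\wedge\xi\quad(\operatorname{Re}\lambda\gg0),\qquad \langle\{\omega\},\xi\rangle_X=\lambda^{\kappa(\omega)}F(\lambda)\big|_{\lambda=0},$$ where $F$ is continued meromorphically to a neighbourhood of $\{\operatorname{Re}\lambda\ge0\}$. For a form $\theta$ of degree $2n$ on $E(\omega)$ with poles along a hypersurface $D'\subset E(\omega)$ with normal crossings, $\langle\{\theta\},1\rangle_{E(\omega)}$ is defined in the same way, by means of a holomorphic section $t$ of a holomorphic line bundle on $E(\omega)$ with zero set $D'$, and of a metric on that bundle. *Iterated Aeppli residue.* Let $(\rho_i)$ be a finite smooth partition of unity on $X$ subordinate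 to charts with coordinates $z=z^{(i)}$ in which $D=\{\prod_{j\in S}z_j=0\}$ and, if the chart meets $E(\omega)$, $E(\omega)=\{z_j=0\ \text{for all } j\in R\}$ with $R\subset S$. In each chart meeting $E(\omega)$ write $$\omega\wedge\xi=\frac{\psi_i}{\prod_{j\in R}z_j^{J_j}\bar z_j^{K_j}}\;dz_1\wedge d\bar z_1\wedge\dots\wedge dz_d\wedge d\bar z_d$$ with integers $J_j,K_j\ge1$ for $j\in R$, and $\psi_i$ smooth where $z_j\ne0$ for all $j\in S\setminus R$. With the sum taken over these charts, put $$\mathrm{Res}_{\rho,z}(\omega\wedge\xi)=\sum_i\Big(\prod_{j\in R}\frac{1}{(J_j-1)!\,(K_j-1)!}\frac{\partial^{J_j+K_j-2}}{\partial z_j^{J_j-1}\partial\bar z_j^{K_j-1}}\Big)(\rho_i\psi_i)\Big|_{E(\omega)}\bigwedge_{j\notin R}(dz_j\wedge d\bar z_j),$$ a form of degree $2n$ on $E(\omega)$ with poles along $D'$, the set of points of $E(\omega)$ through which more than $\kappa(\omega)$ local branches of $D$ pass. Let $\mathrm{Res}_A^{E(\omega)}(\omega\wedge\xi)$ denote any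 form $\theta=\mathrm{Res}_{\rho,z}(\omega\wedge\xi)+\partial a+\bar\partial b$ with $a,b$ smooth forms on $E(\omega)$. *Claim.* For all such choices of $s$, $t$, the metrics, the partition of unity, the charts, the pole orders and the representative, both canonical pairings below exist (the integrals converge absolutely for $\operatorname{Re}\lambda$ large and have the required meromorphic continuations and values at $\lambda=0$), and $$\big\langle\{\omega\},\xi\big\rangle_X=(-2\pi i)^{\kappa(\omega)}\Big\langle\big\{\mathrm{Res}_A^{E(\omega)}(\omega\wedge\xi)\big\},1\Big\rangle_{E(\omega)}.$$ -/

import Mathlib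

open Set Filter Topology MeasureTheory Bundle
open scoped Manifold ContDiff

noncomputable section

/-! ### Differential forms on complex manifolds

A complex manifold of dimension `d` is a manifold `X` modelled on `Fin d → ℂ` which is analytic
over `ℂ`.  Real smoothness is smoothness for the same charts, over `ℝ`. -/

/-- A complex valued differential form of degree `k` (no regularity required): at every point a
real alternating `k`-linear map on the tangent space. -/
abbrev DForm (d k : ℕ) (X : Type*) [TopologicalSpace X] [ChartedSpace (Fin d → ℂ) X] :=
  ∀ x : X, (TangentSpace 𝓘(ℝ, Fin d → ℂ) x) [⋀^Fin k]→ₗ[ℝ] ℂ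

/-- The analytic structure over `ℂ` induces the real smooth structure. -/
theorem isManifold_real {d : ℕ} (X : Type*) [TopologicalSpace X] [ChartedSpace (Fin d → ℂ) X]
    [IsManifold 𝓘(ℂ, Fin d → ℂ) ω X] : IsManifold 𝓘(ℝ, Fin d → ℂ) ∞ X := by
  apply isManifold_of_contDiffOn
  intro e e' he he'
  have h := (contDiffGroupoid ω 𝓘(ℂ, Fin d → ℂ)).compatible he he'
  rw [contDiffGroupoid, mem_groupoid_of_pregroupoid] at h
  have h1 := h.1
  simp only [contDiffPregroupoid] at h1
  have h2 := (ContDiffOn.restrict_scalars ℝ h1).of_le (m := ∞) le_top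
  simpa using h2

section Forms

variable {d k : ℕ} {X : Type*} [TopologicalSpace X] [ChartedSpace (Fin d → ℂ) X]

/-- The expression of a form in a chart: its pull-back under the inverse of the chart. -/
def chartRep (φ : OpenPartialHomeomorph X (Fin d → ℂ)) (α : DForm d k X) (u : Fin d → ℂ) :
    (Fin d → ℂ) [⋀^Fin k]→ₗ[ℝ] ℂ :=
  (α (φ.symm u)).compLinearMap
    (mfderiv 𝓘(ℝ, Fin d → ℂ) 𝓘(ℝ, Fin d → ℂ) φ.symm u).toLinearMap

/-- A form is smooth on an (open) set if its coefficients in charts are smooth. -/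
def SmoothFormOn (α : DForm d k X) (U : Set X) : Prop :=
  ∀ x ∈ U, ∀ v : Fin k → (Fin d → ℂ),
    ContDiffAt ℝ ∞ (fun u ↦ chartRep (chartAt (Fin d → ℂ) x) α u v) (chartAt (Fin d → ℂ) x x)

/-- The exterior product of two alternating forms. -/
def altWedge {V : Type*} [AddCommGroup V] [Module ℝ V] {k l : ℕ}
    (a : V [⋀^Fin k]→ₗ[ℝ] ℂ) (b : V [⋀^Fin l]→ₗ[ℝ] ℂ) : V [⋀^Fin (k + l)]→ₗ[ℝ] ℂ :=
  ((LinearMap.mul' ℝ ℂ).compAlternatingMap (a.domCoprod b)).domDomCongr finSumFinEquiv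

/-- The exterior product of forms of complementary degrees, a form of top degree. -/
def topWedge {k l : ℕ} (hkl : k + l = 2 * d) (α : DForm d k X) (ξ : DForm d l X) :
    DForm d (2 * d) X :=
  fun x ↦ (altWedge (α x) (ξ x)).domDomCongr (finCongr hkl)

/-- The function `1` as a form of degree `0`. -/
def oneForm : DForm d 0 X := fun _ ↦ AlternatingMap.constOfIsEmpty ℝ _ (Fin 0) (1 : ℂ)

/-- The positively oriented real basis `e₁, i e₁, e₂, i e₂, …` of `ℂᵈ`. -/
def realBasis (d : ℕ) (a : Fin (2 * d)) : Fin d → ℂ :=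
  Pi.single ⟨a / 2, by omega⟩ (if (a : ℕ) % 2 = 0 then 1 else Complex.I)

/-- The exterior product `a₁ ∧ … ∧ aₘ` of complex valued covectors. -/
def covectorWedge {V : Type*} [AddCommGroup V] [Module ℝ V] {m : ℕ} (a : Fin m → (V →ₗ[ℝ] ℂ)) :
    V [⋀^Fin m]→ₗ[ℝ] ℂ :=
  AlternatingMap.compLinearMap
    { (Matrix.detRowAlternating (n := Fin m) (R := ℂ)).toMultilinearMap.restrictScalars ℝ with
      map_eq_zero_of_eq' := fun v _ _ h hij ↦
        (Matrix.detRowAlternating (n := Fin m) (R := ℂ)).map_eq_zero_of_eq v h hij }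
    (LinearMap.pi a)

/-- The covectors `dz_{σ 1}, dz̄_{σ 1}, dz_{σ 2}, dz̄_{σ 2}, …` on `ℂᵈ`. -/
def dzCovector {n d : ℕ} (σ : Fin n → Fin d) (a : Fin (2 * n)) : (Fin d → ℂ) →ₗ[ℝ] ℂ :=
  (if (a : ℕ) % 2 = 0 then LinearMap.id else Complex.conjAe.toLinearMap) ∘ₗ
    LinearMap.proj (σ ⟨a / 2, by omega⟩)

/-- The form `dz_{σ 1} ∧ dz̄_{σ 1} ∧ dz_{σ 2} ∧ dz̄_{σ 2} ∧ …` on `ℂᵈ`. -/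
def dzForm {n d : ℕ} (σ : Fin n → Fin d) : (Fin d → ℂ) [⋀^Fin (2 * n)]→ₗ[ℝ] ℂ :=
  covectorWedge (dzCovector σ)

end Forms

/-! ### Integration of forms of top degree -/

section Integration

variable {d : ℕ} {X : Type*} [TopologicalSpace X] [ChartedSpace (Fin d → ℂ) X]

theorem exists_chartPartition (d : ℕ) (X : Type*) [TopologicalSpace X] [T2Space X]
    [CompactSpace X] [ChartedSpace (Fin d → ℂ) X] [IsManifold 𝓘(ℂ, Fin d → ℂ) ω X] :
    ∃ f : SmoothPartitionOfUnity X 𝓘(ℝ, Fin d → ℂ) X univ,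
      f.IsSubordinate (fun x ↦ (chartAt (Fin d → ℂ) x).source) := by
  have := isManifold_real (d := d) X
  exact SmoothPartitionOfUnity.exists_isSubordinate_chartAt_source 𝓘(ℝ, Fin d → ℂ) X

variable [T2Space X] [CompactSpace X] [IsManifold 𝓘(ℂ, Fin d → ℂ) ω X]

/-- A smooth partition of unity subordinate to the charts of the atlas. -/
def chartPartition (d : ℕ) (X : Type*) [TopologicalSpace X] [T2Space X]
    [CompactSpace X] [ChartedSpace (Fin d → ℂ) X] [IsManifold 𝓘(ℂ, Fin d → ℂ) ω X] :
    SmoothPartitionOfUnity X 𝓘(ℝ, Fin d → ℂ) X univ :=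
  (exists_chartPartition d X).choose

/-- The part of the form `η` cut out by the `p`-th function of the partition of unity, as a
function on the target of the `p`-th chart. -/
def localIntegrand (η : DForm d (2 * d) X) (p : X) (u : Fin d → ℂ) : ℂ :=
  (chartPartition d X p ((chartAt (Fin d → ℂ) p).symm u) : ℂ) *
    chartRep (chartAt (Fin d → ℂ) p) η u (realBasis d)

/-- Absolute integrability of a form of top degree. -/
def FormIntegrable (η : DForm d (2 * d) X) : Prop :=
  ∀ p : X, IntegrableOn (localIntegrand η p) (chartAt (Fin d → ℂ) p).target

/-- The integral of a form of top degree over a compact complex manifold with its complex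
orientation. -/
def formIntegral (η : DForm d (2 * d) X) : ℂ :=
  ∑ᶠ p : X, ∫ u in (chartAt (Fin d → ℂ) p).target, localIntegrand η p u

end Integration

/-! ### Normal crossings and quasi-meromorphic forms -/

section Poles

variable {d k : ℕ} {X : Type*} [TopologicalSpace X] [ChartedSpace (Fin d → ℂ) X]

/-- `φ` is a holomorphic chart centred at `x` in which `D` is given by `∏_{j ∈ S} z_j = 0`. -/
def IsNCChart (D : Set X) (x : X) (φ : OpenPartialHomeomorph X (Fin d → ℂ))
    (S : Finset (Fin d)) : Prop :=
  φ ∈ IsManifold.maximalAtlas 𝓘(ℂ, Fin d → ℂ) ω X ∧ x ∈ φ.source ∧ φ x = 0 ∧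
    ∀ y ∈ φ.source, y ∈ D ↔ ∃ j ∈ S, φ y j = 0

/-- `D` is a hypersurface with normal crossings. -/
def IsNormalCrossing (d : ℕ) {X : Type*} [TopologicalSpace X] [ChartedSpace (Fin d → ℂ) X]
    (D : Set X) : Prop :=
  ∀ x : X, ∃ (φ : OpenPartialHomeomorph X (Fin d → ℂ)) (S : Finset (Fin d)), IsNCChart D x φ S

/-- The number of local branches of `D` through `x`. -/
def branchCount (d : ℕ) {X : Type*} [TopologicalSpace X] [ChartedSpace (Fin d → ℂ) X]
    (D : Set X) (x : X) : ℕ :=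
  sInf {m | ∃ (φ : OpenPartialHomeomorph X (Fin d → ℂ)) (S : Finset (Fin d)),
    IsNCChart D x φ S ∧ m = S.card}

/-- The quasi-meromorphic forms with poles along `D`: forms that are smooth outside `D` and locally
of the form `β / (f ḡ)`, with `β` smooth and `f`, `g` holomorphic without zeros outside `D`.  The
values of the form on `D` itself are irrelevant. -/
def IsQuasiMeromorphic (D : Set X) (α : DForm d k X) : Prop :=
  SmoothFormOn α Dᶜ ∧ ∀ x : X, ∃ U : Set X, IsOpen U ∧ x ∈ U ∧
    ∃ (f g : X → ℂ) (β : DForm d k X),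
      MDifferentiableOn 𝓘(ℂ, Fin d → ℂ) 𝓘(ℂ, ℂ) f U ∧
      MDifferentiableOn 𝓘(ℂ, Fin d → ℂ) 𝓘(ℂ, ℂ) g U ∧
      (∀ y ∈ U, f y = 0 → y ∈ D) ∧ (∀ y ∈ U, g y = 0 → y ∈ D) ∧
      SmoothFormOn β U ∧ ∀ y ∈ U, y ∉ D → β y = (f y * starRingEnd ℂ (g y)) • α y

/-- `z^J z̄^K α` extends smoothly across `D` near `x`, where `z` are the coordinates of `φ` and `J`,
`K` only involve the coordinates `z_j`, `j ∈ S`. -/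
def PoleBound (D : Set X) (α : DForm d k X) (x : X) (φ : OpenPartialHomeomorph X (Fin d → ℂ))
    (S : Finset (Fin d)) (J K : Fin d → ℕ) : Prop :=
  (∀ j ∉ S, J j = 0 ∧ K j = 0) ∧ ∃ U : Set X, IsOpen U ∧ x ∈ U ∧ U ⊆ φ.source ∧ ∃ β : DForm d k X, SmoothFormOn β U ∧
    ∀ y ∈ U, y ∉ D → β y = (∏ j, (φ y j ^ J j * starRingEnd ℂ (φ y j) ^ K j)) • α y

/-- The coordinates along which both pole orders are positive. -/
def commonPoles (J K : Fin d → ℕ) : Finset (Fin d) :=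
  Finset.univ.filter fun j ↦ J j ≠ 0 ∧ K j ≠ 0

/-- `κ_x(α)`: the number of `j` with `J_j ≠ 0` and `K_j ≠ 0` for minimal `J`, `K` such that
`z^J z̄^K α` is smooth near `x`.  (There is a smallest admissible pair, and it minimises this
number.) -/
def kappaAt (D : Set X) (α : DForm d k X) (x : X) : ℕ :=
  sInf {m | ∃ (φ : OpenPartialHomeomorph X (Fin d → ℂ)) (S : Finset (Fin d)) (J K : Fin d → ℕ),
    IsNCChart D x φ S ∧ PoleBound D α x φ S J K ∧ m = (commonPoles J K).card}

/-- `κ(α)`, the maximum of the numbers `κ_x(α)`. -/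
def kappa (D : Set X) (α : DForm d k X) : ℕ := ⨆ x, kappaAt D α x

/-- `E(α)`, the deepest stratum: the points where `κ(α)` hypersurfaces meet along each of which
`α` has both a holomorphic and an anti-holomorphic pole. -/
def deepStratum (D : Set X) (α : DForm d k X) : Set X := {x | kappaAt D α x = kappa D α}

end Poles

/-! ### Line bundles, sections, metrics -/

section LineBundles

variable {d k l : ℕ} {X : Type*} [TopologicalSpace X] [ChartedSpace (Fin d → ℂ) X]
  (L : X → Type*) [∀ x, TopologicalSpace (L x)] [∀ x, AddCommGroup (L x)] [∀ x, Module ℂ (L x)]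
  [TopologicalSpace (TotalSpace ℂ L)] [FiberBundle ℂ L] [VectorBundle ℂ ℂ L]

/-- A smooth (hermitian) metric on a complex line bundle. -/
structure LineMetric (d : ℕ) {X : Type*} [TopologicalSpace X] [ChartedSpace (Fin d → ℂ) X]
    (L : X → Type*) [∀ x, TopologicalSpace (L x)] [∀ x, AddCommGroup (L x)]
    [∀ x, Module ℂ (L x)] [TopologicalSpace (TotalSpace ℂ L)] [FiberBundle ℂ L]
    [VectorBundle ℂ ℂ L] where
  /-- The length of a vector. -/
  len : ∀ x, L x → ℝ
  len_smul : ∀ (x : X) (c : ℂ) (v : L x), len x (c • v) = ‖c‖ * len x v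
  len_pos : ∀ (x : X) (v : L x), v ≠ 0 → 0 < len x v
  smooth : ∀ x₀ : X, ContMDiffOn 𝓘(ℝ, Fin d → ℂ) 𝓘(ℝ, ℝ) ∞
    (fun x ↦ len x ((trivializationAt ℂ L x₀).symm x 1)) (trivializationAt ℂ L x₀).baseSet

variable {L}

/-- Holomorphic sections of a holomorphic line bundle. -/
def IsHolSection (d : ℕ) {X : Type*} [TopologicalSpace X] [ChartedSpace (Fin d → ℂ) X]
    {L : X → Type*} [∀ x, TopologicalSpace (L x)] [∀ x, AddCommGroup (L x)]
    [∀ x, Module ℂ (L x)] [TopologicalSpace (TotalSpace ℂ L)] [FiberBundle ℂ L]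
    [VectorBundle ℂ ℂ L] (s : ∀ x, L x) : Prop :=
  ContMDiff 𝓘(ℂ, Fin d → ℂ) (𝓘(ℂ, Fin d → ℂ).prod 𝓘(ℂ, ℂ)) ω (fun x ↦ TotalSpace.mk' ℂ x (s x))

/-- Near `x`, the section `s` is `z^I` times a non-vanishing holomorphic function in a local
holomorphic frame. -/
def SectionOrder (s : ∀ x, L x) (x : X) (φ : OpenPartialHomeomorph X (Fin d → ℂ))
    (I : Fin d → ℕ) : Prop :=
  ∃ (U : Set X) (h : X → ℂ), IsOpen U ∧ x ∈ U ∧ U ⊆ φ.source ∧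
    MDifferentiableOn 𝓘(ℂ, Fin d → ℂ) 𝓘(ℂ, ℂ) h U ∧ (∀ y ∈ U, h y ≠ 0) ∧
    ∀ y ∈ U, (trivializationAt ℂ L x (TotalSpace.mk' ℂ y (s y))).2 = (∏ j, φ y j ^ I j) * h y

/-- `o_{α,x}(s)`: the product of the vanishing orders of `s` along the local hypersurfaces through
`x` along which `α` has both a holomorphic and an anti-holomorphic pole. -/
def orderAt (D : Set X) (α : DForm d k X) (s : ∀ x, L x) (x : X) : ℕ :=
  sInf {m | ∃ (φ : OpenPartialHomeomorph X (Fin d → ℂ)) (S : Finset (Fin d))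
    (J K I : Fin d → ℕ), IsNCChart D x φ S ∧ PoleBound D α x φ S J K ∧
      (commonPoles J K).card = kappaAt D α x ∧ SectionOrder s x φ I ∧
      m = ∏ j ∈ commonPoles J K, I j}

/-- `o_α(s)`, the maximum of the numbers `o_{α,x}(s)`. -/
def orderMax (D : Set X) (α : DForm d k X) (s : ∀ x, L x) : ℕ := ⨆ x, orderAt D α s x

/-! ### Canonical currents -/

/-- The form `|s|^{2λ} α ∧ ξ`. -/
def regularised (hkl : k + l = 2 * d) (α : DForm d k X) (ξ : DForm d l X) (s : ∀ x, L x)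
    (h : LineMetric d L) (lam : ℂ) : DForm d (2 * d) X :=
  fun x ↦ ((h.len x (s x) : ℂ) ^ (2 * lam)) • topWedge hkl α ξ x

/-- `⟨{α}, ξ⟩ = c`: the function `F(λ) = o_α(s) ∫_X |s|^{2λ} α ∧ ξ`, defined for `Re λ` large, has
a meromorphic continuation past the origin, and `λ^{κ(α)} F(λ)` has the value `c` at `λ = 0`. -/
def HasCanonicalValue [T2Space X] [CompactSpace X] [IsManifold 𝓘(ℂ, Fin d → ℂ) ω X]
    (D : Set X) (hkl : k + l = 2 * d) (α : DForm d k X) (ξ : DForm d l X) (s : ∀ x, L x)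
    (h : LineMetric d L) (c : ℂ) : Prop :=
  ∃ ε > (0 : ℝ), ∃ F : ℂ → ℂ, MeromorphicOn F {lam | -ε < lam.re} ∧
    (∃ R : ℝ, ∀ lam : ℂ, R < lam.re →
      FormIntegrable (regularised hkl α ξ s h lam) ∧
      F lam = (orderMax D α s : ℂ) * formIntegral (regularised hkl α ξ s h lam)) ∧
    Tendsto (fun lam ↦ lam ^ kappa D α * F lam) (𝓝[≠] 0) (𝓝 c)

end LineBundles

/-! ### The iterated Aeppli residue -/

/-- The Wirtinger derivative `∂/∂z_j`. -/
def wirtinger {d : ℕ} (j : Fin d) (f : (Fin d → ℂ) → ℂ) (z : Fin d → ℂ) : ℂ :=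
  (fderiv ℝ f z (Pi.single j 1) - Complex.I * fderiv ℝ f z (Pi.single j Complex.I)) / 2

/-- The Wirtinger derivative `∂/∂z̄_j`. -/
def wirtingerBar {d : ℕ} (j : Fin d) (f : (Fin d → ℂ) → ℂ) (z : Fin d → ℂ) : ℂ :=
  (fderiv ℝ f z (Pi.single j 1) + Complex.I * fderiv ℝ f z (Pi.single j Complex.I)) / 2

/-- The operator `1/((m-1)!(n-1)!) ∂^{m+n-2}/∂z_j^{m-1}∂z̄_j^{n-1}` of a single residue along
`z_j = 0`, for pole orders `m` and `n`. -/
def residueStep {d : ℕ} (j : Fin d) (m n : ℕ) (f : (Fin d → ℂ) → ℂ) : (Fin d → ℂ) → ℂ :=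
  fun z ↦ (((m - 1).factorial * (n - 1).factorial : ℕ) : ℂ)⁻¹ *
    ((wirtinger j)^[m - 1] ((wirtingerBar j)^[n - 1] f)) z

/-- The iteration of the operators of the single residues over all `j ∈ R`.  (They commute with
each other and with the restrictions to the other coordinate hyperplanes, so that restricting once
at the end gives the iterated residue.) -/
def residueIter {d : ℕ} (R : Finset (Fin d)) (J K : Fin d → ℕ) (f : (Fin d → ℂ) → ℂ) :
    (Fin d → ℂ) → ℂ :=
  (R.sort (· ≤ ·)).foldr (fun j g ↦ residueStep j (J j) (K j) g) f

section Residue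

variable {d n : ℕ} {X : Type*} [TopologicalSpace X] [ChartedSpace (Fin d → ℂ) X]

/-- The choices used to represent the iterated residue on `E` of a form `η` of top degree with
poles along `D`, where `E` has dimension `n`: a finite partition of unity subordinate to charts in
which `D` is `∏_{j ∈ S} z_j = 0` and `E` (if the chart meets it) is `{z_j = 0 ∀ j ∈ R}` with
`R ⊆ S`, together with pole orders `J`, `K` along the hypersurfaces `z_j = 0`, `j ∈ R`. -/
structure ResidueData (n : ℕ) (D E : Set X) (η : DForm d (2 * d) X) (ι : Type*) [Fintype ι] where
  /-- The partition of unity. -/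
  ρ : SmoothPartitionOfUnity ι 𝓘(ℝ, Fin d → ℂ) X univ
  /-- The coordinates. -/
  φ : ι → OpenPartialHomeomorph X (Fin d → ℂ)
  mem_atlas : ∀ i, φ i ∈ IsManifold.maximalAtlas 𝓘(ℂ, Fin d → ℂ) ω X
  subordinate : ρ.IsSubordinate (fun i ↦ (φ i).source)
  /-- The coordinates whose zero sets make up `D`. -/
  S : ι → Finset (Fin d)
  mem_D : ∀ i, ∀ x ∈ (φ i).source, x ∈ D ↔ ∃ j ∈ S i, φ i x j = 0
  /-- The coordinates tangential to `E`, listed. -/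
  tang : ι → Fin n ↪ Fin d
  /-- The coordinates normal to `E`. -/
  R : ι → Finset (Fin d)
  R_eq : ∀ i, R i = (Finset.univ.map (tang i))ᶜ
  R_subset : ∀ i, (E ∩ (φ i).source).Nonempty → R i ⊆ S i
  mem_E : ∀ i, (E ∩ (φ i).source).Nonempty →
    ∀ x ∈ (φ i).source, x ∈ E ↔ ∀ j ∈ R i, φ i x j = 0
  /-- The orders of the holomorphic poles. -/
  J : ι → Fin d → ℕ
  /-- The orders of the anti-holomorphic poles. -/
  K : ι → Fin d → ℕ
  J_pos : ∀ i, ∀ j ∈ R i, 1 ≤ J i j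
  K_pos : ∀ i, ∀ j ∈ R i, 1 ≤ K i j
  /-- The numerator `ψ` in `η = ψ ∏_{j ∈ R} z_j^{-J_j} z̄_j^{-K_j} dz_1 ∧ dz̄_1 ∧ …`. -/
  ψ : ι → (Fin d → ℂ) → ℂ
  ψ_smooth : ∀ i, (E ∩ (φ i).source).Nonempty →
    ContDiffOn ℝ ∞ (ψ i) {z | z ∈ (φ i).target ∧ ∀ j ∈ S i \ R i, z j ≠ 0}
  ψ_eq : ∀ i, (E ∩ (φ i).source).Nonempty → ∀ z ∈ (φ i).target, (∀ j ∈ S i, z j ≠ 0) →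
    (∏ j ∈ R i, (z j ^ J i j * starRingEnd ℂ (z j) ^ K i j)) • chartRep (φ i) η z =
      ψ i z • dzForm (id : Fin d → Fin d)

open Classical in
/-- The form on `Y` representing the iterated residue, where `f : Y → X` parametrises `E`: the sum
over `i` of the pull-backs of
`(∏_{j ∈ R} 1/((J_j-1)!(K_j-1)!) ∂_j^{J_j-1} ∂̄_j^{K_j-1}) (ρ_i ψ_i) ∧_{j ∉ R} (dz_j ∧ dz̄_j)`. -/
def ResidueData.form {D E : Set X} {η : DForm d (2 * d) X} {ι : Type*} [Fintype ι]
    (P : ResidueData n D E η ι) {Y : Type*} [TopologicalSpace Y] [ChartedSpace (Fin n → ℂ) Y]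
    (f : Y → X) : DForm n (2 * n) Y :=
  fun y ↦ ∑ i, if f y ∈ (P.φ i).source then
    residueIter (P.R i) (P.J i) (P.K i)
        (fun z ↦ (P.ρ i ((P.φ i).symm z) : ℂ) * P.ψ i z) (P.φ i (f y)) •
      (dzForm (P.tang i)).compLinearMap
        (mfderiv 𝓘(ℝ, Fin n → ℂ) 𝓘(ℝ, Fin d → ℂ) (fun y' ↦ P.φ i (f y')) y).toLinearMap
    else 0

/-- `f` is a holomorphic embedding of the compact manifold `Y`. -/
def IsHolEmbedding {Y : Type*} [TopologicalSpace Y] [ChartedSpace (Fin n → ℂ) Y] (f : Y → X) :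
    Prop :=
  ContMDiff 𝓘(ℂ, Fin n → ℂ) 𝓘(ℂ, Fin d → ℂ) ω f ∧ Function.Injective f ∧
    ∀ y, Function.Injective (mfderiv 𝓘(ℂ, Fin n → ℂ) 𝓘(ℂ, Fin d → ℂ) f y)

/-- The trace on `Y` of the components of `D` that do not contain the image of `f`, if this image
is contained in `κ` components. -/
def residualDivisor (d : ℕ) {X : Type*} [TopologicalSpace X] [ChartedSpace (Fin d → ℂ) X]
    (D : Set X) (κ : ℕ) {Y : Type*} (f : Y → X) : Set Y :=
  {y | κ < branchCount d D (f y)}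

/-- `dγ` at the point `y`. -/
def extDerivAt {m : ℕ} {Y : Type*} [TopologicalSpace Y] [ChartedSpace (Fin n → ℂ) Y]
    (γ : DForm n m Y) (y : Y) (v : Fin (m + 1) → (Fin n → ℂ)) : ℂ :=
  ∑ a : Fin (m + 1), (-1 : ℂ) ^ (a : ℕ) *
    fderiv ℝ (fun u ↦ chartRep (chartAt (Fin n → ℂ) y) γ u (a.removeNth v))
      (chartAt (Fin n → ℂ) y y) (v a)

/-- Off `D`, the forms `θ` and `τ` of bidegree `(n,n)` differ by `∂α + ∂̄β` with `α` and `β` smooth on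
`Y`.  Since `∂α + ∂̄β = d(α + β)` for `α`, `β` of bidegrees `(n-1,n)` and `(n,n-1)`, and every form
of degree `2n-1` is such a sum `α + β`, this is the exactness of `θ - τ` for `d`.  (For `n = 0` there
are no forms of degree `-1`.) -/
def AeppliCohomologous {Y : Type*} [TopologicalSpace Y] [ChartedSpace (Fin n → ℂ) Y]
    (D : Set Y) (θ τ : DForm n (2 * n) Y) : Prop :=
  (∀ y ∉ D, θ y = τ y) ∨
  ∃ (m : ℕ) (hm : m + 1 = 2 * n) (γ : DForm n m Y), SmoothFormOn γ univ ∧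
    ∀ y ∉ D, ∀ v : Fin (2 * n) → (Fin n → ℂ),
      θ y v = τ y v + extDerivAt γ y (fun a ↦ v (Fin.cast hm a))

end Residue

end

/-!
Both pairings are local, so that the two forms can be localised by a partition of unity and compared
chart by chart. A holomorphic function whose zeros lie on the normal crossings divisor `D` is
locally a monomial times a unit (`exists_monomial_factor`, `IsNCChart.exists_monomial_factor`).
Hence near each point `α ∧ ξ` has the coefficient `b / (z^J z̄^K)` with `b` smooth, the section
satisfies `|s| = ∏ |z_j|^{I_j} e^v` with `v` smooth, and the regularised integral becomes
`∫ ∏ |z_j|^{2λ I_j} z_j^{-J_j} z̄_j^{-K_j} e^{2λv} χ`, called `singInt` below.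

*The local formula.* Integrating by parts in `∂/∂z_j` and `∂/∂z̄_j` lowers the pole orders, at the
cost of a factor `1 / (λ I_j - a)` each time, where `a` is the order that remains
(`singInt_recursion`, `HasLeading.of_recursion`). As long as `a ≥ 1` this factor is regular at
`λ = 0`, and lowering all orders to at most one produces the operators
`∂^{J_j-1} ∂̄^{K_j-1} / ((J_j-1)! (K_j-1)!)` of the iterated residue (`hasLeading_residueList`). A
coordinate with simple poles of both types allows one more integration by parts, with `a = 0`: it
contributes a pole `1 / (λ I_j)`, and by the Cauchy–Pompeiu formula the remaining integral over
`z_j` is `π` times the restriction to `z_j = 0` (`hasLeading_double_poles`). Once no coordinate has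
poles of both types, the integral is regular at `λ = 0`, since `1/z_j` and `1/z̄_j` are locally
integrable. Altogether the order of the pole is at most the number of coordinates with poles of both
types, and the leading coefficient is `∏ π / I_j` times a principal value of the iterated residue
(`hasLeading_singInt`). The product of the `I_j` cancels against `o_α(s)`.

*Comparison with the submanifold.* At a point outside the deepest stratum `E(α)` the pole is of
order less than `κ(α)` (`exists_formLeading_kappaAt`) and contributes nothing. At a point of `E(α)`
the coordinates with poles of both types are exactly the equations of `E(α)`
(`commonPoles_eq_of_mem_deepStratum`), the remaining coordinates form a chart of `E(α)` adapted to
the residual divisor (`isAdapted_sliceChart`), and the residue has poles of only one type along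
each of them. Its own regularised integral is therefore regular at `λ = 0`, with the same principal
value (`hasLeading_singInt_of_one_type`), for every choice of the section `t` and of the metric; and
its canonical pairing is that value, because its `κ` is zero and the order of `t` is an empty
product (`ResidueData.kappaAt_eq_zero_and_orderAt_eq_one`). Since `dz ∧ dz̄ = -2i dx ∧ dy`, passing
from `d` to `n = d - κ(α)` coordinates changes the constant by `(-2i)^{κ(α)}`, and together with the
powers of `π` this is `(-2πi)^{κ(α)}` (`exists_formLeading_pair_of_slice`).

*Independence of the choices.* Raising the pole orders and multiplying the numerator by the
corresponding monomial does not change the iterated residue on the stratum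
(`residueIter_mul_monomial`); this compares the pole orders of the residue with the minimal ones,
and shows that functions of the remaining coordinates can be taken out of the residue
(`residueIter_relation`). Replacing the residue by an Aeppli-equivalent form adds `∂a + ∂̄b`, which
is exact, and the regularised integral of a smooth exact form vanishes at `λ = 0` by Stokes' theorem
(`formLeading_extDerivForm`). Finally, the numbers `κ_x(α)` and `o_{α,x}(s)` are computed in any
chart adapted to `D`, because the local equations of the branches in two charts agree up to units
and a permutation (`IsNCChart.exists_matching`, `IsAdapted.exists_minimal_orders`).
-/


/-! ### Holomorphic functions of several variables -/

/-- Cauchy's estimate for the derivative: the classical estimate on complex lines through `z`, on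
discs of half the radius. -/
theorem norm_fderiv_le_of_ball {E : Type*} [NormedAddCommGroup E] [NormedSpace ℂ E]
    {f : E → ℂ} {z : E} {r M : ℝ} (hr : 0 < r) (hM : 0 ≤ M)
    (hd : DifferentiableOn ℂ f (Metric.ball z r))
    (hb : ∀ w ∈ Metric.ball z r, ‖f w‖ ≤ M) : ‖fderiv ℂ f z‖ ≤ 2 * M / r := by
  refine ContinuousLinearMap.opNorm_le_bound _ (by positivity) fun v ↦ ?_
  rcases eq_or_ne v 0 with rfl | hv
  · simp
  have hv' : 0 < ‖v‖ := norm_pos_iff.2 hv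
  have hmem : ∀ t ∈ Metric.closedBall (0 : ℂ) (r / (2 * ‖v‖)), z + t • v ∈ Metric.ball z r := by
    intro t ht
    rw [mem_closedBall_zero_iff, le_div_iff₀ (by positivity)] at ht
    rw [Metric.mem_ball, dist_self_add_left, norm_smul]
    linarith
  have hda : ∀ t ∈ Metric.closedBall (0 : ℂ) (r / (2 * ‖v‖)),
      HasDerivAt (fun t : ℂ ↦ f (z + t • v)) (fderiv ℂ f (z + t • v) v) t := by
    intro t ht
    have h1 := ((hd _ (hmem t ht)).differentiableAt
      (Metric.isOpen_ball.mem_nhds (hmem t ht))).hasFDerivAt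
    have h2 : HasDerivAt (fun t : ℂ ↦ z + t • v) v t := by
      simpa using ((hasDerivAt_id t).smul_const v).const_add z
    exact h1.comp_hasDerivAt t h2
  have h0 : (0 : ℝ) < r / (2 * ‖v‖) := by positivity
  have key := Complex.norm_deriv_le_of_forall_mem_sphere_norm_le (c := 0) (C := M)
    (f := fun t : ℂ ↦ f (z + t • v)) h0
    (DifferentiableOn.diffContOnCl (fun t ht ↦ by
      rw [closure_ball _ h0.ne'] at ht
      exact (hda t ht).differentiableAt.differentiableWithinAt))
    (fun t ht ↦ hb _ (hmem t (Metric.sphere_subset_closedBall ht)))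
  rw [(hda 0 (by simp [h0.le])).deriv] at key
  simp only [zero_smul, add_zero] at key
  refine key.trans (le_of_eq ?_)
  field_simp

/-- Holomorphic dependence of an integral on parameters: no assumption on derivatives is needed,
since they are controlled by the Cauchy estimates. -/
theorem differentiableAt_integral_of_dominated {α : Type*} [MeasurableSpace α] {μ : Measure α}
    {E : Type*} [NormedAddCommGroup E] [NormedSpace ℂ E] [FiniteDimensional ℂ E]
    {f : E → α → ℂ} {z₀ : E} {r : ℝ} (hr : 0 < r) {bound : α → ℝ}
    (hm : ∀ z ∈ Metric.ball z₀ r, AEStronglyMeasurable (f z) μ)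
    (hd : ∀ᵐ a ∂μ, DifferentiableOn ℂ (fun z ↦ f z a) (Metric.ball z₀ r))
    (hb : ∀ᵐ a ∂μ, ∀ z ∈ Metric.ball z₀ r, ‖f z a‖ ≤ bound a)
    (hi : Integrable bound μ) : DifferentiableAt ℂ (fun z ↦ ∫ a, f z a ∂μ) z₀ := by
  have hz₀ : z₀ ∈ Metric.ball z₀ r := Metric.mem_ball_self hr
  have hsub : ∀ z ∈ Metric.ball z₀ (r / 2), Metric.ball z (r / 2) ⊆ Metric.ball z₀ r := by
    intro z hz w hw
    rw [Metric.mem_ball] at *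
    linarith [dist_triangle w z z₀]
  -- measurability of the derivative: it is a limit of difference quotients
  have hmeas_v : ∀ v : E, AEStronglyMeasurable (fun a ↦ fderiv ℂ (fun z ↦ f z a) z₀ v) μ := by
    intro v
    obtain ⟨N, hN⟩ : ∃ N : ℕ, ∀ n ≥ N, z₀ + ((n : ℂ) + 1)⁻¹ • v ∈ Metric.ball z₀ r := by
      have : Tendsto (fun n : ℕ ↦ z₀ + ((n : ℂ) + 1)⁻¹ • v) atTop (𝓝 (z₀ + (0 : ℂ) • v)) := by
        have h : Tendsto (fun n : ℕ ↦ ((n : ℂ) + 1)⁻¹) atTop (𝓝 0) := by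
          simpa [one_div] using tendsto_one_div_add_atTop_nhds_zero_nat (𝕜 := ℂ)
        exact tendsto_const_nhds.add (h.smul (tendsto_const_nhds (x := v)))
      rw [zero_smul, add_zero] at this
      exact eventually_atTop.1 (this.eventually (Metric.isOpen_ball.mem_nhds hz₀))
    refine aestronglyMeasurable_of_tendsto_ae atTop
      (f := fun (n : ℕ) a ↦ (((n + N : ℕ) : ℂ) + 1) *
        (f (z₀ + (((n + N : ℕ) : ℂ) + 1)⁻¹ • v) a - f z₀ a)) (fun n ↦ ?_) ?_
    · exact ((hm _ (hN _ (Nat.le_add_left _ _))).sub (hm _ hz₀)).const_mul _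
    · filter_upwards [hd] with a ha
      have h1 := ((ha _ hz₀).differentiableAt (Metric.isOpen_ball.mem_nhds hz₀)).hasFDerivAt
      have h2 : HasDerivAt (fun t : ℂ ↦ f (z₀ + t • v) a) (fderiv ℂ (fun z ↦ f z a) z₀ v) 0 := by
        have h3 : HasDerivAt (fun t : ℂ ↦ z₀ + t • v) v 0 := by
          simpa using ((hasDerivAt_id (0 : ℂ)).smul_const v).const_add z₀
        have h4 : HasFDerivAt (fun z ↦ f z a) (fderiv ℂ (fun z ↦ f z a) z₀)
            (z₀ + (0 : ℂ) • v) := by simpa using h1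
        exact h4.comp_hasDerivAt (0 : ℂ) h3
      have h5 : Tendsto (fun n : ℕ ↦ (((n + N : ℕ) : ℂ) + 1)⁻¹) atTop (𝓝[≠] 0) := by
        refine tendsto_nhdsWithin_iff.2 ⟨?_, Eventually.of_forall fun n ↦ ?_⟩
        · have := (tendsto_one_div_add_atTop_nhds_zero_nat (𝕜 := ℂ)).comp
            (tendsto_add_atTop_nat N)
          refine this.congr fun n ↦ ?_
          simp [one_div]
        · exact inv_ne_zero (by exact_mod_cast Nat.succ_ne_zero (n + N))
      refine ((hasDerivAt_iff_tendsto_slope_zero.1 h2).comp h5).congr fun n ↦ ?_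
      simp
  have hmeas : AEStronglyMeasurable (fun a ↦ fderiv ℂ (fun z ↦ f z a) z₀) μ := by
    let b := Module.finBasis ℂ E
    have : (fun a ↦ fderiv ℂ (fun z ↦ f z a) z₀) = fun a ↦ ∑ i,
        (fderiv ℂ (fun z ↦ f z a) z₀ (b i)) • (LinearMap.toContinuousLinearMap (b.coord i)) := by
      funext a
      ext v
      rw [sum_apply]
      conv_lhs => rw [← b.sum_repr v]
      rw [map_sum]
      refine Finset.sum_congr rfl fun i _ ↦ ?_
      simp [mul_comm]
    rw [this]
    refine Finset.aestronglyMeasurable_fun_sum _ fun i _ ↦ (hmeas_v (b i)).smul_const _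
  refine (hasFDerivAt_integral_of_dominated_of_fderiv_le (𝕜 := ℂ)
    (F' := fun z a ↦ fderiv ℂ (fun z ↦ f z a) z) (bound := fun a ↦ 2 * bound a / (r / 2))
    (Metric.ball_mem_nhds z₀ (half_pos hr)) ?_ ?_ hmeas ?_ ?_ ?_).differentiableAt
  · filter_upwards [Metric.ball_mem_nhds z₀ hr] with z hz using hm z hz
  · refine hi.mono' (hm _ hz₀) ?_
    filter_upwards [hb] with a ha using ha _ hz₀
  · filter_upwards [hd, hb] with a ha hba z hz
    exact norm_fderiv_le_of_ball (half_pos hr) ((norm_nonneg _).trans (hba _ hz₀))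
      (ha.mono (hsub z hz)) fun w hw ↦ hba w (hsub z hz hw)
  · exact (hi.const_mul 2).div_const _
  · filter_upwards [hd] with a ha z hz
    have hz' : z ∈ Metric.ball z₀ r := Metric.ball_subset_ball (by linarith) hz
    exact ((ha _ hz').differentiableAt (Metric.isOpen_ball.mem_nhds hz')).hasFDerivAt

theorem differentiable_update {d : ℕ} (j : Fin d) :
    Differentiable ℂ (fun p : (Fin d → ℂ) × ℂ ↦ Function.update p.1 j p.2) := by
  refine differentiable_pi.2 fun i ↦ ?_
  by_cases h : i = j
  · subst h; simp
  · simp only [Function.update_of_ne h]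
    exact (differentiable_apply (𝕜 := ℂ) (F' := fun _ : Fin d ↦ ℂ) i).comp differentiable_fst

theorem update_mem_ball {d : ℕ} {j : Fin d} {z z₀ : Fin d → ℂ} {ζ : ℂ} {r : ℝ}
    (hz : z ∈ Metric.ball z₀ r) (hζ : dist ζ (z₀ j) < r) :
    Function.update z j ζ ∈ Metric.ball z₀ r := by
  have hr : 0 < r := dist_nonneg.trans_lt hz
  rw [Metric.mem_ball, dist_pi_lt_iff hr] at *
  intro i
  by_cases h : i = j
  · subst h; simpa using hζ
  · simpa [Function.update_of_ne h] using hz i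

/-- A Cauchy-type integral of a holomorphic function in one of its variables is holomorphic in all
variables. -/
theorem differentiableAt_circleIntegral_update {d : ℕ} {f : (Fin d → ℂ) → ℂ} {z₀ : Fin d → ℂ}
    {r : ℝ} (hr : 0 < r) (hf : DifferentiableOn ℂ f (Metric.ball z₀ (3 * r))) (j : Fin d)
    (k : (Fin d → ℂ) → ℂ → ℂ) (z₁ : Fin d → ℂ) (hz₁ : z₁ ∈ Metric.ball z₀ r)
    (hk : ∀ ζ ∈ Metric.sphere (z₀ j) (2 * r),
      DifferentiableOn ℂ (fun z ↦ k z ζ) (Metric.ball z₀ r))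
    (hkc : ∀ z ∈ Metric.ball z₀ r, ContinuousOn (k z) (Metric.sphere (z₀ j) (2 * r)))
    {M : ℝ} (hkM : ∀ z ∈ Metric.ball z₀ r, ∀ ζ ∈ Metric.sphere (z₀ j) (2 * r), ‖k z ζ‖ ≤ M) :
    DifferentiableAt ℂ
      (fun z ↦ ∮ ζ in C(z₀ j, 2 * r), k z ζ * f (Function.update z j ζ)) z₁ := by
  have hupd : ∀ z ∈ Metric.ball z₀ r, ∀ ζ ∈ Metric.sphere (z₀ j) (2 * r),
      Function.update z j ζ ∈ Metric.ball z₀ (3 * r) := fun z hz ζ hζ ↦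
    update_mem_ball (Metric.ball_subset_ball (by linarith) hz)
      (by rw [mem_sphere_iff_norm, ← dist_eq_norm] at hζ; rw [hζ]; linarith)
  have hcont := hf.continuousOn
  obtain ⟨C, hC⟩ := ((isCompact_closedBall z₀ (2 * r)).exists_bound_of_continuousOn
    (hcont.mono (Metric.closedBall_subset_ball (by linarith))))
  have hupd' : ∀ z ∈ Metric.ball z₀ r, ∀ ζ ∈ Metric.sphere (z₀ j) (2 * r),
      Function.update z j ζ ∈ Metric.closedBall z₀ (2 * r) := by
    intro z hz ζ hζ
    rw [Metric.mem_closedBall, dist_pi_le_iff (by linarith)]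
    intro i
    by_cases h : i = j
    · subst h; rw [mem_sphere_iff_norm, ← dist_eq_norm] at hζ; simp [hζ]
    · rw [Function.update_of_ne h]
      rw [Metric.mem_ball, dist_pi_lt_iff hr] at hz
      linarith [hz i]
  obtain ⟨ρ, hρ, hρs⟩ := Metric.isOpen_ball.mem_nhds hz₁ |> Metric.mem_nhds_iff.1
  simp only [circleIntegral, intervalIntegral.integral_of_le Real.two_pi_pos.le]
  refine differentiableAt_integral_of_dominated hρ (bound := fun _ ↦ 2 * r * (M * C)) ?_ ?_ ?_ ?_
  · intro z hz
    have hc : Continuous fun θ ↦ deriv (circleMap (z₀ j) (2 * r)) θ •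
        (k z (circleMap (z₀ j) (2 * r) θ) *
          f (Function.update z j (circleMap (z₀ j) (2 * r) θ))) := by
      have hmap : ∀ θ, circleMap (z₀ j) (2 * r) θ ∈ Metric.sphere (z₀ j) (2 * r) :=
        circleMap_mem_sphere _ (by linarith)
      have hcd : Continuous fun θ ↦ deriv (circleMap (z₀ j) (2 * r)) θ := by
        simp only [deriv_circleMap]
        fun_prop
      refine hcd.smul (Continuous.mul ?_ ?_)
      · exact (hkc z (hρs hz)).comp_continuous (continuous_circleMap _ _) hmap
      · refine hcont.comp_continuous ?_ fun θ ↦ hupd z (hρs hz) _ (hmap θ)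
        exact (differentiable_update j).continuous.comp
          (continuous_const.prodMk (continuous_circleMap _ _))
    exact hc.aestronglyMeasurable
  · refine Eventually.of_forall fun θ ↦ ?_
    have hmap := circleMap_mem_sphere (z₀ j) (by linarith : (0 : ℝ) ≤ 2 * r) θ
    refine DifferentiableOn.fun_const_smul (DifferentiableOn.fun_mul ((hk _ hmap).mono hρs) ?_) _
    refine hf.comp (((differentiable_update j).comp
      (differentiable_id.prodMk (differentiable_const _))).differentiableOn) ?_
    exact fun z hz ↦ hupd z (hρs hz) _ hmap
  · refine Eventually.of_forall fun θ z hz ↦ ?_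
    have hmap := circleMap_mem_sphere (z₀ j) (by linarith : (0 : ℝ) ≤ 2 * r) θ
    rw [norm_smul, norm_mul]
    have h1 : ‖deriv (circleMap (z₀ j) (2 * r)) θ‖ = 2 * r := by
      simp [deriv_circleMap, abs_of_pos hr]
    rw [h1]
    have h2 := hkM z (hρs hz) _ hmap
    exact mul_le_mul_of_nonneg_left (mul_le_mul h2 (hC _ (hupd' z (hρs hz) _ hmap))
      (norm_nonneg _) ((norm_nonneg _).trans h2)) (by linarith)
  · exact integrable_const _

theorem fderiv_single_eq_deriv_update {d : ℕ} {f : (Fin d → ℂ) → ℂ} {z : Fin d → ℂ}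
    (hf : DifferentiableAt ℂ f z) (j : Fin d) :
    HasDerivAt (fun ζ ↦ f (Function.update z j ζ)) (fderiv ℂ f z (Pi.single j 1)) (z j) := by
  have h1 : HasDerivAt (fun ζ ↦ Function.update z j ζ) (Pi.single j (1 : ℂ)) (z j) :=
    hasDerivAt_update z j (z j)
  have h2 : HasFDerivAt f (fderiv ℂ f z) (Function.update z j (z j)) := by
    rw [Function.update_eq_self]; exact hf.hasFDerivAt
  exact h2.comp_hasDerivAt _ h1

theorem differentiableOn_slice {d : ℕ} {f : (Fin d → ℂ) → ℂ} {z₀ z : Fin d → ℂ}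
    {r : ℝ} (hf : DifferentiableOn ℂ f (Metric.ball z₀ r)) (j : Fin d)
    (hz : z ∈ Metric.ball z₀ r) :
    DifferentiableOn ℂ (fun ζ ↦ f (Function.update z j ζ)) (Metric.ball (z₀ j) r) := by
  refine hf.comp ((differentiable_update j).comp
    ((differentiable_const _).prodMk differentiable_id)).differentiableOn ?_
  exact fun ζ hζ ↦ update_mem_ball hz hζ

/-- Partial derivatives of holomorphic functions are holomorphic, since they are given by Cauchy's
formula in the variable `z_j`. -/
theorem differentiableAt_partial {d : ℕ} {f : (Fin d → ℂ) → ℂ} {z₀ : Fin d → ℂ}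
    (hf : ∀ᶠ z in 𝓝 z₀, DifferentiableAt ℂ f z) (j : Fin d) :
    DifferentiableAt ℂ (fun z ↦ fderiv ℂ f z (Pi.single j 1)) z₀ := by
  obtain ⟨R, hR, hball⟩ := Metric.eventually_nhds_iff_ball.1 hf
  obtain ⟨r, rfl⟩ : ∃ r, R = 3 * r := ⟨R / 3, by ring⟩
  have hr : 0 < r := by linarith
  have hfo : DifferentiableOn ℂ f (Metric.ball z₀ (3 * r)) :=
    fun z hz ↦ (hball z hz).differentiableWithinAt
  have hge : ∀ z ∈ Metric.ball z₀ r, ∀ ζ ∈ Metric.sphere (z₀ j) (2 * r), r ≤ ‖ζ - z j‖ := by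
    intro z hz ζ hζ
    have h1 : ‖z j - z₀ j‖ < r := by
      rw [← dist_eq_norm]; exact (dist_le_pi_dist z z₀ j).trans_lt hz
    rw [mem_sphere_iff_norm] at hζ
    have := norm_sub_le_norm_sub_add_norm_sub ζ (z j) (z₀ j)
    linarith
  have hne : ∀ z ∈ Metric.ball z₀ r, ∀ ζ ∈ Metric.sphere (z₀ j) (2 * r), ζ - z j ≠ 0 :=
    fun z hz ζ hζ ↦ norm_pos_iff.1 (hr.trans_le (hge z hz ζ hζ))
  have hd := differentiableAt_circleIntegral_update hr hfo j (fun z ζ ↦ ((ζ - z j) ^ 2)⁻¹) z₀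
    (Metric.mem_ball_self hr) (M := (r ^ 2)⁻¹) ?_ ?_ ?_
  · refine (hd.const_mul (2 * Real.pi * Complex.I)⁻¹).congr_of_eventuallyEq ?_
    filter_upwards [Metric.ball_mem_nhds z₀ hr] with z hz
    have hz3 : z ∈ Metric.ball z₀ (3 * r) := Metric.ball_subset_ball (by linarith) hz
    have hzj : z j ∈ Metric.ball (z₀ j) (2 * r) :=
      (dist_le_pi_dist z z₀ j).trans_lt (lt_trans hz (by linarith))
    rw [← (fderiv_single_eq_deriv_update (hball z hz3) j).deriv]
    rw [← Complex.two_pi_I_inv_smul_circleIntegral_sub_sq_inv_smul_of_differentiable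
      (c := z₀ j) (R := 2 * r) Metric.isOpen_ball (Metric.closedBall_subset_ball (by linarith))
      (differentiableOn_slice hfo j hz3) hzj]
    simp [smul_eq_mul]
  · intro ζ hζ
    refine DifferentiableOn.inv ?_ fun z hz ↦ pow_ne_zero _ (hne z hz ζ hζ)
    fun_prop
  · intro z hz
    refine ContinuousOn.inv₀ (by fun_prop) fun ζ hζ ↦ pow_ne_zero _ (hne z hz ζ hζ)
  · intro z hz ζ hζ
    rw [norm_inv, norm_pow]
    exact inv_anti₀ (by positivity) (pow_le_pow_left₀ hr.le (hge z hz ζ hζ) 2)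

/-- Holomorphic functions of several variables are smooth: by induction on the order, since their
partial derivatives are again holomorphic. -/
theorem contDiffOn_infty_of_differentiableOn_pi {d : ℕ} {f : (Fin d → ℂ) → ℂ} {U : Set (Fin d → ℂ)}
    (hU : IsOpen U) (hf : DifferentiableOn ℂ f U) : ContDiffOn ℂ ∞ f U := by
  rw [contDiffOn_infty]
  intro n
  induction n generalizing f with
  | zero => simpa using hf.continuousOn
  | succ n ih =>
    push_cast
    rw [contDiffOn_succ_iff_fderiv_of_isOpen hU]
    refine ⟨hf, by simp, ?_⟩
    have hcongr : ∀ z ∈ U, fderiv ℂ f z = ∑ j : Fin d, fderiv ℂ f z (Pi.single j 1) •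
        (ContinuousLinearMap.proj (R := ℂ) (φ := fun _ : Fin d ↦ ℂ) j) := by
      intro z _
      ext v
      conv_lhs => rw [show v = ∑ j, v j • Pi.single j (1 : ℂ) by
        exact pi_eq_sum_univ' v]
      simp [mul_comm]
    refine ContDiffOn.congr ?_ hcongr
    refine ContDiffOn.sum fun j _ ↦ ContDiffOn.smul (ih ?_) contDiffOn_const
    intro z hz
    exact (differentiableAt_partial ((hU.eventually_mem hz).mono fun w hw ↦
      (hf w hw).differentiableAt (hU.mem_nhds hw)) j).differentiableWithinAt

theorem differentiableOn_line {d : ℕ} {f : (Fin d → ℂ) → ℂ} {U : Set (Fin d → ℂ)}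
    (hf : DifferentiableOn ℂ f U) (w v : Fin d → ℂ) :
    DifferentiableOn ℂ (fun t : ℂ ↦ f (w + t • v)) ((fun t : ℂ ↦ w + t • v) ⁻¹' U) := by
  refine hf.comp (Differentiable.differentiableOn ?_) fun t ht ↦ ht
  exact (differentiable_const w).add (differentiable_id.smul_const v)

/-- Identity theorem on balls, reduced to one variable by restriction to complex lines. -/
theorem eqOn_zero_of_eventuallyEq_zero {d : ℕ} {f : (Fin d → ℂ) → ℂ} {z₀ w : Fin d → ℂ} {r : ℝ}
    (hf : DifferentiableOn ℂ f (Metric.ball z₀ r)) (hw : w ∈ Metric.ball z₀ r)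
    (h0 : ∀ᶠ z in 𝓝 w, f z = 0) : ∀ z ∈ Metric.ball z₀ r, f z = 0 := by
  intro z hz
  set ℓ : ℂ → (Fin d → ℂ) := fun t ↦ w + t • (z - w) with hℓ
  have hℓc : Continuous ℓ := by fun_prop
  have hV : IsOpen (ℓ ⁻¹' Metric.ball z₀ r) := Metric.isOpen_ball.preimage hℓc
  have hconv : Convex ℝ (ℓ ⁻¹' Metric.ball z₀ r) := by
    intro s hs t ht a b ha hb hab
    have h1 : ℓ (a • s + b • t) = a • ℓ s + b • ℓ t := by
      simp only [hℓ]
      ext i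
      simp only [Pi.add_apply, Pi.smul_apply, Pi.sub_apply, smul_eq_mul, Complex.real_smul]
      have : (a : ℂ) + b = 1 := by exact_mod_cast hab
      linear_combination (- w i) * this
    rw [mem_preimage, h1]
    exact convex_ball z₀ r hs ht ha hb hab
  have han := (differentiableOn_line hf w (z - w)).analyticOnNhd hV
  have h00 : (0 : ℂ) ∈ ℓ ⁻¹' Metric.ball z₀ r := by simpa [hℓ] using hw
  have h01 : (1 : ℂ) ∈ ℓ ⁻¹' Metric.ball z₀ r := by simpa [hℓ] using hz
  have hev : (fun t ↦ f (ℓ t)) =ᶠ[𝓝 0] 0 := by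
    have : Tendsto ℓ (𝓝 0) (𝓝 w) := by simpa [hℓ] using hℓc.tendsto 0
    exact this.eventually h0
  have := han.eqOn_zero_of_preconnected_of_eventuallyEq_zero hconv.isPreconnected h00 hev h01
  simpa [hℓ] using this

/-- The ring of holomorphic functions on a ball is an integral domain. -/
theorem exists_eq_zero_of_prod_eq_zero {d : ℕ} {ι : Type*} (T : Finset ι)
    {f : ι → (Fin d → ℂ) → ℂ} {z₀ : Fin d → ℂ} {r : ℝ} (hr : 0 < r)
    (hf : ∀ i ∈ T, DifferentiableOn ℂ (f i) (Metric.ball z₀ r))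
    (h0 : ∀ z ∈ Metric.ball z₀ r, ∏ i ∈ T, f i z = 0) :
    ∃ i ∈ T, ∀ z ∈ Metric.ball z₀ r, f i z = 0 := by
  classical
  by_contra! hne
  have key : ∀ T' ⊆ T, ∃ z ∈ Metric.ball z₀ r, ∏ i ∈ T', f i z ≠ 0 := by
    intro T'
    induction T' using Finset.induction_on with
    | empty => exact fun _ ↦ ⟨z₀, Metric.mem_ball_self hr, by simp⟩
    | insert a s ha ih =>
      intro hs
      obtain ⟨z, hz, hz0⟩ := ih ((Finset.subset_insert a s).trans hs)
      by_contra! hall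
      have haT : a ∈ T := hs (Finset.mem_insert_self a s)
      have hcont : ContinuousOn (fun z ↦ ∏ i ∈ s, f i z) (Metric.ball z₀ r) :=
        continuousOn_finsetProd _ fun i hi ↦ (hf i (hs (Finset.mem_insert_of_mem hi))).continuousOn
      have hev : ∀ᶠ w in 𝓝 z, f a w = 0 := by
        have h1 := (hcont.continuousAt (Metric.isOpen_ball.mem_nhds hz)).eventually_ne hz0
        filter_upwards [h1, Metric.isOpen_ball.mem_nhds hz] with w hw hwb
        have := hall w hwb
        rw [Finset.prod_insert ha] at this
        exact (mul_eq_zero.1 this).resolve_right hw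
      obtain ⟨w, hw, hw0⟩ := hne a haT
      exact hw0 (eqOn_zero_of_eventuallyEq_zero (hf a haT) hz hev w hw)
  obtain ⟨z, hz, hz0⟩ := key T subset_rfl
  exact hz0 (h0 z hz)

/-- If a holomorphic function has all its zeros near `z₀` on coordinate hyperplanes and vanishes at
`z₀`, it vanishes on one of the hyperplanes: by Hurwitz' theorem each line parallel to the diagonal
contains a zero. -/
theorem exists_vanishing_hyperplane {d : ℕ} {S : Finset (Fin d)} {z₀ : Fin d → ℂ}
    (hS : ∀ j ∈ S, z₀ j = 0) {f : (Fin d → ℂ) → ℂ}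
    (hf : ∀ᶠ z in 𝓝 z₀, DifferentiableAt ℂ f z)
    (h0 : ∀ᶠ z in 𝓝 z₀, f z = 0 → ∃ j ∈ S, z j = 0) (hz : f z₀ = 0) :
    ∃ j ∈ S, ∀ᶠ z in 𝓝 z₀, z j = 0 → f z = 0 := by
  obtain ⟨R, hR, hball⟩ := Metric.eventually_nhds_iff_ball.1 (hf.and h0)
  obtain ⟨r, rfl⟩ : ∃ r, R = 3 * r := ⟨R / 3, by ring⟩
  have hr : 0 < r := by linarith
  have hfo : DifferentiableOn ℂ f (Metric.ball z₀ (3 * r)) :=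
    fun z hz ↦ (hball z hz).1.differentiableWithinAt
  set e : Fin d → ℂ := fun _ ↦ 1 with he
  have hte : ∀ t : ℂ, ‖t • e‖ ≤ ‖t‖ := fun t ↦ by
    refine (pi_norm_le_iff_of_nonneg (norm_nonneg _)).2 fun i ↦ by simp [he]
  have hmem : ∀ w ∈ Metric.ball z₀ r, ∀ t : ℂ, ‖t‖ ≤ r → w + t • e ∈ Metric.ball z₀ (3 * r) := by
    intro w hw t ht
    rw [Metric.mem_ball] at *
    have := dist_triangle (w + t • e) w z₀
    rw [dist_self_add_left] at this
    linarith [hte t]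
  have hz₀ : z₀ ∈ Metric.ball z₀ r := Metric.mem_ball_self hr
  have hfc : ∀ w ∈ Metric.ball z₀ r, ∀ t : ℂ, ‖t‖ ≤ r → ContinuousAt f (w + t • e) :=
    fun w hw t ht ↦ (hball _ (hmem w hw t ht)).1.continuousAt
  -- the minimum of `|f|` on the circle
  obtain ⟨m, hm, hmin⟩ : ∃ m > 0, ∀ t ∈ Metric.sphere (0 : ℂ) r, m < ‖f (z₀ + t • e)‖ := by
    have hcont : ContinuousOn (fun t : ℂ ↦ ‖f (z₀ + t • e)‖) (Metric.sphere (0 : ℂ) r) := by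
      intro t ht
      have h1 := hfc z₀ hz₀ t (by simpa using (mem_sphere_zero_iff_norm.1 ht).le)
      have h2 : ContinuousAt (fun t : ℂ ↦ z₀ + t • e) t := by fun_prop
      exact (ContinuousAt.comp (f := fun t : ℂ ↦ z₀ + t • e) h1 h2).norm.continuousWithinAt
    obtain ⟨t₀, ht₀, hmn⟩ := (isCompact_sphere (0 : ℂ) r).exists_isMinOn
      (NormedSpace.sphere_nonempty.2 hr.le) hcont
    have hpos : 0 < ‖f (z₀ + t₀ • e)‖ := by
      rw [norm_pos_iff]
      intro h
      have ht := mem_sphere_zero_iff_norm.1 ht₀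
      obtain ⟨j, hj, hj0⟩ := (hball _ (hmem z₀ hz₀ t₀ ht.le)).2 h
      simp [he, hS j hj] at hj0
      rw [hj0, norm_zero] at ht
      exact hr.ne ht
    exact ⟨_, half_pos hpos, fun t ht ↦ (half_lt_self hpos).trans_le (hmn ht)⟩
  have hev1 : ∀ᶠ w in 𝓝 z₀, ∀ t ∈ Metric.sphere (0 : ℂ) r, m < ‖f (w + t • e)‖ := by
    refine (isCompact_sphere (0 : ℂ) r).eventually_forall_of_forall_eventually fun t ht ↦ ?_
    have h1 := hfc z₀ hz₀ t (by simpa using (mem_sphere_zero_iff_norm.1 ht).le)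
    have h2 : ContinuousAt (fun p : (Fin d → ℂ) × ℂ ↦ p.1 + p.2 • e) (z₀, t) := by fun_prop
    exact (ContinuousAt.comp (f := fun p : (Fin d → ℂ) × ℂ ↦ p.1 + p.2 • e) h1 h2).norm.eventually
      (lt_mem_nhds (hmin t ht))
  have hev2 : ∀ᶠ w in 𝓝 z₀, ‖f w‖ < m := by
    have h1 := (hfc z₀ hz₀ 0 (by simpa using hr.le)).norm
    simp only [zero_smul, add_zero] at h1
    refine h1.eventually (gt_mem_nhds ?_)
    simpa [hz] using hm
  have hzero : ∀ᶠ w in 𝓝 z₀, ∃ t : ℂ, ‖t‖ ≤ r ∧ f (w + t • e) = 0 := by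
    filter_upwards [hev1, hev2, Metric.ball_mem_nhds z₀ hr] with w h1 h2 hw
    by_contra! hne
    have hdiff : DifferentiableOn ℂ (fun t : ℂ ↦ (f (w + t • e))⁻¹) (Metric.closedBall 0 r) := by
      refine DifferentiableOn.inv ?_ fun t ht ↦ hne t (mem_closedBall_zero_iff.1 ht)
      exact (differentiableOn_line hfo w e).mono fun t ht ↦
        hmem w hw t (mem_closedBall_zero_iff.1 ht)
    have := Complex.norm_le_of_forall_mem_frontier_norm_le (U := Metric.ball (0 : ℂ) r)
      (f := fun t : ℂ ↦ (f (w + t • e))⁻¹) (C := m⁻¹) Metric.isBounded_ball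
      (DifferentiableOn.diffContOnCl (by rwa [closure_ball _ hr.ne'])) (fun t ht ↦ by
        rw [frontier_ball _ hr.ne'] at ht
        rw [norm_inv]
        exact inv_anti₀ hm (h1 t ht).le) (subset_closure (Metric.mem_ball_self hr))
    simp only [zero_smul, add_zero, norm_inv] at this
    have h3 : 0 < ‖f w‖ := by
      have := hne 0 (by simpa using hr.le)
      simpa using this
    exact absurd ((inv_le_inv₀ h3 hm).1 this) (not_le.2 h2)
  obtain ⟨ρ, hρ, hρz⟩ := Metric.eventually_nhds_iff_ball.1 hzero
  set ρ' := min ρ r with hρ'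
  have hρ'0 : 0 < ρ' := lt_min hρ hr
  have hcoord : ∀ j ∈ S, ∀ w ∈ Metric.ball z₀ ρ', ‖w j‖ ≤ r := by
    intro j hj w hw
    have := (dist_le_pi_dist w z₀ j).trans (le_of_lt (lt_of_lt_of_le hw (min_le_right _ _)))
    simpa [hS j hj] using this
  have hsub : Metric.ball z₀ ρ' ⊆ Metric.ball z₀ r := Metric.ball_subset_ball (min_le_right _ _)
  obtain ⟨j, hj, hj0⟩ := exists_eq_zero_of_prod_eq_zero S (f := fun j w ↦ f (w + (-w j) • e))
    (z₀ := z₀) hρ'0 (fun j hj ↦ by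
      refine hfo.comp ?_ fun w hw ↦ hmem w (hsub hw) _ (by simpa using hcoord j hj w hw)
      have : Differentiable ℂ fun w : Fin d → ℂ ↦ w + (-w j) • e := by fun_prop
      exact this.differentiableOn) (fun w hw ↦ by
      obtain ⟨t, ht, ht0⟩ := hρz w (Metric.ball_subset_ball (min_le_left _ _) hw)
      obtain ⟨j, hj, hj0⟩ := (hball _ (hmem w (hsub hw) t ht)).2 ht0
      refine Finset.prod_eq_zero hj ?_
      have : t = - w j := by
        simp [he] at hj0
        linear_combination hj0
      rw [← this, ht0])
  refine ⟨j, hj, ?_⟩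
  filter_upwards [Metric.ball_mem_nhds z₀ hρ'0] with z hz hzj
  simpa [hzj] using hj0 z hz

/-- Division by a coordinate: a holomorphic function that vanishes on `z_j = 0` is divisible by
`z_j`. -/
theorem exists_eq_coord_mul {d : ℕ} {j : Fin d} {z₀ : Fin d → ℂ} (hj : z₀ j = 0)
    {f : (Fin d → ℂ) → ℂ} (hf : ∀ᶠ z in 𝓝 z₀, DifferentiableAt ℂ f z)
    (h0 : ∀ᶠ z in 𝓝 z₀, z j = 0 → f z = 0) :
    ∃ g : (Fin d → ℂ) → ℂ, (∀ᶠ z in 𝓝 z₀, DifferentiableAt ℂ g z) ∧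
      ∀ᶠ z in 𝓝 z₀, f z = z j * g z := by
  obtain ⟨R, hR, hball⟩ := Metric.eventually_nhds_iff_ball.1 (hf.and h0)
  obtain ⟨r, rfl⟩ : ∃ r, R = 3 * r := ⟨R / 3, by ring⟩
  have hr : 0 < r := by linarith
  have hfo : DifferentiableOn ℂ f (Metric.ball z₀ (3 * r)) :=
    fun z hz ↦ (hball z hz).1.differentiableWithinAt
  have hge0 : ∀ ζ ∈ Metric.sphere (z₀ j) (2 * r), ‖ζ‖ = 2 * r := by
    intro ζ hζ
    simpa [hj] using hζ
  have hge : ∀ z ∈ Metric.ball z₀ r, ∀ ζ ∈ Metric.sphere (z₀ j) (2 * r), r ≤ ‖ζ - z j‖ := by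
    intro z hz ζ hζ
    have h1 : ‖z j‖ < r := by
      have := (dist_le_pi_dist z z₀ j).trans_lt hz
      simpa [hj] using this
    have := norm_sub_norm_le ζ (z j)
    linarith [hge0 ζ hζ]
  have hne : ∀ z ∈ Metric.ball z₀ r, ∀ ζ ∈ Metric.sphere (z₀ j) (2 * r), ζ - z j ≠ 0 :=
    fun z hz ζ hζ ↦ norm_pos_iff.1 (hr.trans_le (hge z hz ζ hζ))
  have hne0 : ∀ ζ ∈ Metric.sphere (z₀ j) (2 * r), ζ ≠ 0 :=
    fun ζ hζ ↦ norm_pos_iff.1 (by rw [hge0 ζ hζ]; linarith)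
  -- the difference of the Cauchy integrals for `f(z)` and for `f(z)|_{z_j = 0} = 0`, divided by
  -- `z_j`: `1/(ζ - z_j) - 1/ζ = z_j / (ζ (ζ - z_j))`
  refine ⟨fun z ↦ (2 * Real.pi * Complex.I)⁻¹ *
    ∮ ζ in C(z₀ j, 2 * r), (ζ * (ζ - z j))⁻¹ * f (Function.update z j ζ), ?_, ?_⟩
  · filter_upwards [Metric.ball_mem_nhds z₀ hr] with z₁ hz₁
    refine (differentiableAt_circleIntegral_update hr hfo j (fun z ζ ↦ (ζ * (ζ - z j))⁻¹) z₁ hz₁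
      (M := (2 * r * r)⁻¹) ?_ ?_ ?_).const_mul _
    · intro ζ hζ
      refine DifferentiableOn.inv (by fun_prop)
        fun z hz ↦ mul_ne_zero (hne0 ζ hζ) (hne z hz ζ hζ)
    · intro z hz
      exact ContinuousOn.inv₀ (by fun_prop)
        fun ζ hζ ↦ mul_ne_zero (hne0 ζ hζ) (hne z hz ζ hζ)
    · intro z hz ζ hζ
      rw [norm_inv, norm_mul, hge0 ζ hζ]
      exact inv_anti₀ (by positivity) (by nlinarith [hge z hz ζ hζ])
  · filter_upwards [Metric.ball_mem_nhds z₀ hr] with z hz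
    have hz3 : z ∈ Metric.ball z₀ (3 * r) := Metric.ball_subset_ball (by linarith) hz
    have hzj : z j ∈ Metric.ball (z₀ j) (2 * r) :=
      (dist_le_pi_dist z z₀ j).trans_lt (lt_trans hz (by linarith))
    have hslice := (differentiableOn_slice hfo j hz3).mono
      (Metric.closedBall_subset_ball (x := z₀ j) (by linarith : 2 * r < 3 * r))
    have hcl : DiffContOnCl ℂ (fun ζ ↦ f (Function.update z j ζ)) (Metric.ball (z₀ j) (2 * r)) :=
      DifferentiableOn.diffContOnCl (by rwa [closure_ball _ (by linarith)])
    have h1 := hcl.two_pi_i_inv_smul_circleIntegral_sub_inv_smul hzj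
    have h2 := hcl.two_pi_i_inv_smul_circleIntegral_sub_inv_smul (w := 0)
      (by rw [hj]; exact Metric.mem_ball_self (by linarith))
    have h3 : f (Function.update z j 0) = 0 := by
      refine (hball _ (update_mem_ball hz3 (by simp [hj, hr]))).2 (by simp)
    simp only [Function.update_eq_self, h3, sub_zero] at h1 h2
    have hfc : ContinuousOn (fun ζ ↦ f (Function.update z j ζ)) (Metric.sphere (z₀ j) (2 * r)) :=
      hslice.continuousOn.mono Metric.sphere_subset_closedBall
    have hc1 : CircleIntegrable (fun ζ ↦ (ζ - z j)⁻¹ • f (Function.update z j ζ)) (z₀ j) (2 * r) :=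
      ContinuousOn.circleIntegrable (by linarith) (ContinuousOn.smul
        (ContinuousOn.inv₀ (by fun_prop) fun ζ hζ ↦ hne z hz ζ hζ) hfc)
    have hc2 : CircleIntegrable (fun ζ ↦ ζ⁻¹ • f (Function.update z j ζ)) (z₀ j) (2 * r) :=
      ContinuousOn.circleIntegrable (by linarith) (ContinuousOn.smul
        (ContinuousOn.inv₀ (by fun_prop) fun ζ hζ ↦ hne0 ζ hζ) hfc)
    rw [← sub_zero (f z), ← h2]
    nth_rewrite 1 [← h1]
    rw [← smul_sub, ← circleIntegral.integral_sub hc1 hc2, smul_eq_mul, mul_left_comm,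
      ← smul_eq_mul (a := z j), ← circleIntegral.integral_smul]
    congr 1
    refine circleIntegral.integral_congr (by linarith) fun ζ hζ ↦ ?_
    have h4 := hne z hz ζ hζ
    have h5 := hne0 ζ hζ
    simp only [smul_eq_mul]
    field_simp
    ring

/-- A holomorphic function whose zeros lie on coordinate hyperplanes is a monomial times a unit.
Coordinates are divided out one at a time; each division lowers the order of vanishing along the
diagonal line through `z₀`, which is finite because that line meets the hyperplanes only at `z₀`.
-/
theorem exists_monomial_factor {d : ℕ} {S : Finset (Fin d)} {z₀ : Fin d → ℂ}
    (hS : ∀ j ∈ S, z₀ j = 0) {f : (Fin d → ℂ) → ℂ}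
    (hf : ∀ᶠ z in 𝓝 z₀, DifferentiableAt ℂ f z)
    (h0 : ∀ᶠ z in 𝓝 z₀, f z = 0 → ∃ j ∈ S, z j = 0) :
    ∃ (A : Fin d → ℕ) (u : (Fin d → ℂ) → ℂ), (∀ j ∉ S, A j = 0) ∧
      (∀ᶠ z in 𝓝 z₀, DifferentiableAt ℂ u z ∧ u z ≠ 0) ∧
      ∀ᶠ z in 𝓝 z₀, f z = (∏ j, z j ^ A j) * u z := by
  set e : Fin d → ℂ := fun _ ↦ 1 with he
  have hℓ : Tendsto (fun t : ℂ ↦ z₀ + t • e) (𝓝 0) (𝓝 z₀) := by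
    have : Continuous (fun t : ℂ ↦ z₀ + t • e) := by fun_prop
    simpa using this.tendsto 0
  have han : ∀ {g : (Fin d → ℂ) → ℂ}, (∀ᶠ z in 𝓝 z₀, DifferentiableAt ℂ g z) →
      AnalyticAt ℂ (fun t : ℂ ↦ g (z₀ + t • e)) 0 := by
    intro g hg
    rw [Complex.analyticAt_iff_eventually_differentiableAt]
    filter_upwards [hℓ.eventually hg] with t ht
    exact DifferentiableAt.comp (f := fun t : ℂ ↦ z₀ + t • e) t ht (by fun_prop)
  obtain ⟨m, hm⟩ : ∃ m : ℕ, analyticOrderAt (fun t : ℂ ↦ f (z₀ + t • e)) 0 = m := by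
    refine ENat.ne_top_iff_exists.1 ?_ |>.imp fun _ h ↦ h.symm
    rw [Ne, analyticOrderAt_eq_top]
    intro h
    obtain ⟨t, ⟨ht1, ht2⟩, ht3⟩ := (((h.and (hℓ.eventually h0)).filter_mono
      nhdsWithin_le_nhds).and (self_mem_nhdsWithin : {(0 : ℂ)}ᶜ ∈ 𝓝[≠] 0)).exists
    obtain ⟨j, hj, hj0⟩ := ht2 ht1
    simp [he, hS j hj] at hj0
    exact ht3 hj0
  induction m generalizing f with
  | zero =>
    have hne : f z₀ ≠ 0 := by
      have := (han hf).analyticOrderAt_eq_zero.1 (by simpa using hm)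
      simpa using this
    refine ⟨0, f, by simp, ?_, by simp⟩
    have hc := hf.self_of_nhds.continuousAt.eventually_ne hne
    exact hf.and hc
  | succ m ih =>
    have hz : f z₀ = 0 := by
      have : analyticOrderAt (fun t : ℂ ↦ f (z₀ + t • e)) 0 ≠ 0 := by
        rw [hm]; exact_mod_cast Nat.succ_ne_zero m
      simpa using (han hf).analyticOrderAt_ne_zero.1 this
    obtain ⟨j, hj, hj0⟩ := exists_vanishing_hyperplane hS hf h0 hz
    obtain ⟨g, hg, hfg⟩ := exists_eq_coord_mul (hS j hj) hf hj0
    have hg0 : ∀ᶠ z in 𝓝 z₀, g z = 0 → ∃ j ∈ S, z j = 0 := by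
      filter_upwards [hfg, h0] with z h1 h2 h3
      exact h2 (by rw [h1, h3, mul_zero])
    have hord : analyticOrderAt (fun t : ℂ ↦ g (z₀ + t • e)) 0 = m := by
      have h1 : (fun t : ℂ ↦ f (z₀ + t • e)) =ᶠ[𝓝 0]
          (fun t : ℂ ↦ t) * (fun t : ℂ ↦ g (z₀ + t • e)) := by
        filter_upwards [hℓ.eventually hfg] with t ht
        rw [ht]
        simp [he, hS j hj]
      rw [analyticOrderAt_congr h1, analyticOrderAt_mul (by fun_prop) (han hg)] at hm
      have h2 : analyticOrderAt (fun t : ℂ ↦ t) 0 = 1 := analyticOrderAt_id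
      rw [h2, add_comm] at hm
      push_cast at hm
      exact (ENat.add_left_injective_of_ne_top ENat.one_ne_top) hm
    obtain ⟨A, u, hA, hu, hgu⟩ := ih hg hg0 hord
    refine ⟨A + Pi.single j 1, u, ?_, hu, ?_⟩
    · intro i hi
      have : i ≠ j := fun h ↦ hi (h ▸ hj)
      simp [hA i hi, this]
    · filter_upwards [hfg, hgu] with z h1 h2
      rw [h1, h2, ← mul_assoc]
      congr 1
      simp only [Pi.add_apply, pow_add, Finset.prod_mul_distrib]
      rw [mul_comm]
      congr 1
      rw [Finset.prod_eq_single j]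
      · simp
      · intro i _ hi; simp [hi]
      · simp

/-! ### Singular kernels in one variable -/

/-- The kernel `|ζ|^{2a} ζ^{-m} ζ̄^{-n}`. -/
noncomputable def coordKer (a : ℂ) (m n : ℕ) (ζ : ℂ) : ℂ :=
  (‖ζ‖ : ℂ) ^ (2 * a) / (ζ ^ m * (starRingEnd ℂ ζ) ^ n)

theorem measurable_coordKer (a : ℂ) (m n : ℕ) : Measurable (coordKer a m n) := by
  unfold coordKer
  have h1 : Measurable fun ζ : ℂ ↦ (‖ζ‖ : ℂ) ^ (2 * a) :=
    (Complex.measurable_ofReal.comp measurable_norm).pow_const _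
  have h2 : Measurable fun ζ : ℂ ↦ ζ ^ m * (starRingEnd ℂ ζ) ^ n := by
    have : Continuous fun ζ : ℂ ↦ ζ ^ m * (starRingEnd ℂ ζ) ^ n := by fun_prop
    exact this.measurable
  exact h1.div h2

theorem norm_coordKer (a : ℂ) (m n : ℕ) {ζ : ℂ} (hζ : ζ ≠ 0) :
    ‖coordKer a m n ζ‖ = ‖ζ‖ ^ (2 * a.re - m - n) := by
  have h : 0 < ‖ζ‖ := norm_pos_iff.2 hζ
  unfold coordKer
  rw [norm_div, norm_mul, norm_pow, norm_pow, RCLike.norm_conj,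
    Complex.norm_cpow_eq_rpow_re_of_pos h, ← pow_add, ← Real.rpow_natCast, ← Real.rpow_sub h]
  congr 1
  simp
  ring

theorem coordKer_zero_left (m n : ℕ) (ζ : ℂ) :
    coordKer 0 m n ζ = (ζ ^ m * (starRingEnd ℂ ζ) ^ n)⁻¹ := by
  simp [coordKer]

theorem coordKer_zero_right {a : ℂ} (ha : a ≠ 0) (m n : ℕ) : coordKer a m n 0 = 0 := by
  simp [coordKer, Complex.zero_cpow (mul_ne_zero two_ne_zero ha)]

/-- The powers `|ζ|^p` with `p > -2` are integrable near the origin of the plane. -/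
theorem integrable_norm_rpow_ball {p ρ : ℝ} (hp : -2 < p) :
    Integrable (fun ζ : ℂ ↦ (Iio ρ).indicator (fun r : ℝ ↦ r ^ p) ‖ζ‖) := by
  rw [integrable_fun_norm_addHaar volume (f := (Iio ρ).indicator (fun r : ℝ ↦ r ^ p))]
  have h1 : IntegrableOn (fun r : ℝ ↦ r ^ (p + 1)) (Ioo 0 ρ) := by
    rcases le_or_gt ρ 0 with h | h
    · simp [Ioo_eq_empty (not_lt.2 h)]
    · exact ((intervalIntegral.integrableOn_Ioo_rpow_iff h).2 (by linarith))
  have h2 : (fun y : ℝ ↦ y ^ (Module.finrank ℝ ℂ - 1) • (Iio ρ).indicator (fun r : ℝ ↦ r ^ p) y) =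
      (Iio ρ).indicator (fun y ↦ y * y ^ p) := by
    funext y
    by_cases hy : y ∈ Iio ρ <;> simp [hy, Complex.finrank_real_complex, indicator]
  rw [h2, IntegrableOn, integrable_indicator_iff measurableSet_Iio, IntegrableOn,
    Measure.restrict_restrict measurableSet_Iio, Iio_inter_Ioi, ← IntegrableOn]
  refine h1.congr_fun (fun y hy ↦ ?_) measurableSet_Ioo
  simp only
  rw [Real.rpow_add_one hy.1.ne', mul_comm]

/-- The derivative of the kernel in the direction `c`. The assumption on the exponents makes the
formula valid at the origin as well, where both sides vanish. -/
theorem hasDerivAt_coordKer_line {a : ℂ} {m n : ℕ} (ha : 1 < 2 * a.re - m - n) (ζ c : ℂ) :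
    HasDerivAt (fun t : ℝ ↦ coordKer a m n (ζ + t • c))
      ((a - m) * coordKer a (m + 1) n ζ * c +
        (a - n) * coordKer a m (n + 1) ζ * starRingEnd ℂ c) 0 := by
  have ha0 : a ≠ 0 := by
    rintro rfl
    have : (0 : ℝ) ≤ m + n := by positivity
    simp at ha
    linarith
  rcases eq_or_ne ζ 0 with rfl | hζ
  · have h1 : (fun h : ℂ ↦ coordKer a m n h) =O[𝓝 0] fun h ↦ ‖h‖ ^ (2 * a.re - m - n) := by
      refine Asymptotics.IsBigO.of_bound 1 (Eventually.of_forall fun h ↦ ?_)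
      rcases eq_or_ne h 0 with rfl | hh
      · simp only [coordKer_zero_right ha0, norm_zero, one_mul]; positivity
      · rw [norm_coordKer _ _ _ hh, one_mul]; exact le_abs_self _
    have h2 : (fun h : ℂ ↦ ‖h‖ ^ (2 * a.re - m - n)) =
        fun h ↦ ‖h‖ ^ (2 * a.re - m - n - 1) * ‖h‖ := by
      funext h
      rcases eq_or_ne h 0 with rfl | hh
      · simp [Real.zero_rpow (show 2 * a.re - m - n ≠ 0 by linarith)]
      · rw [← Real.rpow_add_one (norm_ne_zero_iff.2 hh), sub_add_cancel]
    have h3 : Tendsto (fun h : ℂ ↦ ‖h‖ ^ (2 * a.re - m - n - 1)) (𝓝 0) (𝓝 0) := by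
      have h4 : ContinuousAt (fun h : ℂ ↦ ‖h‖ ^ (2 * a.re - m - n - 1)) 0 :=
        continuous_norm.continuousAt.rpow_const (Or.inr (by linarith))
      have := h4.tendsto
      rwa [norm_zero, Real.zero_rpow (by linarith)] at this
    have h6 : HasFDerivAt (coordKer a m n) (0 : ℂ →L[ℝ] ℂ) 0 := by
      rw [hasFDerivAt_iff_isLittleO_nhds_zero]
      simp only [zero_add, coordKer_zero_right ha0, sub_zero]
      have h7 : (fun h : ℂ ↦ coordKer a m n h) =o[𝓝 0] fun h : ℂ ↦ ‖h‖ := by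
        refine h1.trans_isLittleO ?_
        rw [h2]
        have h5 := (Asymptotics.isLittleO_one_iff ℝ).2 h3
        simpa only [one_mul] using
          h5.mul_isBigO (Asymptotics.isBigO_refl (fun h : ℂ ↦ ‖h‖) (𝓝 0))
      exact h7.of_norm_right.congr_left (by simp)
    have h8 : HasDerivAt (fun t : ℝ ↦ (0 : ℂ) + t • c) c 0 := by
      simpa using ((hasDerivAt_id (0 : ℝ)).smul_const c).const_add (0 : ℂ)
    have h9 : HasFDerivAt (coordKer a m n) (0 : ℂ →L[ℝ] ℂ) ((0 : ℂ) + (0 : ℝ) • c) := by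
      simpa using h6
    have h10 := h9.comp_hasDerivAt (0 : ℝ) h8
    exact h10.congr_deriv (by simp [coordKer_zero_right ha0])
  · have hn : Complex.normSq ζ ≠ 0 := (Complex.normSq_pos.2 hζ).ne'
    have hc : starRingEnd ℂ ζ ≠ 0 := by simpa using hζ
    have hpow : ∀ w : ℂ, w ≠ 0 →
        (‖w‖ : ℂ) ^ (2 * a) = Complex.exp (a * Real.log (Complex.normSq w)) := by
      intro w hw
      have hw' : 0 < ‖w‖ := norm_pos_iff.2 hw
      rw [Complex.cpow_def_of_ne_zero (by exact_mod_cast hw'.ne'), ← Complex.ofReal_log hw'.le,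
        Complex.normSq_eq_norm_sq, Real.log_pow]
      congr 1
      push_cast
      ring
    have hw : HasDerivAt (fun t : ℝ ↦ ζ + t • c) c 0 := by
      simpa using ((hasDerivAt_id (0 : ℝ)).smul_const c).const_add ζ
    have hwc : HasDerivAt (fun t : ℝ ↦ starRingEnd ℂ (ζ + t • c)) (starRingEnd ℂ c) 0 := by
      have := ((hasDerivAt_id (0 : ℝ)).smul_const (starRingEnd ℂ c)).const_add (starRingEnd ℂ ζ)
      simpa using this
    have hre : HasDerivAt (fun t : ℝ ↦ ζ.re + t * c.re) c.re 0 := by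
      simpa using ((hasDerivAt_id (0 : ℝ)).mul_const c.re).const_add ζ.re
    have him : HasDerivAt (fun t : ℝ ↦ ζ.im + t * c.im) c.im 0 := by
      simpa using ((hasDerivAt_id (0 : ℝ)).mul_const c.im).const_add ζ.im
    have hns : HasDerivAt (fun t : ℝ ↦ Complex.normSq (ζ + t • c))
        (2 * (ζ.re * c.re + ζ.im * c.im)) 0 := by
      have := (hre.mul hre).add (him.mul him)
      refine (this.congr_of_eventuallyEq (Eventually.of_forall fun t ↦ ?_)).congr_deriv ?_
      · simp [Complex.normSq_apply]
      · simp; ring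
    have hlog := (hns.log (by simpa using hζ)).ofReal_comp
    have hexp := (hlog.const_mul a).cexp
    have hden := (hw.pow m).mul (hwc.pow n)
    have hfin := hexp.div hden (by simp [hζ])
    have hev : ∀ᶠ t : ℝ in 𝓝 0, ζ + t • c ≠ 0 := by
      refine hw.continuousAt.eventually_ne (by simpa using hζ)
    refine (hfin.congr_of_eventuallyEq ?_).congr_deriv ?_
    · filter_upwards [hev] with t ht
      simp only [coordKer, hpow _ ht, Pi.mul_apply, Pi.div_apply, Pi.pow_apply]
    · have hR : ((2 * (ζ.re * c.re + ζ.im * c.im) : ℝ) : ℂ) =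
          ζ * starRingEnd ℂ c + starRingEnd ℂ ζ * c := by
        apply Complex.ext
        · simp; ring
        · simp; ring
      have hN : ((Complex.normSq ζ : ℝ) : ℂ) = ζ * starRingEnd ℂ ζ := (Complex.mul_conj ζ).symm
      simp only [zero_smul, add_zero, Complex.ofReal_div, hR, hN, coordKer, hpow ζ hζ,
        Pi.mul_apply, Pi.pow_apply]
      generalize Complex.exp _ = x
      have key : ∀ (k : ℕ) (y : ℂ), y ≠ 0 → (k : ℂ) * y ^ (k - 1) = k * y ^ k / y := by
        intro k y hy
        cases k with
        | zero => simp
        | succ k => rw [Nat.add_sub_cancel, pow_succ]; field_simp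
      rw [key m ζ hζ, key n _ hc]
      field_simp
      ring

/-- One-dimensional Cauchy–Pompeiu formula for compactly supported functions. -/
theorem integral_inv_mul_dbar {g : ℂ → ℂ} (hg : ContDiff ℝ 1 g) (hs : HasCompactSupport g) :
    ∫ ζ : ℂ, ζ⁻¹ * ((fderiv ℝ g ζ 1 + Complex.I * fderiv ℝ g ζ Complex.I) / 2) =
      -Real.pi * g 0 := by
  rw [← Complex.integral_comp_polarCoord_symm]
  set e : ℝ → ℂ := fun θ ↦ Complex.exp (θ * Complex.I) with he
  have hec : Continuous e := by fun_prop
  have hnorm : ∀ θ, ‖e θ‖ = 1 := fun θ ↦ Complex.norm_exp_ofReal_mul_I θ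
  have hDc : Continuous (fderiv ℝ g) := hg.continuous_fderiv one_ne_zero
  set A : ℝ × ℝ → ℂ := fun p ↦ fderiv ℝ g (p.1 * e p.2) (e p.2) with hA
  set B : ℝ × ℝ → ℂ := fun p ↦ fderiv ℝ g (p.1 * e p.2) (Complex.I * e p.2) with hB
  have hAc : Continuous A := by
    refine Continuous.clm_apply (hDc.comp (by fun_prop)) (by fun_prop)
  have hBc : Continuous B := by
    refine Continuous.clm_apply (hDc.comp (by fun_prop)) (by fun_prop)
  obtain ⟨ρ, hρ, hsub⟩ : ∃ ρ > 0, tsupport g ⊆ Metric.ball 0 ρ := by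
    obtain ⟨ρ, hρ⟩ := hs.isCompact.isBounded.subset_ball (0 : ℂ)
    exact ⟨max ρ 1, by positivity, hρ.trans (Metric.ball_subset_ball (le_max_left _ _))⟩
  have hzero : ∀ p : ℝ × ℝ, ρ ≤ p.1 → g (p.1 * e p.2) = 0 ∧ fderiv ℝ g (p.1 * e p.2) = 0 := by
    intro p hp
    have hn : (p.1 * e p.2 : ℂ) ∉ tsupport g := by
      intro h
      have := hsub h
      rw [mem_ball_zero_iff, norm_mul, hnorm, mul_one, Complex.norm_real, Real.norm_eq_abs] at this
      linarith [le_abs_self p.1]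
    exact ⟨image_eq_zero_of_notMem_tsupport hn,
      image_eq_zero_of_notMem_tsupport fun h ↦ hn (tsupport_fderiv_subset ℝ h)⟩
  -- the integrand in polar coordinates
  have hint : ∀ p ∈ polarCoord.target, p.1 • ((Complex.polarCoord.symm p)⁻¹ *
      ((fderiv ℝ g (Complex.polarCoord.symm p) 1 +
        Complex.I * fderiv ℝ g (Complex.polarCoord.symm p) Complex.I) / 2)) =
      (A p + Complex.I * B p) / 2 := by
    rintro ⟨r, θ⟩ hp
    have hr : 0 < r := by simpa using (polarCoord_target ▸ hp : (r, θ) ∈ Ioi 0 ×ˢ Ioo _ _).1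
    have hsymm : Complex.polarCoord.symm (r, θ) = r * e θ := by
      rw [Complex.polarCoord_symm_apply]
      simp [he, Complex.exp_mul_I]
    have hr' : (r : ℂ) ≠ 0 := by exact_mod_cast hr.ne'
    have heθ : e θ ≠ 0 := Complex.exp_ne_zero _
    have hlin : ∀ v : ℂ, fderiv ℝ g (r * e θ) v =
        v.re * fderiv ℝ g (r * e θ) 1 + v.im * fderiv ℝ g (r * e θ) Complex.I := by
      intro v
      have hv : v = v.re • (1 : ℂ) + v.im • Complex.I := by
        simp [Complex.re_add_im]
      exact (congrArg _ hv).trans (by rw [map_add, map_smul, map_smul, Complex.real_smul,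
        Complex.real_smul])
    have hcs : (Complex.re (e θ) : ℂ) ^ 2 + (Complex.im (e θ) : ℂ) ^ 2 = 1 := by
      have := Complex.sq_norm (e θ)
      rw [hnorm, Complex.normSq_apply] at this
      norm_cast
      nlinarith
    have hinv : (e θ)⁻¹ = Complex.re (e θ) - Complex.im (e θ) * Complex.I := by
      rw [inv_eq_iff_eq_inv, eq_comm, inv_eq_iff_eq_inv]
      refine eq_inv_of_mul_eq_one_left ?_
      conv_lhs => rw [← Complex.re_add_im (e θ)]
      simp only [Complex.add_re, Complex.ofReal_re, Complex.mul_re, Complex.I_re, mul_zero,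
        Complex.ofReal_im, Complex.I_im, mul_one, sub_self, add_zero, Complex.add_im,
        Complex.mul_im, zero_add]
      linear_combination hcs - (Complex.im (e θ) : ℂ) ^ 2 * Complex.I_sq
    simp only [hsymm, hA, hB]
    rw [hlin (e θ), hlin (Complex.I * e θ), mul_inv, hinv, Complex.real_smul]
    simp only [Complex.mul_re, Complex.I_re, Complex.I_im, Complex.mul_im, zero_mul, one_mul,
      zero_sub, zero_add, Complex.ofReal_neg]
    field_simp
    ring_nf
    simp only [Complex.I_sq]
    ring
  rw [setIntegral_congr_fun polarCoord.open_target.measurableSet hint]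
  have htarget : polarCoord.target = Ioi (0 : ℝ) ×ˢ Ioo (-Real.pi) Real.pi := rfl
  have hπ : -Real.pi ≤ Real.pi := by linarith [Real.pi_pos]
  have hset : ∫ p in polarCoord.target, (A p + Complex.I * B p) / 2 =
      ∫ p in Ioc 0 ρ ×ˢ Ioc (-Real.pi) Real.pi, (A p + Complex.I * B p) / 2 := by
    have h1 : ∫ p in polarCoord.target, (A p + Complex.I * B p) / 2 =
        ∫ p in Ioi 0 ×ˢ Ioc (-Real.pi) Real.pi, (A p + Complex.I * B p) / 2 := by
      rw [htarget]
      refine setIntegral_congr_set ?_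
      exact Measure.set_prod_ae_eq (ae_eq_refl _) Ioo_ae_eq_Ioc
    rw [h1]
    refine setIntegral_eq_of_subset_of_forall_sdiff_eq_zero
      (measurableSet_Ioi.prod measurableSet_Ioc) (prod_mono Ioc_subset_Ioi_self subset_rfl) ?_
    rintro p ⟨⟨hp1, hp2⟩, hp3⟩
    have hp : ρ ≤ p.1 := by
      by_contra h
      exact hp3 ⟨⟨hp1, (not_le.1 h).le⟩, hp2⟩
    simp [hA, hB, (hzero p hp).2]
  rw [hset]
  have hIA : IntegrableOn A (Ioc 0 ρ ×ˢ Ioc (-Real.pi) Real.pi) :=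
    (hAc.continuousOn.integrableOn_compact (isCompact_Icc.prod isCompact_Icc)).mono_set
      (prod_mono Ioc_subset_Icc_self Ioc_subset_Icc_self)
  have hIB : IntegrableOn B (Ioc 0 ρ ×ˢ Ioc (-Real.pi) Real.pi) :=
    (hBc.continuousOn.integrableOn_compact (isCompact_Icc.prod isCompact_Icc)).mono_set
      (prod_mono Ioc_subset_Icc_self Ioc_subset_Icc_self)
  have hcurve : ∀ r θ : ℝ, HasDerivAt (fun r : ℝ ↦ g (r * e θ)) (A (r, θ)) r := by
    intro r θ
    have h1 : HasDerivAt (fun r : ℝ ↦ (r * e θ : ℂ)) (e θ) r := by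
      simpa using (Complex.ofRealCLM.hasDerivAt (x := r)).mul_const (e θ)
    exact ((hg.differentiable one_ne_zero _).hasFDerivAt).comp_hasDerivAt r h1
  have hcircle : ∀ r θ : ℝ, HasDerivAt (fun θ : ℝ ↦ g (r * e θ)) (r * B (r, θ)) θ := by
    intro r θ
    have h1 : HasDerivAt (fun θ : ℝ ↦ (r * e θ : ℂ)) (r * (Complex.I * e θ)) θ := by
      have h2 : HasDerivAt (fun θ : ℝ ↦ (θ * Complex.I : ℂ)) Complex.I θ := by
        simpa using (Complex.ofRealCLM.hasDerivAt (x := θ)).mul_const Complex.I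
      exact ((h2.cexp).const_mul (r : ℂ)).congr_deriv (by simp only [he]; ring)
    have h3 := ((hg.differentiable one_ne_zero (r * e θ)).hasFDerivAt).comp_hasDerivAt θ h1
    refine h3.congr_deriv ?_
    simpa only [Complex.real_smul] using (fderiv ℝ g (r * e θ)).map_smul r (Complex.I * e θ)
  have hintA : ∫ p in Ioc 0 ρ ×ˢ Ioc (-Real.pi) Real.pi, A p = -(2 * Real.pi) * g 0 := by
    rw [Measure.volume_eq_prod, ← setIntegral_prod_swap,
      setIntegral_prod (fun z ↦ A z.swap) hIA.swap]
    have : ∀ θ : ℝ, ∫ r in Ioc 0 ρ, A (r, θ) = - g 0 := by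
      intro θ
      rw [← intervalIntegral.integral_of_le hρ.le,
        intervalIntegral.integral_eq_sub_of_hasDerivAt (fun r _ ↦ hcurve r θ)
          ((hAc.comp (by fun_prop)).intervalIntegrable _ _), (hzero (ρ, θ) le_rfl).1]
      simp
    simp only [Prod.swap_prod_mk, this]
    simp
    rw [← two_mul]
    simp [Real.pi_pos.le]
  have hintB : ∫ p in Ioc 0 ρ ×ˢ Ioc (-Real.pi) Real.pi, B p = 0 := by
    rw [Measure.volume_eq_prod, setIntegral_prod _ hIB]
    have : ∀ r ∈ Ioc 0 ρ, ∫ θ in Ioc (-Real.pi) Real.pi, B (r, θ) = 0 := by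
      intro r hr
      have hr' : (r : ℂ) ≠ 0 := by exact_mod_cast hr.1.ne'
      have h1 : ∫ θ in (-Real.pi)..Real.pi, (r : ℂ) * B (r, θ) = 0 := by
        rw [intervalIntegral.integral_eq_sub_of_hasDerivAt (fun θ _ ↦ hcircle r θ)
          ((continuous_const.mul (hBc.comp (by fun_prop))).intervalIntegrable _ _)]
        simp [he, Complex.exp_neg]
      rw [intervalIntegral.integral_const_mul] at h1
      rw [← intervalIntegral.integral_of_le hπ]
      exact (mul_eq_zero.1 h1).resolve_left hr'
    rw [setIntegral_congr_fun measurableSet_Ioc this]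
    simp
  rw [integral_div, integral_add hIA (hIB.const_mul _), integral_const_mul, hintA, hintB]
  ring

/-! ### Leading coefficients of meromorphic continuations -/

/-- The function `G`, defined for `Re λ` large, continues meromorphically past the origin, and
`λ^m G(λ)` has the limit `L` at the origin. -/
def HasLeading (G : ℂ → ℂ) (m : ℕ) (L : ℂ) : Prop :=
  ∃ ε > (0 : ℝ), ∃ F : ℂ → ℂ, MeromorphicOn F {lam | -ε < lam.re} ∧
    (∃ R : ℝ, ∀ lam : ℂ, R < lam.re → F lam = G lam) ∧
    Tendsto (fun lam ↦ lam ^ m * F lam) (𝓝[≠] 0) (𝓝 L)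

theorem HasLeading.congr {G G' : ℂ → ℂ} {m : ℕ} {L : ℂ} (h : HasLeading G m L) {R : ℝ}
    (hG : ∀ lam : ℂ, R < lam.re → G lam = G' lam) : HasLeading G' m L := by
  obtain ⟨ε, hε, F, hF, ⟨R', hR'⟩, hL⟩ := h
  refine ⟨ε, hε, F, hF, ⟨max R R', fun lam hl ↦ ?_⟩, hL⟩
  rw [hR' lam ((le_max_right _ _).trans_lt hl), hG lam ((le_max_left _ _).trans_lt hl)]

theorem HasLeading.zero (m : ℕ) : HasLeading (fun _ ↦ 0) m 0 :=
  ⟨1, one_pos, fun _ ↦ 0, fun _ _ ↦ MeromorphicAt.const 0 _, ⟨0, fun _ _ ↦ rfl⟩, by simp⟩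

theorem HasLeading.add {G G' : ℂ → ℂ} {m : ℕ} {L L' : ℂ} (h : HasLeading G m L)
    (h' : HasLeading G' m L') : HasLeading (fun lam ↦ G lam + G' lam) m (L + L') := by
  obtain ⟨ε, hε, F, hF, ⟨R, hR⟩, hL⟩ := h
  obtain ⟨ε', hε', F', hF', ⟨R', hR'⟩, hL'⟩ := h'
  refine ⟨min ε ε', lt_min hε hε', F + F', ?_, ⟨max R R', fun lam hl ↦ ?_⟩, ?_⟩
  · intro lam hl
    simp only [mem_ofPred_eq] at hl
    refine (hF lam ?_).add (hF' lam ?_)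
    · show -ε < lam.re
      linarith [min_le_left ε ε']
    · show -ε' < lam.re
      linarith [min_le_right ε ε']
  · rw [Pi.add_apply, hR lam ((le_max_left _ _).trans_lt hl),
      hR' lam ((le_max_right _ _).trans_lt hl)]
  · simpa [mul_add] using hL.add hL'

theorem HasLeading.const_mul {G : ℂ → ℂ} {m : ℕ} {L : ℂ} (h : HasLeading G m L) (c : ℂ) :
    HasLeading (fun lam ↦ c * G lam) m (c * L) := by
  obtain ⟨ε, hε, F, hF, ⟨R, hR⟩, hL⟩ := h
  refine ⟨ε, hε, fun lam ↦ c * F lam, fun lam hl ↦ (MeromorphicAt.const c lam).mul (hF lam hl),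
    ⟨R, fun lam hl ↦ by simp only [hR lam hl]⟩, ?_⟩
  exact (hL.const_mul c).congr fun lam ↦ by ring

/-- A pole of order at most `m` has no term of order `k > m`. -/
theorem HasLeading.of_lt {G : ℂ → ℂ} {m k : ℕ} {L : ℂ} (h : HasLeading G m L) (hk : m < k) :
    HasLeading G k 0 := by
  obtain ⟨ε, hε, F, hF, hR, hL⟩ := h
  refine ⟨ε, hε, F, hF, hR, ?_⟩
  have h1 : Tendsto (fun lam : ℂ ↦ lam ^ (k - m)) (𝓝[≠] 0) (𝓝 0) := by
    have : Continuous fun lam : ℂ ↦ lam ^ (k - m) := by fun_prop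
    have h2 := (this.tendsto 0).mono_left (nhdsWithin_le_nhds (s := {0}ᶜ))
    rwa [zero_pow (Nat.sub_ne_zero_of_lt hk)] at h2
  have h3 := h1.mul hL
  rw [zero_mul] at h3
  refine h3.congr fun lam ↦ ?_
  rw [← mul_assoc, ← pow_add, Nat.sub_add_cancel hk.le]

/-- The effect on leading coefficients of an integration by parts which lowers a pole order: the
factor `λ I - a` produces a pole at the origin exactly when `a = 0`. -/
theorem HasLeading.of_recursion {G G₁ G₂ : ℂ → ℂ} {m I a : ℕ} {L₁ L₂ : ℂ} (hI : I ≠ 0)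
    (h₁ : HasLeading G₁ m L₁) (h₂ : HasLeading G₂ m L₂) {R : ℝ}
    (hG : ∀ lam : ℂ, R < lam.re → (lam * I - a) * G lam = -(G₁ lam + lam * G₂ lam)) :
    HasLeading G (if a = 0 then m + 1 else m) (if a = 0 then -(1 / I) * L₁ else L₁ / a) := by
  obtain ⟨ε, hε, F₁, hF₁, ⟨R₁, hR₁⟩, hL₁⟩ := h₁
  obtain ⟨ε', hε', F₂, hF₂, ⟨R₂, hR₂⟩, hL₂⟩ := h₂
  have hI' : (I : ℂ) ≠ 0 := by exact_mod_cast hI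
  refine ⟨min ε ε', lt_min hε hε', fun lam ↦ -(F₁ lam + lam * F₂ lam) / (lam * I - a), ?_, ?_, ?_⟩
  · intro lam hl
    simp only [mem_ofPred_eq] at hl
    have h1 : MeromorphicAt F₁ lam := hF₁ lam (by
      show -ε < lam.re
      linarith [min_le_left ε ε'])
    have h2 : MeromorphicAt F₂ lam := hF₂ lam (by
      show -ε' < lam.re
      linarith [min_le_right ε ε'])
    have h3 : MeromorphicAt (fun lam : ℂ ↦ lam) lam := MeromorphicAt.id lam
    exact (h1.add (h3.mul h2)).neg.div ((h3.mul (MeromorphicAt.const _ _)).sub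
      (MeromorphicAt.const _ _))
  · refine ⟨max (max R a) (max R₁ R₂), fun lam hl ↦ ?_⟩
    simp only [max_lt_iff] at hl
    have hne : lam * I - a ≠ 0 := by
      intro h
      have h1 := congrArg Complex.re h
      simp at h1
      have h2 : (1 : ℝ) ≤ I := by exact_mod_cast Nat.one_le_iff_ne_zero.2 hI
      have h3 : (0 : ℝ) ≤ a := by positivity
      nlinarith [hl.1.2]
    simp only [hR₁ lam hl.2.1, hR₂ lam hl.2.2, ← hG lam hl.1.1]
    rw [mul_div_assoc, mul_div_cancel₀ _ hne]
  · have hid : Tendsto (fun lam : ℂ ↦ lam) (𝓝[≠] 0) (𝓝 0) := nhdsWithin_le_nhds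
    have h3 := (hL₁.add (hid.mul hL₂)).neg
    rw [zero_mul, add_zero] at h3
    split_ifs with ha
    · subst ha
      have h4 := h3.div_const (I : ℂ)
      rw [show -(1 / (I : ℂ)) * L₁ = -L₁ / I by ring]
      refine h4.congr' ?_
      filter_upwards [self_mem_nhdsWithin] with lam hlam
      have : lam ≠ 0 := hlam
      push_cast
      field_simp
      ring
    · have ha' : (a : ℂ) ≠ 0 := by exact_mod_cast ha
      have h5 : Tendsto (fun lam : ℂ ↦ lam * I - a) (𝓝[≠] 0) (𝓝 (0 * I - a)) :=
        (hid.mul_const _).sub_const _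
      have h4 := h3.div h5 (by simpa using ha')
      rw [show -L₁ / (0 * (I : ℂ) - a) = L₁ / a by rw [zero_mul, zero_sub, neg_div_neg_eq]] at h4
      refine h4.congr fun lam ↦ ?_
      simp only [Pi.div_apply]
      ring

/-! ### Singular integrals in several variables -/

/-- Test functions. -/
def IsTest {d : ℕ} (χ : (Fin d → ℂ) → ℂ) : Prop := ContDiff ℝ ∞ χ ∧ HasCompactSupport χ

/-- The kernel `∏_j |z_j|^{2 λ I_j} z_j^{-J_j} z̄_j^{-K_j}`. -/
noncomputable def singKer {d : ℕ} (I J K : Fin d → ℕ) (lam : ℂ) (z : Fin d → ℂ) : ℂ :=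
  ∏ j, coordKer (lam * I j) (J j) (K j) (z j)

/-- The integral `∫ ∏_j |z_j|^{2 λ I_j} z_j^{-J_j} z̄_j^{-K_j} e^{λ v} χ`. -/
noncomputable def singInt {d : ℕ} (I J K : Fin d → ℕ) (v χ : (Fin d → ℂ) → ℂ) (lam : ℂ) : ℂ :=
  ∫ z, singKer I J K lam z * (Complex.exp (lam * v z) * χ z)

theorem measurable_singKer {d : ℕ} (I J K : Fin d → ℕ) (lam : ℂ) :
    Measurable (singKer I J K lam) :=
  Finset.measurable_fun_prod _ fun j _ ↦ (measurable_coordKer _ _ _).comp (measurable_pi_apply j)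

theorem ae_forall_coord_ne_zero (d : ℕ) : ∀ᵐ z : Fin d → ℂ, ∀ j, z j ≠ 0 := by
  refine ae_all_iff.2 fun j ↦ ?_
  have := Measure.ae_eval_ne (μ := fun _ : Fin d ↦ (volume : Measure ℂ)) j 0
  exact this

/-- A dominating function that is uniform for `λ` in a bounded part of a half plane: near the
origin the kernel in each variable is bounded by an integrable power of `|ζ|`. -/
theorem exists_integrable_bound {d : ℕ} {I J K : Fin d → ℕ} {v χ : (Fin d → ℂ) → ℂ}
    (hv : Continuous v) (hχ : Continuous χ) (hs : HasCompactSupport χ) {c C Λ : ℝ}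
    (hc : ∀ j, -2 < 2 * (c * I j) - J j - K j) :
    ∃ b : (Fin d → ℂ) → ℝ, Integrable b ∧ ∀ᵐ z, ∀ lam : ℂ, c ≤ lam.re → lam.re ≤ C → ‖lam‖ ≤ Λ →
      ‖singKer I J K lam z * (Complex.exp (lam * v z) * χ z)‖ ≤ b z := by
  obtain ⟨ρ, hρ⟩ := hs.isCompact.isBounded.subset_ball (0 : Fin d → ℂ)
  obtain ⟨M₁, hM₁⟩ := hs.isCompact.exists_bound_of_continuousOn hv.continuousOn
  obtain ⟨M₂, hM₂⟩ := hs.isCompact.exists_bound_of_continuousOn hχ.continuousOn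
  by_cases hcC : c ≤ C
  swap
  · exact ⟨0, integrable_zero _ _ _, Eventually.of_forall fun z lam h1 h2 ↦
      absurd (h1.trans h2) hcC⟩
  set p : Fin d → ℝ := fun j ↦ 2 * (c * I j) - J j - K j with hp
  set q : Fin d → ℝ := fun j ↦ 2 * (C * I j) - J j - K j with hq
  have hpq : ∀ j, p j ≤ q j := fun j ↦ by
    have : c * I j ≤ C * I j := mul_le_mul_of_nonneg_right hcC (by positivity)
    simp only [hp, hq]; linarith
  set b : Fin d → ℂ → ℝ := fun j ζ ↦ (Iio ρ).indicator (fun r : ℝ ↦ r ^ p j) ‖ζ‖ +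
    (Iio ρ).indicator (fun r : ℝ ↦ r ^ q j) ‖ζ‖ with hb
  have hbi : Integrable (fun z : Fin d → ℂ ↦ ∏ j, b j (z j)) :=
    Integrable.fintype_prod fun j ↦ (integrable_norm_rpow_ball (hc j)).add
      (integrable_norm_rpow_ball ((hc j).trans_le (hpq j)))
  have hb0 : ∀ j ζ, 0 ≤ b j ζ := fun j ζ ↦ by
    refine add_nonneg ?_ ?_ <;>
    exact indicator_apply_nonneg fun _ ↦ Real.rpow_nonneg (norm_nonneg _) _
  refine ⟨fun z ↦ (∏ j, b j (z j)) * (Real.exp (Λ * M₁) * |M₂|), hbi.mul_const _, ?_⟩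
  filter_upwards [ae_forall_coord_ne_zero d] with z hz lam h1 h2 h3
  by_cases hzs : z ∈ tsupport χ
  swap
  · rw [image_eq_zero_of_notMem_tsupport hzs]
    simp only [mul_zero, norm_zero]
    exact mul_nonneg (Finset.prod_nonneg fun j _ ↦ hb0 j _) (by positivity)
  have hzn : ∀ j, ‖z j‖ ∈ Iio ρ := fun j ↦
    (norm_le_pi_norm z j).trans_lt (mem_ball_zero_iff.1 (hρ hzs))
  rw [norm_mul, norm_mul]
  refine mul_le_mul ?_ (mul_le_mul ?_ ((hM₂ z hzs).trans (le_abs_self _))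
    (norm_nonneg _) (Real.exp_pos _).le)
    (by positivity) (Finset.prod_nonneg fun j _ ↦ hb0 j _)
  · rw [singKer, norm_prod]
    refine Finset.prod_le_prod (fun j _ ↦ norm_nonneg _) fun j _ ↦ ?_
    rw [norm_coordKer _ _ _ (hz j)]
    simp only [hb, indicator_of_mem (hzn j)]
    have hpos : 0 < ‖z j‖ := norm_pos_iff.2 (hz j)
    have hre : (lam * I j).re = lam.re * I j := by simp
    rw [hre]
    have h4 : c * I j ≤ lam.re * I j := mul_le_mul_of_nonneg_right h1 (by positivity)
    have h5 : lam.re * I j ≤ C * I j := mul_le_mul_of_nonneg_right h2 (by positivity)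
    rcases le_total ‖z j‖ 1 with hle | hle
    · have := Real.rpow_le_rpow_of_exponent_ge hpos hle
        (show p j ≤ 2 * (lam.re * I j) - J j - K j by simp only [hp]; linarith)
      linarith [Real.rpow_nonneg hpos.le (q j)]
    · have := Real.rpow_le_rpow_of_exponent_le hle
        (show 2 * (lam.re * I j) - J j - K j ≤ q j by simp only [hq]; linarith)
      linarith [Real.rpow_nonneg hpos.le (p j)]
  · rw [Complex.norm_exp]
    refine Real.exp_le_exp.2 ((Complex.re_le_norm _).trans ?_)
    rw [norm_mul]
    exact mul_le_mul h3 (hM₁ z hzs) (norm_nonneg _) ((norm_nonneg _).trans h3)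

theorem aestronglyMeasurable_singInt {d : ℕ} {I J K : Fin d → ℕ} {v χ : (Fin d → ℂ) → ℂ}
    (hv : Continuous v) (hχ : Continuous χ) (lam : ℂ) :
    AEStronglyMeasurable (fun z ↦ singKer I J K lam z * (Complex.exp (lam * v z) * χ z)) := by
  have h1 : Continuous fun z ↦ Complex.exp (lam * v z) * χ z := by fun_prop
  exact ((measurable_singKer I J K lam).mul h1.measurable).aestronglyMeasurable

theorem integrable_singInt {d : ℕ} {I J K : Fin d → ℕ} {v χ : (Fin d → ℂ) → ℂ}
    (hv : Continuous v) (hχ : Continuous χ) (hs : HasCompactSupport χ) {lam : ℂ}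
    (hc : ∀ j, -2 < 2 * (lam.re * I j) - J j - K j) :
    Integrable (fun z ↦ singKer I J K lam z * (Complex.exp (lam * v z) * χ z)) := by
  obtain ⟨b, hb, hbd⟩ := exists_integrable_bound (Λ := ‖lam‖) (C := lam.re) hv hχ hs hc
  refine hb.mono' (aestronglyMeasurable_singInt hv hχ lam) ?_
  filter_upwards [hbd] with z hz using hz lam le_rfl le_rfl le_rfl

/-- The integral depends holomorphically on `λ` wherever the exponents allow it to converge. -/
theorem differentiableAt_singInt {d : ℕ} {I J K : Fin d → ℕ} {v χ : (Fin d → ℂ) → ℂ}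
    (hv : Continuous v) (hχ : Continuous χ) (hs : HasCompactSupport χ) {lam : ℂ} {c : ℝ}
    (hlam : c < lam.re) (hc : ∀ j, -2 < 2 * (c * I j) - J j - K j) :
    DifferentiableAt ℂ (singInt I J K v χ) lam := by
  obtain ⟨b, hb, hbd⟩ := exists_integrable_bound (Λ := ‖lam‖ + (lam.re - c))
    (C := lam.re + (lam.re - c)) hv hχ hs hc
  refine differentiableAt_integral_of_dominated (sub_pos.2 hlam) (bound := b)
    (fun z _ ↦ aestronglyMeasurable_singInt hv hχ z) ?_ ?_ hb
  · filter_upwards [ae_forall_coord_ne_zero d] with z hz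
    refine Differentiable.differentiableOn ?_
    refine Differentiable.fun_mul ?_ (by fun_prop)
    unfold singKer coordKer
    refine Differentiable.fun_finsetProd fun j _ ↦ ?_
    refine Differentiable.div_const ?_ _
    refine Differentiable.const_cpow (by fun_prop) (Or.inl ?_)
    exact_mod_cast norm_ne_zero_iff.2 (hz j)
  · filter_upwards [hbd] with z hz mu hmu
    rw [mem_ball_iff_norm] at hmu
    have h1 := Complex.abs_re_le_norm (mu - lam)
    rw [Complex.sub_re] at h1
    have h2 := abs_lt.1 (h1.trans_lt hmu)
    refine hz mu (by linarith [h2.1]) (by linarith [h2.2]) ?_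
    have := norm_sub_norm_le mu lam
    linarith

/-- If no pole order exceeds one, the integral is holomorphic at the origin. -/
theorem hasLeading_singInt_of_le_one {d : ℕ} {I J K : Fin d → ℕ} {v χ : (Fin d → ℂ) → ℂ}
    (hv : Continuous v) (hχ : Continuous χ) (hs : HasCompactSupport χ)
    (hJK : ∀ j, J j + K j ≤ 1) :
    HasLeading (singInt I J K v χ) 0 (∫ z, singKer I J K 0 z * χ z) := by
  set N : ℝ := ∑ j, (I j : ℝ) with hN
  have hN0 : 0 ≤ N := Finset.sum_nonneg fun j _ ↦ by positivity
  have hIN : ∀ j, (I j : ℝ) ≤ N := fun j ↦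
    Finset.single_le_sum (f := fun j ↦ (I j : ℝ)) (fun j _ ↦ by positivity) (Finset.mem_univ j)
  set ε : ℝ := 1 / (4 * (N + 1)) with hε
  have hε0 : 0 < ε := by positivity
  have hc : ∀ j, -2 < 2 * (-(2 * ε) * I j) - J j - K j := by
    intro j
    have h1 : (J j : ℝ) + K j ≤ 1 := by exact_mod_cast hJK j
    have h2 : ε * I j < 1 / 4 := by
      rw [hε, one_div, inv_mul_lt_iff₀ (by positivity)]
      linarith [hIN j]
    linarith
  have hdiff : ∀ lam : ℂ, -ε < lam.re → DifferentiableAt ℂ (singInt I J K v χ) lam :=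
    fun lam hl ↦ differentiableAt_singInt hv hχ hs (c := -(2 * ε)) (by linarith) hc
  refine ⟨ε, hε0, singInt I J K v χ, ?_, ⟨0, fun _ _ ↦ rfl⟩, ?_⟩
  · have hopen : IsOpen {lam : ℂ | -ε < lam.re} := isOpen_lt continuous_const Complex.continuous_re
    have : DifferentiableOn ℂ (singInt I J K v χ) {lam : ℂ | -ε < lam.re} :=
      fun lam hl ↦ (hdiff lam hl).differentiableWithinAt
    exact (this.analyticOnNhd hopen).meromorphicOn
  · have := (hdiff 0 (by simpa using hε0)).continuousAt.tendsto.mono_left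
      (nhdsWithin_le_nhds (s := {0}ᶜ))
    rw [show singInt I J K v χ 0 = ∫ z, singKer I J K 0 z * χ z by simp [singInt]] at this
    simpa using this

/-! ### Wirtinger derivatives -/

section Wirtinger

variable {d : ℕ} {f g : (Fin d → ℂ) → ℂ} {Ω : Set (Fin d → ℂ)} {z : Fin d → ℂ} (j : Fin d)

theorem contDiffOn_fderiv_apply_infty (hΩ : IsOpen Ω) (hf : ContDiffOn ℝ ∞ f Ω)
    (e : Fin d → ℂ) : ContDiffOn ℝ ∞ (fun z ↦ fderiv ℝ f z e) Ω :=
  (hf.fderiv_of_isOpen hΩ (by simp)).clm_apply contDiffOn_const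

theorem ContDiffOn.wirtinger (hΩ : IsOpen Ω) (hf : ContDiffOn ℝ ∞ f Ω) :
    ContDiffOn ℝ ∞ (wirtinger j f) Ω :=
  ((contDiffOn_fderiv_apply_infty hΩ hf _).sub
    (contDiffOn_const.mul (contDiffOn_fderiv_apply_infty hΩ hf _))).div_const _

theorem ContDiffOn.wirtingerBar (hΩ : IsOpen Ω) (hf : ContDiffOn ℝ ∞ f Ω) :
    ContDiffOn ℝ ∞ (wirtingerBar j f) Ω :=
  ((contDiffOn_fderiv_apply_infty hΩ hf _).add
    (contDiffOn_const.mul (contDiffOn_fderiv_apply_infty hΩ hf _))).div_const _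

theorem wirtinger_eqOn (hΩ : IsOpen Ω) (h : EqOn f g Ω) :
    EqOn (wirtinger j f) (wirtinger j g) Ω := by
  intro z hz
  have := (h.eventuallyEq_of_mem (hΩ.mem_nhds hz)).fderiv_eq (𝕜 := ℝ)
  simp only [wirtinger, this]

theorem wirtingerBar_eqOn (hΩ : IsOpen Ω) (h : EqOn f g Ω) :
    EqOn (wirtingerBar j f) (wirtingerBar j g) Ω := by
  intro z hz
  have := (h.eventuallyEq_of_mem (hΩ.mem_nhds hz)).fderiv_eq (𝕜 := ℝ)
  simp only [wirtingerBar, this]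

theorem wirtinger_add (hf : DifferentiableAt ℝ f z) (hg : DifferentiableAt ℝ g z) :
    wirtinger j (fun z ↦ f z + g z) z = wirtinger j f z + wirtinger j g z := by
  simp only [wirtinger, fderiv_fun_add hf hg, add_apply]
  ring

theorem wirtingerBar_add (hf : DifferentiableAt ℝ f z) (hg : DifferentiableAt ℝ g z) :
    wirtingerBar j (fun z ↦ f z + g z) z = wirtingerBar j f z + wirtingerBar j g z := by
  simp only [wirtingerBar, fderiv_fun_add hf hg, add_apply]
  ring

theorem wirtinger_mul (hf : DifferentiableAt ℝ f z) (hg : DifferentiableAt ℝ g z) :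
    wirtinger j (fun z ↦ f z * g z) z = f z * wirtinger j g z + g z * wirtinger j f z := by
  simp only [wirtinger, fderiv_fun_mul hf hg, add_apply, smul_apply, smul_eq_mul]
  ring

theorem wirtingerBar_mul (hf : DifferentiableAt ℝ f z) (hg : DifferentiableAt ℝ g z) :
    wirtingerBar j (fun z ↦ f z * g z) z =
      f z * wirtingerBar j g z + g z * wirtingerBar j f z := by
  simp only [wirtingerBar, fderiv_fun_mul hf hg, add_apply, smul_apply, smul_eq_mul]
  ring

theorem wirtinger_const_mul (c : ℂ) :
    wirtinger j (fun z ↦ c * f z) = fun z ↦ c * wirtinger j f z := by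
  funext z
  have : fderiv ℝ (fun z ↦ c * f z) z = c • fderiv ℝ f z := by
    have := congrFun (fderiv_const_smul_field (𝕜 := ℝ) (f := f) c) z
    exact this
  simp only [wirtinger, this, smul_apply, smul_eq_mul]
  ring

theorem wirtingerBar_const_mul (c : ℂ) :
    wirtingerBar j (fun z ↦ c * f z) = fun z ↦ c * wirtingerBar j f z := by
  funext z
  have : fderiv ℝ (fun z ↦ c * f z) z = c • fderiv ℝ f z := by
    have := congrFun (fderiv_const_smul_field (𝕜 := ℝ) (f := f) c) z
    exact this
  simp only [wirtingerBar, this, smul_apply, smul_eq_mul]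
  ring

theorem fderiv_eq_zero_of_notMem_tsupport (hz : z ∉ tsupport f) : fderiv ℝ f z = 0 :=
  image_eq_zero_of_notMem_tsupport fun h ↦ hz (tsupport_fderiv_subset ℝ h)

theorem IsTest.wirtinger (hf : IsTest f) : IsTest (wirtinger j f) :=
  ⟨contDiffOn_univ.1 ((contDiffOn_univ.2 hf.1).wirtinger j isOpen_univ),
    hf.2.mono' fun z hz ↦ by
      by_contra h
      exact hz (by simp [_root_.wirtinger, fderiv_eq_zero_of_notMem_tsupport h])⟩

theorem IsTest.wirtingerBar (hf : IsTest f) : IsTest (wirtingerBar j f) :=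
  ⟨contDiffOn_univ.1 ((contDiffOn_univ.2 hf.1).wirtingerBar j isOpen_univ),
    hf.2.mono' fun z hz ↦ by
      by_contra h
      exact hz (by simp [_root_.wirtingerBar, fderiv_eq_zero_of_notMem_tsupport h])⟩

theorem IsTest.mul (hf : IsTest f) (hg : ContDiff ℝ ∞ g) : IsTest (fun z ↦ f z * g z) :=
  ⟨hf.1.mul hg, hf.2.mul_right⟩

theorem IsTest.const_mul (hf : IsTest f) (c : ℂ) : IsTest (fun z ↦ c * f z) :=
  ⟨contDiff_const.mul hf.1, hf.2.mul_left⟩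

theorem contDiff_wirtinger (hf : ContDiff ℝ ∞ f) : ContDiff ℝ ∞ (wirtinger j f) :=
  contDiffOn_univ.1 ((contDiffOn_univ.2 hf).wirtinger j isOpen_univ)

theorem contDiff_wirtingerBar (hf : ContDiff ℝ ∞ f) : ContDiff ℝ ∞ (wirtingerBar j f) :=
  contDiffOn_univ.1 ((contDiffOn_univ.2 hf).wirtingerBar j isOpen_univ)

end Wirtinger

/-! ### Integration by parts -/

section IBP

variable {d : ℕ} {I J K : Fin d → ℕ} {v χ : (Fin d → ℂ) → ℂ}

theorem singKer_eq_mul_erase (I J K : Fin d → ℕ) (lam : ℂ) (z : Fin d → ℂ) (j : Fin d) :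
    singKer I J K lam z = coordKer (lam * I j) (J j) (K j) (z j) *
      ∏ i ∈ Finset.univ.erase j, coordKer (lam * I i) (J i) (K i) (z i) :=
  (Finset.mul_prod_erase _ _ (Finset.mem_univ j)).symm

/-- Differentiating the kernel in the variable `z_j` raises one of the two pole orders in that
variable. -/
theorem hasLineDerivAt_singKer {lam : ℂ} (j : Fin d) (c : ℂ)
    (h : 1 < 2 * (lam * I j).re - J j - K j) (z : Fin d → ℂ) :
    HasLineDerivAt ℝ (singKer I J K lam)
      ((lam * I j - J j) * singKer I (Function.update J j (J j + 1)) K lam z * c +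
        (lam * I j - K j) * singKer I J (Function.update K j (K j + 1)) lam z * starRingEnd ℂ c)
      z (Pi.single j c) := by
  unfold HasLineDerivAt
  set P := ∏ i ∈ Finset.univ.erase j, coordKer (lam * I i) (J i) (K i) (z i) with hP
  have h1 : (fun t : ℝ ↦ singKer I J K lam (z + t • (Pi.single j c : Fin d → ℂ))) =
      fun t : ℝ ↦ coordKer (lam * I j) (J j) (K j) (z j + t • c) * P := by
    funext t
    rw [singKer_eq_mul_erase I J K lam _ j]
    congr 1
    · simp
    · refine Finset.prod_congr rfl fun i hi ↦ ?_
      simp [Finset.ne_of_mem_erase hi]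
  have h2 : singKer I (Function.update J j (J j + 1)) K lam z =
      coordKer (lam * I j) (J j + 1) (K j) (z j) * P := by
    rw [singKer_eq_mul_erase I _ K lam _ j, Function.update_self]
    congr 1
    refine Finset.prod_congr rfl fun i hi ↦ ?_
    rw [Function.update_of_ne (Finset.ne_of_mem_erase hi)]
  have h3 : singKer I J (Function.update K j (K j + 1)) lam z =
      coordKer (lam * I j) (J j) (K j + 1) (z j) * P := by
    rw [singKer_eq_mul_erase I J _ lam _ j, Function.update_self]
    congr 1
    refine Finset.prod_congr rfl fun i hi ↦ ?_
    rw [Function.update_of_ne (Finset.ne_of_mem_erase hi)]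
  rw [h1, h2, h3]
  exact ((hasDerivAt_coordKer_line h (z j) c).mul_const P).congr_deriv (by ring)

/-- A bound beyond which all integrands met in the integrations by parts are integrable. -/
def ibpBound (J K : Fin d → ℕ) : ℝ := ∑ i, ((J i : ℝ) + K i) + 3

/-- The exponents of the kernels occurring in one integration by parts in the variable `z_j`: all
of them are integrable, and those of the variables with `I_i ≠ 0` are large enough for
differentiation. -/
theorem exponent_gt {J' K' : Fin d → ℕ} (hI : ∀ i, J i + K i ≠ 0 → I i ≠ 0) {lam : ℂ}
    (hl : ibpBound J K < lam.re) (j : Fin d) (hIj : I j ≠ 0)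
    (hJ : ∀ i, i ≠ j → J' i = J i) (hK : ∀ i, i ≠ j → K' i = K i)
    (hj : J' j + K' j ≤ J j + K j + 1) (i : Fin d) :
    -2 < 2 * (lam.re * I i) - J' i - K' i ∧ (I i ≠ 0 → 1 < 2 * (lam.re * I i) - J' i - K' i) := by
  have h1 : (J i : ℝ) + K i ≤ ∑ i, ((J i : ℝ) + K i) :=
    Finset.single_le_sum (f := fun i ↦ (J i : ℝ) + K i) (fun _ _ ↦ by positivity)
      (Finset.mem_univ i)
  have h0 : (0 : ℝ) ≤ J i + K i := by positivity
  simp only [ibpBound] at hl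
  have h2 : (J' i : ℝ) + K' i ≤ J i + K i + 1 := by
    by_cases hij : i = j
    · subst hij; exact_mod_cast hj
    · rw [hJ i hij, hK i hij]; linarith
  by_cases hi : I i = 0
  · have hij : i ≠ j := fun h ↦ hIj (h ▸ hi)
    have h3 : J i + K i = 0 := by by_contra h; exact hI i h hi
    have h4 : J i = 0 ∧ K i = 0 := by omega
    refine ⟨?_, fun h ↦ absurd hi h⟩
    rw [hJ i hij, hK i hij, h4.1, h4.2, hi]
    norm_num
  · have h3 : (1 : ℝ) ≤ I i := by exact_mod_cast Nat.one_le_iff_ne_zero.2 hi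
    have h4 : lam.re ≤ lam.re * I i := le_mul_of_one_le_right (by linarith) h3
    exact ⟨by linarith, fun _ ↦ by linarith⟩

theorem hasFDerivAt_exp_mul (hv : ContDiff ℝ ∞ v) (hχ : ContDiff ℝ ∞ χ) (lam : ℂ)
    (z : Fin d → ℂ) : HasFDerivAt (fun z ↦ Complex.exp (lam * v z) * χ z)
      (Complex.exp (lam * v z) • fderiv ℝ χ z +
        (Complex.exp (lam * v z) * (lam * χ z)) • fderiv ℝ v z) z := by
  have h1 := ((hv.differentiable (by simp) z).hasFDerivAt.const_mul lam).cexp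
  have h2 := (hχ.differentiable (by simp) z).hasFDerivAt
  refine (h1.mul h2).congr_fderiv ?_
  ext e
  simp only [add_apply, smul_apply, smul_eq_mul]
  ring

/-- Integration by parts in the real direction `c` of the variable `z_j`. -/
theorem integral_singKer_mul_fderiv (hI : ∀ i, J i + K i ≠ 0 → I i ≠ 0) (j : Fin d)
    (hIj : I j ≠ 0) (hv : ContDiff ℝ ∞ v) (hχ : IsTest χ) {lam : ℂ}
    (hl : ibpBound J K < lam.re) (c : ℂ) :
    (∫ z, singKer I J K lam z * (Complex.exp (lam * v z) *
        (fderiv ℝ χ z (Pi.single j c) + lam * (χ z * fderiv ℝ v z (Pi.single j c))))) =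
      -((lam * I j - J j) * singInt I (Function.update J j (J j + 1)) K v χ lam * c +
        (lam * I j - K j) * singInt I J (Function.update K j (K j + 1)) v χ lam *
          starRingEnd ℂ c) := by
  have hex := fun (J' K' : Fin d → ℕ) hJ hK hj i ↦
    (exponent_gt (J' := J') (K' := K') hI hl j hIj hJ hK hj i)
  have hi0 : ∀ χ' : (Fin d → ℂ) → ℂ, Continuous χ' → HasCompactSupport χ' →
      Integrable (fun z ↦ singKer I J K lam z * (Complex.exp (lam * v z) * χ' z)) :=
    fun χ' h1 h2 ↦ integrable_singInt hv.continuous h1 h2 fun i ↦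
      (hex J K (fun _ _ ↦ rfl) (fun _ _ ↦ rfl) (by omega) i).1
  have hi1 : Integrable (fun z ↦ singKer I (Function.update J j (J j + 1)) K lam z *
      (Complex.exp (lam * v z) * χ z)) :=
    integrable_singInt hv.continuous hχ.1.continuous hχ.2 fun i ↦
      (hex (Function.update J j (J j + 1)) K (fun i hi ↦ Function.update_of_ne hi _ _)
        (fun _ _ ↦ rfl) (by simp; omega) i).1
  have hi2 : Integrable (fun z ↦ singKer I J (Function.update K j (K j + 1)) lam z *
      (Complex.exp (lam * v z) * χ z)) :=
    integrable_singInt hv.continuous hχ.1.continuous hχ.2 fun i ↦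
      (hex J (Function.update K j (K j + 1)) (fun _ _ ↦ rfl)
        (fun i hi ↦ Function.update_of_ne hi _ _) (by simp; omega) i).1
  have hd1 : Continuous fun z ↦ fderiv ℝ χ z (Pi.single j c) :=
    (hχ.1.continuous_fderiv (by simp)).clm_apply continuous_const
  have hd2 : Continuous fun z ↦ fderiv ℝ v z (Pi.single j c) :=
    (hv.continuous_fderiv (by simp)).clm_apply continuous_const
  have hχ' : HasCompactSupport fun z ↦
      fderiv ℝ χ z (Pi.single j c) + lam * (χ z * fderiv ℝ v z (Pi.single j c)) := by
    refine hχ.2.mono' fun z hz ↦ ?_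
    by_contra h
    exact hz (by simp [fderiv_eq_zero_of_notMem_tsupport h, image_eq_zero_of_notMem_tsupport h])
  have hpos : 1 < 2 * (lam * I j).re - J j - K j := by
    have := (hex J K (fun _ _ ↦ rfl) (fun _ _ ↦ rfl) (by omega) j).2 hIj
    simpa using this
  have hker' : ∀ z, ((lam * I j - J j) * singKer I (Function.update J j (J j + 1)) K lam z * c +
      (lam * I j - K j) * singKer I J (Function.update K j (K j + 1)) lam z * starRingEnd ℂ c) *
      (Complex.exp (lam * v z) * χ z) =
      ((lam * I j - J j) * c) * (singKer I (Function.update J j (J j + 1)) K lam z *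
        (Complex.exp (lam * v z) * χ z)) +
      ((lam * I j - K j) * starRingEnd ℂ c) * (singKer I J (Function.update K j (K j + 1)) lam z *
        (Complex.exp (lam * v z) * χ z)) := fun z ↦ by ring
  have key := integral_bilinear_hasLineDerivAt_right_eq_neg_left_of_integrable
    (μ := (volume : Measure (Fin d → ℂ))) (B := ContinuousLinearMap.mul ℝ ℂ)
    (v := Pi.single j c) (f := singKer I J K lam)
    (f' := fun z ↦ (lam * I j - J j) * singKer I (Function.update J j (J j + 1)) K lam z * c +
      (lam * I j - K j) * singKer I J (Function.update K j (K j + 1)) lam z * starRingEnd ℂ c)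
    (g := fun z ↦ Complex.exp (lam * v z) * χ z)
    (g' := fun z ↦ Complex.exp (lam * v z) *
        (fderiv ℝ χ z (Pi.single j c) + lam * (χ z * fderiv ℝ v z (Pi.single j c))))
    (by
      simp only [ContinuousLinearMap.mul_apply', hker']
      exact (hi1.const_mul _).add (hi2.const_mul _))
    (by
      simp only [ContinuousLinearMap.mul_apply']
      exact hi0 _ (hd1.add (continuous_const.mul (hχ.1.continuous.mul hd2))) hχ')
    (by
      simp only [ContinuousLinearMap.mul_apply']
      exact hi0 _ hχ.1.continuous hχ.2)
    (fun z _ ↦ hasLineDerivAt_singKer j c hpos z)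
    (fun z _ ↦ by
      have := (hasFDerivAt_exp_mul hv hχ.1 lam z).hasLineDerivAt (Pi.single j c)
      refine HasDerivAt.congr_deriv this ?_
      simp only [add_apply, smul_apply, smul_eq_mul]
      ring)
  simp only [ContinuousLinearMap.mul_apply', hker'] at key
  rw [key, integral_add (hi1.const_mul _) (hi2.const_mul _), integral_const_mul,
    integral_const_mul]
  simp only [singInt]
  ring

theorem integrable_low (hI : ∀ i, J i + K i ≠ 0 → I i ≠ 0) (j : Fin d)
    (hIj : I j ≠ 0) (hv : ContDiff ℝ ∞ v) (hχ : IsTest χ) {lam : ℂ}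
    (hl : ibpBound J K < lam.re) :
    Integrable (fun z ↦ singKer I J K lam z * (Complex.exp (lam * v z) * χ z)) :=
  integrable_singInt hv.continuous hχ.1.continuous hχ.2 fun i ↦
    (exponent_gt hI hl j hIj (fun _ _ ↦ rfl) (fun _ _ ↦ rfl) (by omega) i).1

/-- The combination of the real directions `1` and `i`. The values `σ = -i` and `σ = i` give the
two Wirtinger derivatives, and remove one of the two terms on the right. -/
theorem singInt_combine (hI : ∀ i, J i + K i ≠ 0 → I i ≠ 0) (j : Fin d)
    (hIj : I j ≠ 0) (hv : ContDiff ℝ ∞ v) (hχ : IsTest χ) {lam : ℂ}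
    (hl : ibpBound J K < lam.re) (σ : ℂ) :
    singInt I J K v (fun z ↦ (fderiv ℝ χ z (Pi.single j 1) +
        σ * fderiv ℝ χ z (Pi.single j Complex.I)) / 2) lam +
      lam * singInt I J K v (fun z ↦ χ z * ((fderiv ℝ v z (Pi.single j 1) +
        σ * fderiv ℝ v z (Pi.single j Complex.I)) / 2)) lam =
    -((lam * I j - J j) * singInt I (Function.update J j (J j + 1)) K v χ lam *
        (1 + σ * Complex.I) / 2 +
      (lam * I j - K j) * singInt I J (Function.update K j (K j + 1)) v χ lam *
        (1 - σ * Complex.I) / 2) := by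
  have h1 := integral_singKer_mul_fderiv hI j hIj hv hχ hl 1
  have h2 := integral_singKer_mul_fderiv hI j hIj hv hχ hl Complex.I
  have hfd : ∀ c, IsTest fun z ↦ fderiv ℝ χ z (Pi.single j c) := fun c ↦
    ⟨contDiffOn_univ.1 (contDiffOn_fderiv_apply_infty isOpen_univ (contDiffOn_univ.2 hχ.1) _),
      hχ.2.fderiv_apply (𝕜 := ℝ) _⟩
  have hvd : ∀ c, ContDiff ℝ ∞ fun z ↦ fderiv ℝ v z (Pi.single j c) := fun c ↦
    contDiffOn_univ.1 (contDiffOn_fderiv_apply_infty isOpen_univ (contDiffOn_univ.2 hv) _)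
  have hsplit : ∀ c, (∫ z, singKer I J K lam z * (Complex.exp (lam * v z) *
        (fderiv ℝ χ z (Pi.single j c) + lam * (χ z * fderiv ℝ v z (Pi.single j c))))) =
      singInt I J K v (fun z ↦ fderiv ℝ χ z (Pi.single j c)) lam +
      lam * singInt I J K v (fun z ↦ χ z * fderiv ℝ v z (Pi.single j c)) lam := by
    intro c
    simp only [singInt]
    rw [← integral_const_mul, ← integral_add (integrable_low hI j hIj hv (hfd c) hl)
      ((integrable_low hI j hIj hv (hχ.mul (hvd c)) hl).const_mul _)]
    congr 1
    funext z
    ring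
  have hlin : ∀ {f g : (Fin d → ℂ) → ℂ}, IsTest f → IsTest g →
      singInt I J K v (fun z ↦ (f z + σ * g z) / 2) lam =
        (singInt I J K v f lam + σ * singInt I J K v g lam) / 2 := by
    intro f g hf hg
    simp only [singInt]
    rw [← integral_const_mul, ← integral_add (integrable_low hI j hIj hv hf hl)
      ((integrable_low hI j hIj hv hg hl).const_mul _), ← integral_div]
    congr 1
    funext z
    ring
  have hfun : (fun z ↦ χ z * ((fderiv ℝ v z (Pi.single j 1) +
        σ * fderiv ℝ v z (Pi.single j Complex.I)) / 2)) =
      fun z ↦ (χ z * fderiv ℝ v z (Pi.single j 1) +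
        σ * (χ z * fderiv ℝ v z (Pi.single j Complex.I))) / 2 := by
    funext z; ring
  rw [hlin (hfd 1) (hfd Complex.I), hfun, hlin (hχ.mul (hvd 1)) (hχ.mul (hvd Complex.I))]
  rw [hsplit] at h1 h2
  simp only [map_one, mul_one, Complex.conj_I] at h1 h2
  linear_combination h1 / 2 + σ * h2 / 2

/-- Integration by parts in `∂/∂z_j`, which lowers the order of the holomorphic pole in `z_j`. -/
theorem singInt_recursion (hI : ∀ i, J i + K i ≠ 0 → I i ≠ 0) (j : Fin d)
    (hIj : I j ≠ 0) (hv : ContDiff ℝ ∞ v) (hχ : IsTest χ) {lam : ℂ}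
    (hl : ibpBound J K < lam.re) :
    (lam * I j - J j) * singInt I (Function.update J j (J j + 1)) K v χ lam =
      -(singInt I J K v (wirtinger j χ) lam +
        lam * singInt I J K v (fun z ↦ χ z * wirtinger j v z) lam) := by
  have := singInt_combine hI j hIj hv hχ hl (-Complex.I)
  have h1 : (-Complex.I) * Complex.I = 1 := by simp
  rw [h1] at this
  have h2 : ∀ f : (Fin d → ℂ) → ℂ, (fun z ↦ (fderiv ℝ f z (Pi.single j 1) +
      -Complex.I * fderiv ℝ f z (Pi.single j Complex.I)) / 2) = wirtinger j f := fun f ↦ by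
    funext z; simp [wirtinger, sub_eq_add_neg]
  have h3 := fun z ↦ congrFun (h2 v) z
  simp only [h3, h2 χ] at this
  rw [this]
  ring

/-- Integration by parts in `∂/∂z̄_j`, which lowers the order of the anti-holomorphic pole in
`z_j`. -/
theorem singInt_recursion_bar (hI : ∀ i, J i + K i ≠ 0 → I i ≠ 0) (j : Fin d)
    (hIj : I j ≠ 0) (hv : ContDiff ℝ ∞ v) (hχ : IsTest χ) {lam : ℂ}
    (hl : ibpBound J K < lam.re) :
    (lam * I j - K j) * singInt I J (Function.update K j (K j + 1)) v χ lam =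
      -(singInt I J K v (wirtingerBar j χ) lam +
        lam * singInt I J K v (fun z ↦ χ z * wirtingerBar j v z) lam) := by
  have := singInt_combine hI j hIj hv hχ hl Complex.I
  rw [Complex.I_mul_I] at this
  have h3 : ∀ (f : (Fin d → ℂ) → ℂ) z, (fderiv ℝ f z (Pi.single j 1) +
      Complex.I * fderiv ℝ f z (Pi.single j Complex.I)) / 2 = wirtingerBar j f z := fun f z ↦ rfl
  simp only [h3] at this
  rw [show (fun z ↦ wirtingerBar j χ z) = wirtingerBar j χ from rfl] at this
  rw [this]
  ring

end IBP

/-! ### Lowering the pole orders to one -/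

section Reduction

variable {d : ℕ} {I J K : Fin d → ℕ} {v χ : (Fin d → ℂ) → ℂ} {m : ℕ}

theorem IsTest.iterate_wirtinger (j : Fin d) (hχ : IsTest χ) (a : ℕ) :
    IsTest ((_root_.wirtinger j)^[a] χ) := by
  induction a generalizing χ with
  | zero => exact hχ
  | succ a ih => exact ih (hχ.wirtinger j)

theorem IsTest.iterate_wirtingerBar (j : Fin d) (hχ : IsTest χ) (a : ℕ) :
    IsTest ((_root_.wirtingerBar j)^[a] χ) := by
  induction a generalizing χ with
  | zero => exact hχ
  | succ a ih => exact ih (hχ.wirtingerBar j)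

theorem IsTest.residueStep (hχ : IsTest χ) (j : Fin d) (m n : ℕ) :
    IsTest (_root_.residueStep j m n χ) :=
  ((hχ.iterate_wirtingerBar j _).iterate_wirtinger j _).const_mul _

theorem residueStep_const_mul (j : Fin d) (m n : ℕ) (c : ℂ) :
    residueStep j m n (fun z ↦ c * χ z) = fun z ↦ c * residueStep j m n χ z := by
  have h1 : ∀ (a : ℕ) (f : (Fin d → ℂ) → ℂ), (wirtingerBar j)^[a] (fun z ↦ c * f z) =
      fun z ↦ c * (wirtingerBar j)^[a] f z := by
    intro a
    induction a with
    | zero => intro f; rfl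
    | succ a ih => intro f; rw [Function.iterate_succ_apply, wirtingerBar_const_mul, ih]; rfl
  have h2 : ∀ (a : ℕ) (f : (Fin d → ℂ) → ℂ), (wirtinger j)^[a] (fun z ↦ c * f z) =
      fun z ↦ c * (wirtinger j)^[a] f z := by
    intro a
    induction a with
    | zero => intro f; rfl
    | succ a ih => intro f; rw [Function.iterate_succ_apply, wirtinger_const_mul, ih]; rfl
  funext z
  simp only [residueStep, h1, h2]
  ring

/-- Lowering the order of a holomorphic pole from `a + 1` to one costs `∂^a / a!`. The factor `λ
I_j - a` of the recursion does not vanish at `λ = 0` as long as `a ≥ 1`, so the order of the pole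
at the origin does not change. -/
theorem hasLeading_reduce_left (hI : ∀ i, J i + K i ≠ 0 → I i ≠ 0) (j : Fin d) (hIj : I j ≠ 0)
    (hv : ContDiff ℝ ∞ v) {Λ : ((Fin d → ℂ) → ℂ) → ℂ}
    (h : ∀ χ, IsTest χ → HasLeading (singInt I (Function.update J j 1) K v χ) m (Λ χ)) (a : ℕ) :
    ∀ χ, IsTest χ → HasLeading (singInt I (Function.update J j (a + 1)) K v χ) m
      ((a.factorial : ℂ)⁻¹ * Λ ((wirtinger j)^[a] χ)) := by
  induction a with
  | zero => simpa using h
  | succ a ih =>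
    intro χ hχ
    have hI' : ∀ i, Function.update J j (a + 1) i + K i ≠ 0 → I i ≠ 0 := by
      intro i hi
      by_cases hij : i = j
      · exact hij ▸ hIj
      · rw [Function.update_of_ne hij] at hi; exact hI i hi
    have := HasLeading.of_recursion (a := a + 1) hIj (ih _ (hχ.wirtinger j))
      (ih _ (hχ.mul (contDiff_wirtinger j hv))) (R := ibpBound (Function.update J j (a + 1)) K)
      (G := singInt I (Function.update J j (a + 1 + 1)) K v χ) (fun lam hl ↦ by
        have := singInt_recursion hI' j hIj hv hχ hl
        simpa using this)
    simp only [Nat.succ_ne_zero, if_false] at this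
    convert! this using 1
    rw [Nat.factorial_succ, Function.iterate_succ_apply]
    push_cast
    rw [mul_inv]
    ring

/-- The anti-holomorphic version of `hasLeading_reduce_left`. -/
theorem hasLeading_reduce_right (hI : ∀ i, J i + K i ≠ 0 → I i ≠ 0) (j : Fin d) (hIj : I j ≠ 0)
    (hv : ContDiff ℝ ∞ v) {Λ : ((Fin d → ℂ) → ℂ) → ℂ}
    (h : ∀ χ, IsTest χ → HasLeading (singInt I J (Function.update K j 1) v χ) m (Λ χ)) (a : ℕ) :
    ∀ χ, IsTest χ → HasLeading (singInt I J (Function.update K j (a + 1)) v χ) m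
      ((a.factorial : ℂ)⁻¹ * Λ ((wirtingerBar j)^[a] χ)) := by
  induction a with
  | zero => simpa using h
  | succ a ih =>
    intro χ hχ
    have hI' : ∀ i, J i + Function.update K j (a + 1) i ≠ 0 → I i ≠ 0 := by
      intro i hi
      by_cases hij : i = j
      · exact hij ▸ hIj
      · rw [Function.update_of_ne hij] at hi; exact hI i hi
    have := HasLeading.of_recursion (a := a + 1) hIj (ih _ (hχ.wirtingerBar j))
      (ih _ (hχ.mul (contDiff_wirtingerBar j hv)))
      (R := ibpBound J (Function.update K j (a + 1)))
      (G := singInt I J (Function.update K j (a + 1 + 1)) v χ) (fun lam hl ↦ by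
        have := singInt_recursion_bar hI' j hIj hv hχ hl
        simpa using this)
    simp only [Nat.succ_ne_zero, if_false] at this
    convert! this using 1
    rw [Nat.factorial_succ, Function.iterate_succ_apply]
    push_cast
    rw [mul_inv]
    ring

/-- Functionals that commute with multiplication of test functions by constants. -/
def IsHomogeneous {d : ℕ} (Λ : ((Fin d → ℂ) → ℂ) → ℂ) : Prop :=
  ∀ (c : ℂ) (χ : (Fin d → ℂ) → ℂ), Λ (fun z ↦ c * χ z) = c * Λ χ

/-- If the leading coefficient is known when the pole orders in `z_j` are at most one, then for
arbitrary pole orders it is obtained by first applying the operator of the single residue in `z_j`.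
-/
theorem hasLeading_residueStep (hI : ∀ i, J i + K i ≠ 0 → I i ≠ 0) (j : Fin d)
    (hv : ContDiff ℝ ∞ v) {Λ : ((Fin d → ℂ) → ℂ) → ℂ} (hΛ : IsHomogeneous Λ)
    (h : ∀ χ, IsTest χ → HasLeading (singInt I (Function.update J j (min (J j) 1))
      (Function.update K j (min (K j) 1)) v χ) m (Λ χ)) :
    ∀ χ, IsTest χ → HasLeading (singInt I J K v χ) m (Λ (residueStep j (J j) (K j) χ)) := by
  have hI' : ∀ i, J i + Function.update K j (min (K j) 1) i ≠ 0 → I i ≠ 0 := by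
    intro i hi
    refine hI i fun h0 ↦ hi ?_
    by_cases hij : i = j
    · subst hij
      simp only [Function.update_self]
      omega
    · rwa [Function.update_of_ne hij]
  have hJ : ∀ χ, IsTest χ → HasLeading (singInt I J (Function.update K j (min (K j) 1)) v χ) m
      (((J j - 1).factorial : ℂ)⁻¹ * Λ ((wirtinger j)^[J j - 1] χ)) := by
    rcases Nat.eq_zero_or_pos (J j) with h0 | h0
    · have e : Function.update J j 0 = J := by rw [← h0]; exact Function.update_eq_self ..
      simpa [h0, e] using h
    · have := hasLeading_reduce_left hI' j (hI j (by omega)) hv (Λ := Λ) (m := m)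
        (by simpa [min_eq_right (show 1 ≤ J j from h0)] using h) (J j - 1)
      rwa [Nat.sub_add_cancel h0, Function.update_eq_self] at this
  intro χ hχ
  have hK : HasLeading (singInt I J K v χ) m (((K j - 1).factorial : ℂ)⁻¹ *
      (((J j - 1).factorial : ℂ)⁻¹ *
        Λ ((wirtinger j)^[J j - 1] ((wirtingerBar j)^[K j - 1] χ)))) := by
    rcases Nat.eq_zero_or_pos (K j) with h0 | h0
    · have := hJ χ hχ
      have e : Function.update K j 0 = K := by rw [← h0]; exact Function.update_eq_self ..
      rw [h0, Nat.zero_min, e] at this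
      simpa [h0] using this
    · have := hasLeading_reduce_right hI j (hI j (by omega)) hv (m := m)
        (Λ := fun χ ↦ ((J j - 1).factorial : ℂ)⁻¹ * Λ ((wirtinger j)^[J j - 1] χ))
        (by simpa [min_eq_right (show 1 ≤ K j from h0)] using hJ) (K j - 1) χ hχ
      rwa [Nat.sub_add_cancel h0, Function.update_eq_self] at this
  convert! hK using 1
  unfold residueStep
  rw [hΛ]
  push_cast
  rw [mul_inv]
  ring

/-- The operators of the single residues, composed along a list of coordinates. -/
noncomputable def residueList {d : ℕ} (J K : Fin d → ℕ) (l : List (Fin d))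
    (f : (Fin d → ℂ) → ℂ) : (Fin d → ℂ) → ℂ :=
  l.foldr (fun j g ↦ residueStep j (J j) (K j) g) f

/-- The multi-index `J` with the entries in `l` lowered to at most one. -/
def capOn {d : ℕ} (l : List (Fin d)) (J : Fin d → ℕ) : Fin d → ℕ :=
  fun i ↦ if i ∈ l then min (J i) 1 else J i

/-- `hasLeading_residueStep` for all coordinates in a list. -/
theorem hasLeading_residueList (hI : ∀ i, J i + K i ≠ 0 → I i ≠ 0) (hv : ContDiff ℝ ∞ v)
    {l : List (Fin d)} (hl : l.Nodup) {Λ : ((Fin d → ℂ) → ℂ) → ℂ} (hΛ : IsHomogeneous Λ)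
    (h : ∀ χ, IsTest χ → HasLeading (singInt I (capOn l J) (capOn l K) v χ) m (Λ χ)) :
    ∀ χ, IsTest χ → HasLeading (singInt I J K v χ) m (Λ (residueList J K l χ)) := by
  induction l generalizing Λ with
  | nil =>
    have e : ∀ J : Fin d → ℕ, capOn [] J = J := fun J ↦ by funext i; simp [capOn]
    simpa [e, residueList] using h
  | cons j l ih =>
    have hj : j ∉ l := (List.nodup_cons.1 hl).1
    have hupd : ∀ J : Fin d → ℕ, capOn (j :: l) J =
        Function.update (capOn l J) j (min (capOn l J j) 1) := by
      intro J
      funext i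
      by_cases hij : i = j
      · subst hij; simp [capOn, hj]
      · simp [capOn, hij]
    have hIl : ∀ i, capOn l J i + capOn l K i ≠ 0 → I i ≠ 0 := by
      intro i hi
      refine hI i fun h0 ↦ hi ?_
      simp only [capOn]
      split_ifs <;> omega
    have hval : ∀ J : Fin d → ℕ, capOn l J j = J j := fun J ↦ by simp [capOn, hj]
    have h1 := hasLeading_residueStep hIl j hv hΛ (m := m) (by
      simpa only [hupd J, hupd K] using h)
    simp only [hval] at h1
    exact ih (List.nodup_cons.1 hl).2
      (Λ := fun χ ↦ Λ (residueStep j (J j) (K j) χ)) (fun c χ ↦ by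
        simp only [residueStep_const_mul]
        exact hΛ c _) h1

end Reduction

/-! ### Simple poles in both directions -/

section DoublePole

variable {d : ℕ}

/-- Fubini's theorem for the variable `z_j`, written as an integral over the whole space. -/
theorem integral_eq_integral_update (j : Fin d) {η : ℂ → ℂ} (hη : ∫ ζ, η ζ = 1)
    {F : (Fin d → ℂ) → ℂ} (hF : Integrable F) :
    ∫ z, F z = ∫ z : Fin d → ℂ, η (z j) * ∫ ζ, F (Function.update z j ζ) := by
  cases d with
  | zero => exact j.elim0
  | succ d =>
    have hmp := (volume_preserving_piFinSuccAbove (fun _ : Fin (d + 1) ↦ ℂ) j).symm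
    rw [← hmp.integral_comp', ← hmp.integral_comp']
    have hF' := (hmp.integrable_comp_emb
      (MeasurableEquiv.piFinSuccAbove (fun _ : Fin (d + 1) ↦ ℂ) j).symm.measurableEmbedding).2 hF
    have hval : ∀ p : ℂ × (Fin d → ℂ),
        (MeasurableEquiv.piFinSuccAbove (fun _ : Fin (d + 1) ↦ ℂ) j).symm p =
          j.insertNth p.1 p.2 := fun p ↦ rfl
    simp only [hval, Fin.insertNth_apply_same, Fin.update_insertNth]
    rw [Measure.volume_eq_prod, integral_prod_symm (fun p : ℂ × (Fin d → ℂ) ↦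
      F (j.insertNth p.1 p.2)) hF']
    have := integral_prod_mul (μ := (volume : Measure ℂ)) (ν := (volume : Measure (Fin d → ℂ)))
      η (fun y ↦ ∫ ζ, F (j.insertNth ζ y))
    rw [hη, one_mul] at this
    exact this.symm

/-- A cutoff in the variable `z_j` times the restriction to `z_j = 0`. -/
def restrictCoord (η : ℂ → ℂ) (j : Fin d) (g : (Fin d → ℂ) → ℂ) (z : Fin d → ℂ) : ℂ :=
  η (z j) * g (Function.update z j 0)

theorem contDiff_update_const (j : Fin d) (c : ℂ) :
    ContDiff ℝ ∞ fun z : Fin d → ℂ ↦ Function.update z j c := by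
  refine contDiff_pi.2 fun i ↦ ?_
  by_cases h : i = j
  · subst h; simpa using contDiff_const
  · simp only [Function.update_of_ne h]; exact contDiff_apply ℝ ℂ i

theorem IsTest.restrictCoord {η : ℂ → ℂ} (hη : ContDiff ℝ ∞ η) (hηs : HasCompactSupport η)
    {g : (Fin d → ℂ) → ℂ} (hg : IsTest g) (j : Fin d) : IsTest (restrictCoord η j g) := by
  refine ⟨(hη.comp (contDiff_apply ℝ ℂ j)).mul (hg.1.comp (contDiff_update_const j 0)), ?_⟩
  obtain ⟨ρ₁, h₁⟩ := hηs.isCompact.isBounded.subset_closedBall (0 : ℂ)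
  obtain ⟨ρ₂, h₂⟩ := hg.2.isCompact.isBounded.subset_closedBall (0 : Fin d → ℂ)
  refine HasCompactSupport.intro (isCompact_closedBall (0 : Fin d → ℂ) (max 0 (max ρ₁ ρ₂)))
    fun z hz ↦ ?_
  by_contra h
  obtain ⟨ha, hb⟩ := mul_ne_zero_iff.1 h
  have ha' := mem_closedBall_zero_iff.1 (h₁ (subset_tsupport _ ha))
  have hb' := mem_closedBall_zero_iff.1 (h₂ (subset_tsupport _ hb))
  refine hz (mem_closedBall_zero_iff.2 ((pi_norm_le_iff_of_nonneg (le_max_left _ _)).2 fun i ↦ ?_))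
  by_cases hij : i = j
  · subst hij
    exact ha'.trans ((le_max_left _ _).trans (le_max_right _ _))
  · have := norm_le_pi_norm (Function.update z j 0) i
    rw [Function.update_of_ne hij] at this
    exact (this.trans hb').trans ((le_max_right _ _).trans (le_max_right _ _))

theorem fderiv_restrictCoord {η : ℂ → ℂ} (hη : ContDiff ℝ ∞ η)
    {g : (Fin d → ℂ) → ℂ} (hg : ContDiff ℝ ∞ g) {i j : Fin d} (hij : j ≠ i) (z : Fin d → ℂ)
    (c : ℂ) :
    fderiv ℝ (restrictCoord η i g) z (Pi.single j c) =
      η (z i) * fderiv ℝ g (Function.update z i 0) (Pi.single j c) := by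
  have hd := (hη.comp (contDiff_apply ℝ ℂ i)).mul (hg.comp (contDiff_update_const i 0))
  have h1 : HasLineDerivAt ℝ (restrictCoord η i g)
      (fderiv ℝ (restrictCoord η i g) z (Pi.single j c)) z (Pi.single j c) :=
    ((hd.differentiable (by simp)) z).hasFDerivAt.hasLineDerivAt _
  have h2 : HasLineDerivAt ℝ g (fderiv ℝ g (Function.update z i 0) (Pi.single j c))
      (Function.update z i 0) (Pi.single j c) :=
    ((hg.differentiable (by simp)) _).hasFDerivAt.hasLineDerivAt _
  have h3 : HasLineDerivAt ℝ (restrictCoord η i g)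
      (η (z i) * fderiv ℝ g (Function.update z i 0) (Pi.single j c)) z (Pi.single j c) := by
    unfold HasLineDerivAt at h2 ⊢
    refine (h2.const_mul (η (z i))).congr_of_eventuallyEq (Eventually.of_forall fun t ↦ ?_)
    simp only [restrictCoord]
    congr 2
    · simp [hij.symm]
    · funext k
      by_cases hk : k = i
      · subst hk; simp [hij.symm]
      · simp [Function.update_of_ne hk]
  exact h1.unique h3

theorem wirtingerBar_restrictCoord {η : ℂ → ℂ} (hη : ContDiff ℝ ∞ η)
    {g : (Fin d → ℂ) → ℂ} (hg : ContDiff ℝ ∞ g) {i j : Fin d} (hij : j ≠ i) :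
    wirtingerBar j (restrictCoord η i g) = restrictCoord η i (wirtingerBar j g) := by
  funext z
  simp only [wirtingerBar, fderiv_restrictCoord hη hg hij, restrictCoord]
  ring

/-- Cauchy–Pompeiu formula in the variable `z_j`. The restriction to `z_j = 0` is integrated over
the whole space with a cutoff of integral one in `z_j`. -/
theorem integral_singKer_mul_wirtingerBar {J K : Fin d → ℕ} {j : Fin d} (hJ : J j = 1)
    (hK : K j = 0) (h1 : ∀ i, J i + K i ≤ 1) {η : ℂ → ℂ} (hη : ∫ ζ, η ζ = 1)
    {g : (Fin d → ℂ) → ℂ} (hg : IsTest g) :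
    ∫ z, singKer 0 J K 0 z * wirtingerBar j g z =
      -Real.pi * ∫ z, singKer 0 (Function.update J j 0) K 0 z * restrictCoord η j g z := by
  have hint : Integrable fun z ↦ singKer 0 J K 0 z * wirtingerBar j g z := by
    have := integrable_singInt (I := 0) (J := J) (K := K) (v := 0) (lam := 0) continuous_const
      (hg.wirtingerBar j).1.continuous (hg.wirtingerBar j).2 (fun i ↦ by
        have : (J i : ℝ) + K i ≤ 1 := by exact_mod_cast h1 i
        simp
        linarith)
    simpa using this
  rw [integral_eq_integral_update j hη hint, ← integral_const_mul]
  congr 1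
  funext z
  have hker : ∀ ζ, singKer 0 J K 0 (Function.update z j ζ) =
      ζ⁻¹ * singKer 0 (Function.update J j 0) K 0 z := by
    intro ζ
    rw [singKer_eq_mul_erase 0 J K 0 _ j, singKer_eq_mul_erase 0 _ K 0 z j]
    have : ∏ i ∈ Finset.univ.erase j, coordKer (0 * (0 : Fin d → ℕ) i) (J i) (K i)
        (Function.update z j ζ i) = ∏ i ∈ Finset.univ.erase j,
          coordKer (0 * (0 : Fin d → ℕ) i) (Function.update J j 0 i) (K i) (z i) := by
      refine Finset.prod_congr rfl fun i hi ↦ ?_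
      rw [Function.update_of_ne (Finset.ne_of_mem_erase hi),
        Function.update_of_ne (Finset.ne_of_mem_erase hi)]
    rw [this]
    simp [coordKer_zero_left, hJ, hK]
  have hslice : ContDiff ℝ 1 fun ζ ↦ g (Function.update z j ζ) :=
    (hg.1.of_le (by simp)).comp (contDiff_update 1 z j)
  have hcs : HasCompactSupport fun ζ ↦ g (Function.update z j ζ) := by
    refine HasCompactSupport.intro (hg.2.isCompact.image (continuous_apply j)) fun ζ hζ ↦ ?_
    by_contra h
    exact hζ ⟨_, subset_tsupport _ h, by simp⟩
  have hfd : ∀ ζ c, fderiv ℝ (fun ζ ↦ g (Function.update z j ζ)) ζ c =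
      fderiv ℝ g (Function.update z j ζ) (Pi.single j c) := by
    intro ζ c
    have h2 := (hg.1.differentiable (by simp) (Function.update z j ζ)).hasFDerivAt.comp ζ
      (hasFDerivAt_update (𝕜 := ℝ) z ζ)
    rw [show (fun ζ ↦ g (Function.update z j ζ)) = g ∘ Function.update z j from rfl, h2.fderiv]
    simp only [ContinuousLinearMap.comp_apply]
    congr 1
    funext k
    by_cases hk : k = j
    · subst hk; simp
    · simp [hk]
  have hCP := integral_inv_mul_dbar hslice hcs
  simp only [hfd] at hCP
  have : ∀ ζ, singKer 0 J K 0 (Function.update z j ζ) *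
      wirtingerBar j g (Function.update z j ζ) =
      singKer 0 (Function.update J j 0) K 0 z * (ζ⁻¹ *
        ((fderiv ℝ g (Function.update z j ζ) (Pi.single j 1) +
          Complex.I * fderiv ℝ g (Function.update z j ζ) (Pi.single j Complex.I)) / 2)) := by
    intro ζ
    rw [hker, wirtingerBar]
    ring
  simp only [this]
  rw [integral_const_mul, hCP, restrictCoord]
  ring

theorem singKer_zero (I J K : Fin d → ℕ) : singKer I J K 0 = singKer 0 J K 0 := by
  funext z; simp [singKer]

/-- The multi-index `J` with the entries in `l` replaced by zero. -/
def zeroOn (l : List (Fin d)) (J : Fin d → ℕ) : Fin d → ℕ := fun i ↦ if i ∈ l then 0 else J i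

/-- The case where no pole order exceeds one and exactly the coordinates in `l` have poles of both
types. Integrating by parts in `∂/∂z̄_j` once more turns `1/|z_j|²` into the factor `-1/(λ I_j)`
times the kernel `1/z_j`, and the Cauchy–Pompeiu formula evaluates the remaining integral as `-π`
times the restriction to `z_j = 0`. -/
theorem hasLeading_double_poles {I : Fin d → ℕ} {v : (Fin d → ℂ) → ℂ} (hv : ContDiff ℝ ∞ v)
    {η : ℂ → ℂ} (hη : ContDiff ℝ ∞ η) (hηs : HasCompactSupport η) (hη1 : ∫ ζ, η ζ = 1)
    {l : List (Fin d)} (hl : l.Nodup) {J K : Fin d → ℕ} (hI : ∀ i, J i + K i ≠ 0 → I i ≠ 0)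
    (hJK : ∀ i ∉ l, J i + K i ≤ 1) (hJl : ∀ i ∈ l, J i = 1 ∧ K i = 1) :
    ∀ χ, IsTest χ → HasLeading (singInt I J K v χ) l.length
      ((l.map fun i ↦ (Real.pi / I i : ℂ)).prod *
        ∫ z, singKer 0 (zeroOn l J) (zeroOn l K) 0 z * l.foldr (restrictCoord η) χ z) := by
  induction l generalizing J K with
  | nil =>
    intro χ hχ
    have := hasLeading_singInt_of_le_one (I := I) hv.continuous hχ.1.continuous hχ.2
      (fun i ↦ hJK i (by simp))
    rw [singKer_zero] at this
    have e : ∀ J : Fin d → ℕ, zeroOn [] J = J := fun J ↦ by funext i; simp [zeroOn]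
    simpa [e] using this
  | cons j l ih =>
    intro χ hχ
    have hj : j ∉ l := (List.nodup_cons.1 hl).1
    have hIj : I j ≠ 0 := hI j (by have := hJl j (by simp); omega)
    set K' := Function.update K j 0 with hK'
    have hI' : ∀ i, J i + K' i ≠ 0 → I i ≠ 0 := by
      intro i hi
      refine hI i fun h0 ↦ hi ?_
      by_cases hij : i = j
      · subst hij; simp [hK']; omega
      · simpa [hK', Function.update_of_ne hij] using h0
    have hJK' : ∀ i ∉ l, J i + K' i ≤ 1 := by
      intro i hi
      by_cases hij : i = j
      · subst hij; simp [hK', (hJl i (by simp)).1]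
      · rw [hK', Function.update_of_ne hij]
        exact hJK i (by simp [hij, hi])
    have hJl' : ∀ i ∈ l, J i = 1 ∧ K' i = 1 := by
      intro i hi
      have hij : i ≠ j := fun h ↦ hj (h ▸ hi)
      rw [hK', Function.update_of_ne hij]
      exact hJl i (by simp [hi])
    have hih := ih (List.nodup_cons.1 hl).2 hI' hJK' hJl'
    have hup : Function.update K' j (K' j + 1) = K := by
      funext i
      by_cases hij : i = j
      · subst hij; simp [hK', (hJl i (by simp)).2]
      · simp [hK', Function.update_of_ne hij]
    have := HasLeading.of_recursion (a := 0) hIj (hih _ (hχ.wirtingerBar j))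
      (hih _ (hχ.mul (contDiff_wirtingerBar j hv))) (R := ibpBound J K')
      (G := singInt I J K v χ) (fun lam hlam ↦ by
        have := singInt_recursion_bar hI' j hIj hv hχ hlam
        rw [hup] at this
        simpa [hK'] using this)
    simp only [if_true] at this
    convert! this using 1
    have hfold : ∀ (l : List (Fin d)), j ∉ l → ∀ χ, IsTest χ →
        IsTest (l.foldr (restrictCoord η) χ) ∧
        l.foldr (restrictCoord η) (wirtingerBar j χ) =
          wirtingerBar j (l.foldr (restrictCoord η) χ) := by
      intro l hjl χ hχ
      induction l with
      | nil => exact ⟨hχ, rfl⟩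
      | cons i l ih =>
        simp only [List.mem_cons, not_or] at hjl
        obtain ⟨h1, h2⟩ := ih hjl.2
        simp only [List.foldr_cons]
        exact ⟨h1.restrictCoord hη hηs i, by
          rw [h2, wirtingerBar_restrictCoord hη h1.1 hjl.1]⟩
    obtain ⟨h1, h2⟩ := hfold l hj χ hχ
    rw [h2, integral_singKer_mul_wirtingerBar (by simp [zeroOn, hj, (hJl j (by simp)).1])
      (by simp [zeroOn, hj, hK']) (fun i ↦ by
        simp only [zeroOn]
        split_ifs with hi
        · simp
        · exact hJK' i hi) hη1 h1]
    have e1 : Function.update (zeroOn l J) j 0 = zeroOn (j :: l) J := by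
      funext i
      by_cases hij : i = j
      · subst hij; simp [zeroOn]
      · simp [zeroOn, hij]
    have e2 : zeroOn l K' = zeroOn (j :: l) K := by
      funext i
      by_cases hij : i = j
      · subst hij; simp [zeroOn, hK']
      · simp [zeroOn, hK', hij]
    rw [e1, e2]
    simp only [List.map_cons, List.prod_cons, List.foldr_cons]
    ring

theorem foldr_restrictCoord (η : ℂ → ℂ) (χ : (Fin d → ℂ) → ℂ) {l : List (Fin d)} (hl : l.Nodup)
    (z : Fin d → ℂ) : l.foldr (restrictCoord η) χ z =
      (l.map fun i ↦ η (z i)).prod * χ (fun i ↦ if i ∈ l then 0 else z i) := by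
  induction l generalizing z with
  | nil => simp
  | cons j l ih =>
    have hj : j ∉ l := (List.nodup_cons.1 hl).1
    simp only [List.foldr_cons, List.map_cons, List.prod_cons]
    rw [restrictCoord, ih (List.nodup_cons.1 hl).2, ← mul_assoc]
    congr 2
    · congr 1
      have : (l.map fun i ↦ η (Function.update z j 0 i)) = l.map fun i ↦ η (z i) :=
        List.map_congr_left fun i hi ↦ by
          rw [Function.update_of_ne (ne_of_mem_of_not_mem hi hj)]
      rw [this]
    · funext i
      by_cases hij : i = j
      · subst hij; simp
      · simp [hij]

end DoublePole

/-! ### Restriction to a coordinate subspace -/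

section CoordinateSubspace

variable {n d : ℕ} (tang : Fin n ↪ Fin d)

/-- The inclusion of the coordinate subspace spanned by the coordinates in the range of `tang`. -/
noncomputable def tangIncl : (Fin n → ℂ) →L[ℂ] (Fin d → ℂ) :=
  LinearMap.toContinuousLinearMap (Function.ExtendByZero.linearMap ℂ tang)

theorem tangIncl_apply_tang (w : Fin n → ℂ) (t : Fin n) : tangIncl tang w (tang t) = w t :=
  tang.injective.extend_apply w (0 : Fin d → ℂ) t

theorem tangIncl_apply_of_forall_ne (w : Fin n → ℂ) {i : Fin d} (hi : ∀ t, tang t ≠ i) :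
    tangIncl tang w i = 0 :=
  Function.extend_apply' (f := tang) w (0 : Fin d → ℂ) i fun ⟨t, ht⟩ ↦ hi t ht

theorem forall_tang_ne {i : Fin d} (hi : i ∈ (Finset.univ.map tang)ᶜ) (t : Fin n) :
    tang t ≠ i := by
  rintro rfl
  simp at hi

theorem tangIncl_comp (z : Fin d → ℂ) : tangIncl tang (z ∘ tang) =
    fun i ↦ if i ∈ (Finset.univ.map tang)ᶜ then 0 else z i := by
  funext i
  split_ifs with hi
  · exact tangIncl_apply_of_forall_ne tang _ (forall_tang_ne tang hi)
  · obtain ⟨t, rfl⟩ : ∃ t, tang t = i := by simpa using hi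
    exact tangIncl_apply_tang tang _ t

theorem tangIncl_single (t : Fin n) (c : ℂ) :
    tangIncl tang (Pi.single t c) = Pi.single (tang t) c := by
  funext i
  by_cases hi : ∃ s, tang s = i
  · obtain ⟨s, rfl⟩ := hi
    rw [tangIncl_apply_tang]
    by_cases hs : s = t
    · subst hs; simp
    · simp [hs, tang.injective.ne hs]
  · push Not at hi
    rw [tangIncl_apply_of_forall_ne tang _ hi, Pi.single_eq_of_ne (hi t).symm]

theorem contDiff_tangIncl : ContDiff ℝ ∞ (tangIncl tang) :=
  ((tangIncl tang).restrictScalars ℝ).contDiff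

theorem fderiv_comp_tangIncl {g : (Fin d → ℂ) → ℂ} {w : Fin n → ℂ}
    (hg : DifferentiableAt ℝ g (tangIncl tang w)) (t : Fin n) (c : ℂ) :
    fderiv ℝ (g ∘ tangIncl tang) w (Pi.single t c) =
      fderiv ℝ g (tangIncl tang w) (Pi.single (tang t) c) := by
  have h := hg.hasFDerivAt.comp w ((tangIncl tang).restrictScalars ℝ).hasFDerivAt
  have h' : fderiv ℝ (g ∘ tangIncl tang) w = _ := h.fderiv
  rw [h', ← tangIncl_single]
  rfl

theorem residueStep_comp_tangIncl {g : (Fin d → ℂ) → ℂ} (hg : ContDiff ℝ ∞ g) (t : Fin n)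
    (a b : ℕ) : residueStep (tang t) a b g ∘ tangIncl tang =
      residueStep t a b (g ∘ tangIncl tang) := by
  have h1 : ∀ (m : ℕ) (g : (Fin d → ℂ) → ℂ), ContDiff ℝ ∞ g →
      ContDiff ℝ ∞ ((wirtingerBar (tang t))^[m] g) ∧
      (wirtingerBar (tang t))^[m] g ∘ tangIncl tang =
        (wirtingerBar t)^[m] (g ∘ tangIncl tang) := by
    intro m
    induction m with
    | zero => exact fun g hg ↦ ⟨hg, rfl⟩
    | succ m ih =>
      intro g hg
      have h2 : wirtingerBar (tang t) g ∘ tangIncl tang =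
          wirtingerBar t (g ∘ tangIncl tang) := by
        funext w
        simp only [Function.comp_apply, wirtingerBar]
        rw [fderiv_comp_tangIncl tang (hg.differentiable (by simp) _),
          fderiv_comp_tangIncl tang (hg.differentiable (by simp) _)]
      simp only [Function.iterate_succ_apply, ← h2]
      exact ih _ (contDiff_wirtingerBar _ hg)
  have h2 : ∀ (m : ℕ) (g : (Fin d → ℂ) → ℂ), ContDiff ℝ ∞ g →
      (wirtinger (tang t))^[m] g ∘ tangIncl tang =
        (wirtinger t)^[m] (g ∘ tangIncl tang) := by
    intro m
    induction m with
    | zero => exact fun g hg ↦ rfl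
    | succ m ih =>
      intro g hg
      have h2 : wirtinger (tang t) g ∘ tangIncl tang = wirtinger t (g ∘ tangIncl tang) := by
        funext w
        simp only [Function.comp_apply, wirtinger]
        rw [fderiv_comp_tangIncl tang (hg.differentiable (by simp) _),
          fderiv_comp_tangIncl tang (hg.differentiable (by simp) _)]
      simp only [Function.iterate_succ_apply, ← h2]
      exact ih _ (contDiff_wirtinger _ hg)
  obtain ⟨h3, h4⟩ := h1 (b - 1) g hg
  funext w
  have := congrFun (h2 (a - 1) _ h3) w
  rw [h4] at this
  simp only [residueStep, Function.comp_apply] at this ⊢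
  rw [this]

theorem IsTest.residueList {J K : Fin d → ℕ} {χ : (Fin d → ℂ) → ℂ} (hχ : IsTest χ)
    (l : List (Fin d)) : IsTest (residueList J K l χ) := by
  induction l with
  | nil => exact hχ
  | cons j l ih => exact ih.residueStep j _ _

theorem residueList_comp_tangIncl (J K : Fin d → ℕ) {g : (Fin d → ℂ) → ℂ} (hg : IsTest g)
    (l : List (Fin n)) : residueList J K (l.map tang) g ∘ tangIncl tang =
      residueList (J ∘ tang) (K ∘ tang) l (g ∘ tangIncl tang) := by
  induction l with
  | nil => rfl
  | cons t l ih =>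
    have h1 := residueStep_comp_tangIncl tang (hg.residueList (l.map tang) (J := J) (K := K)).1 t
      (J (tang t)) (K (tang t))
    rw [ih] at h1
    exact h1

/-- Fubini's theorem for a product of a function of the coordinates in the range of `tang` and of
functions of integral one of the single other coordinates. -/
theorem integral_comp_tang_mul_prod {η : ℂ → ℂ} (hη : ∫ ζ, η ζ = 1) (f : (Fin n → ℂ) → ℂ) :
    ∫ z : Fin d → ℂ, f (z ∘ tang) * ∏ i ∈ (Finset.univ.map tang)ᶜ, η (z i) = ∫ w, f w := by
  set R := (Finset.univ.map tang)ᶜ with hR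
  have hbij : Function.Bijective (Sum.elim tang (Subtype.val : {i // i ∈ R} → Fin d)) := by
    constructor
    · refine tang.injective.sumElim Subtype.val_injective fun t i ↦ ?_
      exact forall_tang_ne tang i.2 t
    · intro i
      by_cases hi : i ∈ R
      · exact ⟨Sum.inr ⟨i, hi⟩, rfl⟩
      · obtain ⟨t, rfl⟩ : ∃ t, tang t = i := by simpa [hR] using hi
        exact ⟨Sum.inl t, rfl⟩
  set σ := Equiv.ofBijective _ hbij with hσ
  have hm1 := volume_measurePreserving_sumPiEquivProdPi_symm (fun _ : Fin n ⊕ {i // i ∈ R} ↦ ℂ)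
  have hm2 := volume_measurePreserving_piCongrLeft (fun _ : Fin d ↦ ℂ) σ
  rw [← hm2.integral_comp', ← hm1.integral_comp']
  have hl : ∀ (p : (Fin n → ℂ) × ({i // i ∈ R} → ℂ)) (a : Fin n ⊕ {i // i ∈ R}),
      MeasurableEquiv.piCongrLeft (fun _ : Fin d ↦ ℂ) σ
        ((MeasurableEquiv.sumPiEquivProdPi fun _ : Fin n ⊕ {i // i ∈ R} ↦ ℂ).symm p) (σ a) =
      Sum.elim p.1 p.2 a := by
    intro p a
    refine (Equiv.piCongrLeft_apply_apply (fun _ : Fin d ↦ ℂ) σ _ a).trans ?_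
    cases a <;> rfl
  have h1 : ∀ p : (Fin n → ℂ) × ({i // i ∈ R} → ℂ),
      (MeasurableEquiv.piCongrLeft (fun _ : Fin d ↦ ℂ) σ
        ((MeasurableEquiv.sumPiEquivProdPi fun _ : Fin n ⊕ {i // i ∈ R} ↦ ℂ).symm p)) ∘ tang
      = p.1 := fun p ↦ funext fun t ↦ hl p (Sum.inl t)
  have h2 : ∀ p : (Fin n → ℂ) × ({i // i ∈ R} → ℂ), ∏ i ∈ R,
      η (MeasurableEquiv.piCongrLeft (fun _ : Fin d ↦ ℂ) σ
        ((MeasurableEquiv.sumPiEquivProdPi fun _ : Fin n ⊕ {i // i ∈ R} ↦ ℂ).symm p) i)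
      = ∏ i : {i // i ∈ R}, η (p.2 i) := by
    intro p
    rw [← Finset.prod_coe_sort]
    exact Finset.prod_congr rfl fun i _ ↦ congrArg η (hl p (Sum.inr i))
  simp only [h1, h2]
  rw [Measure.volume_eq_prod, integral_prod_mul f (fun y : {i // i ∈ R} → ℂ ↦ ∏ i, η (y i)),
    integral_fintype_prod_volume_eq_prod (fun _ ↦ η)]
  simp [hη]

end CoordinateSubspace

/-! ### The leading coefficient of a local integral -/

section LeadingCoefficient

variable {n d : ℕ}

/-- The regularised integral of `f / (z^J z̄^K)` when no coordinate has poles of both types: the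
pole orders are lowered to one by derivatives of `f`. -/
noncomputable def pvInt {n : ℕ} (J K : Fin n → ℕ) (f : (Fin n → ℂ) → ℂ) : ℂ :=
  ∫ w, singKer 0 (fun t ↦ min (J t) 1) (fun t ↦ min (K t) 1) 0 w *
    residueList J K (List.finRange n) f w

/-- A smooth function with compact support and integral one. -/
theorem exists_cutoff_integral_eq_one :
    ∃ η : ℂ → ℂ, ContDiff ℝ ∞ η ∧ HasCompactSupport η ∧ ∫ ζ, η ζ = 1 := by
  let b : ContDiffBump (0 : ℂ) := ⟨1, 2, one_pos, one_lt_two⟩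
  refine ⟨fun ζ ↦ (b.normed volume ζ : ℂ), Complex.ofRealCLM.contDiff.comp b.contDiff_normed,
    b.hasCompactSupport_normed.comp_left (g := fun x : ℝ ↦ (x : ℂ)) Complex.ofReal_zero, ?_⟩
  show ∫ ζ, (b.normed volume ζ : ℂ) = 1
  rw [integral_complex_ofReal, b.integral_normed, Complex.ofReal_one]

/-- The local formula. If the coordinates in `R` are those with poles of both types, the integral
has a pole of order at most `|R|` at the origin, and its leading coefficient is `∏_{i ∈ R} π / I_i`
times the principal value on `{z_i = 0, i ∈ R}` of the iterated residue in the directions of `R`.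
-/
theorem hasLeading_singInt {tang : Fin n ↪ Fin d} {R : Finset (Fin d)}
    (hR : R = (Finset.univ.map tang)ᶜ) {I J K : Fin d → ℕ} (hI : ∀ i, J i + K i ≠ 0 → I i ≠ 0)
    (hJR : ∀ i ∈ R, 1 ≤ J i ∧ 1 ≤ K i) (hJK : ∀ i ∉ R, J i = 0 ∨ K i = 0)
    {v χ : (Fin d → ℂ) → ℂ} (hv : ContDiff ℝ ∞ v) (hχ : IsTest χ) :
    HasLeading (singInt I J K v χ) R.card ((∏ i ∈ R, (Real.pi / I i : ℂ)) *
      pvInt (J ∘ tang) (K ∘ tang) (residueIter R J K χ ∘ tangIncl tang)) := by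
  obtain ⟨η, hη, hηs, hη1⟩ := exists_cutoff_integral_eq_one
  -- The operators at the end of the list are applied to `χ` before the others, so that the single
  -- residues in the directions of `R` act first; those in the tangential directions are then part
  -- of the principal value.
  set l := (List.finRange n).map tang ++ R.sort (· ≤ ·) with hl
  have hnd : l.Nodup := by
    refine List.Nodup.append ((List.nodup_finRange n).map tang.injective)
      (Finset.sort_nodup _ _) ?_
    intro i hi hi'
    obtain ⟨t, -, rfl⟩ := List.mem_map.1 hi
    rw [Finset.mem_sort, hR] at hi'
    exact forall_tang_ne tang hi' t rfl
  have hmem : ∀ i, i ∈ l := by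
    intro i
    by_cases hi : i ∈ R
    · exact List.mem_append_right _ ((Finset.mem_sort _).2 hi)
    · obtain ⟨t, rfl⟩ : ∃ t, tang t = i := by simpa [hR] using hi
      exact List.mem_append_left _ (List.mem_map_of_mem (List.mem_finRange t))
  have hcap : ∀ J : Fin d → ℕ, capOn l J = fun i ↦ min (J i) 1 :=
    fun J ↦ funext fun i ↦ by simp [capOn, hmem i]
  have h1 := hasLeading_residueList (m := (R.sort (· ≤ ·)).length) hI hv hnd (Λ := fun χ ↦
    (((R.sort (· ≤ ·)).map fun i ↦ (Real.pi / I i : ℂ)).prod *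
        ∫ z, singKer 0 (zeroOn (R.sort (· ≤ ·)) (capOn l J))
          (zeroOn (R.sort (· ≤ ·)) (capOn l K)) 0 z *
          (R.sort (· ≤ ·)).foldr (restrictCoord η) χ z)) (by
      intro c χ
      simp only [foldr_restrictCoord η _ (Finset.sort_nodup R (· ≤ ·))]
      simp only [← integral_const_mul]
      congr 1
      funext z
      ring_nf) (by
      refine hasLeading_double_poles hv hη hηs hη1 (Finset.sort_nodup _ _) ?_ ?_ ?_
      · intro i hi
        refine hI i fun h0 ↦ hi ?_
        simp only [hcap]
        omega
      · intro i hi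
        have := hJK i (fun h ↦ hi ((Finset.mem_sort _).2 h))
        simp only [hcap]
        omega
      · intro i hi
        have := hJR i ((Finset.mem_sort _).1 hi)
        simp only [hcap]
        omega) χ hχ
  rw [Finset.length_sort] at h1
  convert! h1 using 1
  congr 1
  · rw [← List.prod_toFinset _ (Finset.sort_nodup R (· ≤ ·)), Finset.sort_toFinset]
  simp only [foldr_restrictCoord η _ (Finset.sort_nodup R (· ≤ ·)), Finset.mem_sort]
  have hg : IsTest (residueIter R J K χ) := hχ.residueList _
  rw [pvInt, ← residueList_comp_tangIncl tang J K hg, ← integral_comp_tang_mul_prod tang hη1,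
    ← hR]
  congr 1
  funext z
  have e1 : residueList J K l χ =
      residueList J K ((List.finRange n).map tang) (residueIter R J K χ) := by
    simp only [residueList, hl, List.foldr_append]
    rfl
  have e2 : ((R.sort (· ≤ ·)).map fun i ↦ η (z i)).prod = ∏ i ∈ R, η (z i) := by
    rw [← List.prod_toFinset _ (Finset.sort_nodup R (· ≤ ·)), Finset.sort_toFinset]
  have e3 : singKer 0 (zeroOn (R.sort (· ≤ ·)) (capOn l J))
          (zeroOn (R.sort (· ≤ ·)) (capOn l K)) 0 z =
      singKer 0 (fun t ↦ min ((J ∘ tang) t) 1) (fun t ↦ min ((K ∘ tang) t) 1) 0 (z ∘ tang) := by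
    simp only [singKer]
    rw [← Finset.prod_compl_mul_prod (Finset.univ.map tang), ← hR, Finset.prod_eq_one,
      one_mul, Finset.prod_map]
    · refine Finset.prod_congr rfl fun t _ ↦ ?_
      have : tang t ∉ R := by simp [hR]
      simp [zeroOn, hcap, this]
    · intro i hi
      simp [zeroOn, hi, coordKer_zero_left]
  rw [e1, e2, e3, Function.comp_apply, tangIncl_comp, ← hR]
  ring

theorem residueIter_empty (J K : Fin d → ℕ) (f : (Fin d → ℂ) → ℂ) : residueIter ∅ J K f = f := by
  simp [residueIter]

/-- Without poles of both types along a coordinate, the integral is regular at the origin and its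
value is the principal value, which depends neither on the exponents `I` nor on `v`. -/
theorem hasLeading_singInt_of_one_type {I J K : Fin n → ℕ} (hI : ∀ i, J i + K i ≠ 0 → I i ≠ 0)
    (hJK : ∀ i, J i = 0 ∨ K i = 0) {v χ : (Fin n → ℂ) → ℂ} (hv : ContDiff ℝ ∞ v)
    (hχ : IsTest χ) : HasLeading (singInt I J K v χ) 0 (pvInt J K χ) := by
  have h := hasLeading_singInt (tang := Function.Embedding.refl (Fin n)) (R := ∅) (by simp) hI
    (by simp) (fun i _ ↦ hJK i) hv hχ
  have e : (tangIncl (Function.Embedding.refl (Fin n)) : (Fin n → ℂ) → Fin n → ℂ) = id := by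
    funext w t
    exact tangIncl_apply_tang (Function.Embedding.refl (Fin n)) w t
  rw [residueIter_empty, e] at h
  simp only [Finset.card_empty, Finset.prod_empty, one_mul] at h
  exact h

/-- The order of the pole at the origin is at most the number of coordinates with poles of both
types. -/
theorem exists_hasLeading_singInt {I J K : Fin d → ℕ} (hI : ∀ i, J i + K i ≠ 0 → I i ≠ 0)
    {v χ : (Fin d → ℂ) → ℂ} (hv : ContDiff ℝ ∞ v) (hχ : IsTest χ) :
    ∃ L, HasLeading (singInt I J K v χ) (commonPoles J K).card L := by
  refine ⟨_, hasLeading_singInt (tang := ((commonPoles J K)ᶜ.orderEmbOfFin rfl).toEmbedding)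
    (R := commonPoles J K) ?_ hI ?_ ?_ hv hχ⟩
  · rw [Finset.map_orderEmbOfFin_univ, compl_compl]
  · intro i hi
    have := (Finset.mem_filter.1 hi).2
    omega
  · intro i hi
    by_contra h
    exact hi (Finset.mem_filter.2 ⟨Finset.mem_univ i, by omega⟩)

end LeadingCoefficient

/-! ### Residues and multiplication by monomials -/

section Derivation

variable {d : ℕ} {Ω : Set (Fin d → ℂ)} {δ : ((Fin d → ℂ) → ℂ) → (Fin d → ℂ) → ℂ}
  {f g m : (Fin d → ℂ) → ℂ}

/-- An operator that acts as a derivation on the smooth functions on `Ω`. -/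
structure IsDerivationOn (Ω : Set (Fin d → ℂ)) (δ : ((Fin d → ℂ) → ℂ) → (Fin d → ℂ) → ℂ) :
    Prop where
  contDiffOn : ∀ f, ContDiffOn ℝ ∞ f Ω → ContDiffOn ℝ ∞ (δ f) Ω
  eqOn : ∀ f g, EqOn f g Ω → EqOn (δ f) (δ g) Ω
  add : ∀ f g, ContDiffOn ℝ ∞ f Ω → ContDiffOn ℝ ∞ g Ω →
    EqOn (δ fun z ↦ f z + g z) (fun z ↦ δ f z + δ g z) Ω
  mul : ∀ f g, ContDiffOn ℝ ∞ f Ω → ContDiffOn ℝ ∞ g Ω →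
    EqOn (δ fun z ↦ f z * g z) (fun z ↦ f z * δ g z + g z * δ f z) Ω

theorem isDerivationOn_wirtinger (hΩ : IsOpen Ω) (j : Fin d) :
    IsDerivationOn Ω (wirtinger j) where
  contDiffOn _ hf := hf.wirtinger j hΩ
  eqOn _ _ h := wirtinger_eqOn j hΩ h
  add _ _ hf hg _ hz := wirtinger_add j
    ((hf.differentiableOn (by simp)).differentiableAt (hΩ.mem_nhds hz))
    ((hg.differentiableOn (by simp)).differentiableAt (hΩ.mem_nhds hz))
  mul _ _ hf hg _ hz := wirtinger_mul j
    ((hf.differentiableOn (by simp)).differentiableAt (hΩ.mem_nhds hz))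
    ((hg.differentiableOn (by simp)).differentiableAt (hΩ.mem_nhds hz))

theorem isDerivationOn_wirtingerBar (hΩ : IsOpen Ω) (j : Fin d) :
    IsDerivationOn Ω (wirtingerBar j) where
  contDiffOn _ hf := hf.wirtingerBar j hΩ
  eqOn _ _ h := wirtingerBar_eqOn j hΩ h
  add _ _ hf hg _ hz := wirtingerBar_add j
    ((hf.differentiableOn (by simp)).differentiableAt (hΩ.mem_nhds hz))
    ((hg.differentiableOn (by simp)).differentiableAt (hΩ.mem_nhds hz))
  mul _ _ hf hg _ hz := wirtingerBar_mul j
    ((hf.differentiableOn (by simp)).differentiableAt (hΩ.mem_nhds hz))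
    ((hg.differentiableOn (by simp)).differentiableAt (hΩ.mem_nhds hz))

namespace IsDerivationOn

theorem iterate_contDiffOn (hδ : IsDerivationOn Ω δ) (hf : ContDiffOn ℝ ∞ f Ω) (a : ℕ) :
    ContDiffOn ℝ ∞ (δ^[a] f) Ω := by
  induction a generalizing f with
  | zero => exact hf
  | succ a ih => exact ih (hδ.contDiffOn _ hf)

theorem iterate_eqOn (hδ : IsDerivationOn Ω δ) (h : EqOn f g Ω) (a : ℕ) :
    EqOn (δ^[a] f) (δ^[a] g) Ω := by
  induction a generalizing f g with
  | zero => exact h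
  | succ a ih => exact ih (hδ.eqOn _ _ h)

theorem iterate_add (hδ : IsDerivationOn Ω δ) (hf : ContDiffOn ℝ ∞ f Ω)
    (hg : ContDiffOn ℝ ∞ g Ω) (a : ℕ) :
    EqOn (δ^[a] fun z ↦ f z + g z) (fun z ↦ δ^[a] f z + δ^[a] g z) Ω := by
  induction a generalizing f g with
  | zero => exact fun _ _ ↦ rfl
  | succ a ih =>
    exact (hδ.iterate_eqOn (hδ.add _ _ hf hg) a).trans
      (ih (hδ.contDiffOn _ hf) (hδ.contDiffOn _ hg))

theorem iterate_mul (hδ : IsDerivationOn Ω δ) (hm : ContDiffOn ℝ ∞ m Ω)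
    (hm0 : EqOn (δ m) 0 Ω) (hf : ContDiffOn ℝ ∞ f Ω) (a : ℕ) :
    EqOn (δ^[a] fun z ↦ m z * f z) (fun z ↦ m z * δ^[a] f z) Ω := by
  induction a generalizing f with
  | zero => exact fun _ _ ↦ rfl
  | succ a ih =>
    refine (hδ.iterate_eqOn ((hδ.mul _ _ hm hf).trans fun z hz ↦ ?_) a).trans
      (ih (hδ.contDiffOn _ hf))
    simp [hm0 hz]

theorem iterate_coord_mul (hδ : IsDerivationOn Ω δ) (hm : ContDiffOn ℝ ∞ m Ω)
    (hm1 : EqOn (δ m) 1 Ω) (hf : ContDiffOn ℝ ∞ f Ω) (a : ℕ) : EqOn (δ^[a + 1] fun z ↦ m z * f z)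
      (fun z ↦ m z * δ^[a + 1] f z + (a + 1) * δ^[a] f z) Ω := by
  induction a generalizing f with
  | zero =>
    intro z hz
    simpa [hm1 hz] using hδ.mul _ _ hm hf hz
  | succ a ih =>
    have h1 : EqOn (δ fun z ↦ m z * f z) (fun z ↦ m z * δ f z + f z) Ω :=
      (hδ.mul _ _ hm hf).trans fun z hz ↦ by simp [hm1 hz]
    have h2 := hδ.iterate_add (hm.mul (hδ.contDiffOn _ hf)) hf (a + 1)
    refine (hδ.iterate_eqOn h1 (a + 1)).trans (h2.trans fun z hz ↦ ?_)
    have h3 := ih (hδ.contDiffOn _ hf) hz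
    simp only at h3 ⊢
    rw [h3]
    simp only [Function.iterate_succ_apply]
    push_cast
    ring

end IsDerivationOn

end Derivation

section ResidueAlgebra

variable {d : ℕ} {Ω : Set (Fin d → ℂ)} {f g m : (Fin d → ℂ) → ℂ} {J K : Fin d → ℕ}

theorem fderiv_single_eq_zero_of_invariant {j : Fin d}
    (h : ∀ z c, m (z + Pi.single j c) = m z) (z : Fin d → ℂ) (c : ℂ) :
    fderiv ℝ m z (Pi.single j c) = 0 := by
  by_cases hm : DifferentiableAt ℝ m z
  · refine (hm.hasFDerivAt.hasLineDerivAt (Pi.single j c)).unique ?_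
    have : ∀ t : ℝ, m (z + t • (Pi.single j c : Fin d → ℂ)) = m z := fun t ↦ by
      rw [← Pi.single_smul]; exact h z _
    simpa [HasLineDerivAt, this] using hasDerivAt_const (0 : ℝ) (m z)
  · simp [fderiv_zero_of_not_differentiableAt hm]

theorem wirtinger_eq_zero_of_invariant {j : Fin d}
    (h : ∀ z c, m (z + Pi.single j c) = m z) : wirtinger j m = 0 := by
  funext z; simp [wirtinger, fderiv_single_eq_zero_of_invariant h]

theorem wirtingerBar_eq_zero_of_invariant {j : Fin d}
    (h : ∀ z c, m (z + Pi.single j c) = m z) : wirtingerBar j m = 0 := by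
  funext z; simp [wirtingerBar, fderiv_single_eq_zero_of_invariant h]

theorem contDiff_coord (j : Fin d) : ContDiff ℝ ∞ fun z : Fin d → ℂ ↦ z j :=
  contDiff_apply ℝ ℂ j

theorem contDiff_coord_conj (j : Fin d) :
    ContDiff ℝ ∞ fun z : Fin d → ℂ ↦ starRingEnd ℂ (z j) :=
  Complex.conjCLE.contDiff.comp (contDiff_coord j)

theorem fderiv_coord (j : Fin d) (z v : Fin d → ℂ) :
    fderiv ℝ (fun z : Fin d → ℂ ↦ z j) z v = v j := by
  have : HasFDerivAt (fun z : Fin d → ℂ ↦ z j)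
    (ContinuousLinearMap.proj (R := ℝ) (φ := fun _ : Fin d ↦ ℂ) j) z :=
    (ContinuousLinearMap.proj (R := ℝ) (φ := fun _ : Fin d ↦ ℂ) j).hasFDerivAt
  rw [this.fderiv]; rfl

theorem fderiv_coord_conj (j : Fin d) (z v : Fin d → ℂ) :
    fderiv ℝ (fun z : Fin d → ℂ ↦ starRingEnd ℂ (z j)) z v = starRingEnd ℂ (v j) := by
  have : HasFDerivAt (fun z : Fin d → ℂ ↦ starRingEnd ℂ (z j))
    ((Complex.conjCLE : ℂ →L[ℝ] ℂ).comp
      (ContinuousLinearMap.proj (R := ℝ) (φ := fun _ : Fin d ↦ ℂ) j)) z :=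
    ((Complex.conjCLE : ℂ →L[ℝ] ℂ).comp
      (ContinuousLinearMap.proj (R := ℝ) (φ := fun _ : Fin d ↦ ℂ) j)).hasFDerivAt
  rw [this.fderiv]; rfl

theorem wirtinger_coord (j : Fin d) : wirtinger j (fun z ↦ z j) = 1 := by
  funext z
  simp only [wirtinger, fderiv_coord, Pi.single_eq_same, Complex.I_mul_I, Pi.one_apply]
  norm_num

theorem wirtingerBar_coord (j : Fin d) : wirtingerBar j (fun z ↦ z j) = 0 := by
  funext z
  simp [wirtingerBar, fderiv_coord]

theorem wirtinger_coord_conj (j : Fin d) :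
    wirtinger j (fun z ↦ starRingEnd ℂ (z j)) = 0 := by
  funext z
  simp [wirtinger, fderiv_coord_conj]

theorem wirtingerBar_coord_conj (j : Fin d) :
    wirtingerBar j (fun z ↦ starRingEnd ℂ (z j)) = 1 := by
  funext z
  simp [wirtingerBar, fderiv_coord_conj]

theorem coord_add_single {i j : Fin d} (hij : i ≠ j) (z : Fin d → ℂ) (c : ℂ) :
    (z + Pi.single j c : Fin d → ℂ) i = z i := by
  simp [hij]

theorem ContDiffOn.residueStep (hΩ : IsOpen Ω) (hf : ContDiffOn ℝ ∞ f Ω) (j : Fin d) (a b : ℕ) :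
    ContDiffOn ℝ ∞ (residueStep j a b f) Ω :=
  contDiffOn_const.mul ((isDerivationOn_wirtinger hΩ j).iterate_contDiffOn
    ((isDerivationOn_wirtingerBar hΩ j).iterate_contDiffOn hf _) _)

theorem residueStep_eqOn (hΩ : IsOpen Ω) (h : EqOn f g Ω) (j : Fin d) (a b : ℕ) :
    EqOn (residueStep j a b f) (residueStep j a b g) Ω := fun z hz ↦ by
  simp only [residueStep]
  rw [(isDerivationOn_wirtinger hΩ j).iterate_eqOn
    ((isDerivationOn_wirtingerBar hΩ j).iterate_eqOn h _) _ hz]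

theorem residueStep_add (hΩ : IsOpen Ω) (hf : ContDiffOn ℝ ∞ f Ω) (hg : ContDiffOn ℝ ∞ g Ω)
    (j : Fin d) (a b : ℕ) : EqOn (residueStep j a b fun z ↦ f z + g z)
      (fun z ↦ residueStep j a b f z + residueStep j a b g z) Ω := fun z hz ↦ by
  have h1 := isDerivationOn_wirtinger hΩ j
  have h2 := isDerivationOn_wirtingerBar hΩ j
  simp only [residueStep]
  rw [h1.iterate_eqOn (h2.iterate_add hf hg _) _ hz,
    h1.iterate_add (h2.iterate_contDiffOn hf _) (h2.iterate_contDiffOn hg _) _ hz]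
  ring

theorem residueStep_mul (hΩ : IsOpen Ω) {j : Fin d} (hm : ContDiffOn ℝ ∞ m Ω)
    (h1 : EqOn (wirtinger j m) 0 Ω) (h2 : EqOn (wirtingerBar j m) 0 Ω) (hf : ContDiffOn ℝ ∞ f Ω)
    (a b : ℕ) : EqOn (residueStep j a b fun z ↦ m z * f z)
      (fun z ↦ m z * residueStep j a b f z) Ω := fun z hz ↦ by
  have d1 := isDerivationOn_wirtinger hΩ j
  have d2 := isDerivationOn_wirtingerBar hΩ j
  simp only [residueStep]
  rw [d1.iterate_eqOn (d2.iterate_mul hm h2 hf _) _ hz,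
    d1.iterate_mul hm h1 (d2.iterate_contDiffOn hf _) _ hz]
  ring

theorem residueStep_coord_mul (hΩ : IsOpen Ω) (hf : ContDiffOn ℝ ∞ f Ω) (j : Fin d) {a : ℕ}
    (ha : 1 ≤ a) (b : ℕ) : EqOn (residueStep j (a + 1) b fun z ↦ z j * f z)
      (fun z ↦ z j * residueStep j (a + 1) b f z + residueStep j a b f z) Ω := fun z hz ↦ by
  have d1 := isDerivationOn_wirtinger hΩ j
  have d2 := isDerivationOn_wirtingerBar hΩ j
  have hc := (contDiff_coord j).contDiffOn (s := Ω)
  obtain ⟨a, rfl⟩ := Nat.exists_eq_add_of_le' ha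
  simp only [residueStep, Nat.add_sub_cancel]
  rw [d1.iterate_eqOn (d2.iterate_mul hc (fun z _ ↦ by rw [wirtingerBar_coord]) hf _) _ hz,
    d1.iterate_coord_mul hc (fun z _ ↦ by rw [wirtinger_coord]) (d2.iterate_contDiffOn hf _) _ hz,
    Nat.factorial_succ]
  push_cast
  field_simp

theorem residueStep_coord_conj_mul (hΩ : IsOpen Ω) (hf : ContDiffOn ℝ ∞ f Ω) (j : Fin d) (a : ℕ)
    {b : ℕ} (hb : 1 ≤ b) :
    EqOn (residueStep j a (b + 1) fun z ↦ starRingEnd ℂ (z j) * f z)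
      (fun z ↦ starRingEnd ℂ (z j) * residueStep j a (b + 1) f z + residueStep j a b f z) Ω :=
    fun z hz ↦ by
  have d1 := isDerivationOn_wirtinger hΩ j
  have d2 := isDerivationOn_wirtingerBar hΩ j
  have hc := (contDiff_coord_conj j).contDiffOn (s := Ω)
  obtain ⟨b, rfl⟩ := Nat.exists_eq_add_of_le' hb
  simp only [residueStep, Nat.add_sub_cancel]
  have h0 : EqOn (wirtinger j fun _ ↦ ((b : ℂ) + 1)) 0 Ω := fun z _ ↦ by simp [wirtinger]
  have s1 := d2.iterate_contDiffOn hf (b + 1)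
  have s2 := d2.iterate_contDiffOn hf b
  rw [d1.iterate_eqOn (d2.iterate_coord_mul hc (fun z _ ↦ by rw [wirtingerBar_coord_conj]) hf _)
      _ hz, d1.iterate_add (hc.mul s1) (contDiffOn_const.mul s2) _ hz]
  simp only
  rw [d1.iterate_mul hc (fun z _ ↦ by rw [wirtinger_coord_conj]) s1 _ hz,
    d1.iterate_mul contDiffOn_const h0 s2 _ hz, Nat.factorial_succ]
  push_cast
  field_simp

theorem ContDiffOn.residueList (hΩ : IsOpen Ω) (hf : ContDiffOn ℝ ∞ f Ω) (J K : Fin d → ℕ)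
    (l : List (Fin d)) : ContDiffOn ℝ ∞ (residueList J K l f) Ω := by
  induction l with
  | nil => exact hf
  | cons j l ih => exact ih.residueStep hΩ j _ _

theorem residueList_eqOn (hΩ : IsOpen Ω) (h : EqOn f g Ω) (J K : Fin d → ℕ) (l : List (Fin d)) :
    EqOn (residueList J K l f) (residueList J K l g) Ω := by
  induction l with
  | nil => exact h
  | cons j l ih => exact residueStep_eqOn hΩ ih j _ _

theorem residueList_congr_index {J' K' : Fin d → ℕ} {l : List (Fin d)}
    (h : ∀ j ∈ l, J j = J' j ∧ K j = K' j) (f : (Fin d → ℂ) → ℂ) :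
    residueList J K l f = residueList J' K' l f := by
  induction l with
  | nil => rfl
  | cons j l ih =>
    have := ih fun i hi ↦ h i (List.mem_cons_of_mem _ hi)
    have hj := h j List.mem_cons_self
    simp only [residueList, List.foldr_cons] at this ⊢
    rw [this, hj.1, hj.2]

theorem residueList_add (hΩ : IsOpen Ω) (hf : ContDiffOn ℝ ∞ f Ω) (hg : ContDiffOn ℝ ∞ g Ω)
    (J K : Fin d → ℕ) (l : List (Fin d)) : EqOn (residueList J K l fun z ↦ f z + g z)
      (fun z ↦ residueList J K l f z + residueList J K l g z) Ω := by
  induction l with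
  | nil => exact fun _ _ ↦ rfl
  | cons j l ih =>
    exact (residueStep_eqOn hΩ ih j _ _).trans
      (residueStep_add hΩ (hf.residueList hΩ J K l) (hg.residueList hΩ J K l) j _ _)

theorem residueList_mul (hΩ : IsOpen Ω) {l : List (Fin d)} (hm : ContDiffOn ℝ ∞ m Ω)
    (h1 : ∀ j ∈ l, EqOn (wirtinger j m) 0 Ω) (h2 : ∀ j ∈ l, EqOn (wirtingerBar j m) 0 Ω)
    (hf : ContDiffOn ℝ ∞ f Ω) (J K : Fin d → ℕ) : EqOn (residueList J K l fun z ↦ m z * f z)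
      (fun z ↦ m z * residueList J K l f z) Ω := by
  induction l with
  | nil => exact fun _ _ ↦ rfl
  | cons j l ih =>
    exact (residueStep_eqOn hΩ (ih (fun i hi ↦ h1 i (List.mem_cons_of_mem _ hi))
      fun i hi ↦ h2 i (List.mem_cons_of_mem _ hi)) j _ _).trans
      (residueStep_mul hΩ hm (h1 j List.mem_cons_self) (h2 j List.mem_cons_self)
        (hf.residueList hΩ J K l) _ _)

/-- Multiplying by `z_j` while raising the order in `z_j` by one does not change the residue, up to
a multiple of `z_j`. -/
theorem residueList_coord_mul (hΩ : IsOpen Ω) {l : List (Fin d)} (hl : l.Nodup) {j : Fin d}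
    (hj : j ∈ l) (hJ : 1 ≤ J j) (hf : ContDiffOn ℝ ∞ f Ω) :
    EqOn (residueList (Function.update J j (J j + 1)) K l fun z ↦ z j * f z)
      (fun z ↦ z j * residueList (Function.update J j (J j + 1)) K l f z +
        residueList J K l f z) Ω := by
  have hc := (contDiff_coord j).contDiffOn (s := Ω)
  induction l with
  | nil => simp at hj
  | cons i l ih =>
    obtain ⟨hil, hl⟩ := List.nodup_cons.1 hl
    by_cases hij : i = j
    · subst hij
      have e : ∀ f, residueList (Function.update J i (J i + 1)) K l f = residueList J K l f :=
        residueList_congr_index fun k hk ↦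
          ⟨Function.update_of_ne (ne_of_mem_of_not_mem hk hil) _ _, rfl⟩
      have h1 := residueList_mul hΩ (l := l) hc (fun k hk z _ ↦ by
        rw [wirtinger_eq_zero_of_invariant
          (coord_add_single (ne_of_mem_of_not_mem hk hil).symm)]) (fun k hk z _ ↦ by
        rw [wirtingerBar_eq_zero_of_invariant
          (coord_add_single (ne_of_mem_of_not_mem hk hil).symm)]) hf J K
      have h2 := (residueStep_eqOn hΩ h1 i (J i + 1) (K i)).trans
        (residueStep_coord_mul hΩ (hf.residueList hΩ J K l) i hJ (K i))
      simp only [residueList, List.foldr_cons, Function.update_self] at h2 e ⊢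
      simpa only [e] using h2
    · have h1 := residueStep_eqOn hΩ (ih hl (List.mem_of_ne_of_mem (Ne.symm hij) hj)) i (J i) (K i)
      have s1 := hf.residueList hΩ (Function.update J j (J j + 1)) K l
      have h2 := h1.trans ((residueStep_add hΩ (hc.mul s1) (hf.residueList hΩ J K l) i _ _).trans
        fun z hz ↦ congrArg (· + _) (residueStep_mul hΩ hc
        (fun z _ ↦ by rw [wirtinger_eq_zero_of_invariant (coord_add_single (Ne.symm hij))])
        (fun z _ ↦ by rw [wirtingerBar_eq_zero_of_invariant (coord_add_single (Ne.symm hij))])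
        s1 _ _ hz))
      simp only [residueList, List.foldr_cons, Function.update_of_ne hij] at h2 ⊢
      exact h2

theorem residueList_coord_conj_mul (hΩ : IsOpen Ω) {l : List (Fin d)} (hl : l.Nodup) {j : Fin d}
    (hj : j ∈ l) (hK : 1 ≤ K j) (hf : ContDiffOn ℝ ∞ f Ω) :
    EqOn (residueList J (Function.update K j (K j + 1)) l fun z ↦ starRingEnd ℂ (z j) * f z)
      (fun z ↦ starRingEnd ℂ (z j) * residueList J (Function.update K j (K j + 1)) l f z +
        residueList J K l f z) Ω := by
  have hc := (contDiff_coord_conj j).contDiffOn (s := Ω)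
  have hinv : ∀ {i : Fin d}, j ≠ i → ∀ (z : Fin d → ℂ) (c : ℂ),
      starRingEnd ℂ ((z + Pi.single i c : Fin d → ℂ) j) = starRingEnd ℂ (z j) :=
    fun h z c ↦ congrArg _ (coord_add_single h z c)
  induction l with
  | nil => simp at hj
  | cons i l ih =>
    obtain ⟨hil, hl⟩ := List.nodup_cons.1 hl
    by_cases hij : i = j
    · subst hij
      have e : ∀ f, residueList J (Function.update K i (K i + 1)) l f = residueList J K l f :=
        residueList_congr_index fun k hk ↦
          ⟨rfl, Function.update_of_ne (ne_of_mem_of_not_mem hk hil) _ _⟩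
      have h1 := residueList_mul hΩ (l := l) hc (fun k hk z _ ↦ by
        rw [wirtinger_eq_zero_of_invariant (hinv (ne_of_mem_of_not_mem hk hil).symm)])
        (fun k hk z _ ↦ by
        rw [wirtingerBar_eq_zero_of_invariant (hinv (ne_of_mem_of_not_mem hk hil).symm)]) hf J K
      have h2 := (residueStep_eqOn hΩ h1 i (J i) (K i + 1)).trans
        (residueStep_coord_conj_mul hΩ (hf.residueList hΩ J K l) i (J i) hK)
      simp only [residueList, List.foldr_cons, Function.update_self] at h2 e ⊢
      simpa only [e] using h2
    · have h1 := residueStep_eqOn hΩ (ih hl (List.mem_of_ne_of_mem (Ne.symm hij) hj)) i (J i) (K i)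
      have s1 := hf.residueList hΩ J (Function.update K j (K j + 1)) l
      have h2 := h1.trans ((residueStep_add hΩ (hc.mul s1) (hf.residueList hΩ J K l) i _ _).trans
        fun z hz ↦ congrArg (· + _) (residueStep_mul hΩ hc
        (fun z _ ↦ by rw [wirtinger_eq_zero_of_invariant (hinv (Ne.symm hij))])
        (fun z _ ↦ by rw [wirtingerBar_eq_zero_of_invariant (hinv (Ne.symm hij))])
        s1 _ _ hz))
      simp only [residueList, List.foldr_cons, Function.update_of_ne hij] at h2 ⊢
      exact h2

/-- On `z_j = 0`, multiplying by `z_j^a z̄_j^b` and raising the pole orders in `z_j` accordingly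
does not change the residue. -/
theorem residueList_pow_mul (hΩ : IsOpen Ω) {l : List (Fin d)} (hl : l.Nodup) {j : Fin d}
    (hj : j ∈ l) (hJ : 1 ≤ J j) (hK : 1 ≤ K j) (hf : ContDiffOn ℝ ∞ f Ω) (a b : ℕ)
    {z : Fin d → ℂ} (hz : z ∈ Ω) (hzj : z j = 0) :
    residueList (Function.update J j (J j + a)) (Function.update K j (K j + b)) l
      (fun z ↦ (z j ^ a * starRingEnd ℂ (z j) ^ b) * f z) z = residueList J K l f z := by
  induction a with
  | zero =>
    induction b with
    | zero => simp
    | succ b ih =>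
      have hs : ContDiffOn ℝ ∞ (fun z ↦ (z j ^ 0 * starRingEnd ℂ (z j) ^ b) * f z) Ω :=
        (((contDiff_coord j).pow 0).mul ((contDiff_coord_conj j).pow b)).contDiffOn.mul hf
      have h1 := residueList_coord_conj_mul (J := Function.update J j (J j + 0))
        (K := Function.update K j (K j + b)) hΩ hl hj (by simp; omega) hs hz
      simp only [Function.update_self, Function.update_idem, hzj, map_zero, zero_mul, zero_add,
        ih] at h1
      rw [← h1]
      congr 2
      funext z
      ring
  | succ a ih =>
    have hs : ContDiffOn ℝ ∞ (fun z ↦ (z j ^ a * starRingEnd ℂ (z j) ^ b) * f z) Ω :=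
      (((contDiff_coord j).pow a).mul ((contDiff_coord_conj j).pow b)).contDiffOn.mul hf
    have h1 := residueList_coord_mul (J := Function.update J j (J j + a))
      (K := Function.update K j (K j + b)) hΩ hl hj (by simp; omega) hs hz
    simp only [Function.update_self, Function.update_idem, hzj, zero_mul, zero_add, ih] at h1
    rw [← h1]
    congr 2
    funext z
    ring

/-- `residueList_pow_mul` for several coordinates. -/
theorem residueList_monomial_mul (hΩ : IsOpen Ω) {l : List (Fin d)} (hl : l.Nodup)
    (hJK : ∀ j ∈ l, 1 ≤ J j ∧ 1 ≤ K j) (hf : ContDiffOn ℝ ∞ f Ω) (A B : Fin d → ℕ)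
    {z : Fin d → ℂ} (hz : z ∈ Ω) (T : Finset (Fin d)) (hT : ∀ j ∈ T, j ∈ l ∧ z j = 0) :
    residueList (fun j ↦ if j ∈ T then J j + A j else J j)
      (fun j ↦ if j ∈ T then K j + B j else K j) l
      (fun z ↦ (∏ j ∈ T, (z j ^ A j * starRingEnd ℂ (z j) ^ B j)) * f z) z =
      residueList J K l f z := by
  induction T using Finset.induction_on with
  | empty => simp
  | insert i T hi ih =>
    have hs : ContDiffOn ℝ ∞
        (fun z ↦ (∏ j ∈ T, (z j ^ A j * starRingEnd ℂ (z j) ^ B j)) * f z) Ω :=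
      (contDiff_prod fun j _ ↦ ((contDiff_coord j).pow (A j)).mul
        ((contDiff_coord_conj j).pow (B j))).contDiffOn.mul hf
    obtain ⟨hil, hzi⟩ := hT i (Finset.mem_insert_self _ _)
    have h1 := residueList_pow_mul (J := fun j ↦ if j ∈ T then J j + A j else J j)
      (K := fun j ↦ if j ∈ T then K j + B j else K j) hΩ hl hil
      (by simp [hi, (hJK i hil).1]) (by simp [hi, (hJK i hil).2]) hs (A i) (B i) hz hzi
    rw [ih fun j hj ↦ hT j (Finset.mem_insert_of_mem hj)] at h1
    rw [← h1]
    have e : ∀ J A : Fin d → ℕ, (fun j ↦ if j ∈ insert i T then J j + A j else J j) =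
        Function.update (fun j ↦ if j ∈ T then J j + A j else J j) i
          ((if i ∈ T then J i + A i else J i) + A i) := by
      intro J A
      funext j
      by_cases hj : j = i
      · subst hj; simp [hi]
      · simp [hj]
    rw [e J A, e K B]
    congr 2
    funext z
    rw [Finset.prod_insert hi]
    ring

/-- The iterated residue does not depend on the choice of the pole orders, and it commutes with
multiplication by functions of the other coordinates. -/
theorem residueIter_mul_monomial (hΩ : IsOpen Ω) {R : Finset (Fin d)} {A B J' K' : Fin d → ℕ}
    (hJK : ∀ j ∈ R, 1 ≤ J j ∧ 1 ≤ K j) (hJ' : ∀ j ∈ R, J' j = J j + A j)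
    (hK' : ∀ j ∈ R, K' j = K j + B j) (hm : ContDiffOn ℝ ∞ m Ω)
    (hmR : ∀ j ∈ R, ∀ z c, m (z + Pi.single j c) = m z)
    (hf : ContDiffOn ℝ ∞ f Ω) {z : Fin d → ℂ} (hz : z ∈ Ω) (hzR : ∀ j ∈ R, z j = 0) :
    residueIter R J' K'
      (fun z ↦ m z * ((∏ j ∈ R, (z j ^ A j * starRingEnd ℂ (z j) ^ B j)) * f z)) z =
      m z * residueIter R J K f z := by
  have hs : ContDiffOn ℝ ∞
      (fun z ↦ (∏ j ∈ R, (z j ^ A j * starRingEnd ℂ (z j) ^ B j)) * f z) Ω :=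
    (contDiff_prod fun j _ ↦ ((contDiff_coord j).pow (A j)).mul
      ((contDiff_coord_conj j).pow (B j))).contDiffOn.mul hf
  have h1 := residueList_mul hΩ (l := R.sort (· ≤ ·)) hm
    (fun j hj z _ ↦ by rw [wirtinger_eq_zero_of_invariant (hmR j ((Finset.mem_sort _).1 hj))])
    (fun j hj z _ ↦ by rw [wirtingerBar_eq_zero_of_invariant (hmR j ((Finset.mem_sort _).1 hj))])
    hs J' K' hz
  refine h1.trans ?_
  simp only
  congr 1
  have h2 := residueList_monomial_mul hΩ (Finset.sort_nodup R (· ≤ ·)) (J := J) (K := K)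
    (fun j hj ↦ hJK j ((Finset.mem_sort _).1 hj)) hf A B hz R
    fun j hj ↦ ⟨(Finset.mem_sort _).2 hj, hzR j hj⟩
  refine Eq.trans ?_ h2
  rw [residueList_congr_index (l := R.sort (· ≤ ·))
    (J' := fun j ↦ if j ∈ R then J j + A j else J j)
    (K' := fun j ↦ if j ∈ R then K j + B j else K j)]
  intro j hj
  have hj' := (Finset.mem_sort _).1 hj
  simp [hj', hJ' j hj', hK' j hj']

theorem residueIter_eqOn (hΩ : IsOpen Ω) (h : EqOn f g Ω) (R : Finset (Fin d)) (J K : Fin d → ℕ) :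
    EqOn (residueIter R J K f) (residueIter R J K g) Ω :=
  residueList_eqOn hΩ h J K _

theorem residueIter_zero (R : Finset (Fin d)) (J K : Fin d → ℕ) :
    residueIter R J K (fun _ ↦ 0) = fun _ ↦ 0 := by
  have h : ∀ l : List (Fin d), residueList J K l (fun _ ↦ (0 : ℂ)) = fun _ ↦ 0 := by
    intro l
    induction l with
    | nil => rfl
    | cons j l ih =>
      have h1 := residueStep_const_mul (χ := fun _ ↦ 0) j (J j) (K j) 0
      simp only [zero_mul] at h1
      simp only [residueList, List.foldr_cons] at ih ⊢
      rw [ih, h1]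
  exact h _

theorem residueIter_sum (hΩ : IsOpen Ω) {β : Type*} (s : Finset β) {f : β → (Fin d → ℂ) → ℂ}
    (hf : ∀ b ∈ s, ContDiffOn ℝ ∞ (f b) Ω) (R : Finset (Fin d)) (J K : Fin d → ℕ) :
    EqOn (residueIter R J K fun z ↦ ∑ b ∈ s, f b z)
      (fun z ↦ ∑ b ∈ s, residueIter R J K (f b) z) Ω := by
  classical
  induction s using Finset.induction_on with
  | empty => intro z _; simp [residueIter_zero]
  | insert a s ha ih =>
    intro z hz
    simp only [Finset.sum_insert ha]
    have h := residueList_add hΩ (hf a (Finset.mem_insert_self _ _))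
      (ContDiffOn.sum fun b hb ↦ hf b (Finset.mem_insert_of_mem hb)) J K (R.sort (· ≤ ·)) hz
    refine h.trans ?_
    exact congrArg (_ + ·) (ih (fun b hb ↦ hf b (Finset.mem_insert_of_mem hb)) hz)

end ResidueAlgebra

/-! ### Forms in charts -/

section Charts

theorem isOpen_transition_source {d : ℕ} {X : Type*} [TopologicalSpace X]
    {φ φ' : OpenPartialHomeomorph X (Fin d → ℂ)} :
    IsOpen (φ.target ∩ φ.symm ⁻¹' φ'.source) :=
  φ.symm.isOpen_inter_preimage φ'.open_source

variable {d k : ℕ} {X : Type*} [TopologicalSpace X] [ChartedSpace (Fin d → ℂ) X]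
  {φ φ' : OpenPartialHomeomorph X (Fin d → ℂ)}

theorem mem_contDiffGroupoid_self {𝕜 E : Type*} [NontriviallyNormedField 𝕜]
    [NormedAddCommGroup E] [NormedSpace 𝕜 E] {n : ℕ∞ω} {e : OpenPartialHomeomorph E E} :
    e ∈ contDiffGroupoid n 𝓘(𝕜, E) ↔
      ContDiffOn 𝕜 n e e.source ∧ ContDiffOn 𝕜 n e.symm e.target := by
  rw [contDiffGroupoid, mem_groupoid_of_pregroupoid]
  simp [contDiffPregroupoid]

/-- Charts of the complex structure are charts of the underlying real structure. -/
theorem mem_maximalAtlas_real (hφ : φ ∈ IsManifold.maximalAtlas 𝓘(ℂ, Fin d → ℂ) ω X) :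
    φ ∈ IsManifold.maximalAtlas 𝓘(ℝ, Fin d → ℂ) ∞ X := by
  have h : ∀ e : OpenPartialHomeomorph (Fin d → ℂ) (Fin d → ℂ),
      e ∈ contDiffGroupoid ω 𝓘(ℂ, Fin d → ℂ) → e ∈ contDiffGroupoid ∞ 𝓘(ℝ, Fin d → ℂ) := by
    intro e he
    rw [mem_contDiffGroupoid_self] at he ⊢
    exact ⟨(he.1.restrict_scalars ℝ).of_le le_top, (he.2.restrict_scalars ℝ).of_le le_top⟩
  rw [IsManifold.mem_maximalAtlas_iff] at hφ ⊢
  exact fun e he ↦ ⟨h _ (hφ e he).1, h _ (hφ e he).2⟩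

/-- Transition functions between charts of the maximal atlas are holomorphic. -/
theorem contDiffOn_transition (hφ : φ ∈ IsManifold.maximalAtlas 𝓘(ℂ, Fin d → ℂ) ω X)
    (hφ' : φ' ∈ IsManifold.maximalAtlas 𝓘(ℂ, Fin d → ℂ) ω X) :
    ContDiffOn ℂ ω (φ' ∘ φ.symm) (φ.target ∩ φ.symm ⁻¹' φ'.source) := by
  have h := IsManifold.compatible_of_mem_maximalAtlas hφ hφ'
  rw [mem_contDiffGroupoid_self] at h
  simpa using h.1

theorem contDiffAt_transition (hφ : φ ∈ IsManifold.maximalAtlas 𝓘(ℂ, Fin d → ℂ) ω X)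
    (hφ' : φ' ∈ IsManifold.maximalAtlas 𝓘(ℂ, Fin d → ℂ) ω X) {u : Fin d → ℂ}
    (hu : u ∈ φ.target) (hu' : φ.symm u ∈ φ'.source) : ContDiffAt ℂ ω (φ' ∘ φ.symm) u :=
  (contDiffOn_transition hφ hφ').contDiffAt (isOpen_transition_source.mem_nhds ⟨hu, hu'⟩)

theorem contDiffAt_transition_real (hφ : φ ∈ IsManifold.maximalAtlas 𝓘(ℂ, Fin d → ℂ) ω X)
    (hφ' : φ' ∈ IsManifold.maximalAtlas 𝓘(ℂ, Fin d → ℂ) ω X) {u : Fin d → ℂ}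
    (hu : u ∈ φ.target) (hu' : φ.symm u ∈ φ'.source) : ContDiffAt ℝ ∞ (φ' ∘ φ.symm) u :=
  ((contDiffAt_transition hφ hφ' hu hu').restrict_scalars ℝ).of_le le_top

theorem DForm.congr_point (α : DForm d k X) {p q : X} (h : p = q) {v w : Fin k → Fin d → ℂ}
    (hvw : v = w) : α p v = α q w := by
  subst h hvw; rfl

theorem SmoothFormOn.mono {α : DForm d k X} {U U' : Set X} (hα : SmoothFormOn α U)
    (h : U' ⊆ U) : SmoothFormOn α U' :=
  fun x hx ↦ hα x (h hx)

variable [IsManifold 𝓘(ℂ, Fin d → ℂ) ω X]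

theorem mdifferentiableAt_symm_real (hφ : φ ∈ IsManifold.maximalAtlas 𝓘(ℂ, Fin d → ℂ) ω X)
    {u : Fin d → ℂ} (hu : u ∈ φ.target) :
    MDifferentiableAt 𝓘(ℝ, Fin d → ℂ) 𝓘(ℝ, Fin d → ℂ) φ.symm u := by
  have := isManifold_real (d := d) X
  exact ((contMDiffOn_symm_of_mem_maximalAtlas (mem_maximalAtlas_real hφ)).contMDiffAt
    (φ.open_target.mem_nhds hu)).mdifferentiableAt (by simp)

theorem contMDiffAt_real (hφ : φ ∈ IsManifold.maximalAtlas 𝓘(ℂ, Fin d → ℂ) ω X)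
    {x : X} (hx : x ∈ φ.source) :
    ContMDiffAt 𝓘(ℝ, Fin d → ℂ) 𝓘(ℝ, Fin d → ℂ) ∞ φ x := by
  have := isManifold_real (d := d) X
  exact contMDiffAt_of_mem_maximalAtlas (mem_maximalAtlas_real hφ) hx

theorem contMDiffAt_symm_real (hφ : φ ∈ IsManifold.maximalAtlas 𝓘(ℂ, Fin d → ℂ) ω X)
    {u : Fin d → ℂ} (hu : u ∈ φ.target) :
    ContMDiffAt 𝓘(ℝ, Fin d → ℂ) 𝓘(ℝ, Fin d → ℂ) ∞ φ.symm u := by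
  have := isManifold_real (d := d) X
  exact contMDiffAt_symm_of_mem_maximalAtlas (mem_maximalAtlas_real hφ) hu

/-- The chain rule for `φ⁻¹ = φ'⁻¹ ∘ (φ' ∘ φ⁻¹)`. -/
theorem mfderiv_symm_eq (hφ : φ ∈ IsManifold.maximalAtlas 𝓘(ℂ, Fin d → ℂ) ω X)
    (hφ' : φ' ∈ IsManifold.maximalAtlas 𝓘(ℂ, Fin d → ℂ) ω X) {u : Fin d → ℂ}
    (hu : u ∈ φ.target) (hu' : φ.symm u ∈ φ'.source) (v : Fin d → ℂ) :
    (mfderiv 𝓘(ℝ, Fin d → ℂ) 𝓘(ℝ, Fin d → ℂ) φ.symm u v : Fin d → ℂ) =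
      (mfderiv 𝓘(ℝ, Fin d → ℂ) 𝓘(ℝ, Fin d → ℂ) φ'.symm (φ' (φ.symm u))
        (fderiv ℝ (φ' ∘ φ.symm) u v) : Fin d → ℂ) := by
  have h1 : φ.symm =ᶠ[𝓝 u] φ'.symm ∘ (φ' ∘ φ.symm) := by
    filter_upwards [(isOpen_transition_source (φ := φ) (φ' := φ')).mem_nhds ⟨hu, hu'⟩] with w hw
    exact (φ'.left_inv hw.2).symm
  have h2 : MDifferentiableAt 𝓘(ℝ, Fin d → ℂ) 𝓘(ℝ, Fin d → ℂ) (φ' ∘ φ.symm) u :=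
    ((contDiffAt_transition_real hφ hφ' hu hu').differentiableAt (by simp)).mdifferentiableAt
  have h3 := mfderiv_comp u (mdifferentiableAt_symm_real hφ' (φ'.map_source hu')) h2
  have h4 := h1.mfderiv_eq (I := 𝓘(ℝ, Fin d → ℂ)) (I' := 𝓘(ℝ, Fin d → ℂ))
  have h5 : (mfderiv 𝓘(ℝ, Fin d → ℂ) 𝓘(ℝ, Fin d → ℂ) φ.symm u v : Fin d → ℂ) =
      (mfderiv 𝓘(ℝ, Fin d → ℂ) 𝓘(ℝ, Fin d → ℂ) (φ'.symm ∘ (φ' ∘ φ.symm)) u v : Fin d → ℂ) :=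
    congrArg (fun L : (Fin d → ℂ) →L[ℝ] (Fin d → ℂ) ↦ L v) h4
  rw [h5]
  have h6 := congrArg (fun L : (Fin d → ℂ) →L[ℝ] (Fin d → ℂ) ↦ L v) h3
  rw [mfderiv_eq_fderiv] at h6
  exact h6

/-- The expressions of a form in two charts are related by pull-back under the transition function.
-/
theorem chartRep_transfer (hφ : φ ∈ IsManifold.maximalAtlas 𝓘(ℂ, Fin d → ℂ) ω X)
    (hφ' : φ' ∈ IsManifold.maximalAtlas 𝓘(ℂ, Fin d → ℂ) ω X) {u : Fin d → ℂ}
    (hu : u ∈ φ.target) (hu' : φ.symm u ∈ φ'.source) (α : DForm d k X)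
    (v : Fin k → Fin d → ℂ) :
    chartRep φ α u v =
      chartRep φ' α (φ' (φ.symm u)) (fun i ↦ fderiv ℝ (φ' ∘ φ.symm) u (v i)) :=
  α.congr_point (φ'.left_inv hu').symm (funext fun i ↦ mfderiv_symm_eq hφ hφ' hu hu' (v i))

theorem mfderiv_symm_eq_fderiv (hφ : φ ∈ IsManifold.maximalAtlas 𝓘(ℂ, Fin d → ℂ) ω X)
    {u : Fin d → ℂ} (hu : u ∈ φ.target) (v : Fin d → ℂ) :
    (mfderiv 𝓘(ℝ, Fin d → ℂ) 𝓘(ℝ, Fin d → ℂ) φ.symm u v : Fin d → ℂ) =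
      fderiv ℝ (chartAt (Fin d → ℂ) (φ.symm u) ∘ φ.symm) u v := by
  have h := congrArg (fun L : (Fin d → ℂ) →L[ℝ] (Fin d → ℂ) ↦ L v)
    (mdifferentiableAt_symm_real hφ hu).mfderiv
  refine h.trans ?_
  simp only [writtenInExtChartAt, mfld_simps, fderivWithin_univ]
  rfl

/-- The coefficients of a form are smooth in all charts if they are smooth in one. -/
theorem contDiffAt_chartRep_transfer
    (hφ : φ ∈ IsManifold.maximalAtlas 𝓘(ℂ, Fin d → ℂ) ω X)
    (hφ' : φ' ∈ IsManifold.maximalAtlas 𝓘(ℂ, Fin d → ℂ) ω X) {x : X} (hx : x ∈ φ.source)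
    (hx' : x ∈ φ'.source) {α : DForm d k X}
    (h : ∀ v, ContDiffAt ℝ ∞ (fun u ↦ chartRep φ' α u v) (φ' x)) (v : Fin k → Fin d → ℂ) :
    ContDiffAt ℝ ∞ (fun u ↦ chartRep φ α u v) (φ x) := by
  have hu := φ.map_source hx
  have hu' : φ.symm (φ x) ∈ φ'.source := by rwa [φ.left_inv hx]
  set τ := φ' ∘ φ.symm with hτ
  have hτs : ContDiffAt ℝ ∞ τ (φ x) := contDiffAt_transition_real hφ hφ' hu hu'
  let b := Module.finBasis ℝ (Fin d → ℂ)
  have hev : (fun u ↦ chartRep φ α u v) =ᶠ[𝓝 (φ x)] fun u ↦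
      ∑ r : Fin k → Fin (Module.finrank ℝ (Fin d → ℂ)),
        ((∏ i, b.coord (r i) (fderiv ℝ τ u (v i)) : ℝ) : ℂ) *
          chartRep φ' α (τ u) (fun i ↦ b (r i)) := by
    filter_upwards [(isOpen_transition_source (φ := φ) (φ' := φ')).mem_nhds ⟨hu, hu'⟩] with u hw
    rw [chartRep_transfer hφ hφ' hw.1 hw.2]
    have e : (fun i ↦ fderiv ℝ τ u (v i)) =
        fun i ↦ ∑ j, b.coord j (fderiv ℝ τ u (v i)) • b j :=
      funext fun i ↦ (b.sum_repr _).symm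
    rw [← hτ, e]
    refine ((chartRep φ' α (τ u)).toMultilinearMap.map_sum _).trans ?_
    refine Finset.sum_congr rfl fun r _ ↦ ?_
    refine ((chartRep φ' α (τ u)).toMultilinearMap.map_smul_univ _ _).trans ?_
    rw [Complex.real_smul]
    rfl
  refine ContDiffAt.congr_of_eventuallyEq ?_ hev
  have hτd : ContDiffAt ℝ ∞ (fderiv ℝ τ) (φ x) := hτs.fderiv_right (by simp)
  have hτx : τ (φ x) = φ' x := by simp [hτ, φ.left_inv hx]
  refine ContDiffAt.sum fun r _ ↦ ContDiffAt.mul ?_ ?_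
  · have h1 : ContDiffAt ℝ ∞ (fun u ↦ ∏ i, b.coord (r i) (fderiv ℝ τ u (v i))) (φ x) :=
      contDiffAt_prod fun i _ ↦
        (LinearMap.toContinuousLinearMap (b.coord (r i))).contDiff.contDiffAt.comp (φ x)
          (hτd.clm_apply contDiffAt_const)
    exact Complex.ofRealCLM.contDiff.contDiffAt.comp (φ x) h1
  · have h1 : ContDiffAt ℝ ∞ (fun u ↦ chartRep φ' α u fun i ↦ b (r i)) (τ (φ x)) := by
      rw [hτx]; exact h _
    exact h1.comp (φ x) hτs

theorem SmoothFormOn.contDiffAt (hφ : φ ∈ IsManifold.maximalAtlas 𝓘(ℂ, Fin d → ℂ) ω X)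
    {α : DForm d k X} {U : Set X} (hα : SmoothFormOn α U) {x : X} (hxU : x ∈ U)
    (hx : x ∈ φ.source) (v : Fin k → Fin d → ℂ) :
    ContDiffAt ℝ ∞ (fun u ↦ chartRep φ α u v) (φ x) :=
  contDiffAt_chartRep_transfer hφ (IsManifold.chart_mem_maximalAtlas x) hx
    (mem_chart_source _ x) (hα x hxU) v

/-- Smoothness of a form can be checked in any charts of the maximal atlas. -/
theorem smoothFormOn_of_contDiffAt {α : DForm d k X} {U : Set X}
    (h : ∀ x ∈ U, ∃ φ ∈ IsManifold.maximalAtlas 𝓘(ℂ, Fin d → ℂ) ω X, x ∈ φ.source ∧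
      ∀ v, ContDiffAt ℝ ∞ (fun u ↦ chartRep φ α u v) (φ x)) : SmoothFormOn α U := by
  intro x hx
  obtain ⟨φ, hφ, hxφ, hs⟩ := h x hx
  exact contDiffAt_chartRep_transfer (IsManifold.chart_mem_maximalAtlas x) hφ
    (mem_chart_source _ x) hxφ hs

end Charts

/-! ### Exterior products -/

section Wedge

variable {V W : Type*} [AddCommGroup V] [Module ℝ V] [AddCommGroup W] [Module ℝ W] {k l : ℕ}

theorem altWedge_eq_sum_summand (a : V [⋀^Fin k]→ₗ[ℝ] ℂ) (b : V [⋀^Fin l]→ₗ[ℝ] ℂ)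
    (v : Fin (k + l) → V) :
    altWedge a b v = ∑ q : Equiv.Perm.ModSumCongr (Fin k) (Fin l), LinearMap.mul' ℝ ℂ
      (AlternatingMap.domCoprod.summand a b q (v ∘ finSumFinEquiv)) := by
  simp [altWedge, AlternatingMap.domCoprod_apply]

theorem mul'_summand (a : V [⋀^Fin k]→ₗ[ℝ] ℂ) (b : V [⋀^Fin l]→ₗ[ℝ] ℂ)
    (σ : Equiv.Perm (Fin k ⊕ Fin l)) (v : Fin k ⊕ Fin l → V) :
    LinearMap.mul' ℝ ℂ (AlternatingMap.domCoprod.summand a b (Quotient.mk'' σ) v) =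
      ((Equiv.Perm.sign σ : ℤ) : ℂ) *
        (a (fun i ↦ v (σ (Sum.inl i))) * b (fun i ↦ v (σ (Sum.inr i)))) := by
  rw [AlternatingMap.domCoprod.summand_mk'', Units.smul_def]
  rw [_root_.smul_apply, map_zsmul, MultilinearMap.domDomCongr_apply,
    MultilinearMap.domCoprod_apply, LinearMap.mul'_apply, zsmul_eq_mul]
  rfl

/-- The exterior product as a sum over shuffles. -/
theorem altWedge_apply (a : V [⋀^Fin k]→ₗ[ℝ] ℂ) (b : V [⋀^Fin l]→ₗ[ℝ] ℂ) (v : Fin (k + l) → V) :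
    altWedge a b v = ∑ q : Equiv.Perm.ModSumCongr (Fin k) (Fin l),
      ((Equiv.Perm.sign q.out : ℤ) : ℂ) *
        (a (fun i ↦ v (finSumFinEquiv (q.out (Sum.inl i)))) *
          b (fun i ↦ v (finSumFinEquiv (q.out (Sum.inr i))))) := by
  rw [altWedge_eq_sum_summand]
  refine Finset.sum_congr rfl fun q _ ↦ ?_
  have h := mul'_summand a b q.out (v ∘ finSumFinEquiv)
  rwa [show (Quotient.mk'' q.out : Equiv.Perm.ModSumCongr (Fin k) (Fin l)) = q from
    q.out_eq] at h

theorem altWedge_smul (c : ℂ) (a : V [⋀^Fin k]→ₗ[ℝ] ℂ) (b : V [⋀^Fin l]→ₗ[ℝ] ℂ) :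
    altWedge (c • a) b = c • altWedge a b := by
  ext v
  simp only [AlternatingMap.smul_apply, altWedge_apply, smul_eq_mul, Finset.mul_sum]
  exact Finset.sum_congr rfl fun q _ ↦ by ring

theorem altWedge_constOfIsEmpty_one (a : V [⋀^Fin k]→ₗ[ℝ] ℂ) (v : Fin k → V) :
    altWedge a (AlternatingMap.constOfIsEmpty ℝ V (Fin 0) (1 : ℂ)) v = a v := by
  have hq : ∀ q : Equiv.Perm.ModSumCongr (Fin k) (Fin 0), q = Quotient.mk'' 1 := by
    intro q
    rw [← q.out_eq]
    refine Quotient.sound' ?_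
    rw [QuotientGroup.leftRel_apply, mul_one]
    refine inv_mem ⟨((Equiv.sumEmpty (Fin k) (Fin 0)).permCongr q.out, 1), ?_⟩
    refine Equiv.ext fun x ↦ ?_
    rcases x with i | i
    · rcases h : q.out (Sum.inl i) with i' | i'
      · simp [Equiv.permCongr_apply, h]
      · exact i'.elim0
    · exact i.elim0
  rw [altWedge_eq_sum_summand]
  refine (Fintype.sum_eq_single (Quotient.mk'' 1) fun q h ↦ absurd (hq q) h).trans ?_
  rw [mul'_summand]
  simp
  rfl

end Wedge

/-! ### Forms of top degree -/

section TopForms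

variable {d : ℕ}

/-- The vectors `e₁, i e₁, e₂, i e₂, …` as a basis. -/
noncomputable def realBasisBasis (d : ℕ) : Module.Basis (Fin (2 * d)) ℝ (Fin d → ℂ) :=
  (Pi.basis fun _ : Fin d ↦ Complex.basisOneI).reindex
    ((Equiv.sigmaEquivProd _ _).trans (finProdFinEquiv.trans (finCongr (mul_comm d 2))))

theorem coe_realBasisBasis (d : ℕ) : ⇑(realBasisBasis d) = realBasis d := by
  funext a
  rw [realBasisBasis, Module.Basis.reindex_apply, Pi.basis_apply, Complex.coe_basisOneI]
  have h2 : (((Equiv.sigmaEquivProd (Fin d) (Fin 2)).trans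
    (finProdFinEquiv.trans (finCongr (mul_comm d 2)))).symm a) =
      ⟨⟨(a : ℕ) / 2, by omega⟩, ⟨(a : ℕ) % 2, by omega⟩⟩ := by
    rw [Equiv.symm_apply_eq]
    ext
    simp
    omega
  rw [h2, realBasis]
  congr 1
  rcases Nat.mod_two_eq_zero_or_one a with h | h <;> simp [h]

/-- A form of top degree is determined by its value on one basis. -/
theorem alternating_top_apply (η : (Fin d → ℂ) [⋀^Fin (2 * d)]→ₗ[ℝ] ℂ)
    (v : Fin (2 * d) → Fin d → ℂ) :
    η v = ((realBasisBasis d).det v : ℂ) * η (realBasis d) := by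
  have h : η = (LinearMap.toSpanSingleton ℝ ℂ (η (realBasis d))).compAlternatingMap
      (realBasisBasis d).det := by
    refine Module.Basis.ext_alternating (realBasisBasis d) fun σ hσ ↦ ?_
    let s : Equiv.Perm (Fin (2 * d)) := Equiv.ofBijective σ (Finite.injective_iff_bijective.1 hσ)
    have h1 := η.map_perm (realBasisBasis d) s
    have h2 := ((LinearMap.toSpanSingleton ℝ ℂ (η (realBasis d))).compAlternatingMap
      (realBasisBasis d).det).map_perm (realBasisBasis d) s
    refine h1.trans (Eq.trans ?_ h2.symm)
    have h3 : (realBasisBasis d).det (realBasis d) = 1 := by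
      rw [← coe_realBasisBasis, Module.Basis.det_self]
    simp [coe_realBasisBasis, h3]
  conv_lhs => rw [h]
  simp [Complex.real_smul]

/-- A form of top degree is multiplied by the determinant under a linear change of variables. -/
theorem alternating_top_comp (η : (Fin d → ℂ) [⋀^Fin (2 * d)]→ₗ[ℝ] ℂ)
    (A : (Fin d → ℂ) →ₗ[ℝ] (Fin d → ℂ)) :
    η (fun i ↦ A (realBasis d i)) = ((LinearMap.det A : ℝ) : ℂ) * η (realBasis d) := by
  rw [alternating_top_apply]
  congr 2
  have := (realBasisBasis d).det_comp A (realBasisBasis d)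
  rw [Module.Basis.det_self, mul_one, coe_realBasisBasis] at this
  exact this

/-- Holomorphic maps preserve the orientation: the real determinant of a complex linear map is
`|det_ℂ|²`. -/
theorem det_fderiv_nonneg {f : (Fin d → ℂ) → Fin d → ℂ} {u : Fin d → ℂ}
    (hf : DifferentiableAt ℂ f u) : 0 ≤ (fderiv ℝ f u).det := by
  rw [hf.fderiv_restrictScalars ℝ]
  have : ((fderiv ℂ f u).restrictScalars ℝ).det =
      LinearMap.det ((fderiv ℂ f u).toLinearMap.restrictScalars ℝ) := rfl
  rw [this, LinearMap.det_restrictScalars, Algebra.norm_complex_apply]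
  exact Complex.normSq_nonneg _

theorem dzForm_apply {n d : ℕ} (σ : Fin n → Fin d) (v : Fin (2 * n) → Fin d → ℂ) :
    dzForm σ v = (Matrix.of fun i j ↦ dzCovector σ j (v i)).det := rfl

/-- The value `(-2i)^n` comes from `dz ∧ dz̄ = -2i dx ∧ dy` in each coordinate. -/
theorem dzForm_realBasis (n : ℕ) : dzForm (id : Fin n → Fin n) (realBasis n) =
    (-2 * Complex.I) ^ n := by
  rw [dzForm_apply]
  let e : Fin 2 × Fin n ≃ Fin (2 * n) :=
    (Equiv.prodComm _ _).trans (finProdFinEquiv.trans (finCongr (mul_comm n 2)))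
  rw [← Matrix.det_submatrix_equiv_self e]
  have hM : (Matrix.of fun i j ↦ dzCovector (id : Fin n → Fin n) j (realBasis n i)).submatrix e e
      = Matrix.blockDiagonal fun _ : Fin n ↦ !![1, 1; Complex.I, -Complex.I] := by
    ext ⟨a, i⟩ ⟨b, j⟩
    have he : ∀ (a : Fin 2) (i : Fin n), ((e (a, i) : Fin (2 * n)) : ℕ) = a + 2 * i :=
      fun a i ↦ by simp [e]
    have hdiv : ∀ (a : Fin 2) (i : Fin n), ((a : ℕ) + 2 * i) / 2 = i := fun a i ↦ by omega
    have hmod : ∀ (a : Fin 2) (i : Fin n), ((a : ℕ) + 2 * i) % 2 = a := fun a i ↦ by omega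
    simp only [Matrix.submatrix_apply, Matrix.of_apply, dzCovector, realBasis, he, hdiv, hmod,
      Matrix.blockDiagonal_apply, LinearMap.comp_apply, LinearMap.proj_apply, id, Fin.eta,
      Pi.single_apply]
    by_cases hij : i = j
    · subst hij
      fin_cases a <;> fin_cases b <;> simp
    · rw [if_neg (Ne.symm hij), if_neg hij]
      split_ifs <;> simp
  rw [hM, Matrix.det_blockDiagonal]
  simp [Matrix.det_fin_two]
  ring_nf

end TopForms

/-! ### Integration in one chart -/

section ChartIntegral

theorem transition_image {d : ℕ} {X : Type*} [TopologicalSpace X]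
    {φ φ' : OpenPartialHomeomorph X (Fin d → ℂ)} :
    (φ' ∘ φ.symm) '' (φ.target ∩ φ.symm ⁻¹' φ'.source) =
    φ'.target ∩ φ'.symm ⁻¹' φ.source := by
  apply Subset.antisymm
  · rintro _ ⟨u, ⟨hu, hu'⟩, rfl⟩
    refine ⟨φ'.map_source hu', ?_⟩
    simp only [mem_preimage, Function.comp_apply, φ'.left_inv hu']
    exact φ.map_target hu
  · rintro w ⟨hw, hw'⟩
    refine ⟨φ (φ'.symm w), ⟨φ.map_source hw', ?_⟩, ?_⟩
    · simp only [mem_preimage, φ.left_inv hw']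
      exact φ'.map_target hw
    · simp only [Function.comp_apply, φ.left_inv hw', φ'.right_inv hw]

variable {d : ℕ} {X : Type*} [TopologicalSpace X] [ChartedSpace (Fin d → ℂ) X]

/-- The coefficient of a form of top degree in a chart. -/
noncomputable def topCoeff (φ : OpenPartialHomeomorph X (Fin d → ℂ)) (η : DForm d (2 * d) X)
    (u : Fin d → ℂ) : ℂ :=
  chartRep φ η u (realBasis d)

variable {φ φ' : OpenPartialHomeomorph X (Fin d → ℂ)}

theorem topCoeff_eq_zero {η : DForm d (2 * d) X} {u : Fin d → ℂ} (h : η (φ.symm u) = 0) :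
    topCoeff φ η u = 0 := by
  unfold topCoeff chartRep
  rw [h]
  rfl

theorem topCoeff_congr {η η' : DForm d (2 * d) X} {u : Fin d → ℂ}
    (h : η (φ.symm u) = η' (φ.symm u)) : topCoeff φ η u = topCoeff φ η' u := by
  simp [topCoeff, chartRep, h]

theorem topCoeff_smul (c : X → ℂ) (η : DForm d (2 * d) X) (u : Fin d → ℂ) :
    topCoeff φ (fun x ↦ c x • η x) u = c (φ.symm u) * topCoeff φ η u := rfl

/-- Subsets of complex hypersurfaces with normal crossings are null sets. -/
theorem volume_hyperplanes_eq_zero [CompactSpace X] {N : Set X}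
    (hN : ∀ x, ∃ φ ∈ IsManifold.maximalAtlas 𝓘(ℂ, Fin d → ℂ) ω X, x ∈ φ.source ∧
      ∀ y ∈ φ.source, y ∈ N → ∃ j, φ y j = 0)
    (hφ : φ ∈ IsManifold.maximalAtlas 𝓘(ℂ, Fin d → ℂ) ω X) :
    volume (φ.target ∩ φ.symm ⁻¹' N) = 0 := by
  choose c hc hcx hcN using hN
  obtain ⟨t, ht⟩ := isCompact_univ.elim_nhds_subcover (fun x ↦ (c x).source)
    fun x _ ↦ (c x).open_source.mem_nhds (hcx x)
  refine measure_mono_null (t := ⋃ x ∈ t, (φ ∘ (c x).symm) ''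
    (((c x).target ∩ (c x).symm ⁻¹' φ.source) ∩ {z | ∃ j, z j = 0})) ?_ ?_
  · intro u hu
    obtain ⟨x, hx, hux⟩ := mem_iUnion₂.1 (ht.2 (mem_univ (φ.symm u)))
    refine mem_iUnion₂.2 ⟨x, hx, c x (φ.symm u), ⟨⟨(c x).map_source hux, ?_⟩,
      hcN x _ hux hu.2⟩, ?_⟩
    · simp only [mem_preimage, (c x).left_inv hux]
      exact φ.map_target hu.1
    · simp only [Function.comp_apply, (c x).left_inv hux, φ.right_inv hu.1]
  · refine (measure_biUnion_null_iff t.countable_toSet).2 fun x _ ↦ ?_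
    refine addHaar_image_eq_zero_of_differentiableOn_of_addHaar_eq_zero volume ?_ ?_
    · intro u hu
      exact ((contDiffAt_transition_real (hc x) hφ hu.1.1 hu.1.2).differentiableAt
        (by simp)).differentiableWithinAt
    · refine measure_mono_null inter_subset_right ?_
      have := ae_forall_coord_ne_zero d
      rw [ae_iff] at this
      convert! this using 2
      ext z
      simp

variable [IsManifold 𝓘(ℂ, Fin d → ℂ) ω X]

/-- The transformation of the coefficient of a form of top degree, with the absolute value of the
Jacobian because the transition function preserves the orientation. -/
theorem topCoeff_transfer (hφ : φ ∈ IsManifold.maximalAtlas 𝓘(ℂ, Fin d → ℂ) ω X)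
    (hφ' : φ' ∈ IsManifold.maximalAtlas 𝓘(ℂ, Fin d → ℂ) ω X) {u : Fin d → ℂ}
    (hu : u ∈ φ.target) (hu' : φ.symm u ∈ φ'.source) (η : DForm d (2 * d) X) :
    topCoeff φ η u = |(fderiv ℝ (φ' ∘ φ.symm) u).det| • topCoeff φ' η (φ' (φ.symm u)) := by
  rw [abs_of_nonneg (det_fderiv_nonneg
    ((contDiffAt_transition hφ hφ' hu hu').differentiableAt (by simp))), topCoeff,
    chartRep_transfer hφ hφ' hu hu', Complex.real_smul]
  exact alternating_top_comp _ (fderiv ℝ (φ' ∘ φ.symm) u).toLinearMap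

variable [T2Space X] [CompactSpace X]

theorem finite_support_chartPartition :
    {p : X | (Function.support (chartPartition d X p)).Nonempty}.Finite :=
  (chartPartition d X).locallyFinite.finite_nonempty_of_compact

theorem tsupport_chartPartition_subset (p : X) :
    tsupport (chartPartition d X p) ⊆ (chartAt (Fin d → ℂ) p).source :=
  (exists_chartPartition d X).choose_spec p

/-- The integral of a form that vanishes outside the domain of a chart is the integral of its
coefficient in this chart. -/
theorem formIntegral_eq_integral_chart
    (hφ : φ ∈ IsManifold.maximalAtlas 𝓘(ℂ, Fin d → ℂ) ω X) {η : DForm d (2 * d) X}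
    (h0 : ∀ y ∉ φ.source, η y = 0) (hint : IntegrableOn (topCoeff φ η) φ.target) :
    FormIntegrable η ∧ formIntegral η = ∫ u in φ.target, topCoeff φ η u := by
  have key : ∀ p : X, IntegrableOn (fun u ↦ (chartPartition d X p (φ.symm u) : ℂ) *
      topCoeff φ η u) φ.target ∧
      IntegrableOn (localIntegrand η p) (chartAt (Fin d → ℂ) p).target ∧
      ∫ u in (chartAt (Fin d → ℂ) p).target, localIntegrand η p u =
        ∫ u in φ.target, (chartPartition d X p (φ.symm u) : ℂ) * topCoeff φ η u := by
    intro p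
    set c := chartAt (Fin d → ℂ) p with hc
    have hcm : c ∈ IsManifold.maximalAtlas 𝓘(ℂ, Fin d → ℂ) ω X :=
      IsManifold.chart_mem_maximalAtlas p
    set G : (Fin d → ℂ) → ℂ :=
      fun u ↦ (chartPartition d X p (φ.symm u) : ℂ) * topCoeff φ η u with hG
    set A := c.target ∩ c.symm ⁻¹' φ.source with hA
    have hAm : MeasurableSet A := isOpen_transition_source.measurableSet
    have hBm : MeasurableSet (φ.target ∩ φ.symm ⁻¹' c.source) :=
      isOpen_transition_source.measurableSet
    have hG1 : IntegrableOn G φ.target := by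
      refine Integrable.bdd_mul (c := 1) hint ?_ ?_
      · refine ContinuousOn.aestronglyMeasurable ?_ φ.open_target.measurableSet
        exact Complex.continuous_ofReal.comp_continuousOn
          ((chartPartition d X p).contMDiff.continuous.comp_continuousOn φ.continuousOn_symm)
      · refine Eventually.of_forall fun u ↦ ?_
        rw [Complex.norm_real, Real.norm_of_nonneg ((chartPartition d X).nonneg p _)]
        exact (chartPartition d X).le_one p _
    have hder : ∀ u ∈ A, HasFDerivWithinAt (φ ∘ c.symm) (fderiv ℝ (φ ∘ c.symm) u) A u :=
      fun u hu ↦ ((contDiffAt_transition_real hcm hφ hu.1 hu.2).differentiableAt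
        (by simp)).hasFDerivAt.hasFDerivWithinAt
    have hinj : InjOn (φ ∘ c.symm) A := by
      intro u hu w hw huw
      exact c.symm.injOn hu.1 hw.1 (φ.injOn hu.2 hw.2 huw)
    have heq : ∀ u ∈ A, localIntegrand η p u =
        |(fderiv ℝ (φ ∘ c.symm) u).det| • G ((φ ∘ c.symm) u) := by
      intro u hu
      have h1 := topCoeff_transfer hcm hφ hu.1 hu.2 η
      simp only [localIntegrand, ← hc, hG, Function.comp_apply, φ.left_inv hu.2]
      rw [show chartRep c η u (realBasis d) = _ from h1, Complex.real_smul, Complex.real_smul]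
      simp only [Function.comp_def]
      ring
    have hzero : ∀ u ∈ c.target \ A, localIntegrand η p u = 0 := by
      intro u hu
      have : c.symm u ∉ φ.source := fun h ↦ hu.2 ⟨hu.1, h⟩
      have h1 : topCoeff c η u = 0 := topCoeff_eq_zero (h0 _ this)
      simp only [localIntegrand, ← hc]
      rw [show chartRep c η u (realBasis d) = _ from h1, mul_zero]
    have hB : IntegrableOn G (φ.target ∩ φ.symm ⁻¹' c.source) := hG1.mono_set inter_subset_left
    have hIA : IntegrableOn (localIntegrand η p) A := by
      rw [← transition_image, integrableOn_image_iff_integrableOn_abs_det_fderiv_smul volume hAm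
        hder hinj] at hB
      exact hB.congr_fun (fun u hu ↦ (heq u hu).symm) hAm
    refine ⟨hG1, hIA.of_forall_sdiff_eq_zero c.open_target.measurableSet hzero, ?_⟩
    rw [setIntegral_eq_of_subset_of_forall_sdiff_eq_zero c.open_target.measurableSet
      inter_subset_left hzero, setIntegral_congr_fun hAm heq,
      ← integral_image_eq_integral_abs_det_fderiv_smul volume hAm hder hinj, transition_image,
      ← setIntegral_eq_of_subset_of_forall_sdiff_eq_zero φ.open_target.measurableSet
      inter_subset_left]
    intro u hu
    have : φ.symm u ∉ c.source := fun h ↦ hu.2 ⟨hu.1, h⟩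
    have h1 : chartPartition d X p (φ.symm u) = 0 :=
      image_eq_zero_of_notMem_tsupport fun h ↦ this (tsupport_chartPartition_subset p h)
    simp [hG, h1]
  refine ⟨fun p ↦ (key p).2.1, ?_⟩
  set T := (finite_support_chartPartition (d := d) (X := X)).toFinset with hT
  have hT' : ∀ p ∉ T, ∀ y, chartPartition d X p y = 0 := by
    intro p hp y
    by_contra h
    exact hp ((Set.Finite.mem_toFinset _).2 ⟨y, h⟩)
  rw [formIntegral, finsum_congr fun p ↦ (key p).2.2, finsum_eq_sum_of_support_subset (s := T),
    ← integral_finsetSum _ fun p _ ↦ (key p).1]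
  · refine integral_congr_ae (Eventually.of_forall fun u ↦ ?_)
    simp only
    rw [← Finset.sum_mul, ← Complex.ofReal_sum, ← finsum_eq_sum_of_support_subset,
      (chartPartition d X).sum_eq_one (mem_univ _), Complex.ofReal_one, one_mul]
    intro p hp
    by_contra h
    exact hp (hT' p h _)
  · intro p hp
    by_contra h
    exact hp (by simp [hT' p h])

/-- The values of a form on a set which locally lies in the union of the coordinate hyperplanes,
and hence is a null set, do not affect its integral. -/
theorem formIntegral_congr {N : Set X}
    (hN : ∀ x, ∃ φ ∈ IsManifold.maximalAtlas 𝓘(ℂ, Fin d → ℂ) ω X, x ∈ φ.source ∧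
      ∀ y ∈ φ.source, y ∈ N → ∃ j, φ y j = 0)
    {η η' : DForm d (2 * d) X} (h : ∀ y ∉ N, η y = η' y) (hη : FormIntegrable η) :
    FormIntegrable η' ∧ formIntegral η = formIntegral η' := by
  have key : ∀ p : X, localIntegrand η p =ᵐ[volume.restrict (chartAt (Fin d → ℂ) p).target]
      localIntegrand η' p := by
    intro p
    have h0 := volume_hyperplanes_eq_zero hN (IsManifold.chart_mem_maximalAtlas p)
    rw [Filter.EventuallyEq, ae_restrict_iff' (chartAt _ p).open_target.measurableSet, ae_iff]
    refine measure_mono_null (fun u hu ↦ ?_) h0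
    simp only [mem_ofPred_eq, Classical.not_imp] at hu
    refine ⟨hu.1, ?_⟩
    by_contra h1
    refine hu.2 ?_
    have := topCoeff_congr (h _ h1)
    simp only [localIntegrand]
    rw [show chartRep (chartAt (Fin d → ℂ) p) η u (realBasis d) = _ from this]
    rfl
  exact ⟨fun p ↦ (hη p).congr (key p), finsum_congr fun p ↦ integral_congr_ae (key p)⟩

theorem finite_support_integral_localIntegrand (η : DForm d (2 * d) X) :
    (Function.support fun p ↦
      ∫ u in (chartAt (Fin d → ℂ) p).target, localIntegrand η p u).Finite := by
  refine (finite_support_chartPartition (d := d) (X := X)).subset fun p hp ↦ ?_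
  by_contra h
  refine hp ?_
  have h1 : ∀ y, chartPartition d X p y = 0 := by
    intro y
    by_contra h'
    exact h ⟨y, h'⟩
  simp [localIntegrand, h1]

theorem formIntegral_add {η η' : DForm d (2 * d) X} (hη : FormIntegrable η)
    (hη' : FormIntegrable η') : FormIntegrable (fun x ↦ η x + η' x) ∧
      formIntegral (fun x ↦ η x + η' x) = formIntegral η + formIntegral η' := by
  have h : ∀ p, localIntegrand (fun x ↦ η x + η' x) p =
      fun u ↦ localIntegrand η p u + localIntegrand η' p u := by
    intro p
    funext u
    exact mul_add _ _ _
  constructor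
  · intro p
    rw [h]
    exact (hη p).add (hη' p)
  · simp only [formIntegral, h]
    rw [← finsum_add_distrib (finite_support_integral_localIntegrand η)
      (finite_support_integral_localIntegrand η')]
    exact finsum_congr fun p ↦ integral_add (hη p) (hη' p)

theorem formIntegral_zero : FormIntegrable (fun _ ↦ 0 : DForm d (2 * d) X) ∧
    formIntegral (fun _ ↦ 0 : DForm d (2 * d) X) = 0 := by
  have h : ∀ p : X, localIntegrand (fun _ ↦ 0 : DForm d (2 * d) X) p = fun _ ↦ 0 := by
    intro p
    funext u
    exact mul_zero _
  constructor
  · intro p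
    rw [h]
    exact integrableOn_zero
  · simp [formIntegral, h]

end ChartIntegral

/-! ### Weighted integrals of forms -/

section WeightedIntegrals

variable {d : ℕ} {X : Type*} [TopologicalSpace X] [ChartedSpace (Fin d → ℂ) X]
  {φ : OpenPartialHomeomorph X (Fin d → ℂ)}

/-- The form `W^{2λ} η`. -/
noncomputable def weighted (W : X → ℝ) (η : DForm d (2 * d) X) (lam : ℂ) : DForm d (2 * d) X :=
  fun x ↦ ((W x : ℂ) ^ (2 * lam)) • η x

theorem log_prod_pow_mul_exp {I : Fin d → ℕ} {u : Fin d → ℂ} (hu : ∀ j, u j ≠ 0) (v : ℝ) :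
    Real.log ((∏ j, ‖u j‖ ^ I j) * Real.exp v) = ∑ j, I j * Real.log ‖u j‖ + v := by
  have h1 : ∀ j, ‖u j‖ ^ I j ≠ 0 := fun j ↦ pow_ne_zero _ (norm_ne_zero_iff.2 (hu j))
  rw [Real.log_mul (Finset.prod_ne_zero_iff.2 fun j _ ↦ h1 j) (Real.exp_pos v).ne', Real.log_exp,
    Real.log_prod fun j _ ↦ h1 j]
  simp

/-- In coordinates, the weight `|s|^{2λ}` with `|s| = ∏ |u_j|^{I_j} e^v` and the monomial poles
make up the kernel `singKer` times `e^{2λv}`. -/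
theorem weight_cpow {I J K : Fin d → ℕ} {u : Fin d → ℂ} (hu : ∀ j, u j ≠ 0) (v : ℝ) (lam : ℂ) :
    ((((∏ j, ‖u j‖ ^ I j) * Real.exp v : ℝ) : ℂ) ^ (2 * lam)) *
      (∏ j, (u j ^ J j * starRingEnd ℂ (u j) ^ K j))⁻¹ =
    singKer I J K lam u * Complex.exp (lam * (2 * v)) := by
  have hpos : 0 < (∏ j, ‖u j‖ ^ I j) * Real.exp v :=
    mul_pos (Finset.prod_pos fun j _ ↦ pow_pos (norm_pos_iff.2 (hu j)) _) (Real.exp_pos v)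
  have h1 : ∀ j, ((‖u j‖ : ℝ) : ℂ) ^ (2 * (lam * I j)) =
      Complex.exp ((Real.log ‖u j‖ : ℝ) * (2 * (lam * I j))) := fun j ↦ by
    rw [Complex.cpow_def_of_ne_zero (by exact_mod_cast norm_ne_zero_iff.2 (hu j)),
      Complex.ofReal_log (norm_nonneg _)]
  rw [Complex.cpow_def_of_ne_zero (by exact_mod_cast hpos.ne'), ← Complex.ofReal_log hpos.le,
    log_prod_pow_mul_exp hu]
  simp only [singKer, coordKer, h1, div_eq_mul_inv, Finset.prod_mul_distrib, ← Complex.exp_sum,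
    Finset.prod_inv_distrib]
  rw [mul_right_comm, ← Complex.exp_add]
  congr 2
  push_cast
  rw [add_mul, Finset.sum_mul]
  congr 1
  · exact Finset.sum_congr rfl fun j _ ↦ by ring
  · ring

variable [IsManifold 𝓘(ℂ, Fin d → ℂ) ω X] [T2Space X] [CompactSpace X]

/-- In coordinates in which the weight is a monomial up to a unit, the weighted integral of a form
is one of the local integrals `singInt`. -/
theorem formIntegral_weighted_eq_singInt
    (hφ : φ ∈ IsManifold.maximalAtlas 𝓘(ℂ, Fin d → ℂ) ω X) {η : DForm d (2 * d) X}
    (h0 : ∀ y ∉ φ.source, η y = 0) {W : X → ℝ} {I J K : Fin d → ℕ}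
    (hI : ∀ i, J i + K i ≠ 0 → I i ≠ 0) {v : (Fin d → ℂ) → ℝ} (hv : Continuous v)
    {f : (Fin d → ℂ) → ℂ} (hf : IsTest f) (hf0 : ∀ u ∉ φ.target, f u = 0)
    (hW : ∀ u ∈ φ.target, f u ≠ 0 → W (φ.symm u) = (∏ j, ‖u j‖ ^ I j) * Real.exp (v u))
    (hη : ∀ u ∈ φ.target, (∀ j, u j ≠ 0) →
      topCoeff φ η u = (∏ j, (u j ^ J j * starRingEnd ℂ (u j) ^ K j))⁻¹ * f u)
    {lam : ℂ} (hlam : ∑ j, ((J j : ℝ) + K j) < lam.re) :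
    FormIntegrable (weighted W η lam) ∧ formIntegral (weighted W η lam) =
      singInt I J K (fun u ↦ 2 * (v u : ℂ)) f lam := by
  set G : (Fin d → ℂ) → ℂ :=
    fun u ↦ singKer I J K lam u * (Complex.exp (lam * (2 * (v u : ℂ))) * f u) with hG
  have hGint : Integrable G := by
    refine integrable_singInt (v := fun u ↦ 2 * (v u : ℂ)) (by fun_prop) hf.1.continuous hf.2
      fun j ↦ ?_
    have h1 : (J j : ℝ) + K j ≤ ∑ j, ((J j : ℝ) + K j) :=
      Finset.single_le_sum (f := fun j ↦ (J j : ℝ) + K j) (fun i _ ↦ by positivity)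
        (Finset.mem_univ j)
    have hpos : 0 < lam.re := lt_of_le_of_lt (Finset.sum_nonneg fun i _ ↦ by positivity) hlam
    by_cases hj : J j + K j = 0
    · have h2 : (J j : ℝ) + K j = 0 := by exact_mod_cast hj
      have : 0 ≤ lam.re * I j := by positivity
      linarith
    · have h2 : (1 : ℝ) ≤ I j := by exact_mod_cast Nat.one_le_iff_ne_zero.2 (hI j hj)
      nlinarith
  have hae : ∀ᵐ u, u ∈ φ.target → topCoeff φ (weighted W η lam) u = G u := by
    filter_upwards [ae_forall_coord_ne_zero d] with u hu hut
    have h1 : topCoeff φ (weighted W η lam) u =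
        ((W (φ.symm u) : ℂ) ^ (2 * lam)) * topCoeff φ η u :=
      topCoeff_smul (fun x ↦ (W x : ℂ) ^ (2 * lam)) η u
    rw [h1, hη u hut hu]
    by_cases hfu : f u = 0
    · simp [hG, hfu]
    · rw [hW u hut hfu, ← mul_assoc, weight_cpow hu, hG]
      ring
  have hcongr : topCoeff φ (weighted W η lam) =ᵐ[volume.restrict φ.target] G := by
    rwa [Filter.EventuallyEq, ae_restrict_iff' φ.open_target.measurableSet]
  have hw0 : ∀ y ∉ φ.source, weighted W η lam y = 0 := fun y hy ↦ by
    simp only [weighted, h0 y hy, smul_zero]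
  obtain ⟨h1, h2⟩ := formIntegral_eq_integral_chart hφ hw0
    (hGint.integrableOn.congr hcongr.symm)
  refine ⟨h1, h2.trans ?_⟩
  rw [integral_congr_ae hcongr]
  exact setIntegral_eq_integral_of_forall_compl_eq_zero fun u hu ↦ by simp [hG, hf0 u hu]

/-- The integral of `W^{2λ} η` converges absolutely for `Re λ` large and continues meromorphically
past the origin, with `λ^m ∫ W^{2λ} η → L` at the origin. -/
def FormLeading (W : X → ℝ) (η : DForm d (2 * d) X) (m : ℕ) (L : ℂ) : Prop :=
  (∃ R : ℝ, ∀ lam : ℂ, R < lam.re → FormIntegrable (weighted W η lam)) ∧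
    HasLeading (fun lam ↦ formIntegral (weighted W η lam)) m L

theorem FormLeading.add {W : X → ℝ} {η η' : DForm d (2 * d) X} {m : ℕ} {L L' : ℂ}
    (h : FormLeading W η m L) (h' : FormLeading W η' m L') :
    FormLeading W (fun x ↦ η x + η' x) m (L + L') := by
  obtain ⟨⟨R, hR⟩, hL⟩ := h
  obtain ⟨⟨R', hR'⟩, hL'⟩ := h'
  have h1 := fun (lam : ℂ) (hlam : max R R' < lam.re) ↦
    formIntegral_add (hR lam ((le_max_left _ _).trans_lt hlam))
      (hR' lam ((le_max_right _ _).trans_lt hlam))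
  have h2 : ∀ lam : ℂ, (fun x ↦ weighted W η lam x + weighted W η' lam x) =
      weighted W (fun x ↦ η x + η' x) lam := by
    intro lam
    funext x
    exact (smul_add _ _ _).symm
  simp only [h2] at h1
  exact ⟨⟨_, fun lam hlam ↦ (h1 lam hlam).1⟩,
    (hL.add hL').congr fun lam hlam ↦ (h1 lam hlam).2.symm⟩

theorem formLeading_zero (W : X → ℝ) (m : ℕ) :
    FormLeading W (fun _ ↦ 0 : DForm d (2 * d) X) m 0 := by
  have h : ∀ lam, weighted W (fun _ ↦ 0 : DForm d (2 * d) X) lam = fun _ ↦ 0 := fun lam ↦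
    funext fun x ↦ smul_zero _
  unfold FormLeading
  simp only [h, formIntegral_zero.2]
  exact ⟨⟨0, fun _ _ ↦ formIntegral_zero.1⟩, HasLeading.zero m⟩

theorem FormLeading.sum {β : Type*} (s : Finset β) {W : X → ℝ} {η : β → DForm d (2 * d) X} {m : ℕ}
    {L : β → ℂ} (h : ∀ b ∈ s, FormLeading W (η b) m (L b)) :
    FormLeading W (fun x ↦ ∑ b ∈ s, η b x) m (∑ b ∈ s, L b) := by
  classical
  induction s using Finset.induction_on with
  | empty => simpa using formLeading_zero W m
  | insert a s ha ih =>
    simp only [Finset.sum_insert ha]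
    exact (h a (Finset.mem_insert_self a s)).add
      (ih fun b hb ↦ h b (Finset.mem_insert_of_mem hb))

/-- The values of the form on a null set are irrelevant; see `formIntegral_congr`. -/
theorem FormLeading.congr {W : X → ℝ} {η η' : DForm d (2 * d) X} {m : ℕ} {L : ℂ} {N : Set X}
    (h : FormLeading W η m L)
    (hN : ∀ x, ∃ φ ∈ IsManifold.maximalAtlas 𝓘(ℂ, Fin d → ℂ) ω X, x ∈ φ.source ∧
      ∀ y ∈ φ.source, y ∈ N → ∃ j, φ y j = 0) (hη : ∀ y ∉ N, η y = η' y) :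
    FormLeading W η' m L := by
  obtain ⟨⟨R, hR⟩, hL⟩ := h
  have h1 := fun lam hlam ↦ formIntegral_congr hN (η := weighted W η lam)
    (η' := weighted W η' lam) (fun y hy ↦ by simp only [weighted, hη y hy]) (hR lam hlam)
  exact ⟨⟨R, fun lam hlam ↦ (h1 lam hlam).1⟩, hL.congr (R := R) fun lam hlam ↦ (h1 lam hlam).2⟩

theorem FormLeading.of_lt {W : X → ℝ} {η : DForm d (2 * d) X} {m k : ℕ} {L : ℂ}
    (h : FormLeading W η m L) (hk : m < k) : FormLeading W η k 0 :=
  ⟨h.1, h.2.of_lt hk⟩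

/-- The leading coefficient for a form supported in a single chart is that of the corresponding
singular integral in the coordinates. -/
theorem formLeading_of_hasLeading_singInt
    (hφ : φ ∈ IsManifold.maximalAtlas 𝓘(ℂ, Fin d → ℂ) ω X) {η : DForm d (2 * d) X}
    (h0 : ∀ y ∉ φ.source, η y = 0) {W : X → ℝ} {I J K : Fin d → ℕ}
    (hI : ∀ i, J i + K i ≠ 0 → I i ≠ 0) {v : (Fin d → ℂ) → ℝ} (hv : Continuous v)
    {f : (Fin d → ℂ) → ℂ} (hf : IsTest f) (hf0 : ∀ u ∉ φ.target, f u = 0)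
    (hW : ∀ u ∈ φ.target, f u ≠ 0 → W (φ.symm u) = (∏ j, ‖u j‖ ^ I j) * Real.exp (v u))
    (hη : ∀ u ∈ φ.target, (∀ j, u j ≠ 0) →
      topCoeff φ η u = (∏ j, (u j ^ J j * starRingEnd ℂ (u j) ^ K j))⁻¹ * f u)
    {m : ℕ} {L : ℂ} (h : HasLeading (singInt I J K (fun u ↦ 2 * (v u : ℂ)) f) m L) :
    FormLeading W η m L := by
  have h1 := fun (lam : ℂ) (hlam : ∑ j, ((J j : ℝ) + K j) < lam.re) ↦
    formIntegral_weighted_eq_singInt hφ h0 hI hv hf hf0 hW hη hlam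
  exact ⟨⟨_, fun lam hlam ↦ (h1 lam hlam).1⟩, h.congr fun lam hlam ↦ (h1 lam hlam).2.symm⟩

end WeightedIntegrals

/-! ### Localisation -/

section Localisation

/-- The function `χ g`, for a cutoff `χ` on the manifold and a function `g` of the coordinates,
extended by zero to the whole coordinate space. -/
noncomputable def chartExtend {d : ℕ} {X : Type*} [TopologicalSpace X]
    (φ : OpenPartialHomeomorph X (Fin d → ℂ)) (χ : X → ℝ) (g : (Fin d → ℂ) → ℂ) : (Fin d → ℂ) → ℂ :=
  φ.target.indicator fun u ↦ (χ (φ.symm u) : ℂ) * g u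

theorem chartExtend_of_mem {d : ℕ} {X : Type*} [TopologicalSpace X]
    {φ : OpenPartialHomeomorph X (Fin d → ℂ)} {χ : X → ℝ} {g : (Fin d → ℂ) → ℂ} {u : Fin d → ℂ}
    (hu : u ∈ φ.target) : chartExtend φ χ g u = (χ (φ.symm u) : ℂ) * g u :=
  indicator_of_mem hu _

theorem chartExtend_of_notMem {d : ℕ} {X : Type*} [TopologicalSpace X]
    {φ : OpenPartialHomeomorph X (Fin d → ℂ)} {χ : X → ℝ} {g : (Fin d → ℂ) → ℂ} {u : Fin d → ℂ}
    (hu : u ∉ φ.target) : chartExtend φ χ g u = 0 :=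
  indicator_of_notMem hu _

variable {d : ℕ} {X : Type*} [TopologicalSpace X] [ChartedSpace (Fin d → ℂ) X]
  {φ : OpenPartialHomeomorph X (Fin d → ℂ)}

theorem contDiffOn_comp_symm [IsManifold 𝓘(ℂ, Fin d → ℂ) ω X]
    (hφ : φ ∈ IsManifold.maximalAtlas 𝓘(ℂ, Fin d → ℂ) ω X)
    {χ : X → ℝ} (hχ : ContMDiff 𝓘(ℝ, Fin d → ℂ) 𝓘(ℝ, ℝ) ∞ χ) :
    ContDiffOn ℝ ∞ (fun u ↦ χ (φ.symm u)) φ.target := fun _ hu ↦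
  (contMDiffAt_iff_contDiffAt.1
    (hχ.contMDiffAt.comp _ (contMDiffAt_symm_real hφ hu))).contDiffWithinAt

theorem isTest_chartExtend [IsManifold 𝓘(ℂ, Fin d → ℂ) ω X] [CompactSpace X]
    (hφ : φ ∈ IsManifold.maximalAtlas 𝓘(ℂ, Fin d → ℂ) ω X)
    {χ : X → ℝ} (hχ : ContMDiff 𝓘(ℝ, Fin d → ℂ) 𝓘(ℝ, ℝ) ∞ χ) {U : Set X} (hU : IsOpen U)
    (hUφ : U ⊆ φ.source) (hχU : tsupport χ ⊆ U) {g : (Fin d → ℂ) → ℂ}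
    (hg : ContDiffOn ℝ ∞ g (φ.target ∩ φ.symm ⁻¹' U)) : IsTest (chartExtend φ χ g) := by
  set Q := φ '' tsupport χ with hQ
  have hQc : IsCompact Q := (isClosed_tsupport χ).isCompact.image_of_continuousOn
    (φ.continuousOn.mono (hχU.trans hUφ))
  have hQ0 : ∀ u ∉ Q, chartExtend φ χ g u = 0 := by
    intro u hu
    by_cases hut : u ∈ φ.target
    · rw [chartExtend_of_mem hut, image_eq_zero_of_notMem_tsupport (f := χ)]
      · simp
      · exact fun h ↦ hu ⟨_, h, φ.right_inv hut⟩
    · exact chartExtend_of_notMem hut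
  refine ⟨contDiff_iff_contDiffAt.2 fun u ↦ ?_, HasCompactSupport.intro hQc hQ0⟩
  by_cases hu : u ∈ Q
  · obtain ⟨y, hy, rfl⟩ := hu
    have hyφ := hUφ (hχU hy)
    have hopen : IsOpen (φ.target ∩ φ.symm ⁻¹' U) := φ.symm.isOpen_inter_preimage hU
    have hmem : φ y ∈ φ.target ∩ φ.symm ⁻¹' U :=
      ⟨φ.map_source hyφ, by simpa [φ.left_inv hyφ] using hχU hy⟩
    have h1 : ContDiffAt ℝ ∞ (fun u ↦ (χ (φ.symm u) : ℂ) * g u) (φ y) :=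
      (Complex.ofRealCLM.contDiff.contDiffAt.comp _ ((contDiffOn_comp_symm hφ hχ).contDiffAt
        (φ.open_target.mem_nhds hmem.1))).mul (hg.contDiffAt (hopen.mem_nhds hmem))
    refine h1.congr_of_eventuallyEq ?_
    filter_upwards [φ.open_target.mem_nhds hmem.1] with w hw using chartExtend_of_mem hw
  · refine (contDiffAt_const (c := (0 : ℂ))).congr_of_eventuallyEq ?_
    filter_upwards [hQc.isClosed.isOpen_compl.mem_nhds hu] with w hw using hQ0 w hw

/-- Germs of smooth functions extend to smooth functions. -/
theorem exists_contDiff_eventuallyEq {E F : Type*} [NormedAddCommGroup E] [NormedSpace ℝ E]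
    [FiniteDimensional ℝ E] [NormedAddCommGroup F] [NormedSpace ℝ F] {v : E → F} {W : Set E}
    {z : E} (hW : W ∈ 𝓝 z) (hv : ContDiffOn ℝ ∞ v W) :
    ∃ v' : E → F, ContDiff ℝ ∞ v' ∧ v' =ᶠ[𝓝 z] v := by
  obtain ⟨r, hr, hball⟩ := Metric.nhds_basis_closedBall.mem_iff.1 (interior_mem_nhds.2 hW)
  let b : ContDiffBump z := ⟨r / 2, r, by positivity, by linarith⟩
  refine ⟨fun x ↦ b x • v x, contDiff_iff_contDiffAt.2 fun x ↦ ?_, ?_⟩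
  · by_cases hx : x ∈ Metric.closedBall z r
    · exact b.contDiff.contDiffAt.smul (hv.contDiffAt (mem_interior_iff_mem_nhds.1 (hball hx)))
    · refine (contDiffAt_const (c := (0 : F))).congr_of_eventuallyEq ?_
      filter_upwards [Metric.isClosed_closedBall.isOpen_compl.mem_nhds hx] with y hy
      have : b y = 0 := image_eq_zero_of_notMem_tsupport (by rwa [b.tsupport_eq])
      simp [this]
  · filter_upwards [b.eventuallyEq_one] with x hx
    simp [hx]

/-- On a compact manifold every open cover indexed by the points has a finite smooth partition of
unity subordinate to it. -/
theorem exists_finite_smooth_partition [IsManifold 𝓘(ℂ, Fin d → ℂ) ω X] [T2Space X]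
    [CompactSpace X] (U : X → Set X) (hU : ∀ x, IsOpen (U x)) (hx : ∀ x, x ∈ U x) :
    ∃ (B : Finset X) (χ : X → X → ℝ), (∀ b, ContMDiff 𝓘(ℝ, Fin d → ℂ) 𝓘(ℝ, ℝ) ∞ (χ b)) ∧
      (∀ b, tsupport (χ b) ⊆ U b) ∧ ∀ y, ∑ b ∈ B, χ b y = 1 := by
  have := isManifold_real (d := d) X
  obtain ⟨f, hf⟩ := SmoothPartitionOfUnity.exists_isSubordinate 𝓘(ℝ, Fin d → ℂ)
    (isClosed_univ (X := X)) U hU fun x _ ↦ mem_iUnion.2 ⟨x, hx x⟩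
  have hfin : {p : X | (Function.support (f p)).Nonempty}.Finite :=
    f.locallyFinite.finite_nonempty_of_compact
  refine ⟨hfin.toFinset, fun b ↦ f b, fun b ↦ (f b).contMDiff, hf, fun y ↦ ?_⟩
  rw [← f.sum_eq_one (mem_univ y)]
  refine (finsum_eq_sum_of_support_subset _ fun p hp ↦ ?_).symm
  exact (Set.Finite.mem_toFinset _).2 ⟨y, hp⟩

end Localisation

/-! ### Germs of functions -/

theorem eventually_symm {d : ℕ} {X : Type*} [TopologicalSpace X]
    {φ : OpenPartialHomeomorph X (Fin d → ℂ)} {x : X} (hx : x ∈ φ.source) {Q : X → Prop}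
    (h : ∀ᶠ y in 𝓝 x, Q y) :
    ∀ᶠ z in 𝓝 (φ x), Q (φ.symm z) := by
  have := φ.continuousAt_symm (φ.map_source hx)
  rw [ContinuousAt, φ.left_inv hx] at this
  exact this.eventually h

theorem eventually_chart {d : ℕ} {X : Type*} [TopologicalSpace X]
    {φ : OpenPartialHomeomorph X (Fin d → ℂ)} {x : X} (hx : x ∈ φ.source) {Q : (Fin d → ℂ) → Prop}
    (h : ∀ᶠ z in 𝓝 (φ x), Q z) : ∀ᶠ y in 𝓝 x, Q (φ y) :=
  (φ.continuousAt hx).eventually h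

section Germs

variable {d : ℕ} {X : Type*} [TopologicalSpace X] [ChartedSpace (Fin d → ℂ) X]
  {φ φ' : OpenPartialHomeomorph X (Fin d → ℂ)} {x : X} {f g : X → ℂ}

/-- The function `f` is holomorphic near `x`. -/
def IsHolGerm (d : ℕ) {X : Type*} [TopologicalSpace X] [ChartedSpace (Fin d → ℂ) X] (x : X)
    (f : X → ℂ) : Prop :=
  ∀ᶠ y in 𝓝 x, MDifferentiableAt 𝓘(ℂ, Fin d → ℂ) 𝓘(ℂ, ℂ) f y

/-- The function `f` is smooth near `x`. -/
def IsSmoothGerm (d : ℕ) {X : Type*} [TopologicalSpace X] [ChartedSpace (Fin d → ℂ) X] (x : X)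
    (f : X → ℂ) : Prop :=
  ∀ᶠ y in 𝓝 x, ContMDiffAt 𝓘(ℝ, Fin d → ℂ) 𝓘(ℝ, ℂ) ∞ f y

theorem IsHolGerm.mul (hf : IsHolGerm d x f) (hg : IsHolGerm d x g) :
    IsHolGerm d x (fun y ↦ f y * g y) := by
  filter_upwards [hf, hg] with y h1 h2 using h1.mul h2

theorem isHolGerm_const (c : ℂ) : IsHolGerm d x (fun _ ↦ c) :=
  Eventually.of_forall fun _ ↦ mdifferentiableAt_const

theorem IsHolGerm.pow (hf : IsHolGerm d x f) (n : ℕ) : IsHolGerm d x (fun y ↦ f y ^ n) := by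
  induction n with
  | zero => simpa using isHolGerm_const 1
  | succ n ih => simpa only [pow_succ] using ih.mul hf

theorem IsHolGerm.prod {β : Type*} (s : Finset β) {F : β → X → ℂ}
    (hF : ∀ b ∈ s, IsHolGerm d x (F b)) : IsHolGerm d x (fun y ↦ ∏ b ∈ s, F b y) := by
  classical
  induction s using Finset.induction_on with
  | empty => simpa using isHolGerm_const 1
  | insert a s ha ih =>
    simp only [Finset.prod_insert ha]
    exact (hF a (Finset.mem_insert_self a s)).mul
      (ih fun b hb ↦ hF b (Finset.mem_insert_of_mem hb))

theorem IsSmoothGerm.congr (hf : IsSmoothGerm d x f) (h : ∀ᶠ y in 𝓝 x, f y = g y) :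
    IsSmoothGerm d x g := by
  filter_upwards [hf, h.eventually_nhds] with y h1 h2
  exact h1.congr_of_eventuallyEq (h2.mono fun _ h ↦ h.symm)

theorem IsSmoothGerm.mul (hf : IsSmoothGerm d x f) (hg : IsSmoothGerm d x g) :
    IsSmoothGerm d x (fun y ↦ f y * g y) := by
  filter_upwards [hf, hg] with y h1 h2
  exact (contDiff_mul (𝕜 := ℝ) (𝔸 := ℂ) (n := ∞)).contMDiff.contMDiffAt.comp y (h1.prodMk_space h2)

theorem IsSmoothGerm.conj (hf : IsSmoothGerm d x f) :
    IsSmoothGerm d x (fun y ↦ starRingEnd ℂ (f y)) := by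
  filter_upwards [hf] with y h1
  exact (Complex.conjCLE.contDiff (n := ∞)).contMDiff.contMDiffAt.comp y h1

theorem IsSmoothGerm.inv (hf : IsSmoothGerm d x f) (h0 : ∀ᶠ y in 𝓝 x, f y ≠ 0) :
    IsSmoothGerm d x (fun y ↦ (f y)⁻¹) := by
  filter_upwards [hf, h0] with y h1 h2
  exact ContMDiffAt.comp (I' := 𝓘(ℝ, ℂ)) y (contDiffAt_inv ℝ h2).contMDiffAt h1

theorem mdifferentiableAt_chart (hφ : φ ∈ IsManifold.maximalAtlas 𝓘(ℂ, Fin d → ℂ) ω X)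
    (hx : x ∈ φ.source) : MDifferentiableAt 𝓘(ℂ, Fin d → ℂ) 𝓘(ℂ, Fin d → ℂ) φ x :=
  (contMDiffAt_of_mem_maximalAtlas hφ hx).mdifferentiableAt (by simp)

theorem mdifferentiableAt_chart_symm (hφ : φ ∈ IsManifold.maximalAtlas 𝓘(ℂ, Fin d → ℂ) ω X)
    {z : Fin d → ℂ} (hz : z ∈ φ.target) :
    MDifferentiableAt 𝓘(ℂ, Fin d → ℂ) 𝓘(ℂ, Fin d → ℂ) φ.symm z :=
  (contMDiffAt_symm_of_mem_maximalAtlas hφ hz).mdifferentiableAt (by simp)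

/-- The derivative of a transition function is surjective, with the derivative of the inverse
transition function as a right inverse. -/
theorem fderiv_transition_comp (hφ : φ ∈ IsManifold.maximalAtlas 𝓘(ℂ, Fin d → ℂ) ω X)
    (hφ' : φ' ∈ IsManifold.maximalAtlas 𝓘(ℂ, Fin d → ℂ) ω X) (hx : x ∈ φ.source)
    (hx' : x ∈ φ'.source) (v : Fin d → ℂ) :
    fderiv ℂ (φ' ∘ φ.symm) (φ x) (fderiv ℂ (φ ∘ φ'.symm) (φ' x) v) = v := by
  have h1 := (contDiffAt_transition hφ hφ' (φ.map_source hx)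
    (by rwa [φ.left_inv hx])).differentiableAt (by simp)
  have h2 := (contDiffAt_transition hφ' hφ (φ'.map_source hx')
    (by rwa [φ'.left_inv hx'])).differentiableAt (by simp)
  have e : (φ ∘ φ'.symm) (φ' x) = φ x := by simp [φ'.left_inv hx']
  have h3 := (e ▸ h1.hasFDerivAt : HasFDerivAt (φ' ∘ φ.symm) _ ((φ ∘ φ'.symm) (φ' x))).comp
    (φ' x) h2.hasFDerivAt
  have h4 : (φ' ∘ φ.symm) ∘ (φ ∘ φ'.symm) =ᶠ[𝓝 (φ' x)] id := by
    filter_upwards [eventually_symm hx' (φ.open_source.mem_nhds hx),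
      φ'.open_target.mem_nhds (φ'.map_source hx')] with z h5 h6
    simp [φ.left_inv h5, φ'.right_inv h6]
  have h5 := h3.unique ((hasFDerivAt_id (φ' x)).congr_of_eventuallyEq h4)
  rw [e] at h5
  exact congrArg (fun T : (Fin d → ℂ) →L[ℂ] (Fin d → ℂ) ↦ T v) h5

theorem IsHolGerm.eventually_differentiableAt
    (hφ : φ ∈ IsManifold.maximalAtlas 𝓘(ℂ, Fin d → ℂ) ω X) (hx : x ∈ φ.source)
    (hf : IsHolGerm d x f) : ∀ᶠ z in 𝓝 (φ x), DifferentiableAt ℂ (fun z ↦ f (φ.symm z)) z := by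
  filter_upwards [eventually_symm hx hf, φ.open_target.mem_nhds (φ.map_source hx)] with z h1 h2
  exact mdifferentiableAt_iff_differentiableAt.1
    (h1.comp z (mdifferentiableAt_chart_symm hφ h2))

theorem isHolGerm_comp_chart (hφ : φ ∈ IsManifold.maximalAtlas 𝓘(ℂ, Fin d → ℂ) ω X)
    (hx : x ∈ φ.source) {u : (Fin d → ℂ) → ℂ} (hu : ∀ᶠ z in 𝓝 (φ x), DifferentiableAt ℂ u z) :
    IsHolGerm d x (fun y ↦ u (φ y)) := by
  filter_upwards [eventually_chart hx hu, φ.open_source.mem_nhds hx] with y h1 h2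
  exact h1.mdifferentiableAt.comp y (mdifferentiableAt_chart hφ h2)

theorem isHolGerm_coord (hφ : φ ∈ IsManifold.maximalAtlas 𝓘(ℂ, Fin d → ℂ) ω X)
    (hx : x ∈ φ.source) (j : Fin d) : IsHolGerm d x (fun y ↦ φ y j) :=
  isHolGerm_comp_chart hφ hx (u := fun z ↦ z j)
    (Eventually.of_forall fun z ↦ differentiableAt_apply j z)

variable [IsManifold 𝓘(ℂ, Fin d → ℂ) ω X]

theorem IsSmoothGerm.eventually_contDiffAt
    (hφ : φ ∈ IsManifold.maximalAtlas 𝓘(ℂ, Fin d → ℂ) ω X) (hx : x ∈ φ.source)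
    (hf : IsSmoothGerm d x f) : ∀ᶠ z in 𝓝 (φ x), ContDiffAt ℝ ∞ (fun z ↦ f (φ.symm z)) z := by
  filter_upwards [eventually_symm hx hf, φ.open_target.mem_nhds (φ.map_source hx)] with z h1 h2
  exact contMDiffAt_iff_contDiffAt.1 (h1.comp z (contMDiffAt_symm_real hφ h2))

theorem isSmoothGerm_comp_chart (hφ : φ ∈ IsManifold.maximalAtlas 𝓘(ℂ, Fin d → ℂ) ω X)
    (hx : x ∈ φ.source) {u : (Fin d → ℂ) → ℂ} (hu : ∀ᶠ z in 𝓝 (φ x), ContDiffAt ℝ ∞ u z) :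
    IsSmoothGerm d x (fun y ↦ u (φ y)) := by
  filter_upwards [eventually_chart hx hu, φ.open_source.mem_nhds hx] with y h1 h2
  exact ContMDiffAt.comp (I' := 𝓘(ℝ, Fin d → ℂ)) y h1.contMDiffAt (contMDiffAt_real hφ h2)

theorem IsHolGerm.isSmoothGerm (hf : IsHolGerm d x f) : IsSmoothGerm d x f := by
  have hc := IsManifold.chart_mem_maximalAtlas (I := 𝓘(ℂ, Fin d → ℂ)) (n := ω) x
  have hx := mem_chart_source (Fin d → ℂ) x
  have h1 := hf.eventually_differentiableAt hc hx
  obtain ⟨U, hU, hUo, hxU⟩ := eventually_nhds_iff.1 h1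
  have h2 : ContDiffOn ℝ ∞ (fun z ↦ f ((chartAt (Fin d → ℂ) x).symm z)) U :=
    (contDiffOn_infty_of_differentiableOn_pi hUo
      fun z hz ↦ (hU z hz).differentiableWithinAt).restrict_scalars ℝ
  refine (isSmoothGerm_comp_chart hc hx (u := fun z ↦ f ((chartAt (Fin d → ℂ) x).symm z))
    (eventually_of_mem (hUo.mem_nhds hxU) fun z hz ↦ h2.contDiffAt (hUo.mem_nhds hz))).congr ?_
  filter_upwards [(chartAt (Fin d → ℂ) x).open_source.mem_nhds hx] with y hy
  rw [(chartAt (Fin d → ℂ) x).left_inv hy]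

theorem isSmoothGerm_monomial (hφ : φ ∈ IsManifold.maximalAtlas 𝓘(ℂ, Fin d → ℂ) ω X)
    (hx : x ∈ φ.source) (s : Finset (Fin d)) (J K : Fin d → ℕ) :
    IsSmoothGerm d x fun y ↦ ∏ j ∈ s, (φ y j ^ J j * starRingEnd ℂ (φ y j) ^ K j) := by
  have h1 := (IsHolGerm.prod s fun j _ ↦ (isHolGerm_coord hφ hx j).pow (J j)).isSmoothGerm
  have h2 := (IsHolGerm.prod s fun j _ ↦ (isHolGerm_coord hφ hx j).pow (K j)).isSmoothGerm.conj
  refine (h1.mul h2).congr (Eventually.of_forall fun y ↦ ?_)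
  simp [Finset.prod_mul_distrib]

/-- Products of smooth forms and smooth functions are smooth. -/
theorem SmoothFormOn.smul {k : ℕ} {β : DForm d k X} {U : Set X} (hβ : SmoothFormOn β U)
    (hf : ∀ y ∈ U, ContMDiffAt 𝓘(ℝ, Fin d → ℂ) 𝓘(ℝ, ℂ) ∞ f y) :
    SmoothFormOn (fun y ↦ f y • β y) U := by
  intro y hy v
  have h1 : ContDiffAt ℝ ∞ (fun z ↦ f ((chartAt (Fin d → ℂ) y).symm z))
      (chartAt (Fin d → ℂ) y y) := by
    have h2 := contMDiffAt_symm_real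
      (IsManifold.chart_mem_maximalAtlas (I := 𝓘(ℂ, Fin d → ℂ)) (n := ω) y)
      ((chartAt (Fin d → ℂ) y).map_source (mem_chart_source _ y))
    refine contMDiffAt_iff_contDiffAt.1 (ContMDiffAt.comp _ ?_ h2)
    rw [(chartAt (Fin d → ℂ) y).left_inv (mem_chart_source _ y)]
    exact hf y hy
  exact h1.mul (hβ y hy v)

end Germs

/-! ### Local equations of a hypersurface with normal crossings -/

section NormalCrossings

variable {d k : ℕ} {X : Type*} [TopologicalSpace X] [ChartedSpace (Fin d → ℂ) X]
  {φ φ' : OpenPartialHomeomorph X (Fin d → ℂ)} {x : X} {D : Set X} {S S' : Finset (Fin d)}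

/-- A holomorphic function with zeros only on `D` is a monomial up to a unit. -/
theorem IsNCChart.exists_monomial_factor (hφ : IsNCChart D x φ S) {f : X → ℂ}
    (hf : IsHolGerm d x f) (hf0 : ∀ᶠ y in 𝓝 x, f y = 0 → y ∈ D) :
    ∃ (A : Fin d → ℕ) (u : X → ℂ), (∀ j ∉ S, A j = 0) ∧ IsHolGerm d x u ∧
      (∀ᶠ y in 𝓝 x, u y ≠ 0) ∧ ∀ᶠ y in 𝓝 x, f y = (∏ j, φ y j ^ A j) * u y := by
  obtain ⟨ha, hx, h0, hD⟩ := hφ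
  have h1 : ∀ᶠ z in 𝓝 (φ x), f (φ.symm z) = 0 → ∃ j ∈ S, z j = 0 := by
    filter_upwards [eventually_symm hx hf0, φ.open_target.mem_nhds (φ.map_source hx)]
      with z h2 h3 h4
    have := (hD _ (φ.map_target h3)).1 (h2 h4)
    rwa [φ.right_inv h3] at this
  obtain ⟨A, u, hA, hu, hfu⟩ := _root_.exists_monomial_factor (S := S) (z₀ := φ x)
    (fun j _ ↦ by rw [h0]; rfl) (hf.eventually_differentiableAt ha hx) h1
  refine ⟨A, fun y ↦ u (φ y), hA, isHolGerm_comp_chart ha hx (hu.mono fun _ h ↦ h.1),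
    eventually_chart hx (hu.mono fun _ h ↦ h.2), ?_⟩
  filter_upwards [eventually_chart hx hfu, φ.open_source.mem_nhds hx] with y h2 h3
  rwa [φ.left_inv h3] at h2

/-- The local equations of the branches of `D` in two charts agree up to units and up to a
permutation: a coordinate `φ'_k` with zeros in `D` is a monomial in the coordinates of `φ` times a
unit, and it has a non-zero differential. -/
theorem IsNCChart.exists_matching (hφ : IsNCChart D x φ S) (hφ' : IsNCChart D x φ' S') :
    ∃ σ : Fin d → Fin d, (∀ k ∈ S', σ k ∈ S) ∧ InjOn σ S' ∧ ∀ k ∈ S', ∃ u : X → ℂ,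
      IsHolGerm d x u ∧ (∀ᶠ y in 𝓝 x, u y ≠ 0) ∧ ∀ᶠ y in 𝓝 x, φ' y k = φ y (σ k) * u y := by
  classical
  have hx := hφ.2.1
  have hx' := hφ'.2.1
  set T := fderiv ℂ (φ' ∘ φ.symm) (φ x) with hT
  have hTd : HasFDerivAt (φ' ∘ φ.symm) T (φ x) :=
    ((contDiffAt_transition hφ.1 hφ'.1 (φ.map_source hx)
      (by rwa [φ.left_inv hx])).differentiableAt (by simp)).hasFDerivAt
  have hTs : ∀ w, ∃ v, T v = w := fun w ↦ ⟨_, fderiv_transition_comp hφ.1 hφ'.1 hx hx' w⟩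
  have key : ∀ k ∈ S', ∃ (j : Fin d) (u : X → ℂ), j ∈ S ∧ IsHolGerm d x u ∧
      (∀ᶠ y in 𝓝 x, u y ≠ 0) ∧ (∀ᶠ y in 𝓝 x, φ' y k = φ y j * u y) ∧
      ∀ v, T v k = v j * u x := by
    intro k hk
    obtain ⟨A, u, hA, hu, hu0, hfu⟩ := hφ.exists_monomial_factor
      (isHolGerm_coord hφ'.1 hx' k) (by
        filter_upwards [φ'.open_source.mem_nhds hx'] with y hy h0
        exact (hφ'.2.2.2 y hy).2 ⟨k, hk, h0⟩)
    have hprod : ∏ j, φ x j ^ A j = 0 := by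
      have h1 := hfu.self_of_nhds
      rw [hφ'.2.2.1] at h1
      exact (mul_eq_zero.1 h1.symm).resolve_right hu0.self_of_nhds
    obtain ⟨j, -, hj⟩ := Finset.prod_eq_zero_iff.1 hprod
    have hAj : A j ≠ 0 := fun h ↦ by simp [h] at hj
    set w : X → ℂ := fun y ↦ (∏ i, φ y i ^ (Function.update A j (A j - 1)) i) * u y with hw
    have hwh : IsHolGerm d x w := (IsHolGerm.prod Finset.univ fun i _ ↦
      (isHolGerm_coord hφ.1 hx i).pow (Function.update A j (A j - 1) i)).mul hu
    have hfw : ∀ᶠ y in 𝓝 x, φ' y k = φ y j * w y := by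
      filter_upwards [hfu] with y hy
      rw [hy, hw]
      simp only
      rw [← Finset.mul_prod_erase _ _ (Finset.mem_univ j),
        ← Finset.mul_prod_erase (a := j) _ (fun i ↦ φ y i ^ (Function.update A j (A j - 1)) i)
          (Finset.mem_univ j), Function.update_self]
      have : ∏ i ∈ Finset.univ.erase j, φ y i ^ (Function.update A j (A j - 1)) i =
          ∏ i ∈ Finset.univ.erase j, φ y i ^ A i :=
        Finset.prod_congr rfl fun i hi ↦ by rw [Function.update_of_ne (Finset.ne_of_mem_erase hi)]
      rw [this, ← mul_assoc, ← mul_assoc, ← pow_succ',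
        Nat.sub_add_cancel (Nat.one_le_iff_ne_zero.2 hAj)]
    have hder : ∀ v, T v k = v j * w x := by
      have h1 : HasFDerivAt (fun z ↦ (φ' ∘ φ.symm) z k)
          ((ContinuousLinearMap.proj (R := ℂ) (φ := fun _ : Fin d ↦ ℂ) k).comp T) (φ x) :=
        (ContinuousLinearMap.proj (R := ℂ) (φ := fun _ : Fin d ↦ ℂ) k).hasFDerivAt.comp _ hTd
      have h2 := (hasFDerivAt_apply (𝕜 := ℂ) j (φ x)).mul
        (hwh.eventually_differentiableAt hφ.1 hx).self_of_nhds.hasFDerivAt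
      have h3 : (fun z ↦ (φ' ∘ φ.symm) z k) =ᶠ[𝓝 (φ x)]
          (fun z ↦ z j) * fun z ↦ w (φ.symm z) := by
        filter_upwards [eventually_symm hx hfw, φ.open_target.mem_nhds (φ.map_source hx)]
          with z h4 h5
        simp only [Function.comp_apply, Pi.mul_apply]
        rw [h4, φ.right_inv h5]
      have h4 := h1.unique (h2.congr_of_eventuallyEq h3)
      intro v
      have h5 := congrArg (fun T : (Fin d → ℂ) →L[ℂ] ℂ ↦ T v) h4
      simp only [ContinuousLinearMap.comp_apply, ContinuousLinearMap.proj_apply, hφ.2.2.1,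
        Pi.zero_apply, add_apply, smul_apply, smul_eq_mul] at h5
      rw [h5]
      have h6 : φ.symm 0 = x := by rw [← hφ.2.2.1, φ.left_inv hx]
      simp [h6, mul_comm]
    have hwx : w x ≠ 0 := by
      intro h0
      obtain ⟨v, hv⟩ := hTs (Pi.single k 1)
      have := hder v
      rw [hv, h0] at this
      simp at this
    have hwc : ∀ᶠ y in 𝓝 x, w y ≠ 0 :=
      hwh.self_of_nhds.continuousAt.eventually_ne hwx
    exact ⟨j, w, by_contra fun h ↦ hAj (hA j h), hwh, hwc, hfw, hder⟩
  choose! σ u hσ hu hu0 hfu hder using key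
  refine ⟨σ, hσ, ?_, fun k hk ↦ ⟨u k, hu k hk, hu0 k hk, hfu k hk⟩⟩
  intro k hk k' hk' hkk
  by_contra hne
  obtain ⟨v, hv⟩ := hTs (Pi.single k 1)
  have h1 := hder k hk v
  have h2 := hder k' hk' v
  rw [hv] at h1 h2
  rw [Pi.single_eq_of_ne (Ne.symm hne)] at h2
  rw [Pi.single_eq_same, hkk, (mul_eq_zero.1 h2.symm).resolve_right
    (hu0 k' hk').self_of_nhds] at h1
  simp at h1

/-- The number of local branches through a point does not depend on the chart. -/
theorem IsNCChart.card_eq (hφ : IsNCChart D x φ S) (hφ' : IsNCChart D x φ' S') :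
    S.card = S'.card := by
  obtain ⟨σ, h1, h2, -⟩ := hφ.exists_matching hφ'
  obtain ⟨σ', h1', h2', -⟩ := hφ'.exists_matching hφ
  exact le_antisymm (Finset.card_le_card_of_injOn σ' h1' h2')
    (Finset.card_le_card_of_injOn σ h1 h2)

theorem IsNCChart.branchCount_eq (hφ : IsNCChart D x φ S) : branchCount d D x = S.card := by
  have hne : {m | ∃ (φ : OpenPartialHomeomorph X (Fin d → ℂ)) (S : Finset (Fin d)),
      IsNCChart D x φ S ∧ m = S.card}.Nonempty := ⟨_, φ, S, hφ, rfl⟩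
  obtain ⟨φ', S', h', he⟩ := Nat.sInf_mem hne
  exact he.trans (h'.card_eq hφ)

end NormalCrossings

/-! ### Pole orders in adapted charts -/

section Adapted

variable {d k : ℕ} {X : Type*} [TopologicalSpace X] [ChartedSpace (Fin d → ℂ) X]
  {φ φ' : OpenPartialHomeomorph X (Fin d → ℂ)} {x : X} {D : Set X} {S S' : Finset (Fin d)}

theorem IsHolGerm.inv {f : X → ℂ} (hf : IsHolGerm d x f) (h0 : ∀ᶠ y in 𝓝 x, f y ≠ 0) :
    IsHolGerm d x (fun y ↦ (f y)⁻¹) := by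
  filter_upwards [hf, h0] with y h1 h2
  exact (differentiableAt_inv h2).mdifferentiableAt.comp y h1

theorem IsSmoothGerm.pow {f : X → ℂ} (hf : IsSmoothGerm d x f) (n : ℕ) :
    IsSmoothGerm d x (fun y ↦ f y ^ n) := by
  induction n with
  | zero => exact Eventually.of_forall fun y ↦ by simpa using contMDiffAt_const
  | succ n ih => simpa only [pow_succ] using ih.mul hf

theorem IsSmoothGerm.prod {β : Type*} (s : Finset β) {F : β → X → ℂ}
    (hF : ∀ b ∈ s, IsSmoothGerm d x (F b)) : IsSmoothGerm d x (fun y ↦ ∏ b ∈ s, F b y) := by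
  classical
  induction s using Finset.induction_on with
  | empty => exact Eventually.of_forall fun y ↦ by simpa using contMDiffAt_const
  | insert a s ha ih =>
    simp only [Finset.prod_insert ha]
    exact (hF a (Finset.mem_insert_self a s)).mul
      (ih fun b hb ↦ hF b (Finset.mem_insert_of_mem hb))

theorem eventually_prod_ne_zero {β : Type*} (s : Finset β) {F : β → X → ℂ}
    (hF : ∀ b ∈ s, ∀ᶠ y in 𝓝 x, F b y ≠ 0) : ∀ᶠ y in 𝓝 x, ∏ b ∈ s, F b y ≠ 0 := by
  filter_upwards [(s.eventually_all).2 hF] with y hy using Finset.prod_ne_zero_iff.2 hy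

/-- `φ` is a holomorphic chart, not necessarily centred, in which `D` is `∏_{j ∈ S} z_j = 0`. -/
def IsAdapted (D : Set X) (φ : OpenPartialHomeomorph X (Fin d → ℂ)) (S : Finset (Fin d)) : Prop :=
  φ ∈ IsManifold.maximalAtlas 𝓘(ℂ, Fin d → ℂ) ω X ∧ ∀ y ∈ φ.source, y ∈ D ↔ ∃ j ∈ S, φ y j = 0

theorem IsNCChart.isAdapted (h : IsNCChart D x φ S) : IsAdapted D φ S := ⟨h.1, h.2.2.2⟩

/-- The function `p` is a denominator of the form `α` at `x`: the form `p α` extends smoothly across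
`D` near `x`. -/
def IsDenominator (D : Set X) (α : DForm d k X) (x : X) (p : X → ℂ) : Prop :=
  ∃ U : Set X, IsOpen U ∧ x ∈ U ∧ ∃ β : DForm d k X, SmoothFormOn β U ∧
    ∀ y ∈ U, y ∉ D → β y = p y • α y

theorem IsDenominator.eventually {α : DForm d k X} {p : X → ℂ} (h : IsDenominator D α x p) :
    ∀ᶠ y in 𝓝 x, IsDenominator D α y p := by
  obtain ⟨U, hU, hx, h⟩ := h
  exact eventually_of_mem (hU.mem_nhds hx) fun y hy ↦ ⟨U, hU, hy, h⟩

theorem PoleBound.isDenominator {α : DForm d k X} {J K : Fin d → ℕ}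
    (h : PoleBound D α x φ S J K) :
    IsDenominator D α x (fun y ↦ ∏ j, (φ y j ^ J j * starRingEnd ℂ (φ y j) ^ K j)) := by
  obtain ⟨-, U, hU, hx, -, h⟩ := h
  exact ⟨U, hU, hx, h⟩

theorem IsDenominator.poleBound {α : DForm d k X} {J K : Fin d → ℕ} (hx : x ∈ φ.source)
    (hJK : ∀ j ∉ S, J j = 0 ∧ K j = 0)
    (h : IsDenominator D α x (fun y ↦ ∏ j, (φ y j ^ J j * starRingEnd ℂ (φ y j) ^ K j))) :
    PoleBound D α x φ S J K := by
  obtain ⟨U, hU, hxU, β, hβ, h⟩ := h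
  exact ⟨hJK, U ∩ φ.source, hU.inter φ.open_source, ⟨hxU, hx⟩, inter_subset_right, β,
    hβ.mono inter_subset_left, fun y hy ↦ h y hy.1⟩

theorem card_commonPoles_le {J K : Fin d → ℕ} : (commonPoles J K).card ≤ d := by
  simpa using Finset.card_le_univ (commonPoles J K)

theorem kappaAt_le_of_poleBound {α : DForm d k X} {J K : Fin d → ℕ} (hφ : IsNCChart D x φ S)
    (h : PoleBound D α x φ S J K) : kappaAt D α x ≤ (commonPoles J K).card :=
  Nat.sInf_le ⟨φ, S, J, K, hφ, h, rfl⟩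

theorem kappaAt_le (α : DForm d k X) : kappaAt D α x ≤ d := by
  rw [kappaAt]
  rcases eq_empty_or_nonempty {m | ∃ (φ : OpenPartialHomeomorph X (Fin d → ℂ))
    (S : Finset (Fin d)) (J K : Fin d → ℕ),
    IsNCChart D x φ S ∧ PoleBound D α x φ S J K ∧ m = (commonPoles J K).card} with h | h
  · rw [h, Nat.sInf_empty]; exact Nat.zero_le _
  · obtain ⟨φ, S, J, K, -, -, he⟩ := Nat.sInf_mem h
    exact he.le.trans card_commonPoles_le

theorem kappaAt_le_kappa (α : DForm d k X) (x : X) : kappaAt D α x ≤ kappa D α :=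
  le_ciSup (f := fun x ↦ kappaAt D α x) ⟨d, by rintro _ ⟨y, rfl⟩; exact kappaAt_le α⟩ x

variable [IsManifold 𝓘(ℂ, Fin d → ℂ) ω X]

/-- Smooth multiples of denominators are denominators. -/
theorem IsDenominator.of_eq_mul {α : DForm d k X} {p q w : X → ℂ} (h : IsDenominator D α x p)
    (hw : IsSmoothGerm d x w) (hq : ∀ᶠ y in 𝓝 x, y ∉ D → q y = w y * p y) :
    IsDenominator D α x q := by
  obtain ⟨U, hU, hxU, β, hβ, h⟩ := h
  obtain ⟨U', hU', hU'o, hxU'⟩ := eventually_nhds_iff.1 (hw.and hq)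
  refine ⟨U ∩ U', hU.inter hU'o, ⟨hxU, hxU'⟩, fun y ↦ w y • β y,
    (hβ.mono inter_subset_left).smul fun y hy ↦ (hU' y hy.2).1, fun y hy hyD ↦ ?_⟩
  simp only [h y hy.1 hyD, (hU' y hy.2).2 hyD, mul_smul]

/-- Adapted charts can be centred at any point, where the branches of `D` are given by the
coordinates that vanish there. -/
theorem IsAdapted.exists_centred (h : IsAdapted D φ S) (hx : x ∈ φ.source) :
    ∃ φ' : OpenPartialHomeomorph X (Fin d → ℂ), IsNCChart D x φ' (S.filter fun j ↦ φ x j = 0) ∧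
      ∀ y, φ' y = φ y - φ x := by
  obtain ⟨hφ, hD⟩ := h
  let O : Set X := φ.source ∩ φ ⁻¹' {z | ∀ j ∈ S, φ x j ≠ 0 → z j ≠ 0}
  have hO : IsOpen O := by
    refine φ.isOpen_inter_preimage ?_
    simp only [ofPred_forall]
    exact isOpen_biInter_finset fun j _ ↦ isOpen_iInter_of_finite fun _ ↦
      isOpen_ne_fun (continuous_apply j) continuous_const
  let φ' := (φ.restrOpen O hO).transHomeomorph (Homeomorph.addRight (-(φ x)))
  have hsrc : φ'.source = φ.source ∩ O := by simp [φ']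
  have happ : ∀ y, φ' y = φ y - φ x := fun y ↦ by simp [φ', sub_eq_add_neg]
  have hsymm : ∀ z, φ'.symm z = φ.symm (z + φ x) := fun z ↦ by
    change φ.symm (z + - -(φ x)) = _
    rw [neg_neg]
  have htgt : ∀ z ∈ φ'.target, z + φ x ∈ φ.target := by
    intro z hz
    have h1 := φ'.map_target hz
    have h2 := φ'.right_inv hz
    rw [hsrc] at h1
    rw [happ] at h2
    rw [← h2, sub_add_cancel]
    exact φ.map_source h1.1
  refine ⟨φ', ⟨?_, ?_, ?_, ?_⟩, happ⟩
  · refine OpenPartialHomeomorph.mem_maximalAtlas_of_contMDiffOn φ' (fun y hy ↦ ?_) fun z hz ↦ ?_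
    · have h1 : ContMDiffAt 𝓘(ℂ, Fin d → ℂ) 𝓘(ℂ, Fin d → ℂ) ω (fun y ↦ φ y - φ x) y :=
        ContMDiffAt.comp (I' := 𝓘(ℂ, Fin d → ℂ)) (g := fun z ↦ z - φ x) y
          (contDiff_id.sub contDiff_const).contMDiff.contMDiffAt
          (contMDiffAt_of_mem_maximalAtlas hφ (by rw [hsrc] at hy; exact hy.1))
      exact (h1.congr_of_eventuallyEq (Eventually.of_forall happ)).contMDiffWithinAt
    · have h1 : ContMDiffAt 𝓘(ℂ, Fin d → ℂ) 𝓘(ℂ, Fin d → ℂ) ω (fun z ↦ φ.symm (z + φ x)) z :=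
        ContMDiffAt.comp (I' := 𝓘(ℂ, Fin d → ℂ)) z
          (contMDiffAt_symm_of_mem_maximalAtlas hφ (htgt z hz))
          (contDiff_id.add contDiff_const).contMDiff.contMDiffAt
      exact (h1.congr_of_eventuallyEq (Eventually.of_forall hsymm)).contMDiffWithinAt
  · rw [hsrc]
    exact ⟨hx, hx, fun j _ h ↦ h⟩
  · rw [happ, sub_self]
  · intro y hy
    rw [hsrc] at hy
    rw [hD y hy.1]
    constructor
    · rintro ⟨j, hj, hy0⟩
      have hxj : φ x j = 0 := by_contra fun h ↦ hy.2.2 j hj h hy0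
      exact ⟨j, Finset.mem_filter.2 ⟨hj, hxj⟩, by rw [happ, Pi.sub_apply, hy0, hxj, sub_zero]⟩
    · rintro ⟨j, hj, hy0⟩
      rw [Finset.mem_filter] at hj
      exact ⟨j, hj.1, by rwa [happ, Pi.sub_apply, hj.2, sub_zero] at hy0⟩

/-- A monomial in the coordinates that vanish at a point is not affected by centring the chart
there. -/
theorem prod_coord_sub {J K : Fin d → ℕ} {z c : Fin d → ℂ}
    (h : ∀ j, c j ≠ 0 → J j = 0 ∧ K j = 0) :
    ∏ j, ((z - c) j ^ J j * starRingEnd ℂ ((z - c) j) ^ K j) =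
      ∏ j, (z j ^ J j * starRingEnd ℂ (z j) ^ K j) := by
  refine Finset.prod_congr rfl fun j _ ↦ ?_
  by_cases hj : c j = 0
  · simp [hj]
  · simp [h j hj]

theorem IsAdapted.kappaAt_le {α : DForm d k X} {J K : Fin d → ℕ} (h : IsAdapted D φ S)
    (hx : x ∈ φ.source) (hJK : ∀ j ∉ S.filter (fun j ↦ φ x j = 0), J j = 0 ∧ K j = 0)
    (hp : IsDenominator D α x (fun y ↦ ∏ j, (φ y j ^ J j * starRingEnd ℂ (φ y j) ^ K j))) :
    kappaAt D α x ≤ (commonPoles J K).card := by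
  obtain ⟨φ', hφ', happ⟩ := h.exists_centred hx
  refine kappaAt_le_of_poleBound hφ' (IsDenominator.poleBound hφ'.2.1 hJK ?_)
  have he : (fun y ↦ ∏ j, (φ' y j ^ J j * starRingEnd ℂ (φ' y j) ^ K j)) =
      fun y ↦ ∏ j, (φ y j ^ J j * starRingEnd ℂ (φ y j) ^ K j) := funext fun y ↦ by
    rw [happ]
    exact prod_coord_sub fun j hj ↦ hJK j (by simp [hj])
  rwa [he]

/-- Near `x`, the number `κ_y` is at most the number of those common poles that pass through `y`. -/
theorem IsAdapted.eventually_kappaAt_le {α : DForm d k X} {J K : Fin d → ℕ} (h : IsAdapted D φ S)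
    (hx : x ∈ φ.source) (hJK : ∀ j ∉ S, J j = 0 ∧ K j = 0)
    (hp : IsDenominator D α x (fun y ↦ ∏ j, (φ y j ^ J j * starRingEnd ℂ (φ y j) ^ K j))) :
    ∀ᶠ y in 𝓝 x, kappaAt D α y ≤ ((commonPoles J K).filter fun j ↦ φ y j = 0).card := by
  filter_upwards [hp.eventually, φ.open_source.mem_nhds hx] with y hy hys
  let J' : Fin d → ℕ := fun j ↦ if φ y j = 0 then J j else 0
  let K' : Fin d → ℕ := fun j ↦ if φ y j = 0 then K j else 0
  have hcp : commonPoles J' K' = (commonPoles J K).filter fun j ↦ φ y j = 0 := by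
    ext j
    by_cases hj : φ y j = 0 <;> simp [commonPoles, J', K', hj]
  rw [← hcp]
  refine h.kappaAt_le hys (fun j hj ↦ ?_) ?_
  · by_cases hj0 : φ y j = 0
    · have : j ∉ S := fun hS ↦ hj (Finset.mem_filter.2 ⟨hS, hj0⟩)
      simp [J', K', hJK j this]
    · simp [J', K', hj0]
  · let T : Finset (Fin d) := Finset.univ.filter fun j ↦ φ y j ≠ 0
    have h1 := isSmoothGerm_monomial h.1 hys T J K
    have h0 : ∀ᶠ y' in 𝓝 y, ∏ j ∈ T, (φ y' j ^ J j * starRingEnd ℂ (φ y' j) ^ K j) ≠ 0 := by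
      refine eventually_prod_ne_zero T fun j hj ↦ ?_
      have h2 : ∀ᶠ y' in 𝓝 y, φ y' j ≠ 0 :=
        ((continuous_apply j).continuousAt.comp (φ.continuousAt hys)).eventually_ne
          (Finset.mem_filter.1 hj).2
      filter_upwards [h2] with y' h3
      exact mul_ne_zero (pow_ne_zero _ h3) (pow_ne_zero _ (by simpa using h3))
    refine hy.of_eq_mul (h1.inv h0) (h0.mono fun y' h2 _ ↦ ?_)
    rw [← Finset.prod_mul_prod_compl T
      (fun j ↦ φ y' j ^ J j * starRingEnd ℂ (φ y' j) ^ K j), inv_mul_cancel_left₀ h2]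
    rw [← Finset.prod_subset (Finset.subset_univ Tᶜ)]
    · refine Finset.prod_congr rfl fun j hj ↦ ?_
      have : φ y j = 0 := by simpa [T] using hj
      simp [J', K', this]
    · intro j _ hj
      have : φ y j ≠ 0 := by simpa [T] using hj
      simp [J', K', this]

/-- Quasi-meromorphic forms have finite pole orders. -/
theorem IsQuasiMeromorphic.exists_poleBound {α : DForm d k X} (hα : IsQuasiMeromorphic D α)
    (hφ : IsNCChart D x φ S) : ∃ J K, PoleBound D α x φ S J K := by
  obtain ⟨U, hU, hxU, f, g, β, hf, hg, hf0, hg0, hβ, h⟩ := hα.2 x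
  have hUx := hU.mem_nhds hxU
  have germ : ∀ {f : X → ℂ}, MDifferentiableOn 𝓘(ℂ, Fin d → ℂ) 𝓘(ℂ, ℂ) f U → IsHolGerm d x f :=
    fun hf ↦ eventually_of_mem hUx fun y hy ↦ (hf y hy).mdifferentiableAt (hU.mem_nhds hy)
  obtain ⟨A, u, hA, hu, hu0, hfu⟩ := hφ.exists_monomial_factor (germ hf)
    (eventually_of_mem hUx hf0)
  obtain ⟨B, w, hB, hw, hw0, hgw⟩ := hφ.exists_monomial_factor (germ hg)
    (eventually_of_mem hUx hg0)
  refine ⟨A, B, IsDenominator.poleBound hφ.2.1 (fun j hj ↦ ⟨hA j hj, hB j hj⟩) ?_⟩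
  have h1 : IsDenominator D α x (fun y ↦ f y * starRingEnd ℂ (g y)) := ⟨U, hU, hxU, β, hβ, h⟩
  refine h1.of_eq_mul ((hu.isSmoothGerm.mul hw.isSmoothGerm.conj).inv ?_) ?_
  · filter_upwards [hu0, hw0] with y h2 h3
    exact mul_ne_zero h2 (by simpa using h3)
  · filter_upwards [hu0, hw0, hfu, hgw] with y h2 h3 h4 h5 _
    have h6 : starRingEnd ℂ (w y) ≠ 0 := by simpa using h3
    rw [h4, h5, Finset.prod_mul_distrib, map_mul, map_prod]
    simp only [map_pow]
    field_simp

/-- Change of local equations: a product of powers of the equations in one chart is the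
corresponding product for another chart, up to a unit. -/
theorem exists_unit_of_matching {σ : Fin d → Fin d} (hσi : InjOn σ S)
    (hσ : ∀ k ∈ S, ∃ u : X → ℂ, IsHolGerm d x u ∧ (∀ᶠ y in 𝓝 x, u y ≠ 0) ∧
      ∀ᶠ y in 𝓝 x, φ y k = φ' y (σ k) * u y)
    {T : Finset (Fin d)} (hT : T ⊆ S) (A B : Fin d → ℕ) :
    ∃ w : X → ℂ, IsSmoothGerm d x w ∧ (∀ᶠ y in 𝓝 x, w y ≠ 0) ∧ ∀ᶠ y in 𝓝 x,
      ∏ j ∈ T, (φ y j ^ A (σ j) * starRingEnd ℂ (φ y j) ^ B (σ j)) =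
        w y * ∏ k ∈ T.image σ, (φ' y k ^ A k * starRingEnd ℂ (φ' y k) ^ B k) := by
  choose! u hu hu0 hfu using hσ
  refine ⟨fun y ↦ ∏ j ∈ T, (u j y ^ A (σ j) * starRingEnd ℂ (u j y) ^ B (σ j)), ?_, ?_, ?_⟩
  · exact IsSmoothGerm.prod T fun j hj ↦ ((hu j (hT hj)).isSmoothGerm.pow _).mul
      ((hu j (hT hj)).isSmoothGerm.conj.pow _)
  · refine eventually_prod_ne_zero T fun j hj ↦ ?_
    filter_upwards [hu0 j (hT hj)] with y hy
    exact mul_ne_zero (pow_ne_zero _ hy) (pow_ne_zero _ (by simpa using hy))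
  · filter_upwards [(T.eventually_all).2 fun j hj ↦ hfu j (hT hj)] with y hy
    rw [Finset.prod_image (fun a ha b hb ↦ hσi (hT ha) (hT hb)), ← Finset.prod_mul_distrib]
    refine Finset.prod_congr rfl fun j hj ↦ ?_
    rw [hy j hj, map_mul]
    ring

end Adapted

/-- There are points arbitrarily close to `x` where exactly the coordinates in `T` vanish, provided
they vanish at `x`. -/
theorem exists_coord_eq_zero_iff {d : ℕ} {X : Type*} [TopologicalSpace X]
    {φ : OpenPartialHomeomorph X (Fin d → ℂ)} {x : X} (hx : x ∈ φ.source) {T : Finset (Fin d)}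
    (hT : ∀ m ∈ T, φ x m = 0) {Q : X → Prop} (hQ : ∀ᶠ y in 𝓝 x, Q y) :
    ∃ y ∈ φ.source, Q y ∧ ∀ m, φ y m = 0 ↔ m ∈ T := by
  let z : ℂ → Fin d → ℂ := fun ε m ↦ if m ∈ T then 0 else φ x m + ε
  have hz0 : z 0 = φ x := by
    ext m
    by_cases hm : m ∈ T <;> simp [z, hm, hT]
  have hzc : Continuous z := by
    refine continuous_pi fun m ↦ ?_
    by_cases hm : m ∈ T
    · simpa [z, hm] using continuous_const
    · simp only [z, hm, if_false]; fun_prop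
  have h1 : ∀ᶠ ε in 𝓝 (0 : ℂ), Q (φ.symm (z ε)) ∧ z ε ∈ φ.target := by
    have h2 := (eventually_symm hx hQ).and (φ.open_target.mem_nhds (φ.map_source hx))
    rw [← hz0] at h2
    exact hzc.continuousAt.eventually h2
  have h3 : ∀ᶠ ε in 𝓝[≠] (0 : ℂ), ∀ m, φ x m + ε ≠ 0 := by
    refine eventually_all.2 fun m ↦ ?_
    by_cases hm : φ x m = 0
    · filter_upwards [self_mem_nhdsWithin] with ε hε
      simpa [hm] using hε
    · have : ContinuousAt (fun ε : ℂ ↦ φ x m + ε) 0 := by fun_prop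
      exact (this.eventually_ne (by simpa using hm)).filter_mono nhdsWithin_le_nhds
  obtain ⟨ε, ⟨h4, h5⟩, h6⟩ := ((h1.filter_mono nhdsWithin_le_nhds).and h3).exists
  refine ⟨φ.symm (z ε), φ.map_target h5, h4, fun m ↦ ?_⟩
  rw [φ.right_inv h5]
  by_cases hm : m ∈ T <;> simp [z, hm, h6]

section Matching

variable {d k : ℕ} {X : Type*} [TopologicalSpace X] [ChartedSpace (Fin d → ℂ) X]
  {φ φ' : OpenPartialHomeomorph X (Fin d → ℂ)} {x : X} {D : Set X} {S S' : Finset (Fin d)}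
  {σ : Fin d → Fin d} {J K I : Fin d → ℕ}

/-- The map `σ` matches the coordinates `z_j`, `j ∈ S`, of `φ` with the coordinates `z_j`, `j ∈ S'`,
of `φ'`, up to holomorphic units. -/
structure IsMatching (x : X) (φ : OpenPartialHomeomorph X (Fin d → ℂ)) (S : Finset (Fin d))
    (φ' : OpenPartialHomeomorph X (Fin d → ℂ)) (S' : Finset (Fin d)) (σ : Fin d → Fin d) :
    Prop where
  injOn : InjOn σ S
  image_eq : S.image σ = S'
  exists_unit : ∀ k ∈ S, ∃ u : X → ℂ, IsHolGerm d x u ∧ (∀ᶠ y in 𝓝 x, u y ≠ 0) ∧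
    ∀ᶠ y in 𝓝 x, φ y k = φ' y (σ k) * u y

/-- The orders `J` of the coordinates of one chart as orders of the matching coordinates. -/
def pullOrder (S : Finset (Fin d)) (σ : Fin d → Fin d) (J : Fin d → ℕ) (j : Fin d) : ℕ :=
  if j ∈ S then J (σ j) else 0

theorem pullOrder_of_mem {j : Fin d} (hj : j ∈ S) : pullOrder S σ J j = J (σ j) := if_pos hj

theorem pullOrder_of_notMem {j : Fin d} (hj : j ∉ S) : pullOrder S σ J j = 0 := if_neg hj

theorem commonPoles_pullOrder : commonPoles (pullOrder S σ J) (pullOrder S σ K) =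
    S.filter fun j ↦ σ j ∈ commonPoles J K := by
  ext j
  by_cases hj : j ∈ S <;> simp [commonPoles, pullOrder, hj]

theorem commonPoles_subset (hJK : ∀ j ∉ S, J j = 0 ∧ K j = 0) : commonPoles J K ⊆ S := by
  intro j hj
  by_contra h
  simp [commonPoles, hJK j h] at hj

theorem IsMatching.mem (h : IsMatching x φ S φ' S' σ) {j : Fin d} (hj : j ∈ S) : σ j ∈ S' :=
  h.image_eq ▸ Finset.mem_image_of_mem σ hj

theorem IsMatching.image_commonPoles (h : IsMatching x φ S φ' S' σ)
    (hJK : ∀ j ∉ S', J j = 0 ∧ K j = 0) :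
    (commonPoles (pullOrder S σ J) (pullOrder S σ K)).image σ = commonPoles J K := by
  rw [commonPoles_pullOrder]
  ext k
  simp only [Finset.mem_image, Finset.mem_filter]
  constructor
  · rintro ⟨j, ⟨-, hj⟩, rfl⟩
    exact hj
  · intro hk
    have hk' := commonPoles_subset hJK hk
    rw [← h.image_eq] at hk'
    obtain ⟨j, hj, rfl⟩ := Finset.mem_image.1 hk'
    exact ⟨j, ⟨hj, hk⟩, rfl⟩

theorem commonPoles_pullOrder_subset :
    commonPoles (pullOrder S σ J) (pullOrder S σ K) ⊆ S := by
  rw [commonPoles_pullOrder]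
  exact Finset.filter_subset _ _

theorem IsMatching.card_commonPoles (h : IsMatching x φ S φ' S' σ)
    (hJK : ∀ j ∉ S', J j = 0 ∧ K j = 0) :
    (commonPoles (pullOrder S σ J) (pullOrder S σ K)).card = (commonPoles J K).card := by
  rw [← h.image_commonPoles hJK, Finset.card_image_of_injOn]
  exact h.injOn.mono (by exact_mod_cast commonPoles_pullOrder_subset)

theorem IsMatching.prod_commonPoles (h : IsMatching x φ S φ' S' σ)
    (hJK : ∀ j ∉ S', J j = 0 ∧ K j = 0) :
    ∏ j ∈ commonPoles (pullOrder S σ J) (pullOrder S σ K), pullOrder S σ I j =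
      ∏ j ∈ commonPoles J K, I j := by
  rw [← h.image_commonPoles hJK, Finset.prod_image
    (h.injOn.mono (by exact_mod_cast commonPoles_pullOrder_subset))]
  exact Finset.prod_congr rfl fun j hj ↦ pullOrder_of_mem (commonPoles_pullOrder_subset hj)

theorem IsNCChart.exists_isMatching (hφ : IsNCChart D x φ S) (hφ' : IsNCChart D x φ' S') :
    ∃ σ, IsMatching x φ S φ' S' σ := by
  obtain ⟨σ, h1, h2, h3⟩ := hφ'.exists_matching hφ
  refine ⟨σ, h2, Finset.eq_of_subset_of_card_le (Finset.image_subset_iff.2 h1) ?_, h3⟩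
  rw [Finset.card_image_of_injOn h2, hφ.card_eq hφ']

variable [IsManifold 𝓘(ℂ, Fin d → ℂ) ω X]

/-- A monomial in the coordinates of one chart is a unit times the matched monomial in those of
another chart. -/
theorem IsMatching.exists_unit_prod (h : IsMatching x φ S φ' S' σ) {T T' : Finset (Fin d)}
    (hJK : ∀ j ∉ S', J j = 0 ∧ K j = 0) (hT : ∀ j ∈ S, j ∈ T ↔ σ j ∈ T') :
    ∃ w : X → ℂ, IsSmoothGerm d x w ∧ (∀ᶠ y in 𝓝 x, w y ≠ 0) ∧ ∀ᶠ y in 𝓝 x,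
      ∏ j ∈ T, (φ y j ^ pullOrder S σ J j * starRingEnd ℂ (φ y j) ^ pullOrder S σ K j) =
        w y * ∏ k ∈ T', (φ' y k ^ J k * starRingEnd ℂ (φ' y k) ^ K k) := by
  obtain ⟨w, hw, hw0, he⟩ := exists_unit_of_matching h.injOn h.exists_unit
    (Finset.inter_subset_right (s₁ := T)) J K
  refine ⟨w, hw, hw0, he.mono fun y hy ↦ ?_⟩
  have h1 : (T ∩ S).image σ = T' ∩ S' := by
    ext k
    simp only [Finset.mem_image, Finset.mem_inter]
    constructor
    · rintro ⟨j, ⟨hj, hjS⟩, rfl⟩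
      exact ⟨(hT j hjS).1 hj, h.mem hjS⟩
    · rintro ⟨hk, hkS⟩
      rw [← h.image_eq] at hkS
      obtain ⟨j, hj, rfl⟩ := Finset.mem_image.1 hkS
      exact ⟨j, ⟨(hT j hj).2 hk, hj⟩, rfl⟩
  rw [h1] at hy
  rw [← Finset.prod_subset (Finset.inter_subset_left (s₁ := T) (s₂ := S)),
    ← Finset.prod_subset (Finset.inter_subset_left (s₁ := T') (s₂ := S')), ← hy]
  · refine Finset.prod_congr rfl fun j hj ↦ ?_
    rw [pullOrder_of_mem (Finset.mem_inter.1 hj).2, pullOrder_of_mem (Finset.mem_inter.1 hj).2]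
  · intro k hk hkS
    simp [hJK k fun h ↦ hkS (Finset.mem_inter.2 ⟨hk, h⟩)]
  · intro k hk hkS
    have : k ∉ S := fun h ↦ hkS (Finset.mem_inter.2 ⟨hk, h⟩)
    simp [pullOrder_of_notMem this]

theorem IsMatching.isDenominator {α : DForm d k X} (h : IsMatching x φ S φ' S' σ)
    (hJK : ∀ j ∉ S', J j = 0 ∧ K j = 0)
    (hp : IsDenominator D α x fun y ↦ ∏ j, (φ' y j ^ J j * starRingEnd ℂ (φ' y j) ^ K j)) :
    IsDenominator D α x fun y ↦
      ∏ j, (φ y j ^ pullOrder S σ J j * starRingEnd ℂ (φ y j) ^ pullOrder S σ K j) := by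
  obtain ⟨w, hw, -, he⟩ := h.exists_unit_prod (T := Finset.univ) (T' := Finset.univ) hJK (by simp)
  exact hp.of_eq_mul hw (he.mono fun y hy _ ↦ hy)

/-- Pole orders in one adapted chart can be transferred to another one. -/
theorem IsAdapted.exists_transfer (h : IsAdapted D φ S) (hx : x ∈ φ.source)
    (h' : IsAdapted D φ' S') (hx' : x ∈ φ'.source)
    (hJK : ∀ j ∉ S'.filter (fun j ↦ φ' x j = 0), J j = 0 ∧ K j = 0) :
    ∃ J' K' : Fin d → ℕ, (∀ j ∉ S.filter (fun j ↦ φ x j = 0), J' j = 0 ∧ K' j = 0) ∧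
      (commonPoles J' K').card = (commonPoles J K).card ∧
      (∀ α : DForm d k X, IsDenominator D α x
          (fun y ↦ ∏ j, (φ' y j ^ J j * starRingEnd ℂ (φ' y j) ^ K j)) →
        IsDenominator D α x fun y ↦ ∏ j, (φ y j ^ J' j * starRingEnd ℂ (φ y j) ^ K' j)) ∧
      ∃ w : X → ℂ, IsSmoothGerm d x w ∧ (∀ᶠ y in 𝓝 x, w y ≠ 0) ∧ ∀ᶠ y in 𝓝 x,
        ∏ j ∈ (commonPoles J' K')ᶜ, (φ y j ^ J' j * starRingEnd ℂ (φ y j) ^ K' j) =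
          w y * ∏ j ∈ (commonPoles J K)ᶜ, (φ' y j ^ J j * starRingEnd ℂ (φ' y j) ^ K j) := by
  obtain ⟨ψ, hψ, hψφ⟩ := h.exists_centred hx
  obtain ⟨ψ', hψ', hψφ'⟩ := h'.exists_centred hx'
  obtain ⟨σ, hσ⟩ := hψ.exists_isMatching hψ'
  have hsup : ∀ {c : Fin d → ℂ} {S : Finset (Fin d)} {J K : Fin d → ℕ},
      (∀ j ∉ S.filter (fun j ↦ c j = 0), J j = 0 ∧ K j = 0) → ∀ j, c j ≠ 0 → J j = 0 ∧ K j = 0 :=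
    fun h j hj ↦ h j (by simp [hj])
  have hJ' : ∀ j ∉ S.filter (fun j ↦ φ x j = 0),
      pullOrder (S.filter fun j ↦ φ x j = 0) σ J j = 0 ∧
        pullOrder (S.filter fun j ↦ φ x j = 0) σ K j = 0 :=
    fun j hj ↦ ⟨pullOrder_of_notMem hj, pullOrder_of_notMem hj⟩
  have hmul : ∀ {c : Fin d → ℂ} {S : Finset (Fin d)} {J K : Fin d → ℕ},
      (∀ j ∉ S.filter (fun j ↦ c j = 0), J j = 0 ∧ K j = 0) → ∀ (T : Finset (Fin d))
      (z : Fin d → ℂ), ∏ j ∈ T, ((z - c) j ^ J j * starRingEnd ℂ ((z - c) j) ^ K j) =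
        ∏ j ∈ T, (z j ^ J j * starRingEnd ℂ (z j) ^ K j) := by
    intro c S J K h T z
    refine Finset.prod_congr rfl fun j _ ↦ ?_
    by_cases hj : c j = 0
    · simp [hj]
    · simp [hsup h j hj]
  refine ⟨_, _, hJ', hσ.card_commonPoles hJK, fun α hp ↦ ?_, ?_⟩
  · have h1 := hσ.isDenominator (α := α) (D := D) hJK
    simp only [hψφ, hψφ', hmul hJK, hmul hJ'] at h1
    exact h1 hp
  · have h1 := hσ.exists_unit_prod
      (T := (commonPoles (pullOrder (S.filter fun j ↦ φ x j = 0) σ J)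
        (pullOrder (S.filter fun j ↦ φ x j = 0) σ K))ᶜ)
      (T' := (commonPoles J K)ᶜ) hJK fun j hj ↦ by
        rw [commonPoles_pullOrder]
        simp only [Finset.mem_compl, Finset.mem_filter] at hj ⊢
        simp [hj]
    simp only [hψφ, hψφ', hmul hJK, hmul hJ'] at h1
    exact h1

end Matching

/-! ### Vanishing orders of sections and weights -/

section Sections

variable {d : ℕ} {X : Type*} [TopologicalSpace X] [ChartedSpace (Fin d → ℂ) X]
  {φ φ' : OpenPartialHomeomorph X (Fin d → ℂ)} {x : X} {D : Set X} {S S' : Finset (Fin d)}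
  {σ : Fin d → Fin d} {I : Fin d → ℕ}
  {L : X → Type*} [∀ x, TopologicalSpace (L x)] [TopologicalSpace (TotalSpace ℂ L)]
  [FiberBundle ℂ L] {s : ∀ x, L x}

theorem sectionOrder_of_germ (hx : x ∈ φ.source) {h : X → ℂ} (hh : IsHolGerm d x h)
    (h0 : ∀ᶠ y in 𝓝 x, h y ≠ 0)
    (hs : ∀ᶠ y in 𝓝 x, (trivializationAt ℂ L x (TotalSpace.mk' ℂ y (s y))).2 =
      (∏ j, φ y j ^ I j) * h y) : SectionOrder s x φ I := by
  obtain ⟨U, hU, hUo, hxU⟩ := eventually_nhds_iff.1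
    ((hh.and (h0.and hs)).and (φ.open_source.mem_nhds hx))
  exact ⟨U, h, hUo, hxU, fun y hy ↦ (hU y hy).2,
    fun y hy ↦ (hU y hy).1.1.mdifferentiableWithinAt, fun y hy ↦ (hU y hy).1.2.1,
    fun y hy ↦ (hU y hy).1.2.2⟩

theorem SectionOrder.exists_germ (hI : SectionOrder s x φ I) : ∃ h : X → ℂ, IsHolGerm d x h ∧
    (∀ᶠ y in 𝓝 x, h y ≠ 0) ∧ ∀ᶠ y in 𝓝 x,
      (trivializationAt ℂ L x (TotalSpace.mk' ℂ y (s y))).2 = (∏ j, φ y j ^ I j) * h y := by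
  obtain ⟨U, h, hU, hxU, -, hh, h0, hs⟩ := hI
  exact ⟨h, eventually_of_mem (hU.mem_nhds hxU) fun y hy ↦
    (hh y hy).mdifferentiableAt (hU.mem_nhds hy), eventually_of_mem (hU.mem_nhds hxU) h0,
    eventually_of_mem (hU.mem_nhds hxU) hs⟩

variable [∀ x, AddCommGroup (L x)] [∀ x, Module ℂ (L x)] [VectorBundle ℂ ℂ L]

theorem trivialization_eq_zero_iff {y : X}
    (hy : y ∈ (trivializationAt ℂ L x).baseSet) (v : L y) :
    (trivializationAt ℂ L x (TotalSpace.mk' ℂ y v)).2 = 0 ↔ v = 0 := by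
  have h1 := congrFun ((trivializationAt ℂ L x).coe_linearMapAt_of_mem (R := ℂ) hy) v
  change _ = (trivializationAt ℂ L x (TotalSpace.mk' ℂ y v)).2 at h1
  rw [← h1]
  constructor
  · intro h
    rw [← (trivializationAt ℂ L x).symmₗ_linearMapAt (R := ℂ) hy v, h, map_zero]
  · rintro rfl
    exact map_zero _

/-- In a trivialization, a metric is the absolute value times a positive weight. -/
theorem len_eq_norm_mul (g : LineMetric d L) {y : X}
    (hy : y ∈ (trivializationAt ℂ L x).baseSet) (v : L y) :
    g.len y v = ‖(trivializationAt ℂ L x (TotalSpace.mk' ℂ y v)).2‖ *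
      g.len y ((trivializationAt ℂ L x).symm y 1) := by
  rw [← g.len_smul, ← (trivializationAt ℂ L x).symmₗ_apply (R := ℂ) hy, ← map_smul,
    smul_eq_mul, mul_one,
    (trivializationAt ℂ L x).symmₗ_apply (R := ℂ) hy]
  exact congrArg _ ((trivializationAt ℂ L x).symm_apply_apply_mk hy v).symm

theorem len_symm_pos (g : LineMetric d L) {y : X}
    (hy : y ∈ (trivializationAt ℂ L x).baseSet) :
    0 < g.len y ((trivializationAt ℂ L x).symm y 1) := by
  refine g.len_pos y _ fun h ↦ ?_
  have h1 := (trivializationAt ℂ L x).linearMapAt_symmₗ (R := ℂ) hy 1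
  rw [(trivializationAt ℂ L x).symmₗ_apply (R := ℂ) hy, h, map_zero] at h1
  exact zero_ne_one h1

theorem IsHolSection.isHolGerm [ContMDiffVectorBundle ω ℂ L 𝓘(ℂ, Fin d → ℂ)]
    (hs : IsHolSection d s) :
    IsHolGerm d x fun y ↦ (trivializationAt ℂ L x (TotalSpace.mk' ℂ y (s y))).2 := by
  have := ContMDiffVectorBundle.of_le (IB := 𝓘(ℂ, Fin d → ℂ)) (F := ℂ) (E := L)
    (show (1 : ℕ∞ω) ≤ ω from le_top)
  refine eventually_of_mem ((trivializationAt ℂ L x).open_baseSet.mem_nhds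
    (mem_baseSet_trivializationAt ℂ L x)) fun y hy ↦ ?_
  exact ((trivializationAt ℂ L x).mdifferentiableAt_section_iff 𝓘(ℂ, Fin d → ℂ) s hy).1
    ((hs y).mdifferentiableAt (by simp))

/-- A holomorphic section with zero set `D` vanishes exactly along the branches of `D`. -/
theorem SectionOrder.ne_zero_iff (hI : SectionOrder s x φ I) (hφ : IsNCChart D x φ S)
    (hsD : ∀ x, s x = 0 ↔ x ∈ D) (j : Fin d) : I j ≠ 0 ↔ j ∈ S := by
  obtain ⟨h, -, h0, hs⟩ := hI.exists_germ
  have hb := (trivializationAt ℂ L x).open_baseSet.mem_nhds (mem_baseSet_trivializationAt ℂ L x)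
  obtain ⟨y, hy, ⟨⟨h1, h2⟩, h3⟩, hz⟩ := exists_coord_eq_zero_iff hφ.2.1 (T := {j})
    (fun m _ ↦ by rw [hφ.2.2.1]; rfl) ((h0.and hs).and hb)
  have h4 : y ∈ D ↔ j ∈ S := by
    rw [hφ.2.2.2 y hy]
    simp [hz]
  rw [← h4, ← hsD, ← trivialization_eq_zero_iff h3, h2, mul_eq_zero, or_iff_left h1,
    Finset.prod_eq_zero_iff]
  simp only [Finset.mem_univ, true_and, pow_eq_zero_iff', hz, Finset.mem_singleton]
  simp

/-- The vanishing orders of a section along the branches of `D` do not depend on the chart. -/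
theorem IsMatching.sectionOrder (hσ : IsMatching x φ S φ' S' σ) (hφ : IsNCChart D x φ S)
    (hφ' : IsNCChart D x φ' S') (hsD : ∀ x, s x = 0 ↔ x ∈ D) (hI : SectionOrder s x φ' I) :
    SectionOrder s x φ (pullOrder S σ I) := by
  obtain ⟨h, hh, h0, hs⟩ := hI.exists_germ
  choose! u hu hu0 hfu using hσ.exists_unit
  have hpu := eventually_prod_ne_zero S (F := fun j y ↦ u j y ^ I (σ j)) fun j hj ↦
    (hu0 j hj).mono fun y hy ↦ pow_ne_zero _ hy
  refine sectionOrder_of_germ hφ.2.1 (hh.mul ((IsHolGerm.prod S fun j hj ↦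
    (hu j hj).pow (I (σ j))).inv hpu)) ?_ ?_
  · filter_upwards [h0, hpu] with y h1 h2 using mul_ne_zero h1 (inv_ne_zero h2)
  · filter_upwards [hs, hpu, (S.eventually_all).2 hfu] with y h1 h2 h3
    rw [h1]
    have h4 : ∏ j, φ y j ^ pullOrder S σ I j = ∏ j ∈ S, φ y j ^ I (σ j) := by
      rw [← Finset.prod_subset (Finset.subset_univ S)]
      · exact Finset.prod_congr rfl fun j hj ↦ by rw [pullOrder_of_mem hj]
      · intro j _ hj
        rw [pullOrder_of_notMem hj, pow_zero]
    have h5 : ∏ k, φ' y k ^ I k = ∏ j ∈ S, φ' y (σ j) ^ I (σ j) := by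
      rw [← Finset.prod_subset (Finset.subset_univ S'), ← hσ.image_eq,
        Finset.prod_image hσ.injOn]
      intro j _ hj
      have : I j = 0 := by_contra fun h ↦ hj ((hI.ne_zero_iff hφ' hsD j).1 h)
      rw [this, pow_zero]
    have h6 : ∏ j ∈ S, φ y j ^ I (σ j) =
        (∏ j ∈ S, φ' y (σ j) ^ I (σ j)) * ∏ j ∈ S, u j y ^ I (σ j) := by
      rw [← Finset.prod_mul_distrib]
      exact Finset.prod_congr rfl fun j hj ↦ by rw [h3 j hj, mul_pow]
    rw [h4, h5, h6]
    field_simp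

/-- A holomorphic section with zero set `D` is locally a monomial times a unit. -/
theorem IsHolSection.exists_sectionOrder [ContMDiffVectorBundle ω ℂ L 𝓘(ℂ, Fin d → ℂ)]
    (hs : IsHolSection d s) (hsD : ∀ x, s x = 0 ↔ x ∈ D) (hφ : IsNCChart D x φ S) :
    ∃ I, SectionOrder s x φ I := by
  have hb := (trivializationAt ℂ L x).open_baseSet.mem_nhds (mem_baseSet_trivializationAt ℂ L x)
  obtain ⟨I, u, -, hu, hu0, he⟩ := hφ.exists_monomial_factor hs.isHolGerm (by
    filter_upwards [hb] with y hy h0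
    exact (hsD y).1 ((trivialization_eq_zero_iff hy _).1 h0))
  exact ⟨I, sectionOrder_of_germ hφ.2.1 hu hu0 he⟩

variable [IsManifold 𝓘(ℂ, Fin d → ℂ) ω X]

/-- In coordinates adapted to a section, its length is a monomial times the exponential of a smooth
function. -/
theorem SectionOrder.exists_weight (hI : SectionOrder s x φ I)
    (hφ : φ ∈ IsManifold.maximalAtlas 𝓘(ℂ, Fin d → ℂ) ω X) (hx : x ∈ φ.source)
    (g : LineMetric d L) : ∃ v : (Fin d → ℂ) → ℝ, ContDiff ℝ ∞ v ∧
      ∀ᶠ y in 𝓝 x, g.len y (s y) = (∏ j, ‖φ y j‖ ^ I j) * Real.exp (v (φ y)) := by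
  obtain ⟨h, hh, h0, hs⟩ := hI.exists_germ
  have hb := (trivializationAt ℂ L x).open_baseSet.mem_nhds (mem_baseSet_trivializationAt ℂ L x)
  let ℓ : X → ℝ := fun y ↦ g.len y ((trivializationAt ℂ L x).symm y 1)
  let v : (Fin d → ℂ) → ℝ := fun z ↦ Real.log (‖h (φ.symm z)‖ * ℓ (φ.symm z))
  have hv : ∀ᶠ z in 𝓝 (φ x), ContDiffAt ℝ ∞ v z := by
    filter_upwards [hh.isSmoothGerm.eventually_contDiffAt hφ hx, eventually_symm hx h0,
      eventually_symm hx hb, φ.open_target.mem_nhds (φ.map_source hx)] with z h1 h2 h3 h4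
    have h5 : ContDiffAt ℝ ∞ (fun z ↦ ℓ (φ.symm z)) z :=
      contMDiffAt_iff_contDiffAt.1 (((g.smooth x).contMDiffAt
        ((trivializationAt ℂ L x).open_baseSet.mem_nhds h3)).comp z (contMDiffAt_symm_real hφ h4))
    exact ((h1.norm ℝ h2).mul h5).log
      (mul_ne_zero (norm_ne_zero_iff.2 h2) (len_symm_pos g h3).ne')
  obtain ⟨v', hv', he⟩ := exists_contDiff_eventuallyEq hv
    (fun z hz ↦ ContDiffAt.contDiffWithinAt hz)
  refine ⟨v', hv', ?_⟩
  filter_upwards [eventually_chart hx he, hs, h0, hb, φ.open_source.mem_nhds hx]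
    with y h1 h2 h3 h4 h5
  rw [len_eq_norm_mul g h4, h2, h1]
  simp only [v, φ.left_inv h5]
  rw [Real.exp_log (mul_pos (norm_pos_iff.2 h3) (len_symm_pos g h4)), norm_mul, norm_prod]
  simp only [norm_pow]
  ring

end Sections

/-! ### Coefficients of exterior products -/

section Coefficients

variable {d k l : ℕ} {X : Type*} [TopologicalSpace X] [ChartedSpace (Fin d → ℂ) X]
  {φ : OpenPartialHomeomorph X (Fin d → ℂ)} {x : X} {D : Set X} {S : Finset (Fin d)}

theorem topWedge_smul {hkl : k + l = 2 * d} {α β : DForm d k X} {ξ : DForm d l X} {c : ℂ}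
    (h : β x = c • α x) : topWedge hkl β ξ x = c • topWedge hkl α ξ x := by
  simp only [topWedge]
  rw [h, altWedge_smul]
  rfl

theorem topCoeff_topWedge (hkl : k + l = 2 * d) (β : DForm d k X) (ξ : DForm d l X)
    (u : Fin d → ℂ) : topCoeff φ (topWedge hkl β ξ) u =
      ∑ q : Equiv.Perm.ModSumCongr (Fin k) (Fin l), ((Equiv.Perm.sign q.out : ℤ) : ℂ) *
        (chartRep φ β u (fun i ↦ realBasis d (Fin.cast hkl (finSumFinEquiv (q.out (Sum.inl i))))) *
          chartRep φ ξ u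
            (fun i ↦ realBasis d (Fin.cast hkl (finSumFinEquiv (q.out (Sum.inr i)))))) :=
  altWedge_apply (V := Fin d → ℂ) (β (φ.symm u)) (ξ (φ.symm u)) _

theorem topCoeff_eq_mul {η η' : DForm d (2 * d) X} {u : Fin d → ℂ} {c : ℂ}
    (h : η' (φ.symm u) = c • η (φ.symm u)) : topCoeff φ η' u = c * topCoeff φ η u := by
  change η' (φ.symm u) _ = c * η (φ.symm u) _
  rw [h]
  rfl

variable [IsManifold 𝓘(ℂ, Fin d → ℂ) ω X]

theorem contDiffAt_topCoeff_topWedge (hφ : φ ∈ IsManifold.maximalAtlas 𝓘(ℂ, Fin d → ℂ) ω X)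
    (hkl : k + l = 2 * d) {β : DForm d k X} {ξ : DForm d l X} {U : Set X}
    (hβ : SmoothFormOn β U) (hξ : SmoothFormOn ξ U) (hxU : x ∈ U) (hx : x ∈ φ.source) :
    ContDiffAt ℝ ∞ (topCoeff φ (topWedge hkl β ξ)) (φ x) := by
  have h : topCoeff φ (topWedge hkl β ξ) = fun u ↦ _ := funext fun u ↦ topCoeff_topWedge hkl β ξ u
  rw [h]
  exact ContDiffAt.sum fun q _ ↦ contDiffAt_const.mul
    ((hβ.contDiffAt hφ hxU hx _).mul (hξ.contDiffAt hφ hxU hx _))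

/-- If `p` is a denominator of `α`, then `p` times the coefficient of `α ∧ ξ` is smooth. -/
theorem IsDenominator.exists_coeff {α : DForm d k X} {p : X → ℂ} (h : IsDenominator D α x p)
    (hφ : φ ∈ IsManifold.maximalAtlas 𝓘(ℂ, Fin d → ℂ) ω X) (hx : x ∈ φ.source)
    (hkl : k + l = 2 * d) {ξ : DForm d l X} (hξ : SmoothFormOn ξ univ) :
    ∃ U : Set X, IsOpen U ∧ x ∈ U ∧ U ⊆ φ.source ∧ ∃ b : (Fin d → ℂ) → ℂ,
      ContDiffOn ℝ ∞ b (φ.target ∩ φ.symm ⁻¹' U) ∧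
      ∀ u ∈ φ.target, φ.symm u ∈ U → φ.symm u ∉ D →
        b u = p (φ.symm u) * topCoeff φ (topWedge hkl α ξ) u := by
  obtain ⟨U, hU, hxU, β, hβ, h⟩ := h
  refine ⟨U ∩ φ.source, hU.inter φ.open_source, ⟨hxU, hx⟩, inter_subset_right,
    topCoeff φ (topWedge hkl β ξ), fun u hu ↦ ?_, fun u hu huU huD ↦ ?_⟩
  · have h1 := contDiffAt_topCoeff_topWedge hφ hkl hβ (hξ.mono (subset_univ U)) hu.2.1 hu.2.2
    rw [φ.right_inv hu.1] at h1
    exact h1.contDiffWithinAt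
  · exact topCoeff_eq_mul (topWedge_smul (h _ huU.1 huD))

/-- The leading coefficient of the integral of a localised form with monomial poles. -/
theorem formLeading_of_coeff [T2Space X] [CompactSpace X]
    (hφ : φ ∈ IsManifold.maximalAtlas 𝓘(ℂ, Fin d → ℂ) ω X)
    {η : DForm d (2 * d) X} {U : Set X} (hU : IsOpen U) (hUφ : U ⊆ φ.source)
    {b : (Fin d → ℂ) → ℂ} (hb : ContDiffOn ℝ ∞ b (φ.target ∩ φ.symm ⁻¹' U))
    {I J K : Fin d → ℕ} (hI : ∀ i, J i + K i ≠ 0 → I i ≠ 0) {v : (Fin d → ℂ) → ℝ}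
    (hv : ContDiff ℝ ∞ v) {W : X → ℝ}
    (hW : ∀ y ∈ U, W y = (∏ j, ‖φ y j‖ ^ I j) * Real.exp (v (φ y)))
    (hη : ∀ u ∈ φ.target, φ.symm u ∈ U → (∀ j, u j ≠ 0) →
      b u = (∏ j, (u j ^ J j * starRingEnd ℂ (u j) ^ K j)) * topCoeff φ η u)
    {χ : X → ℝ} (hχ : ContMDiff 𝓘(ℝ, Fin d → ℂ) 𝓘(ℝ, ℝ) ∞ χ) (hχU : tsupport χ ⊆ U)
    {m : ℕ} {L : ℂ}
    (h : HasLeading (singInt I J K (fun u ↦ 2 * (v u : ℂ)) (chartExtend φ χ b)) m L) :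
    FormLeading W (fun y ↦ (χ y : ℂ) • η y) m L := by
  have hχ0 : ∀ y ∉ U, χ y = 0 := fun y hy ↦
    by_contra fun h ↦ hy (hχU (subset_tsupport χ h))
  refine formLeading_of_hasLeading_singInt hφ (fun y hy ↦ ?_) hI hv.continuous
    (isTest_chartExtend hφ hχ hU hUφ hχU hb) (fun u hu ↦ chartExtend_of_notMem hu)
    (fun u hu hf ↦ ?_) (fun u hu hu0 ↦ ?_) h
  · rw [hχ0 y fun h ↦ hy (hUφ h)]
    simp
  · have huU : φ.symm u ∈ U := by
      by_contra h
      exact hf (by rw [chartExtend_of_mem hu, hχ0 _ h]; simp)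
    rw [hW _ huU, φ.right_inv hu]
  · rw [topCoeff_smul, chartExtend_of_mem hu]
    by_cases huU : φ.symm u ∈ U
    · rw [hη u hu huU hu0]
      have : ∏ j, (u j ^ J j * starRingEnd ℂ (u j) ^ K j) ≠ 0 :=
        Finset.prod_ne_zero_iff.2 fun j _ ↦ mul_ne_zero (pow_ne_zero _ (hu0 j))
          (pow_ne_zero _ (by simpa using hu0 j))
      field_simp
    · rw [hχ0 _ huU]
      simp

end Coefficients

/-! ### The integral near a point -/

section MinimalOrders

variable {d k l : ℕ} {X : Type*} [TopologicalSpace X] [ChartedSpace (Fin d → ℂ) X]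
  [IsManifold 𝓘(ℂ, Fin d → ℂ) ω X]
  {φ : OpenPartialHomeomorph X (Fin d → ℂ)} {x : X} {D : Set X} {S : Finset (Fin d)}
  {L : X → Type*} [∀ x, TopologicalSpace (L x)] [TopologicalSpace (TotalSpace ℂ L)]
  [FiberBundle ℂ L] {s : ∀ x, L x} [∀ x, AddCommGroup (L x)] [∀ x, Module ℂ (L x)]
  [VectorBundle ℂ ℂ L]

theorem SectionOrder.exists_weight_of_centred {ψ : OpenPartialHomeomorph X (Fin d → ℂ)}
    {I : Fin d → ℕ} (hI : SectionOrder s x ψ I)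
    (hψ : IsNCChart D x ψ (S.filter fun j ↦ φ x j = 0)) (hψφ : ∀ y, ψ y = φ y - φ x)
    (hsD : ∀ x, s x = 0 ↔ x ∈ D) (g : LineMetric d L) :
    ∃ v : (Fin d → ℂ) → ℝ, ContDiff ℝ ∞ v ∧
      ∀ᶠ y in 𝓝 x, g.len y (s y) = (∏ j, ‖φ y j‖ ^ I j) * Real.exp (v (φ y)) := by
  obtain ⟨v, hv, hw⟩ := hI.exists_weight hψ.1 hψ.2.1 g
  refine ⟨fun z ↦ v (z - φ x), hv.comp (contDiff_id.sub contDiff_const), hw.mono fun y hy ↦ ?_⟩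
  rw [hy, hψφ]
  congr 1
  refine Finset.prod_congr rfl fun j _ ↦ ?_
  by_cases hj : φ x j = 0
  · simp [hj]
  · have : I j = 0 := by_contra fun h ↦ hj
      (Finset.mem_filter.1 ((hI.ne_zero_iff hψ hsD j).1 h)).2
    simp [this]

/-- The vanishing orders of a section in an adapted chart. -/
theorem IsAdapted.exists_weight [ContMDiffVectorBundle ω ℂ L 𝓘(ℂ, Fin d → ℂ)]
    (h : IsAdapted D φ S) (hx : x ∈ φ.source) (hs : IsHolSection d s)
    (hsD : ∀ x, s x = 0 ↔ x ∈ D) (g : LineMetric d L) :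
    ∃ (I : Fin d → ℕ) (v : (Fin d → ℂ) → ℝ), (∀ j, I j ≠ 0 ↔ j ∈ S.filter fun j ↦ φ x j = 0) ∧
      ContDiff ℝ ∞ v ∧
      ∀ᶠ y in 𝓝 x, g.len y (s y) = (∏ j, ‖φ y j‖ ^ I j) * Real.exp (v (φ y)) := by
  obtain ⟨ψ, hψ, hψφ⟩ := h.exists_centred hx
  obtain ⟨I, hI⟩ := hs.exists_sectionOrder hsD hψ
  obtain ⟨v, hv, hw⟩ := hI.exists_weight_of_centred hψ hψφ hsD g
  exact ⟨I, v, hI.ne_zero_iff hψ hsD, hv, hw⟩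

/-- The numbers `κ_x(α)` and `o_{α,x}(s)` are attained in every adapted chart around `x`. -/
theorem IsAdapted.exists_minimal_orders [ContMDiffVectorBundle ω ℂ L 𝓘(ℂ, Fin d → ℂ)]
    (h : IsAdapted D φ S) (hx : x ∈ φ.source)
    {α : DForm d k X} (hα : IsQuasiMeromorphic D α) (hs : IsHolSection d s)
    (hsD : ∀ x, s x = 0 ↔ x ∈ D) (g : LineMetric d L) :
    ∃ (J K I : Fin d → ℕ) (v : (Fin d → ℂ) → ℝ),
      (∀ j ∉ S.filter (fun j ↦ φ x j = 0), J j = 0 ∧ K j = 0) ∧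
      IsDenominator D α x (fun y ↦ ∏ j, (φ y j ^ J j * starRingEnd ℂ (φ y j) ^ K j)) ∧
      (commonPoles J K).card = kappaAt D α x ∧
      (∀ j, I j ≠ 0 ↔ j ∈ S.filter fun j ↦ φ x j = 0) ∧
      ∏ j ∈ commonPoles J K, I j = orderAt D α s x ∧ ContDiff ℝ ∞ v ∧
      ∀ᶠ y in 𝓝 x, g.len y (s y) = (∏ j, ‖φ y j‖ ^ I j) * Real.exp (v (φ y)) := by
  obtain ⟨ψ, hψ, hψφ⟩ := h.exists_centred hx
  have hne : {m | ∃ (φ : OpenPartialHomeomorph X (Fin d → ℂ)) (S : Finset (Fin d))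
      (J K I : Fin d → ℕ), IsNCChart D x φ S ∧ PoleBound D α x φ S J K ∧
      (commonPoles J K).card = kappaAt D α x ∧ SectionOrder s x φ I ∧
      m = ∏ j ∈ commonPoles J K, I j}.Nonempty := by
    obtain ⟨J, K, hJK⟩ := hα.exists_poleBound hψ
    have hne : {m | ∃ (φ : OpenPartialHomeomorph X (Fin d → ℂ)) (S : Finset (Fin d))
        (J K : Fin d → ℕ), IsNCChart D x φ S ∧ PoleBound D α x φ S J K ∧
        m = (commonPoles J K).card}.Nonempty := ⟨_, ψ, _, J, K, hψ, hJK, rfl⟩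
    obtain ⟨φ₁, S₁, J₁, K₁, h1, h2, h3⟩ := Nat.sInf_mem hne
    obtain ⟨I₁, hI₁⟩ := hs.exists_sectionOrder hsD h1
    exact ⟨_, φ₁, S₁, J₁, K₁, I₁, h1, h2, h3.symm, hI₁, rfl⟩
  obtain ⟨φ', S', J', K', I', hφ', hJK', hcard, hI', ho⟩ := Nat.sInf_mem hne
  obtain ⟨σ, hσ⟩ := hψ.exists_isMatching hφ'
  have hI := hσ.sectionOrder hψ hφ' hsD hI'
  obtain ⟨v, hv, hw⟩ := hI.exists_weight_of_centred hψ hψφ hsD g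
  have hden := hσ.isDenominator hJK'.1 hJK'.isDenominator
  refine ⟨_, _, _, v, fun j hj ↦ ⟨pullOrder_of_notMem hj, pullOrder_of_notMem hj⟩, ?_,
    (hσ.card_commonPoles hJK'.1).trans hcard, hI.ne_zero_iff hψ hsD,
    (hσ.prod_commonPoles hJK'.1).trans ho.symm, hv, hw⟩
  convert! hden using 2 with y
  rw [hψφ]
  refine (prod_coord_sub fun j hj ↦ ?_).symm
  have : j ∉ S.filter fun j ↦ φ x j = 0 := by simp [hj]
  exact ⟨pullOrder_of_notMem this, pullOrder_of_notMem this⟩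

/-- Near any point `x`, the integral of `|s|^{2λ} α ∧ ξ` has a pole of order at most `κ_x(α)` at
the origin. -/
theorem exists_formLeading_kappaAt [T2Space X] [CompactSpace X]
    [ContMDiffVectorBundle ω ℂ L 𝓘(ℂ, Fin d → ℂ)] (hD : IsNormalCrossing d D)
    {α : DForm d k X} (hα : IsQuasiMeromorphic D α) (hkl : k + l = 2 * d) {ξ : DForm d l X}
    (hξ : SmoothFormOn ξ univ) (hs : IsHolSection d s) (hsD : ∀ x, s x = 0 ↔ x ∈ D)
    (g : LineMetric d L) (x : X) : ∃ U : Set X, IsOpen U ∧ x ∈ U ∧ ∀ χ : X → ℝ,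
      ContMDiff 𝓘(ℝ, Fin d → ℂ) 𝓘(ℝ, ℝ) ∞ χ → tsupport χ ⊆ U →
      ∃ c, FormLeading (fun y ↦ g.len y (s y)) (fun y ↦ (χ y : ℂ) • topWedge hkl α ξ y)
        (kappaAt D α x) c := by
  obtain ⟨φ, S, hφ⟩ := hD x
  obtain ⟨J, K, I, v, hJK, hden, hcard, hI, -, hv, hw⟩ :=
    hφ.isAdapted.exists_minimal_orders hφ.2.1 hα hs hsD g
  obtain ⟨U, hU, hxU, hUφ, b, hb, hη⟩ := hden.exists_coeff hφ.1 hφ.2.1 hkl hξ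
  obtain ⟨U', hU', hU'o, hxU'⟩ := eventually_nhds_iff.1 hw
  have hI0 : ∀ i, J i + K i ≠ 0 → I i ≠ 0 := fun i hi ↦ by
    rw [hI]
    by_contra h
    exact hi (by simp [hJK i h])
  refine ⟨U ∩ U', hU.inter hU'o, ⟨hxU, hxU'⟩, fun χ hχ hχU ↦ ?_⟩
  have hb' := hb.mono (inter_subset_inter_right φ.target
    (preimage_mono (inter_subset_left (s := U) (t := U'))))
  obtain ⟨c, hc⟩ := exists_hasLeading_singInt (I := I) (J := J) (K := K)
    (v := fun u ↦ 2 * (v u : ℂ)) hI0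
    (contDiff_const.mul (Complex.ofRealCLM.contDiff.comp hv))
    (isTest_chartExtend hφ.1 hχ (hU.inter hU'o) (inter_subset_left.trans hUφ) hχU hb')
  rw [hcard] at hc
  refine ⟨c, formLeading_of_coeff hφ.1 (hU.inter hU'o) (inter_subset_left.trans hUφ) hb' hI0 hv
    (fun y hy ↦ hU' y hy.2) (fun u hu huU hu0 ↦ ?_) hχ hχU hc⟩
  have huD : φ.symm u ∉ D := fun h ↦ by
    obtain ⟨j, -, hj⟩ := (hφ.2.2.2 _ (φ.map_target hu)).1 h
    rw [φ.right_inv hu] at hj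
    exact hu0 j hj
  rw [hη u hu huU.1 huD, φ.right_inv hu]

end MinimalOrders

/-! ### Charts of a submanifold -/

section Slices

variable {d n : ℕ} {X : Type*} [TopologicalSpace X] [ChartedSpace (Fin d → ℂ) X]
  {Y : Type*} {φ : OpenPartialHomeomorph X (Fin d → ℂ)} {tang : Fin n ↪ Fin d} {j : Y → X}

/-- In the chart `φ`, the image of `j` is the coordinate subspace spanned by the coordinates listed
by `tang`. -/
structure IsSlice (φ : OpenPartialHomeomorph X (Fin d → ℂ)) (tang : Fin n ↪ Fin d) (j : Y → X) :
    Prop where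
  mem_atlas : φ ∈ IsManifold.maximalAtlas 𝓘(ℂ, Fin d → ℂ) ω X
  mem_range : ∀ x ∈ φ.source, x ∈ range j ↔ ∀ k ∈ (Finset.univ.map tang)ᶜ, φ x k = 0

theorem IsSlice.tangIncl_eq (h : IsSlice φ tang j) {y : Y} (hy : j y ∈ φ.source) :
    tangIncl tang (fun t ↦ φ (j y) (tang t)) = φ (j y) := by
  refine (tangIncl_comp tang (φ (j y))).trans (funext fun k ↦ ?_)
  split_ifs with hk
  · exact ((h.mem_range _ hy).1 (mem_range_self y) k hk).symm
  · rfl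

theorem IsSlice.exists_eq (h : IsSlice φ tang j) {w : Fin n → ℂ}
    (hw : tangIncl tang w ∈ φ.target) : ∃ y, j y = φ.symm (tangIncl tang w) := by
  refine (h.mem_range _ (φ.map_target hw)).2 fun k hk ↦ ?_
  rw [φ.right_inv hw]
  exact tangIncl_apply_of_forall_ne tang w (forall_tang_ne tang hk)

variable [TopologicalSpace Y] [ChartedSpace (Fin n → ℂ) Y]

theorem contMDiffAt_comp_embedding (h : IsSlice φ tang j)
    (hj : IsHolEmbedding (n := n) (d := d) j) {y : Y} (hy : j y ∈ φ.source) :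
    ContMDiffAt 𝓘(ℂ, Fin n → ℂ) 𝓘(ℂ, Fin d → ℂ) ω (fun y ↦ φ (j y)) y :=
  (contMDiffAt_of_mem_maximalAtlas h.mem_atlas hy).comp y (hj.1 y)

theorem contMDiffAt_comp_embedding_real [IsManifold 𝓘(ℂ, Fin n → ℂ) ω Y]
    (h : IsSlice φ tang j) (hj : IsHolEmbedding (n := n) (d := d) j) {y : Y} (hy : j y ∈ φ.source) :
    ContMDiffAt 𝓘(ℝ, Fin n → ℂ) 𝓘(ℝ, Fin d → ℂ) ∞ (fun y ↦ φ (j y)) y := by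
  refine contMDiffAt_pi_space.2 fun k ↦ ?_
  have hh : IsHolGerm n y fun y ↦ φ (j y) k := by
    filter_upwards [hj.1.continuous.continuousAt.eventually (φ.open_source.mem_nhds hy)] with y' hy'
    exact (contMDiffAt_pi_space.1 (contMDiffAt_comp_embedding h hj hy') k).mdifferentiableAt
      (by simp)
  exact hh.isSmoothGerm.self_of_nhds

/-- The chart of a compact submanifold given by the tangential coordinates of a chart of the ambient
manifold. -/
noncomputable def sliceChart [T2Space X] [CompactSpace Y] [Nonempty Y] (h : IsSlice φ tang j)
    (hj : IsHolEmbedding (n := n) (d := d) j) : OpenPartialHomeomorph Y (Fin n → ℂ) where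
  toFun y t := φ (j y) (tang t)
  invFun w := Function.invFun j (φ.symm (tangIncl tang w))
  source := j ⁻¹' φ.source
  target := tangIncl tang ⁻¹' φ.target
  map_source' y hy := by
    change tangIncl tang (fun t ↦ φ (j y) (tang t)) ∈ φ.target
    rw [h.tangIncl_eq hy]
    exact φ.map_source hy
  map_target' w hw := by
    change j (Function.invFun j (φ.symm (tangIncl tang w))) ∈ φ.source
    rw [Function.invFun_eq (h.exists_eq hw)]
    exact φ.map_target hw
  left_inv' y hy := by
    rw [h.tangIncl_eq hy, φ.left_inv hy, Function.leftInverse_invFun hj.2.1]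
  right_inv' w hw := by
    ext t
    rw [Function.invFun_eq (h.exists_eq hw), φ.right_inv hw, tangIncl_apply_tang]
  open_source := φ.open_source.preimage hj.1.continuous
  open_target := φ.open_target.preimage (tangIncl tang).continuous
  continuousOn_toFun := continuousOn_pi.2 fun t ↦ (continuous_apply (tang t)).comp_continuousOn
    (φ.continuousOn.comp hj.1.continuous.continuousOn fun _ hy ↦ hy)
  continuousOn_invFun := by
    rw [(hj.1.continuous.isClosedEmbedding hj.2.1).isInducing.continuousOn_iff]
    refine (φ.continuousOn_symm.comp (tangIncl tang).continuous.continuousOn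
      fun _ hw ↦ hw).congr fun w hw ↦ ?_
    exact Function.invFun_eq (h.exists_eq hw)

variable [T2Space X] [CompactSpace Y] [Nonempty Y] (h : IsSlice φ tang j)
  (hj : IsHolEmbedding (n := n) (d := d) j)

theorem tangIncl_sliceChart {y : Y} (hy : j y ∈ φ.source) :
    tangIncl tang (sliceChart h hj y) = φ (j y) := h.tangIncl_eq hy

theorem apply_sliceChart_symm {w : Fin n → ℂ} (hw : w ∈ (sliceChart h hj).target) :
    j ((sliceChart h hj).symm w) = φ.symm (tangIncl tang w) :=
  Function.invFun_eq (h.exists_eq hw)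

variable [IsManifold 𝓘(ℂ, Fin n → ℂ) ω Y]

/-- The tangential coordinates are a holomorphic chart of the submanifold, by the inverse function
theorem. -/
theorem sliceChart_mem_atlas :
    sliceChart h hj ∈ IsManifold.maximalAtlas 𝓘(ℂ, Fin n → ℂ) ω Y := by
  set Φ := sliceChart h hj with hΦ
  have hsm : ∀ y ∈ Φ.source, ContMDiffAt 𝓘(ℂ, Fin n → ℂ) 𝓘(ℂ, Fin n → ℂ) ω Φ y := fun y hy ↦
    contMDiffAt_pi_space.2 fun t ↦
      contMDiffAt_pi_space.1 (contMDiffAt_comp_embedding h hj hy) (tang t)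
  refine OpenPartialHomeomorph.mem_maximalAtlas_of_contMDiffOn Φ
    (fun y hy ↦ (hsm y hy).contMDiffWithinAt) fun w hw ↦ ContMDiffAt.contMDiffWithinAt ?_
  set y := Φ.symm w with hy
  have hys : y ∈ Φ.source := Φ.map_target hw
  have hyφ : j y ∈ φ.source := hys
  set e := chartAt (Fin n → ℂ) y with he
  have hea : e ∈ IsManifold.maximalAtlas 𝓘(ℂ, Fin n → ℂ) ω Y :=
    IsManifold.chart_mem_maximalAtlas y
  have hye : y ∈ e.source := mem_chart_source _ y
  -- the derivative of `Φ` is injective, since `φ ∘ j` is an immersion with values in the slice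
  have hinj : Function.Injective (mfderiv 𝓘(ℂ, Fin n → ℂ) 𝓘(ℂ, Fin n → ℂ) Φ y) := by
    have h1 : Function.Injective
        (mfderiv 𝓘(ℂ, Fin n → ℂ) 𝓘(ℂ, Fin d → ℂ) (fun y ↦ φ (j y)) y) := by
      have h2 : mfderiv 𝓘(ℂ, Fin n → ℂ) 𝓘(ℂ, Fin d → ℂ) (fun y ↦ φ (j y)) y = _ :=
        mfderiv_comp y (mdifferentiableAt_chart h.mem_atlas hyφ)
          ((hj.1 y).mdifferentiableAt (by simp))
      rw [h2]
      have h3 : φ.MDifferentiable 𝓘(ℂ, Fin d → ℂ) 𝓘(ℂ, Fin d → ℂ) :=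
        ⟨fun x hx ↦ (mdifferentiableAt_chart h.mem_atlas hx).mdifferentiableWithinAt,
          fun x hx ↦ (mdifferentiableAt_chart_symm h.mem_atlas hx).mdifferentiableWithinAt⟩
      exact (h3.mfderiv_injective hyφ).comp (hj.2.2 y)
    have h4 : (fun y ↦ φ (j y)) =ᶠ[𝓝 y] fun y ↦ tangIncl tang (Φ y) :=
      eventually_of_mem (Φ.open_source.mem_nhds hys) fun y' hy' ↦
        (tangIncl_sliceChart h hj hy').symm
    rw [h4.mfderiv_eq] at h1
    have h5 : mfderiv 𝓘(ℂ, Fin n → ℂ) 𝓘(ℂ, Fin d → ℂ) (fun y ↦ tangIncl tang (Φ y)) y = _ :=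
      mfderiv_comp (I' := 𝓘(ℂ, Fin n → ℂ)) (g := tangIncl tang) y
        (tangIncl tang).mdifferentiableAt ((hsm y hys).mdifferentiableAt (by simp))
    rw [h5] at h1
    exact Function.Injective.of_comp h1
  -- the transition from the preferred chart to `Φ` is locally biholomorphic
  let F := e.symm.trans Φ
  have hFs : F.symm w = e y := by simp [F, ← hy]
  have hwF : w ∈ F.target := by
    simp only [F, OpenPartialHomeomorph.trans_target, OpenPartialHomeomorph.symm_target,
      mem_inter_iff, mem_preimage]
    exact ⟨hw, hye⟩
  have hFc : ContMDiffAt 𝓘(ℂ, Fin n → ℂ) 𝓘(ℂ, Fin n → ℂ) ω (Φ ∘ e.symm) (e y) := by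
    refine ContMDiffAt.comp (e y) ?_ (contMDiffAt_symm_of_mem_maximalAtlas hea (e.map_source hye))
    rw [e.left_inv hye]
    exact hsm y hys
  have hF : ContDiffAt ℂ ω F (e y) := contMDiffAt_iff_contDiffAt.1 hFc
  have hFinj : Function.Injective (fderiv ℂ F (e y)) := by
    have h3 : e.MDifferentiable 𝓘(ℂ, Fin n → ℂ) 𝓘(ℂ, Fin n → ℂ) := mdifferentiable_chart y
    have h1 : mfderiv 𝓘(ℂ, Fin n → ℂ) 𝓘(ℂ, Fin n → ℂ) (Φ ∘ e.symm) (e y) = _ :=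
      mfderiv_comp_of_eq (x := e y) ((hsm y hys).mdifferentiableAt (by simp))
        (mdifferentiableAt_chart_symm hea (e.map_source hye)) (e.left_inv hye)
    rw [← mfderiv_eq_fderiv]
    change Function.Injective (mfderiv 𝓘(ℂ, Fin n → ℂ) 𝓘(ℂ, Fin n → ℂ) (Φ ∘ e.symm) (e y))
    rw [h1]
    have h2 : Function.Injective
        (mfderiv 𝓘(ℂ, Fin n → ℂ) 𝓘(ℂ, Fin n → ℂ) Φ (e.symm (e y))) := by
      rw [e.left_inv hye]
      exact hinj
    exact h2.comp (h3.symm.mfderiv_injective (e.map_source hye))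
  let T : (Fin n → ℂ) ≃L[ℂ] (Fin n → ℂ) :=
    (LinearEquiv.ofInjectiveEndo (fderiv ℂ F (e y)).toLinearMap hFinj).toContinuousLinearEquiv
  have hT : HasFDerivAt F (T : (Fin n → ℂ) →L[ℂ] (Fin n → ℂ)) (F.symm w) := by
    rw [hFs]
    exact (hF.differentiableAt (by simp)).hasFDerivAt
  have hFsymm := F.contDiffAt_symm hwF hT (by rwa [hFs])
  have h6 : ContMDiffAt 𝓘(ℂ, Fin n → ℂ) 𝓘(ℂ, Fin n → ℂ) ω (e.symm ∘ F.symm) w := by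
    refine ContMDiffAt.comp w ?_ hFsymm.contMDiffAt
    rw [hFs]
    exact contMDiffAt_symm_of_mem_maximalAtlas hea (e.map_source hye)
  refine h6.congr_of_eventuallyEq ?_
  filter_upwards [F.open_target.mem_nhds hwF] with w' hw'
  have : Φ.symm w' ∈ e.source := by
    simp only [F, OpenPartialHomeomorph.trans_target, OpenPartialHomeomorph.symm_target,
      mem_inter_iff, mem_preimage] at hw'
    exact hw'.2
  simp [F, e.left_inv this]

/-- The pull-back of `∧_{t} (dz_t ∧ dz̄_t)` in the coordinates of the submanifold. -/
theorem topCoeff_pullback_dzForm {w : Fin n → ℂ} (hw : w ∈ (sliceChart h hj).target)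
    {η : DForm n (2 * n) Y} {c : ℂ}
    (hη : η ((sliceChart h hj).symm w) = c • (dzForm tang).compLinearMap
      (mfderiv 𝓘(ℝ, Fin n → ℂ) 𝓘(ℝ, Fin d → ℂ) (fun y' ↦ φ (j y'))
        ((sliceChart h hj).symm w)).toLinearMap) (v : Fin (2 * n) → Fin n → ℂ) :
    chartRep (sliceChart h hj) η w v = c * dzForm (id : Fin n → Fin n) v := by
  set Φ := sliceChart h hj with hΦ
  have hys : j (Φ.symm w) ∈ φ.source := Φ.map_target hw
  have h1 : mfderiv 𝓘(ℝ, Fin n → ℂ) 𝓘(ℝ, Fin d → ℂ) ((fun y ↦ φ (j y)) ∘ Φ.symm) w = _ :=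
    mfderiv_comp w ((contMDiffAt_comp_embedding_real h hj hys).mdifferentiableAt (by simp))
      (mdifferentiableAt_symm_real (sliceChart_mem_atlas h hj) hw)
  have h2 : (fun y ↦ φ (j y)) ∘ Φ.symm =ᶠ[𝓝 w] tangIncl tang := by
    filter_upwards [Φ.open_target.mem_nhds hw] with w' hw'
    simp only [Function.comp_apply]
    rw [apply_sliceChart_symm h hj hw', φ.right_inv hw']
  rw [h2.mfderiv_eq, mfderiv_eq_fderiv] at h1
  have h3 : fderiv ℝ (tangIncl tang) w = (tangIncl tang).restrictScalars ℝ :=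
    ((tangIncl tang).restrictScalars ℝ).fderiv
  rw [h3] at h1
  change (η (Φ.symm w)) (fun i ↦ mfderiv 𝓘(ℝ, Fin n → ℂ) 𝓘(ℝ, Fin n → ℂ) Φ.symm w (v i)) = _
  rw [hη]
  change c * dzForm tang (fun i ↦ mfderiv 𝓘(ℝ, Fin n → ℂ) 𝓘(ℝ, Fin d → ℂ) (fun y' ↦ φ (j y'))
    (Φ.symm w) (mfderiv 𝓘(ℝ, Fin n → ℂ) 𝓘(ℝ, Fin n → ℂ) Φ.symm w (v i))) = _
  have h4 : (fun i ↦ (mfderiv 𝓘(ℝ, Fin n → ℂ) 𝓘(ℝ, Fin d → ℂ) (fun y' ↦ φ (j y'))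
      (Φ.symm w) (mfderiv 𝓘(ℝ, Fin n → ℂ) 𝓘(ℝ, Fin n → ℂ) Φ.symm w (v i)) : Fin d → ℂ)) =
      fun i ↦ tangIncl tang (v i) := funext fun i ↦
    (congrArg (fun T : (Fin n → ℂ) →L[ℝ] (Fin d → ℂ) ↦ T (v i)) h1).symm
  congr 1
  refine (congrArg (dzForm tang) h4).trans ?_
  rw [dzForm_apply, dzForm_apply]
  congr 1
  ext a b
  simp only [Matrix.of_apply, dzCovector, LinearMap.comp_apply, LinearMap.proj_apply,
    tangIncl_apply_tang, id]

end Slices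

section ResidualDivisor

variable {d n : ℕ} {X : Type*} [TopologicalSpace X] [ChartedSpace (Fin d → ℂ) X]
  [IsManifold 𝓘(ℂ, Fin d → ℂ) ω X]
  {Y : Type*} [TopologicalSpace Y] [ChartedSpace (Fin n → ℂ) Y]
  {φ : OpenPartialHomeomorph X (Fin d → ℂ)} {tang : Fin n ↪ Fin d} {j : Y → X}
  {D : Set X} {S : Finset (Fin d)}

/-- The number of local branches of `D` through `x` is the number of the coordinates with index in
`S` that vanish at `x`. -/
theorem IsAdapted.branchCount_eq (h : IsAdapted D φ S) {x : X} (hx : x ∈ φ.source) :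
    branchCount d D x = (S.filter fun k ↦ φ x k = 0).card := by
  obtain ⟨ψ, hψ, -⟩ := h.exists_centred hx
  exact hψ.branchCount_eq

/-- The tangential coordinates are adapted to the residual divisor. -/
theorem isAdapted_sliceChart [T2Space X] [CompactSpace Y] [Nonempty Y]
    [IsManifold 𝓘(ℂ, Fin n → ℂ) ω Y] (h : IsSlice φ tang j)
    (hj : IsHolEmbedding (n := n) (d := d) j) (hS : IsAdapted D φ S)
    (hR : (Finset.univ.map tang)ᶜ ⊆ S) {κ : ℕ} (hκ : n + κ = d) :
    IsAdapted (residualDivisor d D κ j) (sliceChart h hj)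
      (Finset.univ.filter fun t ↦ tang t ∈ S) := by
  refine ⟨sliceChart_mem_atlas h hj, fun y hy ↦ ?_⟩
  have hyφ : j y ∈ φ.source := hy
  have hcard : (Finset.univ.map tang)ᶜ.card = κ := by
    rw [Finset.card_compl, Finset.card_map, Finset.card_univ, Fintype.card_fin, Fintype.card_fin]
    omega
  have hsub : (Finset.univ.map tang)ᶜ ⊆ S.filter fun k ↦ φ (j y) k = 0 := fun k hk ↦
    Finset.mem_filter.2 ⟨hR hk, (h.mem_range _ hyφ).1 (mem_range_self y) k hk⟩
  change κ < branchCount d D (j y) ↔ _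
  rw [hS.branchCount_eq hyφ, ← hcard]
  constructor
  · intro hlt
    obtain ⟨k, hk, hkR⟩ := Finset.exists_mem_notMem_of_card_lt_card hlt
    obtain ⟨t, rfl⟩ : ∃ t, tang t = k := by simpa using hkR
    rw [Finset.mem_filter] at hk
    exact ⟨t, by simpa using hk.1, hk.2⟩
  · rintro ⟨t, ht, ht0⟩
    refine Finset.card_lt_card ((Finset.ssubset_iff_of_subset hsub).2 ⟨tang t, ?_, by simp⟩)
    rw [Finset.mem_filter]
    exact ⟨by simpa using ht, ht0⟩

end ResidualDivisor

/-! ### The exterior derivative and Stokes' theorem -/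

section Alternating

variable {V : Type*} [NormedAddCommGroup V] [NormedSpace ℝ V] [FiniteDimensional ℝ V] {m : ℕ}

/-- An alternating map on a finite dimensional space as a continuous alternating map. -/
noncomputable def toContinuousAlternating (f : V [⋀^Fin m]→ₗ[ℝ] ℂ) : V [⋀^Fin m]→L[ℝ] ℂ :=
  { f with
    cont := by
      let b := Module.finBasis ℝ V
      have h : ∀ v : Fin m → V, f v =
          ∑ r : Fin m → Fin (Module.finrank ℝ V),
            (∏ i, b.repr (v i) (r i)) • f fun i ↦ b (r i) := by
        intro v
        conv_lhs => rw [show v = fun i ↦ ∑ j, b.repr (v i) j • b j from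
          funext fun i ↦ (b.sum_repr (v i)).symm]
        rw [← AlternatingMap.coe_multilinearMap, MultilinearMap.map_sum]
        exact Finset.sum_congr rfl fun r _ ↦ MultilinearMap.map_smul_univ _ _ _
      change Continuous f
      rw [show (⇑f : (Fin m → V) → ℂ) = _ from funext h]
      refine continuous_finsetSum _ fun r _ ↦ ?_
      have hp : Continuous fun v : Fin m → V ↦ ∏ i, b.repr (v i) (r i) :=
        continuous_finsetProd _ fun i _ ↦
          ((b.coord (r i)).continuous_of_finiteDimensional).comp (continuous_apply i)
      exact hp.smul continuous_const }

theorem toContinuousAlternating_apply (f : V [⋀^Fin m]→ₗ[ℝ] ℂ) (v : Fin m → V) :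
    toContinuousAlternating f v = f v := rfl

/-- A family of alternating maps is differentiable if its values on fixed vectors are. -/
theorem differentiableAt_toContinuousAlternating {E : Type*} [NormedAddCommGroup E]
    [NormedSpace ℝ E] {β : E → V [⋀^Fin m]→ₗ[ℝ] ℂ} {u : E}
    (h : ∀ v, DifferentiableAt ℝ (fun u ↦ β u v) u) :
    DifferentiableAt ℝ (fun u ↦ toContinuousAlternating (β u)) u := by
  let b := Module.finBasis ℝ V
  let ev : (V [⋀^Fin m]→L[ℝ] ℂ) →ₗ[ℝ] ((Fin m → Fin (Module.finrank ℝ V)) → ℂ) :=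
    { toFun := fun f r ↦ f fun i ↦ b (r i)
      map_add' := fun f g ↦ rfl
      map_smul' := fun c f ↦ rfl }
  have hinj : LinearMap.ker ev = ⊥ := by
    refine LinearMap.ker_eq_bot.2 fun f g hfg ↦ ?_
    apply ContinuousAlternatingMap.toAlternatingMap_injective
    refine Module.Basis.ext_alternating b fun r _ ↦ ?_
    exact congrFun hfg r
  obtain ⟨T, hT⟩ := LinearMap.exists_leftInverse_of_injective ev hinj
  have hd : DifferentiableAt ℝ (fun u ↦ ev (toContinuousAlternating (β u))) u :=
    differentiableAt_pi.2 fun r ↦ h _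
  have h1 : (fun u ↦ toContinuousAlternating (β u)) =
      fun u ↦ (LinearMap.toContinuousLinearMap T) (ev (toContinuousAlternating (β u))) :=
    funext fun u ↦ (LinearMap.congr_fun hT (toContinuousAlternating (β u))).symm
  rw [h1]
  exact (LinearMap.toContinuousLinearMap T).differentiableAt.comp u hd

end Alternating

section ExteriorDerivative

variable {n m : ℕ} {Y : Type*} [TopologicalSpace Y] [ChartedSpace (Fin n → ℂ) Y]
  {Φ : OpenPartialHomeomorph Y (Fin n → ℂ)}

/-- The exterior derivative `dγ` of a form of degree `2n - 1`. -/
noncomputable def extDerivForm (hm : m + 1 = 2 * n) (γ : DForm n m Y) : DForm n (2 * n) Y :=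
  fun y ↦ (extDeriv (fun u ↦ toContinuousAlternating (chartRep (chartAt (Fin n → ℂ) y) γ u))
    (chartAt (Fin n → ℂ) y y)).toAlternatingMap.domDomCongr (finCongr hm)

theorem extDerivForm_eq_zero (hm : m + 1 = 2 * n) {γ : DForm n m Y} {y : Y}
    (h : ∀ᶠ y' in 𝓝 y, γ y' = 0) : extDerivForm hm γ y = 0 := by
  have h1 : (fun u ↦ toContinuousAlternating (chartRep (chartAt (Fin n → ℂ) y) γ u))
      =ᶠ[𝓝 (chartAt (Fin n → ℂ) y y)] fun _ ↦ 0 := by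
    filter_upwards [eventually_symm (mem_chart_source _ y) h] with u hu
    ext v
    rw [toContinuousAlternating_apply]
    change (γ _).compLinearMap _ v = 0
    rw [hu]
    rfl
  have h2 : extDeriv (fun _ : Fin n → ℂ ↦ (0 : (Fin n → ℂ) [⋀^Fin m]→L[ℝ] ℂ))
      (chartAt (Fin n → ℂ) y y) = 0 := by
    ext v
    rw [extDeriv_apply (differentiableAt_const _)]
    simp
  rw [extDerivForm, h1.extDeriv_eq, h2]
  rfl

theorem extDerivForm_apply (hm : m + 1 = 2 * n) {γ : DForm n m Y} (hγ : SmoothFormOn γ univ) (y : Y)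
    (v : Fin (2 * n) → Fin n → ℂ) :
    extDerivForm hm γ y v = extDerivAt γ y (fun a ↦ v (Fin.cast hm a)) := by
  change extDeriv _ _ (fun a ↦ v (Fin.cast hm a)) = _
  rw [extDeriv_apply (differentiableAt_toContinuousAlternating fun v ↦
    (hγ y (mem_univ y) v).differentiableAt (by simp))]
  simp [extDerivAt, toContinuousAlternating_apply]

variable [IsManifold 𝓘(ℂ, Fin n → ℂ) ω Y] {γ : DForm n m Y}

/-- The exterior derivative in an arbitrary chart. -/
theorem chartRep_extDerivForm (hm : m + 1 = 2 * n) (hγ : SmoothFormOn γ univ)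
    (hΦ : Φ ∈ IsManifold.maximalAtlas 𝓘(ℂ, Fin n → ℂ) ω Y) {w : Fin n → ℂ} (hw : w ∈ Φ.target)
    (v : Fin (2 * n) → Fin n → ℂ) :
    chartRep Φ (extDerivForm hm γ) w v = ∑ a : Fin (m + 1), (-1 : ℂ) ^ (a : ℕ) *
      fderiv ℝ (fun u ↦ chartRep Φ γ u (a.removeNth fun a ↦ v (Fin.cast hm a))) w
        (v (Fin.cast hm a)) := by
  set y := Φ.symm w with hy
  set c := chartAt (Fin n → ℂ) y with hc
  have hca : c ∈ IsManifold.maximalAtlas 𝓘(ℂ, Fin n → ℂ) ω Y := IsManifold.chart_mem_maximalAtlas y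
  have hyc : y ∈ c.source := mem_chart_source _ y
  have hsm := contDiffAt_transition_real hΦ hca hw hyc
  have h1 : (fun u ↦ toContinuousAlternating (chartRep Φ γ u)) =ᶠ[𝓝 w] fun u ↦
      (toContinuousAlternating (chartRep c γ ((c ∘ Φ.symm) u))).compContinuousLinearMap
        (fderiv ℝ (c ∘ Φ.symm) u) := by
    filter_upwards [isOpen_transition_source.mem_nhds (show w ∈ Φ.target ∩ Φ.symm ⁻¹' c.source from
      ⟨hw, hyc⟩)] with u hu
    ext v
    exact chartRep_transfer hΦ hca hu.1 hu.2 γ v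
  have h2 : DifferentiableAt ℝ (fun u ↦ toContinuousAlternating (chartRep c γ u))
      ((c ∘ Φ.symm) w) :=
    differentiableAt_toContinuousAlternating fun v ↦
      (hγ y (mem_univ y) v).differentiableAt (by simp)
  have h3 := extDeriv_pullback h2 hsm
    (by rw [minSmoothness_of_isRCLikeNormedField]; exact WithTop.coe_le_coe.2 le_top)
  have h4 : DifferentiableAt ℝ (fun u ↦ toContinuousAlternating (chartRep Φ γ u)) w := by
    refine differentiableAt_toContinuousAlternating fun v ↦ ?_
    have h5 := hγ.contDiffAt hΦ (mem_univ y) (Φ.map_target hw) v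
    rw [hy, Φ.right_inv hw] at h5
    exact h5.differentiableAt (by simp)
  have h5 : chartRep Φ (extDerivForm hm γ) w v =
      extDeriv (fun u ↦ toContinuousAlternating (chartRep Φ γ u)) w
        (fun a ↦ v (Fin.cast hm a)) := by
    rw [h1.extDeriv_eq, h3]
    exact congrArg (fun v' : Fin (m + 1) → Fin n → ℂ ↦
      extDeriv (fun u ↦ toContinuousAlternating (chartRep c γ u)) (c y) v')
      (funext fun a ↦ mfderiv_symm_eq_fderiv hΦ hw _)
  rw [h5, extDeriv_apply h4]
  simp [toContinuousAlternating_apply]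

theorem smoothFormOn_extDerivForm (hm : m + 1 = 2 * n) (hγ : SmoothFormOn γ univ) :
    SmoothFormOn (extDerivForm hm γ) univ := by
  refine smoothFormOn_of_contDiffAt fun y _ ↦ ⟨chartAt (Fin n → ℂ) y,
    IsManifold.chart_mem_maximalAtlas y, mem_chart_source _ y, fun v ↦ ?_⟩
  have hc := IsManifold.chart_mem_maximalAtlas (I := 𝓘(ℂ, Fin n → ℂ)) (n := ω) y
  refine ContDiffAt.congr_of_eventuallyEq ?_ (eventually_of_mem
    ((chartAt (Fin n → ℂ) y).open_target.mem_nhds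
      ((chartAt (Fin n → ℂ) y).map_source (mem_chart_source _ y)))
    fun w hw ↦ chartRep_extDerivForm hm hγ hc hw v)
  exact ContDiffAt.sum fun a _ ↦ contDiffAt_const.mul
    (((hγ y (mem_univ y) _).fderiv_right (m := ∞) (by simp)).clm_apply contDiffAt_const)

theorem smoothFormOn_mul {χ : Y → ℝ} (hχ : ContMDiff 𝓘(ℝ, Fin n → ℂ) 𝓘(ℝ, ℝ) ∞ χ)
    (hγ : SmoothFormOn γ univ) : SmoothFormOn (fun y ↦ (χ y : ℂ) • γ y) univ :=
  hγ.smul fun y _ ↦ ContMDiffAt.comp (I' := 𝓘(ℝ, ℝ)) (g := fun r : ℝ ↦ (r : ℂ)) y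
    Complex.ofRealCLM.contDiff.contMDiff.contMDiffAt (hχ y)

/-- Since the functions `χ_b` add up to one, an exact form is the sum of the exact forms `d(χ_b
γ)`, without terms in `dχ_b ∧ γ`. -/
theorem extDerivForm_sum (hm : m + 1 = 2 * n) (hγ : SmoothFormOn γ univ) {B : Finset Y}
    {χ : Y → Y → ℝ} (hχ : ∀ b, ContMDiff 𝓘(ℝ, Fin n → ℂ) 𝓘(ℝ, ℝ) ∞ (χ b))
    (h1 : ∀ y, ∑ b ∈ B, χ b y = 1) (y : Y) :
    extDerivForm hm γ y = ∑ b ∈ B, extDerivForm hm (fun y ↦ (χ b y : ℂ) • γ y) y := by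
  have hsum : ∀ (F : Y → (Fin n → ℂ) [⋀^Fin (2 * n)]→ₗ[ℝ] ℂ) (v : Fin (2 * n) → Fin n → ℂ),
      (∑ b ∈ B, F b) v = ∑ b ∈ B, F b v := fun F v ↦
    map_sum (⟨⟨fun G ↦ G v, rfl⟩, fun _ _ ↦ rfl⟩ :
      ((Fin n → ℂ) [⋀^Fin (2 * n)]→ₗ[ℝ] ℂ) →+ ℂ) F B
  have key : ∀ v : Fin (2 * n) → Fin n → ℂ, extDerivForm hm γ y v =
      ∑ b ∈ B, extDerivForm hm (fun y ↦ (χ b y : ℂ) • γ y) y v := ?_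
  · exact AlternatingMap.ext fun v ↦ (key v).trans (hsum _ v).symm
  intro v
  refine (extDerivForm_apply hm hγ y v).trans ?_
  rw [Finset.sum_congr rfl fun b _ ↦ extDerivForm_apply hm (smoothFormOn_mul (hχ b) hγ) y v]
  simp only [extDerivAt]
  rw [Finset.sum_comm]
  refine Finset.sum_congr rfl fun a _ ↦ ?_
  rw [← Finset.mul_sum]
  congr 1
  have h3 : ∀ w, (fun u ↦ chartRep (chartAt (Fin n → ℂ) y) γ u w) = fun u ↦
      ∑ b ∈ B, chartRep (chartAt (Fin n → ℂ) y) (fun y ↦ (χ b y : ℂ) • γ y) u w := by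
    intro w
    funext u
    have : ∀ b, chartRep (chartAt (Fin n → ℂ) y) (fun y ↦ (χ b y : ℂ) • γ y) u w =
        (χ b ((chartAt (Fin n → ℂ) y).symm u) : ℂ) * chartRep (chartAt (Fin n → ℂ) y) γ u w :=
      fun b ↦ rfl
    simp only [this]
    rw [← Finset.sum_mul, ← Complex.ofReal_sum, h1, Complex.ofReal_one, one_mul]
  rw [h3, fderiv_fun_sum fun b _ ↦ (smoothFormOn_mul (hχ b) hγ y (mem_univ y) _).differentiableAt
    (by simp), _root_.sum_apply]

end ExteriorDerivative

section Stokes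

theorem integral_fderiv_eq_zero {n : ℕ} {f : (Fin n → ℂ) → ℂ} (hf : IsTest f) (e : Fin n → ℂ) :
    ∫ u, fderiv ℝ f u e = 0 := by
  have hc : Continuous fun u ↦ fderiv ℝ f u e :=
    (hf.1.continuous_fderiv (by simp)).clm_apply continuous_const
  have hs : HasCompactSupport fun u ↦ fderiv ℝ f u e :=
    (hf.2.fderiv (𝕜 := ℝ)).comp_left (g := fun L : (Fin n → ℂ) →L[ℝ] ℂ ↦ L e) rfl
  have h := integral_mul_fderiv_eq_neg_fderiv_mul_of_integrable (𝕜 := ℂ) (μ := volume)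
    (f := fun _ : Fin n → ℂ ↦ (1 : ℂ)) (g := f) (v := e)
    (by simp) (by simpa using hc.integrable_of_hasCompactSupport hs)
    (by simpa using hf.1.continuous.integrable_of_hasCompactSupport hf.2)
    (fun _ _ ↦ differentiableAt_const _) fun u _ ↦ hf.1.differentiable (by simp) u
  simpa using h

theorem tsupport_chartExtend_subset {n : ℕ} {Y : Type*} [TopologicalSpace Y] [CompactSpace Y]
    {Φ : OpenPartialHomeomorph Y (Fin n → ℂ)} {χ : Y → ℝ} (hχ : tsupport χ ⊆ Φ.source)
    (g : (Fin n → ℂ) → ℂ) : tsupport (chartExtend Φ χ g) ⊆ Φ '' tsupport χ := by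
  refine closure_minimal (fun u hu ↦ ?_) ((isClosed_tsupport χ).isCompact.image_of_continuousOn
    (Φ.continuousOn.mono hχ)).isClosed
  by_cases hut : u ∈ Φ.target
  · refine ⟨Φ.symm u, subset_tsupport χ fun h ↦ hu ?_, Φ.right_inv hut⟩
    rw [chartExtend_of_mem hut, h]
    simp
  · exact absurd (chartExtend_of_notMem hut) hu

variable {n m : ℕ} {Y : Type*} [TopologicalSpace Y] [ChartedSpace (Fin n → ℂ) Y]
  [IsManifold 𝓘(ℂ, Fin n → ℂ) ω Y] [CompactSpace Y]
  {Φ : OpenPartialHomeomorph Y (Fin n → ℂ)} {γ : DForm n m Y}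

variable [T2Space Y]

/-- The regularised integral of an exact form supported in a chart is regular at the origin, where
its value is the integral of the form, which vanishes by Stokes' theorem. -/
theorem formLeading_extDerivForm_of_tsupport (hm : m + 1 = 2 * n) (hγ : SmoothFormOn γ univ)
    (hΦ : Φ ∈ IsManifold.maximalAtlas 𝓘(ℂ, Fin n → ℂ) ω Y) {U : Set Y} (hU : IsOpen U)
    (hUΦ : U ⊆ Φ.source) {I : Fin n → ℕ} {v : (Fin n → ℂ) → ℝ} (hv : ContDiff ℝ ∞ v) {W : Y → ℝ}
    (hW : ∀ y ∈ U, W y = (∏ j, ‖Φ y j‖ ^ I j) * Real.exp (v (Φ y)))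
    {χ : Y → ℝ} (hχ : ContMDiff 𝓘(ℝ, Fin n → ℂ) 𝓘(ℝ, ℝ) ∞ χ) (hχU : tsupport χ ⊆ U) :
    FormLeading W (extDerivForm hm fun y ↦ (χ y : ℂ) • γ y) 0 0 := by
  let e : Fin (m + 1) → Fin n → ℂ := fun a ↦ realBasis n (Fin.cast hm a)
  let g : Fin (m + 1) → (Fin n → ℂ) → ℂ := fun a ↦
    chartExtend Φ χ fun u ↦ chartRep Φ γ u (a.removeNth e)
  have hg : ∀ a, IsTest (g a) := fun a ↦ isTest_chartExtend hΦ hχ hU hUΦ hχU fun u hu ↦ by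
    have h1 := hγ.contDiffAt hΦ (mem_univ _) (hUΦ hu.2) (a.removeNth e)
    rw [Φ.right_inv hu.1] at h1
    exact h1.contDiffWithinAt
  let f : (Fin n → ℂ) → ℂ := fun u ↦ ∑ a : Fin (m + 1), (-1 : ℂ) ^ (a : ℕ) * fderiv ℝ (g a) u (e a)
  have hfd : ∀ a, IsTest fun u ↦ fderiv ℝ (g a) u (e a) := fun a ↦
    ⟨((hg a).1.fderiv_right (m := ∞) (by simp)).clm_apply contDiff_const,
      ((hg a).2.fderiv (𝕜 := ℝ)).comp_left (g := fun L : (Fin n → ℂ) →L[ℝ] ℂ ↦ L (e a)) rfl⟩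
  have hfi : ∀ a ∈ (Finset.univ : Finset (Fin (m + 1))),
      Integrable fun u ↦ (-1 : ℂ) ^ (a : ℕ) * fderiv ℝ (g a) u (e a) :=
    fun a _ ↦ ((hfd a).1.continuous.integrable_of_hasCompactSupport (hfd a).2).const_mul _
  have hQ : IsCompact (Φ '' tsupport χ) := (isClosed_tsupport χ).isCompact.image_of_continuousOn
    (Φ.continuousOn.mono (hχU.trans hUΦ))
  have hf0 : ∀ u ∉ Φ '' tsupport χ, f u = 0 := fun u hu ↦ by
    refine Finset.sum_eq_zero fun a _ ↦ ?_
    have : fderiv ℝ (g a) u = 0 := by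
      by_contra h
      exact hu (tsupport_chartExtend_subset (hχU.trans hUΦ) _ (support_fderiv_subset ℝ h))
    rw [this]
    simp
  have hf : IsTest f := ⟨ContDiff.sum fun a _ ↦ contDiff_const.mul (hfd a).1,
    HasCompactSupport.intro hQ hf0⟩
  have hint : ∫ z, singKer I 0 0 0 z * f z = 0 := by
    have h1 : ∀ z, singKer I (0 : Fin n → ℕ) 0 0 z = 1 := fun z ↦ by
      simp [singKer, coordKer_zero_left]
    simp only [h1, one_mul, f]
    rw [integral_finsetSum _ hfi]
    refine Finset.sum_eq_zero fun a _ ↦ ?_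
    rw [integral_const_mul, integral_fderiv_eq_zero (hg a), mul_zero]
  have hlead := hasLeading_singInt_of_le_one (I := I) (J := 0) (K := 0)
    (v := fun u ↦ 2 * (v u : ℂ)) (continuous_const.mul (Complex.continuous_ofReal.comp
      hv.continuous)) hf.1.continuous hf.2 (by simp)
  rw [hint] at hlead
  refine formLeading_of_hasLeading_singInt hΦ (fun y hy ↦ ?_) (by simp) hv.continuous hf
    (fun u hu ↦ hf0 u ?_) (fun u hu hfu ↦ ?_) (fun u hu _ ↦ ?_) hlead
  · refine extDerivForm_eq_zero hm ?_
    filter_upwards [(isClosed_tsupport χ).isOpen_compl.mem_nhds fun h ↦ hy (hUΦ (hχU h))]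
      with y' hy'
    rw [image_eq_zero_of_notMem_tsupport hy']
    simp
  · rintro ⟨y, hy, rfl⟩
    exact hu (Φ.map_source (hUΦ (hχU hy)))
  · obtain ⟨y, hy, rfl⟩ : u ∈ Φ '' tsupport χ := by_contra fun h ↦ hfu (hf0 u h)
    rw [Φ.left_inv (hUΦ (hχU hy)), hW y (hχU hy)]
  · have h1 : topCoeff Φ (extDerivForm hm fun y ↦ (χ y : ℂ) • γ y) u = _ :=
      chartRep_extDerivForm hm (smoothFormOn_mul hχ hγ) hΦ hu (realBasis n)
    rw [h1]
    simp only [Pi.zero_apply, pow_zero, mul_one, Finset.prod_const_one, inv_one, one_mul]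
    refine Finset.sum_congr rfl fun a _ ↦ ?_
    congr 2
    refine Filter.EventuallyEq.fderiv_eq ?_
    filter_upwards [Φ.open_target.mem_nhds hu] with u' hu'
    exact (chartExtend_of_mem (χ := χ) (g := fun u ↦ chartRep Φ γ u (a.removeNth e)) hu').symm

/-- Exact forms do not contribute to the value at the origin. -/
theorem formLeading_extDerivForm (hm : m + 1 = 2 * n) (hγ : SmoothFormOn γ univ) {W : Y → ℝ}
    (hW : ∀ y, ∃ Φ ∈ IsManifold.maximalAtlas 𝓘(ℂ, Fin n → ℂ) ω Y, y ∈ Φ.source ∧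
      ∃ (I : Fin n → ℕ) (v : (Fin n → ℂ) → ℝ), ContDiff ℝ ∞ v ∧
        ∀ᶠ y' in 𝓝 y, W y' = (∏ j, ‖Φ y' j‖ ^ I j) * Real.exp (v (Φ y'))) :
    FormLeading W (extDerivForm hm γ) 0 0 := by
  choose Φ hΦ hyΦ I v hv hw using hW
  choose U hU hUo hyU using fun y ↦ eventually_nhds_iff.1 (hw y)
  obtain ⟨B, χ, hχ, hχU, hsum⟩ := exists_finite_smooth_partition (d := n)
    (fun y ↦ U y ∩ (Φ y).source) (fun y ↦ (hUo y).inter (Φ y).open_source)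
    fun y ↦ ⟨hyU y, hyΦ y⟩
  have h1 := FormLeading.sum (d := n) (X := Y) (W := W) B fun b _ ↦
    formLeading_extDerivForm_of_tsupport hm hγ (hΦ b)
    ((hUo b).inter (Φ b).open_source) inter_subset_right (hv b) (fun y hy ↦ hU b y hy.1)
    (hχ b) (hχU b)
  simp only [Finset.sum_const_zero] at h1
  have h2 : extDerivForm hm γ =
      fun y : Y ↦ ∑ b ∈ B, extDerivForm hm (fun y ↦ (χ b y : ℂ) • γ y) y :=
    funext fun y ↦ extDerivForm_sum hm hγ hχ hsum y
  rw [h2]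
  exact h1

end Stokes

/-! ### The residue of the numerator -/

theorem eq_zero_or_of_commonPoles {d : ℕ} {J K : Fin d → ℕ} {j : Fin d}
    (hj : j ∉ commonPoles J K) : J j = 0 ∨ K j = 0 := by
  simp only [commonPoles, Finset.mem_filter, Finset.mem_univ, true_and, not_and_or, not_not] at hj
  exact hj

theorem one_le_of_commonPoles {d : ℕ} {J K : Fin d → ℕ} {j : Fin d}
    (hj : j ∈ commonPoles J K) : 1 ≤ J j ∧ 1 ≤ K j := by
  have := (Finset.mem_filter.1 hj).2
  omega

theorem residueList_const_mul {d : ℕ} (J K : Fin d → ℕ) (l : List (Fin d)) (c : ℂ)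
    (f : (Fin d → ℂ) → ℂ) :
    residueList J K l (fun z ↦ c * f z) = fun z ↦ c * residueList J K l f z := by
  induction l with
  | nil => rfl
  | cons j l ih =>
    change residueStep j (J j) (K j) (residueList J K l fun z ↦ c * f z) = _
    rw [ih, residueStep_const_mul]
    rfl

theorem pvInt_const_mul {n : ℕ} (J K : Fin n → ℕ) (c : ℂ) (f : (Fin n → ℂ) → ℂ) :
    pvInt J K (fun z ↦ c * f z) = c * pvInt J K f := by
  simp only [pvInt, residueList_const_mul, ← integral_const_mul]
  congr 1
  ext w
  ring

theorem prod_pow_mul_conj_ne_zero {d : ℕ} {T : Finset (Fin d)} {J K : Fin d → ℕ} {z : Fin d → ℂ}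
    (h : ∀ j ∈ T, z j ≠ 0 ∨ J j = 0 ∧ K j = 0) :
    ∏ j ∈ T, (z j ^ J j * starRingEnd ℂ (z j) ^ K j) ≠ 0 := by
  refine Finset.prod_ne_zero_iff.2 fun j hj ↦ ?_
  rcases h j hj with h | ⟨h1, h2⟩
  · exact mul_ne_zero (pow_ne_zero _ h) (pow_ne_zero _ (by simpa using h))
  · simp [h1, h2]

section Numerators

variable {d k : ℕ} {X : Type*} [TopologicalSpace X] [ChartedSpace (Fin d → ℂ) X]
  {φ : OpenPartialHomeomorph X (Fin d → ℂ)} {x : X} {D : Set X} {S R : Finset (Fin d)}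

/-- At a point of the deepest stratum the coordinates with poles of both types are the equations of
the stratum: near the point, `κ` is at most the number of those among them that vanish, and it
equals the number `κ(α)` of all of them at a point where no coordinates other than the equations of
the stratum vanish. -/
theorem commonPoles_eq_of_mem_deepStratum [IsManifold 𝓘(ℂ, Fin d → ℂ) ω X]
    {α : DForm d k X} {J K : Fin d → ℕ} (h : IsAdapted D φ S) (hx : x ∈ φ.source)
    (hJK : ∀ j ∉ S, J j = 0 ∧ K j = 0)
    (hp : IsDenominator D α x (fun y ↦ ∏ j, (φ y j ^ J j * starRingEnd ℂ (φ y j) ^ K j)))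
    (hcard : (commonPoles J K).card = kappaAt D α x) (hxE : x ∈ deepStratum D α)
    (hE : ∀ y ∈ φ.source, y ∈ deepStratum D α ↔ ∀ j ∈ R, φ y j = 0)
    (hR : R.card = kappa D α) : commonPoles J K = R := by
  obtain ⟨y, hy, hle, h0⟩ := exists_coord_eq_zero_iff hx ((hE x hx).1 hxE)
    (h.eventually_kappaAt_le hx hJK hp)
  have hyE : kappaAt D α y = kappa D α := (hE y hy).2 fun j hj ↦ (h0 j).2 hj
  have hxE' : kappaAt D α x = kappa D α := hxE
  have h1 : (commonPoles J K).filter (fun j ↦ φ y j = 0) = commonPoles J K :=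
    Finset.eq_of_subset_of_card_le (Finset.filter_subset _ _) (by omega)
  refine Finset.eq_of_subset_of_card_le (fun j hj ↦ ?_) (by omega)
  rw [← h1, Finset.mem_filter, h0] at hj
  exact hj.2

/-- The relation between the numerators `ψ` and `b` of the same form for the pole orders `(J', K')`
along `R` and for the pole orders `(J, K)`: it extends across the hypersurfaces `z_j = 0`, `j ∈ R`,
by continuity. -/
theorem numerator_relation (h : IsAdapted D φ S) {η : DForm d (2 * d) X} {U : Set X}
    (hU : IsOpen U) {b ψ : (Fin d → ℂ) → ℂ} {J K J' K' : Fin d → ℕ}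
    (hb : ContinuousOn b (φ.target ∩ φ.symm ⁻¹' U))
    (hbη : ∀ u ∈ φ.target, φ.symm u ∈ U → φ.symm u ∉ D →
      b u = (∏ j, (u j ^ J j * starRingEnd ℂ (u j) ^ K j)) * topCoeff φ η u)
    (hψ : ContinuousOn ψ {z | z ∈ φ.target ∧ ∀ j ∈ S \ R, z j ≠ 0})
    (hψη : ∀ z ∈ φ.target, (∀ j ∈ S, z j ≠ 0) →
      (∏ j ∈ R, (z j ^ J' j * starRingEnd ℂ (z j) ^ K' j)) • chartRep φ η z =
        ψ z • dzForm (id : Fin d → Fin d))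
    {z : Fin d → ℂ} (hz : z ∈ φ.target) (hzU : φ.symm z ∈ U) (hzS : ∀ j ∈ S \ R, z j ≠ 0) :
    (-2 * Complex.I) ^ d * ψ z * ∏ j, (z j ^ J j * starRingEnd ℂ (z j) ^ K j) =
      (∏ j ∈ R, (z j ^ J' j * starRingEnd ℂ (z j) ^ K' j)) * b z := by
  have hopen : IsOpen {z | z ∈ φ.target ∧ ∀ j ∈ S \ R, z j ≠ 0} := by
    refine φ.open_target.inter ?_
    change IsOpen {z : Fin d → ℂ | ∀ j ∈ S \ R, z j ≠ 0}
    simp only [ofPred_forall]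
    exact isOpen_biInter_finset fun j _ ↦ isOpen_ne_fun (continuous_apply j) continuous_const
  have hopen' : IsOpen (φ.target ∩ φ.symm ⁻¹' U) := φ.symm.isOpen_inter_preimage hU
  have hmon : ∀ (T : Finset (Fin d)) (J K : Fin d → ℕ),
      Continuous fun z : Fin d → ℂ ↦ ∏ j ∈ T, (z j ^ J j * starRingEnd ℂ (z j) ^ K j) :=
    fun T J K ↦ continuous_finsetProd _ fun j _ ↦ ((continuous_apply j).pow _).mul
      ((Complex.continuous_conj.comp (continuous_apply j)).pow _)
  by_contra hne
  have hc : ContinuousAt (fun z ↦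
      (-2 * Complex.I) ^ d * ψ z * ∏ j, (z j ^ J j * starRingEnd ℂ (z j) ^ K j) -
      (∏ j ∈ R, (z j ^ J' j * starRingEnd ℂ (z j) ^ K' j)) * b z) z :=
    ((continuousAt_const.mul (hψ.continuousAt (hopen.mem_nhds ⟨hz, hzS⟩))).mul
      (hmon Finset.univ J K).continuousAt).sub ((hmon R J' K').continuousAt.mul
        (hb.continuousAt (hopen'.mem_nhds ⟨hz, hzU⟩)))
  have hev := (hc.eventually_ne (sub_ne_zero.2 hne)).and (hopen'.mem_nhds ⟨hz, hzU⟩)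
  rw [← φ.right_inv hz] at hev
  obtain ⟨y, hy, ⟨h1, h2⟩, h0⟩ := exists_coord_eq_zero_iff (φ.map_target hz) (T := ∅) (by simp)
    (eventually_chart (φ.map_target hz) hev)
  have h0' : ∀ j, φ y j ≠ 0 := fun j hj ↦ by simpa using (h0 j).1 hj
  have hyt := φ.map_source hy
  refine h1 (sub_eq_zero.2 ?_)
  have hyD : φ.symm (φ y) ∉ D := by
    rw [φ.left_inv hy, h.2 y hy]
    rintro ⟨j, -, hj⟩
    exact h0' j hj
  rw [hbη _ hyt h2.2 hyD]
  have h3 : (∏ j ∈ R, (φ y j ^ J' j * starRingEnd ℂ (φ y j) ^ K' j)) * topCoeff φ η (φ y) =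
      ψ (φ y) * (-2 * Complex.I) ^ d := by
    have h4 := congrArg (fun F : (Fin d → ℂ) [⋀^Fin (2 * d)]→ₗ[ℝ] ℂ ↦ F (realBasis d))
      (hψη _ hyt fun j _ ↦ h0' j)
    rw [← dzForm_realBasis]
    exact h4
  linear_combination (-∏ j, (φ y j ^ J j * starRingEnd ℂ (φ y j) ^ K j)) * h3

/-- The iterated residue does not depend on the pole orders, and commutes with functions of the
remaining coordinates. -/
theorem residueIter_relation {Ω : Set (Fin d → ℂ)} (hΩ : IsOpen Ω) {b ψ c : (Fin d → ℂ) → ℂ}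
    {J K J' K' : Fin d → ℕ} {C : ℂ} (hb : ContDiffOn ℝ ∞ b Ω) (hψ : ContDiffOn ℝ ∞ ψ Ω)
    (hc : ContDiffOn ℝ ∞ c Ω) (hJK : ∀ j ∈ R, 1 ≤ J j ∧ 1 ≤ K j)
    (hJK' : ∀ j ∈ R, 1 ≤ J' j ∧ 1 ≤ K' j)
    (hrel : ∀ z ∈ Ω, C * ψ z * ∏ j, (z j ^ J j * starRingEnd ℂ (z j) ^ K j) =
      (∏ j ∈ R, (z j ^ J' j * starRingEnd ℂ (z j) ^ K' j)) * b z)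
    {z : Fin d → ℂ} (hz : z ∈ Ω) (hzR : ∀ j ∈ R, z j = 0) :
    residueIter R J K (fun z ↦ c z * b z) z =
      C * (∏ j ∈ Rᶜ, (z j ^ J j * starRingEnd ℂ (z j) ^ K j)) *
        residueIter R J' K' (fun z ↦ c z * ψ z) z := by
  have h1 := residueIter_mul_monomial hΩ (R := R) (J := J') (K := K') (A := J) (B := K)
    (J' := fun j ↦ J' j + J j) (K' := fun j ↦ K' j + K j)
    (m := fun z ↦ C * ∏ j ∈ Rᶜ, (z j ^ J j * starRingEnd ℂ (z j) ^ K j))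
    (f := fun z ↦ c z * ψ z) hJK' (fun _ _ ↦ rfl) (fun _ _ ↦ rfl)
    (contDiff_const.mul (contDiff_prod fun j _ ↦ ((contDiff_coord j).pow (J j)).mul
      ((contDiff_coord_conj j).pow (K j)))).contDiffOn
    (fun j hj z a ↦ by
      congr 1
      refine Finset.prod_congr rfl fun i hi ↦ ?_
      have : i ≠ j := fun h ↦ Finset.mem_compl.1 hi (h ▸ hj)
      simp [this])
    (hc.mul hψ) hz hzR
  have h2 := residueIter_mul_monomial hΩ (R := R) (J := J) (K := K) (A := J') (B := K')
    (J' := fun j ↦ J' j + J j) (K' := fun j ↦ K' j + K j) (m := fun _ ↦ 1)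
    (f := fun z ↦ c z * b z) hJK (fun _ _ ↦ add_comm _ _) (fun _ _ ↦ add_comm _ _)
    contDiffOn_const (fun _ _ _ _ ↦ rfl) (hc.mul hb) hz hzR
  rw [one_mul] at h2
  rw [← h2, ← h1]
  refine residueIter_eqOn hΩ (fun z hz ↦ ?_) _ _ _ hz
  have h3 := hrel z hz
  rw [← Finset.prod_mul_prod_compl R] at h3
  linear_combination (-(c z)) * h3

end Numerators

theorem IsTest.comp_tangIncl {d n : ℕ} (tang : Fin n ↪ Fin d) {f : (Fin d → ℂ) → ℂ}
    (hf : IsTest f) : IsTest (f ∘ tangIncl tang) := by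
  refine ⟨hf.1.comp (contDiff_tangIncl tang), hf.2.comp_isClosedEmbedding ?_⟩
  refine (Function.LeftInverse.isClosedEmbedding (f := fun z : Fin d → ℂ ↦ z ∘ tang)
    (fun w ↦ ?_) (by fun_prop) (contDiff_tangIncl tang).continuous)
  ext t
  exact tangIncl_apply_tang tang w t

/-! ### The local residue form -/

section ResidueForm

variable {d n : ℕ} {X : Type*} [TopologicalSpace X]
  {φ : OpenPartialHomeomorph X (Fin d → ℂ)} {R : Finset (Fin d)} {J K : Fin d → ℕ}

theorem residueIter_eq_zero {f : (Fin d → ℂ) → ℂ} {Ω : Set (Fin d → ℂ)} (hΩ : IsOpen Ω)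
    (h : ∀ z ∈ Ω, f z = 0) {z : Fin d → ℂ} (hz : z ∈ Ω) : residueIter R J K f z = 0 := by
  have h1 := residueIter_eqOn hΩ (f := f) (g := fun _ ↦ 0) h R J K hz
  rwa [residueIter_zero] at h1

theorem residueIter_cutoff_eq_zero {χ : X → ℝ} {ψ : (Fin d → ℂ) → ℂ} {z : Fin d → ℂ}
    (hz : z ∈ φ.target) (h : φ.symm z ∉ tsupport χ) :
    residueIter R J K (fun z ↦ (χ (φ.symm z) : ℂ) * ψ z) z = 0 := by
  refine residueIter_eq_zero (φ.symm.isOpen_inter_preimage (isClosed_tsupport χ).isOpen_compl)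
    (fun u hu ↦ ?_) ⟨hz, h⟩
  rw [image_eq_zero_of_notMem_tsupport hu.2]
  simp

theorem isOpen_residue_domain {S : Finset (Fin d)} :
    IsOpen {z | z ∈ φ.target ∧ ∀ k ∈ S \ R, z k ≠ 0} := by
  refine φ.open_target.inter ?_
  change IsOpen {z : Fin d → ℂ | ∀ j ∈ S \ R, z j ≠ 0}
  simp only [ofPred_forall]
  exact isOpen_biInter_finset fun j _ ↦ isOpen_ne_fun (continuous_apply j) continuous_const

variable {Y : Type*} [TopologicalSpace Y] [ChartedSpace (Fin n → ℂ) Y]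
  {tang : Fin n ↪ Fin d} {j : Y → X}

open Classical in
/-- The contribution of a single chart to the iterated residue: the pull-back under `j` of
`(∏_{k ∈ R} 1/((J_k-1)!(K_k-1)!) ∂_k^{J_k-1} ∂̄_k^{K_k-1}) f ∧_t (dz_{tang t} ∧ dz̄_{tang t})`. -/
noncomputable def residueForm (φ : OpenPartialHomeomorph X (Fin d → ℂ)) (tang : Fin n ↪ Fin d)
    (R : Finset (Fin d)) (J K : Fin d → ℕ) (f : (Fin d → ℂ) → ℂ) (j : Y → X) :
    DForm n (2 * n) Y :=
  fun y ↦ if j y ∈ φ.source then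
    residueIter R J K f (φ (j y)) • (dzForm tang).compLinearMap
      (mfderiv 𝓘(ℝ, Fin n → ℂ) 𝓘(ℝ, Fin d → ℂ) (fun y' ↦ φ (j y')) y).toLinearMap
  else 0

theorem residueForm_of_mem {f : (Fin d → ℂ) → ℂ} {y : Y} (hy : j y ∈ φ.source) :
    residueForm φ tang R J K f j y = residueIter R J K f (φ (j y)) • (dzForm tang).compLinearMap
      (mfderiv 𝓘(ℝ, Fin n → ℂ) 𝓘(ℝ, Fin d → ℂ) (fun y' ↦ φ (j y')) y).toLinearMap :=
  if_pos hy

theorem residueForm_of_notMem {f : (Fin d → ℂ) → ℂ} {y : Y} (hy : j y ∉ φ.source) :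
    residueForm φ tang R J K f j y = 0 :=
  if_neg hy

/-- The residue of a localised form is supported in the support of the cutoff function. -/
theorem residueForm_cutoff_eq_zero {χ : X → ℝ} {ψ : (Fin d → ℂ) → ℂ} {y : Y}
    (h : j y ∉ tsupport χ) :
    residueForm φ tang R J K (fun z ↦ (χ (φ.symm z) : ℂ) * ψ z) j y = 0 := by
  by_cases hy : j y ∈ φ.source
  · rw [residueForm_of_mem hy, residueIter_cutoff_eq_zero (φ.map_source hy), zero_smul]
    rwa [φ.left_inv hy]
  · exact residueForm_of_notMem hy

/-- In the tangential coordinates, the coefficient of the residue form is the iterated residue, up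
to the constant `(-2i)^n` relating `∧ dz_t ∧ dz̄_t` to Lebesgue measure. -/
theorem topCoeff_residueForm [T2Space X] [ChartedSpace (Fin d → ℂ) X] [CompactSpace Y] [Nonempty Y]
    [IsManifold 𝓘(ℂ, Fin d → ℂ) ω X] [IsManifold 𝓘(ℂ, Fin n → ℂ) ω Y] (h : IsSlice φ tang j)
    (hj : IsHolEmbedding (n := n) (d := d) j) {f : (Fin d → ℂ) → ℂ} {w : Fin n → ℂ}
    (hw : w ∈ (sliceChart h hj).target) :
    topCoeff (sliceChart h hj) (residueForm φ tang R J K f j) w =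
      residueIter R J K f (tangIncl tang w) * (-2 * Complex.I) ^ n := by
  have hys : j ((sliceChart h hj).symm w) ∈ φ.source := (sliceChart h hj).map_target hw
  have h1 := topCoeff_pullback_dzForm h hj hw
    (residueForm_of_mem (R := R) (J := J) (K := K) (f := f) hys) (realBasis n)
  rw [dzForm_realBasis, apply_sliceChart_symm h hj hw, φ.right_inv hw] at h1
  exact h1

end ResidueForm

/-! ### The comparison near a point of the deepest stratum -/

section Comparison

variable {d n k l : ℕ} {X : Type*} [TopologicalSpace X] [T2Space X] [CompactSpace X]
  [ChartedSpace (Fin d → ℂ) X] [IsManifold 𝓘(ℂ, Fin d → ℂ) ω X]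
  {Y : Type*} [TopologicalSpace Y] [T2Space Y] [CompactSpace Y]
  [ChartedSpace (Fin n → ℂ) Y] [IsManifold 𝓘(ℂ, Fin n → ℂ) ω Y]
  {φ : OpenPartialHomeomorph X (Fin d → ℂ)} {tang : Fin n ↪ Fin d} {j : Y → X}
  {D : Set X} {S R : Finset (Fin d)}
  {L : X → Type*} [∀ x, TopologicalSpace (L x)] [∀ x, AddCommGroup (L x)]
  [∀ x, Module ℂ (L x)] [TopologicalSpace (TotalSpace ℂ L)] [FiberBundle ℂ L]
  [VectorBundle ℂ ℂ L] [ContMDiffVectorBundle ω ℂ L 𝓘(ℂ, Fin d → ℂ)] {s : ∀ x, L x}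
  {M : Y → Type*} [∀ y, TopologicalSpace (M y)] [∀ y, AddCommGroup (M y)]
  [∀ y, Module ℂ (M y)] [TopologicalSpace (TotalSpace ℂ M)] [FiberBundle ℂ M]
  [VectorBundle ℂ ℂ M] [ContMDiffVectorBundle ω ℂ M 𝓘(ℂ, Fin n → ℂ)] {t : ∀ y, M y}

/-- The theorem near a point of the deepest stratum. Both sides are multiples of the same principal
value integral of the iterated residue: the singular integral on `X` by `hasLeading_singInt`, and
the one on the submanifold by `hasLeading_singInt_of_one_type`, since the residue keeps the poles
in the tangential coordinates, and there has poles of only one type along each of them. -/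
theorem exists_formLeading_pair_of_slice {α : DForm d k X} (hα : IsQuasiMeromorphic D α)
    (hkl : k + l = 2 * d) {ξ : DForm d l X} (hξ : SmoothFormOn ξ univ)
    (hs : IsHolSection d s) (hsD : ∀ x, s x = 0 ↔ x ∈ D) (h : LineMetric d L)
    (ho : ∀ x ∈ deepStratum D α, orderAt D α s x = orderMax D α s)
    (hn : n + kappa D α = d) (hj : IsHolEmbedding (n := n) (d := d) j)
    (hjE : range j = deepStratum D α) (ht : IsHolSection n t)
    (htD : ∀ y, t y = 0 ↔ y ∈ residualDivisor d D (kappa D α) j) (g : LineMetric n M)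
    (hsl : IsSlice φ tang j) (hS : IsAdapted D φ S) (hR : R = (Finset.univ.map tang)ᶜ)
    (hRS : R ⊆ S) {J' K' : Fin d → ℕ} (hJK' : ∀ k ∈ R, 1 ≤ J' k ∧ 1 ≤ K' k)
    {ψ : (Fin d → ℂ) → ℂ} (hψ : ContDiffOn ℝ ∞ ψ {z | z ∈ φ.target ∧ ∀ k ∈ S \ R, z k ≠ 0})
    (hψη : ∀ z ∈ φ.target, (∀ k ∈ S, z k ≠ 0) →
      (∏ k ∈ R, (z k ^ J' k * starRingEnd ℂ (z k) ^ K' k)) • chartRep φ (topWedge hkl α ξ) z =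
        ψ z • dzForm (id : Fin d → Fin d))
    {y : Y} (hy : j y ∈ φ.source) :
    ∃ U : Set X, IsOpen U ∧ j y ∈ U ∧ ∀ χ : X → ℝ,
      ContMDiff 𝓘(ℝ, Fin d → ℂ) 𝓘(ℝ, ℝ) ∞ χ → tsupport χ ⊆ U → ∃ c c' : ℂ,
      FormLeading (fun x ↦ h.len x (s x)) (fun x ↦ (χ x : ℂ) • topWedge hkl α ξ x) (kappa D α) c ∧
      FormLeading (fun y ↦ g.len y (t y))
        (residueForm φ tang R J' K' (fun z ↦ (χ (φ.symm z) : ℂ) * ψ z) j) 0 c' ∧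
      (orderMax D α s : ℂ) * c = (-2 * (Real.pi : ℂ) * Complex.I) ^ kappa D α * c' := by
  have : Nonempty Y := ⟨y⟩
  have hyE : j y ∈ deepStratum D α := hjE ▸ mem_range_self y
  have hcard : R.card = kappa D α := by
    rw [hR, Finset.card_compl, Finset.card_map, Finset.card_univ, Fintype.card_fin,
      Fintype.card_fin]
    omega
  obtain ⟨J, K, I, v, hJK, hden, hcK, hI, hoI, hv, hw⟩ :=
    hS.exists_minimal_orders hy hα hs hsD h
  have hJKS : ∀ k ∉ S, J k = 0 ∧ K k = 0 := fun k hk ↦ hJK k fun h ↦ hk (Finset.mem_filter.1 h).1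
  have hcom : commonPoles J K = R :=
    commonPoles_eq_of_mem_deepStratum hS hy hJKS hden hcK hyE
      (fun x hx ↦ by rw [← hjE, hsl.mem_range x hx, hR]) hcard
  have hJR : ∀ k ∈ R, 1 ≤ J k ∧ 1 ≤ K k := fun k hk ↦ one_le_of_commonPoles (hcom ▸ hk)
  have hJK0 : ∀ k ∉ R, J k = 0 ∨ K k = 0 := fun k hk ↦ eq_zero_or_of_commonPoles (hcom ▸ hk)
  have hI0 : ∀ k, J k + K k ≠ 0 → I k ≠ 0 := fun k hk ↦ by
    rw [hI]
    by_contra h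
    exact hk (by simp [hJK k h])
  have hRI : ∀ k ∈ R, (I k : ℂ) ≠ 0 := fun k hk ↦ by
    have := hJR k hk
    exact_mod_cast hI0 k (by omega)
  obtain ⟨U₁, hU₁, hyU₁, hU₁φ, b, hb, hη⟩ := hden.exists_coeff hsl.mem_atlas hy hkl hξ
  obtain ⟨U₂, hU₂, hU₂o, hyU₂⟩ := eventually_nhds_iff.1 hw
  -- the weight on the submanifold
  set Φ := sliceChart hsl hj with hΦ
  have hΦa := isAdapted_sliceChart hsl hj hS (hR ▸ hRS) hn
  have hyΦ : y ∈ Φ.source := hy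
  obtain ⟨I', v', hI', hv', hw'⟩ := hΦa.exists_weight hyΦ ht htD g
  have hemb := hj.1.continuous.isClosedEmbedding hj.2.1
  rw [hemb.isInducing.nhds_eq_comap, eventually_comap] at hw'
  obtain ⟨U₃, hU₃, hU₃o, hyU₃⟩ := eventually_nhds_iff.1 hw'
  set U := U₁ ∩ (U₂ ∩ U₃) with hUdef
  have hU : IsOpen U := hU₁.inter (hU₂o.inter hU₃o)
  have hUφ : U ⊆ φ.source := inter_subset_left.trans hU₁φ
  refine ⟨U, hU, ⟨hyU₁, hyU₂, hyU₃⟩, fun χ hχ hχU ↦ ?_⟩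
  have hb' : ContDiffOn ℝ ∞ b (φ.target ∩ φ.symm ⁻¹' U) :=
    hb.mono (inter_subset_inter_right φ.target (preimage_mono inter_subset_left))
  have hbη : ∀ u ∈ φ.target, φ.symm u ∈ U → φ.symm u ∉ D →
      b u = (∏ k, (u k ^ J k * starRingEnd ℂ (u k) ^ K k)) *
        topCoeff φ (topWedge hkl α ξ) u := fun u hu huU huD ↦ by
    rw [hη u hu huU.1 huD, φ.right_inv hu]
  set f := chartExtend φ χ b with hf
  have hft : IsTest f := isTest_chartExtend hsl.mem_atlas hχ hU hUφ hχU hb'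
  have hfs : tsupport f ⊆ φ '' tsupport χ := tsupport_chartExtend_subset (hχU.trans hUφ) b
  set r := residueIter R J K f with hr
  have hrt : IsTest r := hft.residueList _
  have hr0 : ∀ z, z ∉ tsupport f → r z = 0 := fun z hz ↦
    residueIter_eq_zero (isClosed_tsupport f).isOpen_compl
      (fun u hu ↦ image_eq_zero_of_notMem_tsupport hu) hz
  -- The numerators are defined by means of `∧ dz_j ∧ dz̄_j`, and the singular integrals by means
  -- of Lebesgue measure; `C` is the quotient of the two constants for dimension `n` and dimension
  -- `d`.
  set C : ℂ := (-2 * Complex.I) ^ n * ((-2 * Complex.I) ^ d)⁻¹ with hC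
  have h2I : (-2 * Complex.I : ℂ) ≠ 0 := by simp
  refine ⟨(∏ k ∈ R, (Real.pi / I k : ℂ)) * pvInt (J ∘ tang) (K ∘ tang) (r ∘ tangIncl tang),
    C * pvInt (J ∘ tang) (K ∘ tang) (r ∘ tangIncl tang), ?_, ?_, ?_⟩
  · rw [← hcard]
    refine formLeading_of_coeff hsl.mem_atlas hU hUφ hb' hI0 hv (fun x hx ↦ hU₂ x hx.2.1)
      (fun u hu huU hu0 ↦ hbη u hu huU fun hD ↦ ?_) hχ hχU
      (hasLeading_singInt hR hI0 hJR hJK0 (contDiff_const.mul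
        (Complex.ofRealCLM.contDiff.comp hv)) hft)
    obtain ⟨k, -, hk⟩ := (hS.2 _ (φ.map_target hu)).1 hD
    rw [φ.right_inv hu] at hk
    exact hu0 k hk
  · have hι : ∀ w, tangIncl tang w ∈ tsupport f → w ∈ Φ.target ∧
        φ.symm (tangIncl tang w) ∈ tsupport χ := fun w hw ↦ by
      obtain ⟨x, hx, hxw⟩ := hfs hw
      refine ⟨?_, ?_⟩
      · change tangIncl tang w ∈ φ.target
        rw [← hxw]
        exact φ.map_source (hUφ (hχU hx))
      · rwa [← hxw, φ.left_inv (hUφ (hχU hx))]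
    rw [← pvInt_const_mul]
    have hI'0 : ∀ i, (J ∘ tang) i + (K ∘ tang) i ≠ 0 → I' i ≠ 0 := fun i hi ↦ by
      have h1 : tang i ∈ S.filter fun k ↦ φ (j y) k = 0 := by
        by_contra h
        exact hi (by simp [hJK _ h])
      rw [Finset.mem_filter] at h1
      rw [hI', Finset.mem_filter, Finset.mem_filter]
      exact ⟨⟨Finset.mem_univ _, h1.1⟩, h1.2⟩
    refine formLeading_of_hasLeading_singInt (v := v') hΦa.1
      (fun y' hy' ↦ residueForm_of_notMem hy')
      hI'0 hv'.continuous ((hrt.comp_tangIncl tang).const_mul C) (fun w hw ↦ ?_) (fun w hw hfw ↦ ?_)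
      (fun w hw hw0 ↦ ?_)
      (hasLeading_singInt_of_one_type hI'0
        (fun i ↦ hJK0 (tang i) (by simp [hR])) (contDiff_const.mul
        (Complex.ofRealCLM.contDiff.comp hv')) ((hrt.comp_tangIncl tang).const_mul C))
    · simp only [Function.comp_apply]
      rw [hr0 _ fun h ↦ hw (hι w h).1, mul_zero]
    · have h1 : tangIncl tang w ∈ tsupport f := by
        by_contra h
        exact hfw (by simp only [Function.comp_apply]; rw [hr0 _ h, mul_zero])
      have h2 := hU₃ _ (hχU (hι w h1).2).2.2 (Φ.symm w) (apply_sliceChart_symm hsl hj hw)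
      rw [h2, Φ.right_inv hw]
    · rw [topCoeff_residueForm hsl hj hw]
      set z := tangIncl tang w with hz
      have hzt : z ∈ φ.target := hw
      simp only [Function.comp_apply]
      rw [← hz]
      by_cases hzU : φ.symm z ∈ U
      · set Ω := (φ.target ∩ φ.symm ⁻¹' U) ∩ {z | z ∈ φ.target ∧ ∀ k ∈ S \ R, z k ≠ 0} with hΩd
        have hΩ : IsOpen Ω := (φ.symm.isOpen_inter_preimage hU).inter isOpen_residue_domain
        have hzΩ : z ∈ Ω := by
          refine ⟨⟨hzt, hzU⟩, hzt, fun k hk ↦ ?_⟩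
          obtain ⟨i, rfl⟩ : ∃ i, tang i = k := by
            simpa [hR] using (Finset.mem_sdiff.1 hk).2
          rw [hz, tangIncl_apply_tang]
          exact hw0 i
        have hzR : ∀ k ∈ R, z k = 0 := fun k hk ↦
          tangIncl_apply_of_forall_ne tang w (forall_tang_ne tang (hR ▸ hk))
        have h1 := residueIter_relation (R := R) hΩ (C := (-2 * Complex.I) ^ d)
          (hb'.mono inter_subset_left) (hψ.mono inter_subset_right)
          (Complex.ofRealCLM.contDiff.comp_contDiffOn
            ((contDiffOn_comp_symm hsl.mem_atlas hχ).mono fun u hu ↦ hu.1.1))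
          hJR hJK' (fun u hu ↦ numerator_relation hS hU hb'.continuousOn hbη hψ.continuousOn hψη
            hu.1.1 hu.1.2 hu.2.2) hzΩ hzR
        have h2 : r z = _ := residueIter_eqOn hΩ
          (fun u hu ↦ chartExtend_of_mem (χ := χ) (g := b) hu.1.1) R J K hzΩ
        have h3 : Rᶜ = Finset.univ.map tang := by rw [hR, compl_compl]
        have h4 : ∏ k ∈ Rᶜ, (z k ^ J k * starRingEnd ℂ (z k) ^ K k) =
            ∏ i, (w i ^ (J ∘ tang) i * starRingEnd ℂ (w i) ^ (K ∘ tang) i) := by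
          rw [h3, Finset.prod_map]
          simp only [hz, tangIncl_apply_tang, Function.comp_apply]
        have h5 : ∏ i, (w i ^ (J ∘ tang) i * starRingEnd ℂ (w i) ^ (K ∘ tang) i) ≠ 0 :=
          prod_pow_mul_conj_ne_zero fun i _ ↦ Or.inl (hw0 i)
        rw [h2]
        refine Eq.trans ?_ (congrArg _ (congrArg _ h1.symm))
        rw [h4, hC]
        change residueIter R J' K' (fun z ↦ (χ (φ.symm z) : ℂ) * ψ z) z * _ =
          (∏ i, (w i ^ (J ∘ tang) i * starRingEnd ℂ (w i) ^ (K ∘ tang) i))⁻¹ *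
            (_ * (_ * residueIter R J' K' (fun z ↦ (χ (φ.symm z) : ℂ) * ψ z) z))
        generalize residueIter R J' K' (fun z ↦ (χ (φ.symm z) : ℂ) * ψ z) z = B
        generalize ∏ i, (w i ^ (J ∘ tang) i * starRingEnd ℂ (w i) ^ (K ∘ tang) i) = A at h5 ⊢
        field_simp
      · have h1 : φ.symm z ∉ tsupport χ := fun h ↦ hzU (hχU h)
        rw [residueIter_cutoff_eq_zero hzt h1, hr0 z fun h ↦ h1 (hι w h).2]
        simp
  · have h1 : (orderMax D α s : ℂ) = ∏ k ∈ R, (I k : ℂ) := by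
      rw [← ho _ hyE, ← hoI, hcom]
      push_cast
      rfl
    have h2 : (∏ k ∈ R, (I k : ℂ)) * ∏ k ∈ R, (Real.pi / I k : ℂ) = (Real.pi : ℂ) ^ kappa D α := by
      rw [← Finset.prod_mul_distrib, ← hcard, ← Finset.prod_const]
      exact Finset.prod_congr rfl fun k hk ↦ mul_div_cancel₀ _ (hRI k hk)
    have h3 : (-2 * (Real.pi : ℂ) * Complex.I) ^ kappa D α * C = (Real.pi : ℂ) ^ kappa D α := by
      have h4 : (-2 * Complex.I : ℂ) ^ d =
          (-2 * Complex.I) ^ n * (-2 * Complex.I) ^ kappa D α := by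
        rw [← pow_add, hn]
      rw [hC, h4, show -2 * (Real.pi : ℂ) * Complex.I = Real.pi * (-2 * Complex.I) by ring,
        mul_pow]
      field_simp
    rw [h1, ← mul_assoc, h2, ← mul_assoc, h3]

end Comparison

/-! ### Denominators of sums -/

section Denominators

variable {d k : ℕ} {X : Type*} [TopologicalSpace X] [ChartedSpace (Fin d → ℂ) X]
  {x : X} {D : Set X} {p : X → ℂ}

theorem smoothFormOn_zero (U : Set X) : SmoothFormOn (fun _ ↦ 0 : DForm d k X) U :=
  fun _ _ _ ↦ contDiffAt_const (c := (0 : ℂ))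

theorem IsDenominator.congr {α β : DForm d k X} (h : IsDenominator D α x p)
    (he : ∀ᶠ y in 𝓝 x, y ∉ D → β y = α y) : IsDenominator D β x p := by
  obtain ⟨U, hU, hxU, γ, hγ, h⟩ := h
  obtain ⟨U', hU', hU'o, hxU'⟩ := eventually_nhds_iff.1 he
  exact ⟨U ∩ U', hU.inter hU'o, ⟨hxU, hxU'⟩, γ, hγ.mono inter_subset_left, fun y hy hyD ↦ by
    rw [hU' y hy.2 hyD, h y hy.1 hyD]⟩

theorem isDenominator_zero : IsDenominator D (fun _ ↦ 0 : DForm d k X) x p :=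
  ⟨univ, isOpen_univ, mem_univ x, fun _ ↦ 0, smoothFormOn_zero _, fun _ _ _ ↦ (smul_zero _).symm⟩

theorem IsDenominator.add {α β : DForm d k X} (hα : IsDenominator D α x p)
    (hβ : IsDenominator D β x p) : IsDenominator D (fun y ↦ α y + β y) x p := by
  obtain ⟨U, hU, hxU, γ, hγ, h⟩ := hα
  obtain ⟨U', hU', hxU', γ', hγ', h'⟩ := hβ
  refine ⟨U ∩ U', hU.inter hU', ⟨hxU, hxU'⟩, fun y ↦ γ y + γ' y, fun y hy v ↦
    (hγ y hy.1 v).add (hγ' y hy.2 v), fun y hy hyD ↦ ?_⟩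
  simp only [h y hy.1 hyD, h' y hy.2 hyD, smul_add]

theorem IsDenominator.sum {β : Type*} (s : Finset β) {α : β → DForm d k X}
    (h : ∀ b ∈ s, IsDenominator D (α b) x p) : IsDenominator D (fun y ↦ ∑ b ∈ s, α b y) x p := by
  classical
  induction s using Finset.induction_on with
  | empty => simpa using isDenominator_zero
  | insert a s ha ih =>
    simp only [Finset.sum_insert ha]
    exact (h a (Finset.mem_insert_self a s)).add
      (ih fun b hb ↦ h b (Finset.mem_insert_of_mem hb))

variable {L : X → Type*} [∀ x, TopologicalSpace (L x)] [TopologicalSpace (TotalSpace ℂ L)]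
  [FiberBundle ℂ L] {s : ∀ x, L x} [∀ x, AddCommGroup (L x)] [∀ x, Module ℂ (L x)]
  [VectorBundle ℂ ℂ L] [IsManifold 𝓘(ℂ, Fin d → ℂ) ω X]
  {φ : OpenPartialHomeomorph X (Fin d → ℂ)} {S : Finset (Fin d)} {J K : Fin d → ℕ}

/-- If no coordinate carries both a holomorphic and an anti-holomorphic pole, then `κ_x = 0` and
the order of the section is an empty product. -/
theorem IsAdapted.kappaAt_eq_zero_and_orderAt_eq_one
    [ContMDiffVectorBundle ω ℂ L 𝓘(ℂ, Fin d → ℂ)] {α : DForm d k X} (h : IsAdapted D φ S)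
    (hx : x ∈ φ.source) (hJK : ∀ j ∉ S.filter (fun j ↦ φ x j = 0), J j = 0 ∧ K j = 0)
    (hp : IsDenominator D α x (fun y ↦ ∏ j, (φ y j ^ J j * starRingEnd ℂ (φ y j) ^ K j)))
    (hc : commonPoles J K = ∅) (hs : IsHolSection d s) (hsD : ∀ x, s x = 0 ↔ x ∈ D) :
    kappaAt D α x = 0 ∧ orderAt D α s x = 1 := by
  have h0 : kappaAt D α x = 0 := by
    have := h.kappaAt_le hx hJK hp
    rwa [hc, Finset.card_empty, Nat.le_zero] at this
  refine ⟨h0, ?_⟩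
  obtain ⟨φ', hφ', happ⟩ := h.exists_centred hx
  have he : (fun y ↦ ∏ j, (φ' y j ^ J j * starRingEnd ℂ (φ' y j) ^ K j)) =
      fun y ↦ ∏ j, (φ y j ^ J j * starRingEnd ℂ (φ y j) ^ K j) := funext fun y ↦ by
    rw [happ]
    exact prod_coord_sub fun j hj ↦ hJK j (by simp [hj])
  obtain ⟨I, hI⟩ := hs.exists_sectionOrder hsD hφ'
  have hne : {m | ∃ (φ : OpenPartialHomeomorph X (Fin d → ℂ)) (S : Finset (Fin d))
      (J K I : Fin d → ℕ), IsNCChart D x φ S ∧ PoleBound D α x φ S J K ∧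
      (commonPoles J K).card = kappaAt D α x ∧ SectionOrder s x φ I ∧
      m = ∏ j ∈ commonPoles J K, I j}.Nonempty :=
    ⟨_, φ', _, J, K, I, hφ', IsDenominator.poleBound hφ'.2.1 hJK (he ▸ hp), by simp [hc, h0], hI,
      rfl⟩
  obtain ⟨φ₁, S₁, J₁, K₁, I₁, -, -, h3, -, h5⟩ := Nat.sInf_mem hne
  rw [h0, Finset.card_eq_zero] at h3
  rw [h3, Finset.prod_empty] at h5
  exact h5

end Denominators

/-! ### The poles of the iterated residue -/

section ResiduePoles

variable {d n k l : ℕ} {X : Type*} [TopologicalSpace X]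
  [ChartedSpace (Fin d → ℂ) X] {Y : Type*} [TopologicalSpace Y]
  [ChartedSpace (Fin n → ℂ) Y] [IsManifold 𝓘(ℂ, Fin n → ℂ) ω Y]
  {φ : OpenPartialHomeomorph X (Fin d → ℂ)} {tang : Fin n ↪ Fin d} {j : Y → X}
  {D : Set X} {S R : Finset (Fin d)} {J K : Fin d → ℕ}

/-- Restriction of germs of smooth functions to a submanifold. -/
theorem IsSmoothGerm.comp_embedding [IsManifold 𝓘(ℂ, Fin d → ℂ) ω X] (h : IsSlice φ tang j)
    (hj : IsHolEmbedding (n := n) (d := d) j) {y : Y} (hy : j y ∈ φ.source) {w : X → ℂ}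
    (hw : IsSmoothGerm d (j y) w) : IsSmoothGerm n y fun y ↦ w (j y) := by
  have hc := hj.1.continuous.continuousAt (x := y)
  have h1 := hw.eventually_contDiffAt h.mem_atlas hy
  filter_upwards [hc.eventually (eventually_chart hy h1),
    (hc.eventually (φ.open_source.mem_nhds hy)).eventually_nhds] with y' h2 h3
  have h4 : ContMDiffAt 𝓘(ℝ, Fin n → ℂ) 𝓘(ℝ, ℂ) ∞ (fun y ↦ w (φ.symm (φ (j y)))) y' :=
    ContMDiffAt.comp (I' := 𝓘(ℝ, Fin d → ℂ)) (g := fun z ↦ w (φ.symm z))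
      (f := fun y ↦ φ (j y)) y' h2.contMDiffAt
      (contMDiffAt_comp_embedding_real h hj h3.self_of_nhds)
  refine h4.congr_of_eventuallyEq ?_
  filter_upwards [h3] with y'' h5
  rw [φ.left_inv h5]

variable [T2Space X] [CompactSpace Y] [Nonempty Y]

/-- The residue form is smooth wherever the numerator is. -/
theorem smoothFormOn_residueForm (h : IsSlice φ tang j) (hj : IsHolEmbedding (n := n) (d := d) j)
    {f : (Fin d → ℂ) → ℂ} {Ω : Set (Fin d → ℂ)} (hΩ : IsOpen Ω) (hf : ContDiffOn ℝ ∞ f Ω) :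
    SmoothFormOn (residueForm φ tang R J K f j) {y | j y ∈ φ.source ∧ φ (j y) ∈ Ω} := by
  set Φ := sliceChart h hj with hΦ
  refine smoothFormOn_of_contDiffAt fun y hy ↦ ⟨Φ, sliceChart_mem_atlas h hj, hy.1, fun v ↦ ?_⟩
  have h1 : ∀ᶠ w in 𝓝 (Φ y), chartRep Φ (residueForm φ tang R J K f j) w v =
      residueIter R J K f (tangIncl tang w) * dzForm (id : Fin n → Fin n) v := by
    filter_upwards [Φ.open_target.mem_nhds (Φ.map_source hy.1)] with w hw
    have hys : j (Φ.symm w) ∈ φ.source := Φ.map_target hw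
    have h1 := topCoeff_pullback_dzForm h hj hw
      (residueForm_of_mem (R := R) (J := J) (K := K) (f := f) hys) v
    rw [apply_sliceChart_symm h hj hw, φ.right_inv hw] at h1
    exact h1
  refine ContDiffAt.congr_of_eventuallyEq (ContDiffAt.mul ?_ contDiffAt_const) h1
  have h2 : ContDiffAt ℝ ∞ (residueIter R J K f) (tangIncl tang (Φ y)) := by
    rw [tangIncl_sliceChart h hj hy.1]
    exact (hf.residueList hΩ J K _).contDiffAt (hΩ.mem_nhds hy.2)
  exact h2.comp _ (contDiff_tangIncl tang).contDiffAt

variable [IsManifold 𝓘(ℂ, Fin d → ℂ) ω X]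

/-- The tangential part of a denominator of the form is a denominator of its residue. -/
theorem IsDenominator.residueForm {α : DForm d k X} {hkl : k + l = 2 * d} {ξ : DForm d l X}
    (hξ : SmoothFormOn ξ univ) {κ : ℕ} (hn : n + κ = d) (h : IsSlice φ tang j)
    (hj : IsHolEmbedding (n := n) (d := d) j) (hS : IsAdapted D φ S)
    (hR : R = (Finset.univ.map tang)ᶜ) (hRS : R ⊆ S) {J' K' : Fin d → ℕ}
    (hJK' : ∀ k ∈ R, 1 ≤ J' k ∧ 1 ≤ K' k)
    {ψ : (Fin d → ℂ) → ℂ} (hψ : ContDiffOn ℝ ∞ ψ {z | z ∈ φ.target ∧ ∀ k ∈ S \ R, z k ≠ 0})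
    (hψη : ∀ z ∈ φ.target, (∀ k ∈ S, z k ≠ 0) →
      (∏ k ∈ R, (z k ^ J' k * starRingEnd ℂ (z k) ^ K' k)) • chartRep φ (topWedge hkl α ξ) z =
        ψ z • dzForm (id : Fin d → Fin d))
    {y : Y} (hy : j y ∈ φ.source) (hJK : ∀ k ∈ R, 1 ≤ J k ∧ 1 ≤ K k)
    (hp : IsDenominator D α (j y) fun x ↦ ∏ k, (φ x k ^ J k * starRingEnd ℂ (φ x k) ^ K k))
    {χ : X → ℝ} (hχ : ContMDiff 𝓘(ℝ, Fin d → ℂ) 𝓘(ℝ, ℝ) ∞ χ) :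
    IsDenominator (residualDivisor d D κ j)
      (residueForm φ tang R J' K' (fun z ↦ (χ (φ.symm z) : ℂ) * ψ z) j) y
      fun y ↦ ∏ k ∈ Rᶜ, (φ (j y) k ^ J k * starRingEnd ℂ (φ (j y) k) ^ K k) := by
  obtain ⟨U, hU, hyU, hUφ, b, hb, hη⟩ := hp.exists_coeff h.mem_atlas hy hkl hξ
  have hbη : ∀ u ∈ φ.target, φ.symm u ∈ U → φ.symm u ∉ D →
      b u = (∏ k, (u k ^ J k * starRingEnd ℂ (u k) ^ K k)) *
        topCoeff φ (topWedge hkl α ξ) u := fun u hu huU huD ↦ by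
    rw [hη u hu huU huD, φ.right_inv hu]
  set f : (Fin d → ℂ) → ℂ := fun z ↦ ((-2 * Complex.I) ^ d)⁻¹ * (χ (φ.symm z) : ℂ) * b z with hf
  have hΩ₀ := φ.symm.isOpen_inter_preimage hU
  have hχs : ContDiffOn ℝ ∞ (fun u ↦ (χ (φ.symm u) : ℂ)) φ.target :=
    Complex.ofRealCLM.contDiff.comp_contDiffOn (contDiffOn_comp_symm h.mem_atlas hχ)
  have hfs : ContDiffOn ℝ ∞ f (φ.target ∩ φ.symm ⁻¹' U) :=
    (contDiffOn_const.mul (hχs.mono inter_subset_left)).mul hb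
  have hd := isAdapted_sliceChart h hj hS (hR ▸ hRS) hn
  have h2I : ((-2 * Complex.I) ^ d : ℂ) ≠ 0 := by simp
  refine ⟨j ⁻¹' U, hU.preimage hj.1.continuous, hyU, _,
    (smoothFormOn_residueForm (R := R) (J := J) (K := K) h hj hΩ₀ hfs).mono fun y' hy' ↦ ?_,
    fun y' hy' hyD ↦ ?_⟩
  · have h1 : j y' ∈ φ.source := hUφ hy'
    exact ⟨h1, φ.map_source h1, by rwa [mem_preimage, φ.left_inv h1]⟩
  · have h1 : j y' ∈ φ.source := hUφ hy'
    rw [residueForm_of_mem h1, residueForm_of_mem h1, smul_smul]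
    congr 1
    set Ω := (φ.target ∩ φ.symm ⁻¹' U) ∩ {z | z ∈ φ.target ∧ ∀ k ∈ S \ R, z k ≠ 0} with hΩd
    have hΩ : IsOpen Ω := hΩ₀.inter isOpen_residue_domain
    have hzΩ : φ (j y') ∈ Ω := by
      refine ⟨⟨φ.map_source h1, by rwa [mem_preimage, φ.left_inv h1]⟩, φ.map_source h1,
        fun k hk hk0 ↦ hyD ?_⟩
      obtain ⟨i, rfl⟩ : ∃ i, tang i = k := by
        simpa [hR] using (Finset.mem_sdiff.1 hk).2
      exact (hd.2 y' h1).2 ⟨i, by simpa using (Finset.mem_sdiff.1 hk).1, hk0⟩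
    have h2 := residueIter_relation (R := R) hΩ (C := (-2 * Complex.I) ^ d)
      (c := fun z ↦ ((-2 * Complex.I) ^ d)⁻¹ * (χ (φ.symm z) : ℂ))
      (hb.mono inter_subset_left) (hψ.mono inter_subset_right)
      (contDiffOn_const.mul (hχs.mono fun u hu ↦ hu.1.1))
      hJK hJK' (fun u hu ↦ numerator_relation hS hU hb.continuousOn hbη hψ.continuousOn hψη
        hu.1.1 hu.1.2 hu.2.2) hzΩ fun k hk ↦ (h.mem_range _ h1).1 (mem_range_self y') k (hR ▸ hk)
    refine h2.trans ?_
    have h3 : residueIter R J' K'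
        (fun z ↦ ((-2 * Complex.I) ^ d)⁻¹ * (χ (φ.symm z) : ℂ) * ψ z) = fun z ↦
          ((-2 * Complex.I) ^ d)⁻¹ * residueIter R J' K' (fun z ↦ (χ (φ.symm z) : ℂ) * ψ z) z := by
      simp only [mul_assoc]
      exact residueList_const_mul _ _ _ _ _
    rw [h3]
    field_simp

end ResiduePoles

/-! ### The iterated residue -/

section ResidueData

variable {d n : ℕ} {X : Type*} [TopologicalSpace X] [ChartedSpace (Fin d → ℂ) X]
  {D E : Set X} {η : DForm d (2 * d) X} {ι : Type*} [Fintype ι] {Y : Type*} {j : Y → X}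

theorem ResidueData.isAdapted (P : ResidueData n D E η ι) (i : ι) : IsAdapted D (P.φ i) (P.S i) :=
  ⟨P.mem_atlas i, P.mem_D i⟩

theorem ResidueData.isSlice (P : ResidueData n D E η ι) (hjE : range j = E) {i : ι} {y : Y}
    (hy : j y ∈ (P.φ i).source) : IsSlice (P.φ i) (P.tang i) j :=
  ⟨P.mem_atlas i, fun x hx ↦ by
    rw [hjE, P.mem_E i ⟨j y, hjE ▸ mem_range_self y, hy⟩ x hx, P.R_eq]⟩

theorem ResidueData.exists_mem_source (P : ResidueData n D E η ι) (x : X) :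
    ∃ i, x ∈ (P.φ i).source := by
  obtain ⟨i, hi⟩ : ∃ i, P.ρ i x ≠ 0 := by
    by_contra! h
    have h1 := P.ρ.sum_eq_one (mem_univ x)
    simp [h] at h1
  exact ⟨i, P.subordinate i (subset_tsupport _ hi)⟩

theorem ResidueData.one_le (P : ResidueData n D E η ι) (i : ι) :
    ∀ k ∈ P.R i, 1 ≤ P.J i k ∧ 1 ≤ P.K i k := fun k hk ↦ ⟨P.J_pos i k hk, P.K_pos i k hk⟩

variable [TopologicalSpace Y] [ChartedSpace (Fin n → ℂ) Y]

theorem ResidueData.form_eq_sum (P : ResidueData n D E η ι) (j : Y → X) :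
    P.form j = fun y ↦ ∑ i, residueForm (P.φ i) (P.tang i) (P.R i) (P.J i) (P.K i)
      (fun z ↦ (P.ρ i ((P.φ i).symm z) : ℂ) * P.ψ i z) j y := rfl

/-- The cohomology class only matters through exact forms. -/
theorem AeppliCohomologous.exists_eq {D : Set Y} {θ τ : DForm n (2 * n) Y}
    (h : AeppliCohomologous D θ τ) : ∃ σ : DForm n (2 * n) Y,
      (σ = (fun _ ↦ 0) ∨ ∃ (m : ℕ) (hm : m + 1 = 2 * n) (γ : DForm n m Y), SmoothFormOn γ univ ∧
        σ = extDerivForm hm γ) ∧ ∀ y ∉ D, θ y = τ y + σ y := by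
  rcases h with h | ⟨m, hm, γ, hγ, h⟩
  · exact ⟨_, Or.inl rfl, fun y hy ↦ by rw [h y hy, add_zero]⟩
  · refine ⟨_, Or.inr ⟨m, hm, γ, hγ, rfl⟩, fun y hy ↦ AlternatingMap.ext fun v ↦ ?_⟩
    exact (h y hy v).trans (congrArg (τ y v + ·) (extDerivForm_apply hm hγ y v).symm)

variable [T2Space X] [CompactSpace Y] [IsManifold 𝓘(ℂ, Fin n → ℂ) ω Y]
  [IsManifold 𝓘(ℂ, Fin d → ℂ) ω X] {κ : ℕ}

theorem ResidueData.isAdapted_sliceChart [Nonempty Y] (P : ResidueData n D E η ι)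
    (hj : IsHolEmbedding (n := n) (d := d) j) (hjE : range j = E) (hn : n + κ = d) {i : ι} {y : Y}
    (hy : j y ∈ (P.φ i).source) : IsAdapted (residualDivisor d D κ j)
      (sliceChart (P.isSlice hjE hy) hj) (Finset.univ.filter fun t ↦ P.tang i t ∈ P.S i) :=
  _root_.isAdapted_sliceChart (P.isSlice hjE hy) hj (P.isAdapted i)
    (P.R_eq i ▸ P.R_subset i ⟨j y, hjE ▸ mem_range_self y, hy⟩) hn

/-- Off the residual divisor, the local residue forms of a partition of unity add up. -/
theorem ResidueData.sum_residueForm (P : ResidueData n D E η ι)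
    (hj : IsHolEmbedding (n := n) (d := d) j) (hjE : range j = E) (hn : n + κ = d)
    {β : Type*} (B : Finset β) {χ : β → X → ℝ}
    (hχ : ∀ b, ContMDiff 𝓘(ℝ, Fin d → ℂ) 𝓘(ℝ, ℝ) ∞ (χ b)) (hsum : ∀ x, ∑ b ∈ B, χ b x = 1)
    {y : Y} (hy : y ∉ residualDivisor d D κ j) :
    ∑ b ∈ B, ∑ i, residueForm (P.φ i) (P.tang i) (P.R i) (P.J i) (P.K i)
      (fun z ↦ ((χ b ((P.φ i).symm z) * P.ρ i ((P.φ i).symm z) : ℝ) : ℂ) * P.ψ i z) j y =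
      P.form j y := by
  have : Nonempty Y := ⟨y⟩
  rw [Finset.sum_comm, P.form_eq_sum]
  refine Finset.sum_congr rfl fun i _ ↦ ?_
  by_cases hyi : j y ∈ (P.φ i).source
  · simp only [residueForm_of_mem hyi]
    rw [← Finset.sum_smul]
    congr 1
    have hz : P.φ i (j y) ∈ {z | z ∈ (P.φ i).target ∧ ∀ k ∈ P.S i \ P.R i, z k ≠ 0} := by
      refine ⟨(P.φ i).map_source hyi, fun k hk hk0 ↦ hy ?_⟩
      obtain ⟨a, rfl⟩ : ∃ a, P.tang i a = k := by
        simpa [P.R_eq] using (Finset.mem_sdiff.1 hk).2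
      exact ((P.isAdapted_sliceChart hj hjE hn hyi).2 y hyi).2
        ⟨a, by simpa using (Finset.mem_sdiff.1 hk).1, hk0⟩
    have hψ := P.ψ_smooth i ⟨j y, hjE ▸ mem_range_self y, hyi⟩
    have h1 := residueIter_sum isOpen_residue_domain B
      (f := fun b z ↦ ((χ b ((P.φ i).symm z) * P.ρ i ((P.φ i).symm z) : ℝ) : ℂ) * P.ψ i z)
      (fun b _ ↦ ContDiffOn.mul (Complex.ofRealCLM.contDiff.comp_contDiffOn
        (((contDiffOn_comp_symm (P.mem_atlas i) (hχ b)).mul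
          (contDiffOn_comp_symm (P.mem_atlas i) (P.ρ i).contMDiff)).mono fun z hz ↦ hz.1)) hψ)
      (P.R i) (P.J i) (P.K i) hz
    refine h1.symm.trans ?_
    congr 1
    funext z
    rw [← Finset.sum_mul, ← Complex.ofReal_sum, ← Finset.sum_mul, hsum, one_mul]
  · simp only [residueForm_of_notMem hyi, Finset.sum_const_zero]

end ResidueData

section Poles

variable {d n k l : ℕ} {X : Type*} [TopologicalSpace X] [T2Space X]
  [ChartedSpace (Fin d → ℂ) X] [IsManifold 𝓘(ℂ, Fin d → ℂ) ω X]
  {Y : Type*} [TopologicalSpace Y] [CompactSpace Y]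
  [ChartedSpace (Fin n → ℂ) Y] [IsManifold 𝓘(ℂ, Fin n → ℂ) ω Y]
  {j : Y → X} {D : Set X} {ι : Type*} [Fintype ι]
  {L : X → Type*} [∀ x, TopologicalSpace (L x)] [∀ x, AddCommGroup (L x)]
  [∀ x, Module ℂ (L x)] [TopologicalSpace (TotalSpace ℂ L)] [FiberBundle ℂ L]
  [VectorBundle ℂ ℂ L] [ContMDiffVectorBundle ω ℂ L 𝓘(ℂ, Fin d → ℂ)] {s : ∀ x, L x}
  {M : Y → Type*} [∀ y, TopologicalSpace (M y)] [∀ y, AddCommGroup (M y)]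
  [∀ y, Module ℂ (M y)] [TopologicalSpace (TotalSpace ℂ M)] [FiberBundle ℂ M]
  [VectorBundle ℂ ℂ M] [ContMDiffVectorBundle ω ℂ M 𝓘(ℂ, Fin n → ℂ)] {t : ∀ y, M y}

/-- The residue has no coordinate along which it has both a holomorphic and an anti-holomorphic
pole, so that its canonical pairing is the value of the regularised integral at `λ = 0`. The charts
of the partition of unity give different pole orders, and `IsAdapted.exists_transfer` compares all
of them to a single one. -/
theorem ResidueData.kappaAt_eq_zero_and_orderAt_eq_one {α : DForm d k X}
    (hα : IsQuasiMeromorphic D α) {hkl : k + l = 2 * d} {ξ : DForm d l X}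
    (hξ : SmoothFormOn ξ univ) (hs : IsHolSection d s) (hsD : ∀ x, s x = 0 ↔ x ∈ D)
    (h : LineMetric d L) (hn : n + kappa D α = d) (hj : IsHolEmbedding (n := n) (d := d) j)
    (hjE : range j = deepStratum D α) (ht : IsHolSection n t)
    (htD : ∀ y, t y = 0 ↔ y ∈ residualDivisor d D (kappa D α) j)
    (P : ResidueData n D (deepStratum D α) (topWedge hkl α ξ) ι) {θ : DForm n (2 * n) Y}
    (hθ : AeppliCohomologous (residualDivisor d D (kappa D α) j) θ (P.form j)) (y : Y) :
    kappaAt (residualDivisor d D (kappa D α) j) θ y = 0 ∧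
      orderAt (residualDivisor d D (kappa D α) j) θ t y = 1 := by
  have : Nonempty Y := ⟨y⟩
  have hyE : j y ∈ deepStratum D α := hjE ▸ mem_range_self y
  have hcard : ∀ i, (P.R i).card = kappa D α := fun i ↦ by
    rw [P.R_eq, Finset.card_compl, Finset.card_map, Finset.card_univ, Fintype.card_fin,
      Fintype.card_fin]
    omega
  obtain ⟨i₀, hi₀⟩ := P.exists_mem_source (j y)
  obtain ⟨J, K, -, -, hJK, hden, hcK, -, -, -, -⟩ :=
    (P.isAdapted i₀).exists_minimal_orders hi₀ hα hs hsD h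
  have hcom : ∀ {i J K}, j y ∈ (P.φ i).source →
      (∀ k ∉ (P.S i).filter (fun k ↦ P.φ i (j y) k = 0), J k = 0 ∧ K k = 0) →
      IsDenominator D α (j y)
        (fun x ↦ ∏ k, (P.φ i x k ^ J k * starRingEnd ℂ (P.φ i x k) ^ K k)) →
      (commonPoles J K).card = kappaAt D α (j y) → commonPoles J K = P.R i := by
    intro i J K hi hJK hden hcK
    exact commonPoles_eq_of_mem_deepStratum (P.isAdapted i) hi
      (fun k hk ↦ hJK k fun h ↦ hk (Finset.mem_filter.1 h).1) hden hcK hyE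
      (P.mem_E i ⟨j y, hyE, hi⟩) (hcard i)
  have hcom₀ := hcom hi₀ hJK hden hcK
  set Φ := sliceChart (P.isSlice hjE hi₀) hj with hΦ
  have hΦa := P.isAdapted_sliceChart hj hjE hn hi₀
  set p : Y → ℂ := fun y' ↦ ∏ a, (Φ y' a ^ (J ∘ P.tang i₀) a *
    starRingEnd ℂ (Φ y' a) ^ (K ∘ P.tang i₀) a) with hp
  have hpe : ∀ y', ∏ k ∈ (P.R i₀)ᶜ, (P.φ i₀ (j y') k ^ J k *
      starRingEnd ℂ (P.φ i₀ (j y') k) ^ K k) = p y' := fun y' ↦ by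
    rw [P.R_eq, compl_compl, Finset.prod_map]
    rfl
  have hform : IsDenominator (residualDivisor d D (kappa D α) j) (P.form j) y p := by
    rw [P.form_eq_sum]
    refine IsDenominator.sum _ fun i _ ↦ ?_
    by_cases hi : j y ∈ tsupport (P.ρ i)
    · have hyi := P.subordinate i hi
      obtain ⟨J₁, K₁, hJK₁, hc₁, hd₁, w, hw, hw0, hwe⟩ :=
        (P.isAdapted i).exists_transfer (k := k) hyi (P.isAdapted i₀) hi₀ hJK
      have hcom₁ := hcom hyi hJK₁ (hd₁ α hden) (hc₁.trans hcK)
      rw [hcom₀, hcom₁] at hwe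
      have hne : (deepStratum D α ∩ (P.φ i).source).Nonempty := ⟨j y, hyE, hyi⟩
      have h1 := IsDenominator.residueForm hξ hn (P.isSlice hjE hyi) hj (P.isAdapted i) (P.R_eq i)
        (P.R_subset i hne) (P.one_le i) (P.ψ_smooth i hne) (P.ψ_eq i hne) hyi
        (fun k hk ↦ one_le_of_commonPoles (hcom₁ ▸ hk)) (hd₁ α hden) (P.ρ i).contMDiff
      refine h1.of_eq_mul ((hw.inv hw0).comp_embedding (P.isSlice hjE hyi) hj hyi) ?_
      filter_upwards [hj.1.continuous.continuousAt.eventually hwe,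
        hj.1.continuous.continuousAt.eventually hw0] with y' h2 h3 _
      rw [h2, ← mul_assoc, inv_mul_cancel₀ h3, one_mul, hpe]
    · refine isDenominator_zero.congr ?_
      filter_upwards [((isClosed_tsupport (P.ρ i)).isOpen_compl.preimage
        hj.1.continuous).mem_nhds hi] with y' hy' _
      exact residueForm_cutoff_eq_zero hy'
  have hθp : IsDenominator (residualDivisor d D (kappa D α) j) θ y p := by
    obtain ⟨σ, hσ, he⟩ := hθ.exists_eq
    refine (hform.add (β := σ) ?_).congr (Eventually.of_forall he)
    rcases hσ with rfl | ⟨m, hm, γ, hγ, rfl⟩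
    · exact isDenominator_zero
    · have h1 : IsDenominator (residualDivisor d D (kappa D α) j) (extDerivForm hm γ) y
          fun _ ↦ 1 := ⟨univ, isOpen_univ, mem_univ y, _, smoothFormOn_extDerivForm hm hγ,
            fun _ _ _ ↦ (one_smul _ _).symm⟩
      exact h1.of_eq_mul (isSmoothGerm_monomial hΦa.1 (show y ∈ Φ.source from hi₀) Finset.univ
        (J ∘ P.tang i₀) (K ∘ P.tang i₀)) (Eventually.of_forall fun y' _ ↦ (mul_one _).symm)
  refine hΦa.kappaAt_eq_zero_and_orderAt_eq_one hi₀ (fun a ha ↦ hJK _ fun h ↦ ha ?_) hθp ?_ ht htD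
  · rw [Finset.mem_filter] at h
    rw [Finset.mem_filter, Finset.mem_filter]
    exact ⟨⟨Finset.mem_univ _, h.1⟩, h.2⟩
  · refine Finset.eq_empty_of_forall_notMem fun a ha ↦ ?_
    have h1 : P.tang i₀ a ∈ commonPoles J K := by
      simpa [commonPoles] using ha
    rw [hcom₀, P.R_eq] at h1
    simp at h1

end Poles

/-! ### The canonical pairings -/

/-- A canonical pairing exists as soon as the leading coefficient of the regularised integral does.
-/
theorem FormLeading.hasCanonicalValue {d k l : ℕ} {X : Type*} [TopologicalSpace X] [T2Space X]
    [CompactSpace X] [ChartedSpace (Fin d → ℂ) X] [IsManifold 𝓘(ℂ, Fin d → ℂ) ω X] {D : Set X}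
    {hkl : k + l = 2 * d} {α : DForm d k X} {ξ : DForm d l X}
    {L : X → Type*} [∀ x, TopologicalSpace (L x)] [∀ x, AddCommGroup (L x)]
    [∀ x, Module ℂ (L x)] [TopologicalSpace (TotalSpace ℂ L)] [FiberBundle ℂ L]
    [VectorBundle ℂ ℂ L] {s : ∀ x, L x} {h : LineMetric d L} {c : ℂ}
    (H : FormLeading (fun x ↦ h.len x (s x)) (topWedge hkl α ξ) (kappa D α) c) :
    HasCanonicalValue D hkl α ξ s h ((orderMax D α s : ℂ) * c) := by
  obtain ⟨⟨R, hR⟩, hL⟩ := H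
  obtain ⟨ε, hε, F, hF, ⟨R', hR'⟩, hT⟩ := hL.const_mul (orderMax D α s : ℂ)
  exact ⟨ε, hε, F, hF, ⟨max R R', fun lam hlam ↦ ⟨hR lam ((le_max_left _ _).trans_lt hlam),
    hR' lam ((le_max_right _ _).trans_lt hlam)⟩⟩, hT⟩

theorem topWedge_oneForm {n : ℕ} {Y : Type*} [TopologicalSpace Y] [ChartedSpace (Fin n → ℂ) Y]
    (θ : DForm n (2 * n) Y) : topWedge (Nat.add_zero (2 * n)) θ oneForm = θ :=
  funext fun y ↦ AlternatingMap.ext fun v ↦ altWedge_constOfIsEmpty_one (θ y) v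

section Comparison

variable {d n k l : ℕ} {X : Type*} [TopologicalSpace X] [T2Space X] [CompactSpace X]
  [ChartedSpace (Fin d → ℂ) X] [IsManifold 𝓘(ℂ, Fin d → ℂ) ω X]
  {Y : Type*} [TopologicalSpace Y] [T2Space Y] [CompactSpace Y]
  [ChartedSpace (Fin n → ℂ) Y] [IsManifold 𝓘(ℂ, Fin n → ℂ) ω Y]
  {j : Y → X} {D : Set X} {ι : Type*} [Fintype ι]
  {L : X → Type*} [∀ x, TopologicalSpace (L x)] [∀ x, AddCommGroup (L x)]
  [∀ x, Module ℂ (L x)] [TopologicalSpace (TotalSpace ℂ L)] [FiberBundle ℂ L]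
  [VectorBundle ℂ ℂ L] [ContMDiffVectorBundle ω ℂ L 𝓘(ℂ, Fin d → ℂ)] {s : ∀ x, L x}
  {M : Y → Type*} [∀ y, TopologicalSpace (M y)] [∀ y, AddCommGroup (M y)]
  [∀ y, Module ℂ (M y)] [TopologicalSpace (TotalSpace ℂ M)] [FiberBundle ℂ M]
  [VectorBundle ℂ ℂ M] [ContMDiffVectorBundle ω ℂ M 𝓘(ℂ, Fin n → ℂ)] {t : ∀ y, M y}

/-- The theorem for the part of the form cut out near a point by one of the functions of the
partition of unity. -/
theorem ResidueData.exists_formLeading_pair (hD : IsNormalCrossing d D) {α : DForm d k X}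
    (hα : IsQuasiMeromorphic D α)
    {hkl : k + l = 2 * d} {ξ : DForm d l X} (hξ : SmoothFormOn ξ univ)
    (hs : IsHolSection d s) (hsD : ∀ x, s x = 0 ↔ x ∈ D) (h : LineMetric d L)
    (ho : ∀ x ∈ deepStratum D α, orderAt D α s x = orderMax D α s)
    (hn : n + kappa D α = d) (hj : IsHolEmbedding (n := n) (d := d) j)
    (hjE : range j = deepStratum D α) (ht : IsHolSection n t)
    (htD : ∀ y, t y = 0 ↔ y ∈ residualDivisor d D (kappa D α) j) (g : LineMetric n M)
    (P : ResidueData n D (deepStratum D α) (topWedge hkl α ξ) ι) (x : X) (i : ι) :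
    ∃ U : Set X, IsOpen U ∧ x ∈ U ∧ ∀ χ : X → ℝ,
      ContMDiff 𝓘(ℝ, Fin d → ℂ) 𝓘(ℝ, ℝ) ∞ χ → tsupport χ ⊆ U → ∃ c c' : ℂ,
      FormLeading (fun x ↦ h.len x (s x))
        (fun x ↦ ((χ x * P.ρ i x : ℝ) : ℂ) • topWedge hkl α ξ x) (kappa D α) c ∧
      FormLeading (fun y ↦ g.len y (t y))
        (residueForm (P.φ i) (P.tang i) (P.R i) (P.J i) (P.K i)
          (fun z ↦ ((χ ((P.φ i).symm z) * P.ρ i ((P.φ i).symm z) : ℝ) : ℂ) * P.ψ i z) j) 0 c' ∧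
      (orderMax D α s : ℂ) * c = (-2 * (Real.pi : ℂ) * Complex.I) ^ kappa D α * c' := by
  have hmul : ∀ χ : X → ℝ, ContMDiff 𝓘(ℝ, Fin d → ℂ) 𝓘(ℝ, ℝ) ∞ χ →
      ContMDiff 𝓘(ℝ, Fin d → ℂ) 𝓘(ℝ, ℝ) ∞ fun x ↦ χ x * P.ρ i x := fun χ hχ ↦
    hχ.mul (P.ρ i).contMDiff
  have hsup : ∀ χ : X → ℝ, tsupport (fun x ↦ χ x * P.ρ i x) ⊆ tsupport χ := fun χ ↦
    tsupport_mul_subset_left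
  have hzero : ∀ χ : X → ℝ, (∀ y, j y ∉ tsupport fun x ↦ χ x * P.ρ i x) →
      FormLeading (fun y ↦ g.len y (t y))
        (residueForm (P.φ i) (P.tang i) (P.R i) (P.J i) (P.K i)
          (fun z ↦ ((χ ((P.φ i).symm z) * P.ρ i ((P.φ i).symm z) : ℝ) : ℂ) * P.ψ i z) j) 0 0 :=
    fun χ hχ ↦ by
      have h1 := formLeading_zero (d := n) (fun y ↦ g.len y (t y)) 0
      convert! h1 using 1
      exact funext fun y ↦ residueForm_cutoff_eq_zero (χ := fun x ↦ χ x * P.ρ i x) (hχ y)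
  -- Near a point of the deepest stratum, the chart of the residue contributes if the point is in
  -- the support of `ρ_i`, and otherwise both forms vanish. Away from the stratum, the pole on `X`
  -- has order at most `κ_x(α) < κ(α)`, and the residue vanishes.
  by_cases hxE : x ∈ deepStratum D α
  · by_cases hxi : x ∈ tsupport (P.ρ i)
    · obtain ⟨y, rfl⟩ : x ∈ range j := hjE ▸ hxE
      have hyi := P.subordinate i hxi
      have hne : (deepStratum D α ∩ (P.φ i).source).Nonempty := ⟨j y, hxE, hyi⟩
      obtain ⟨U, hU, hyU, H⟩ := exists_formLeading_pair_of_slice hα hkl hξ hs hsD h ho hn hj hjE ht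
        htD g (P.isSlice hjE hyi) (P.isAdapted i) (P.R_eq i) (P.R_subset i hne) (P.one_le i)
        (P.ψ_smooth i hne) (P.ψ_eq i hne) hyi
      exact ⟨U, hU, hyU, fun χ hχ hχU ↦ H _ (hmul χ hχ) ((hsup χ).trans hχU)⟩
    · refine ⟨(tsupport (P.ρ i))ᶜ, (isClosed_tsupport _).isOpen_compl, hxi, fun χ hχ hχU ↦ ?_⟩
      have h0 : ∀ x, χ x * P.ρ i x = 0 := fun x ↦ by
        by_cases hx : x ∈ tsupport (P.ρ i)
        · rw [image_eq_zero_of_notMem_tsupport (f := χ) fun h ↦ hχU h hx, zero_mul]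
        · rw [image_eq_zero_of_notMem_tsupport (f := P.ρ i) hx, mul_zero]
      refine ⟨0, 0, ?_, hzero χ fun y ↦ ?_, by simp⟩
      · simpa only [h0, Complex.ofReal_zero, zero_smul] using formLeading_zero (d := d) _ _
      · simp [h0, tsupport]
  · obtain ⟨U, hU, hxU, H⟩ := exists_formLeading_kappaAt hD hα hkl hξ hs hsD h x
    have hE : IsClosed (deepStratum D α) :=
      hjE ▸ (hj.1.continuous.isClosedEmbedding hj.2.1).isClosed_range
    refine ⟨U ∩ (deepStratum D α)ᶜ, hU.inter hE.isOpen_compl, ⟨hxU, hxE⟩, fun χ hχ hχU ↦ ?_⟩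
    obtain ⟨c, hc⟩ := H _ (hmul χ hχ) ((hsup χ).trans (hχU.trans inter_subset_left))
    refine ⟨0, 0, hc.of_lt (lt_of_le_of_ne (kappaAt_le_kappa α x) hxE),
      hzero χ fun y hy ↦ (hχU (hsup χ hy)).2 (hjE ▸ mem_range_self y), by simp⟩

end Comparison

/-- The maximum `κ(α)` is attained, because the numbers `κ_x(α)` are bounded. -/
theorem exists_kappaAt_eq_kappa {d k : ℕ} {X : Type*} [TopologicalSpace X]
    [ChartedSpace (Fin d → ℂ) X] [Nonempty X] (D : Set X) (α : DForm d k X) :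
    ∃ x, kappaAt D α x = kappa D α := by
  have h1 : BddAbove (range fun x ↦ kappaAt D α x) :=
    ⟨d, by rintro _ ⟨y, rfl⟩; exact kappaAt_le α⟩
  exact Nat.sSup_mem (range_nonempty _) h1

theorem theorem3p11 {d : ℕ} {X : Type*} [TopologicalSpace X] [T2Space X] [CompactSpace X]
    [ChartedSpace (Fin d → ℂ) X] [IsManifold 𝓘(ℂ, Fin d → ℂ) ω X]
    (D : Set X) (hD : IsNormalCrossing d D)
    {k l : ℕ} (hkl : k + l = 2 * d)
    (α : DForm d k X) (hα : IsQuasiMeromorphic D α)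
    (ξ : DForm d l X) (hξ : SmoothFormOn ξ univ)
    -- a holomorphic section `s` with zero set `D`, and a metric
    {L : X → Type*} [∀ x, TopologicalSpace (L x)] [∀ x, AddCommGroup (L x)]
    [∀ x, Module ℂ (L x)] [TopologicalSpace (TotalSpace ℂ L)] [FiberBundle ℂ L]
    [VectorBundle ℂ ℂ L] [ContMDiffVectorBundle ω ℂ L 𝓘(ℂ, Fin d → ℂ)]
    (s : ∀ x, L x) (hs : IsHolSection d s) (hsD : ∀ x, s x = 0 ↔ x ∈ D) (h : LineMetric d L)
    (ho : ∀ x ∈ deepStratum D α, orderAt D α s x = orderMax D α s)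
    -- the complex submanifold `E(α)`, as the image of `j`
    {n : ℕ} (hn : n + kappa D α = d)
    {Y : Type*} [TopologicalSpace Y] [T2Space Y] [CompactSpace Y]
    [ChartedSpace (Fin n → ℂ) Y] [IsManifold 𝓘(ℂ, Fin n → ℂ) ω Y]
    (j : Y → X) (hj : IsHolEmbedding (n := n) (d := d) j) (hjE : range j = deepStratum D α)
    -- a holomorphic section `t` on `E(α)` with zero set the residual divisor, and a metric
    {M : Y → Type*} [∀ y, TopologicalSpace (M y)] [∀ y, AddCommGroup (M y)]
    [∀ y, Module ℂ (M y)] [TopologicalSpace (TotalSpace ℂ M)] [FiberBundle ℂ M]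
    [VectorBundle ℂ ℂ M] [ContMDiffVectorBundle ω ℂ M 𝓘(ℂ, Fin n → ℂ)]
    (t : ∀ y, M y) (ht : IsHolSection n t)
    (htD : ∀ y, t y = 0 ↔ y ∈ residualDivisor d D (kappa D α) j) (g : LineMetric n M)
    -- a representative `θ` of the iterated residue of `α ∧ ξ`
    {ι : Type*} [Fintype ι]
    (P : ResidueData n D (deepStratum D α) (topWedge hkl α ξ) ι)
    (θ : DForm n (2 * n) Y)
    (hθ : AeppliCohomologous (residualDivisor d D (kappa D α) j) θ (P.form j)) :
    ∃ c c' : ℂ,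
      HasCanonicalValue D hkl α ξ s h c ∧
      HasCanonicalValue (residualDivisor d D (kappa D α) j) (Nat.add_zero (2 * n)) θ oneForm t g c' ∧
      c = (-2 * (Real.pi : ℂ) * Complex.I) ^ kappa D α * c' := by
  -- The deepest stratum is empty only if `X` is.
  rcases isEmpty_or_nonempty Y with hY | hY
  · have hX : IsEmpty X := by
      rw [← not_nonempty_iff]
      intro hX
      obtain ⟨x, hx⟩ := exists_kappaAt_eq_kappa D α
      have : x ∈ range j := hjE ▸ hx
      exact isEmptyElim this.choose
    have h1 : topWedge hkl α ξ = fun _ ↦ 0 := funext fun x ↦ hX.elim x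
    have h2 : topWedge (Nat.add_zero (2 * n)) θ oneForm = fun _ ↦ 0 := funext fun y ↦ hY.elim y
    exact ⟨_, _, FormLeading.hasCanonicalValue (h1 ▸ formLeading_zero _ _),
      FormLeading.hasCanonicalValue (h2 ▸ formLeading_zero _ _), by simp⟩
  -- The products of a second partition of unity with the functions `ρ_i` localise both forms to
  -- the sets where the leading coefficients are known.
  choose U hU hxU H using P.exists_formLeading_pair hD hα hξ hs hsD h ho hn hj hjE ht htD g
  obtain ⟨B, χ, hχ, hχU, hsum⟩ := exists_finite_smooth_partition (d := d)
    (fun x ↦ ⋂ i, U x i) (fun x ↦ isOpen_iInter_of_finite (hU x)) fun x ↦ mem_iInter.2 (hxU x)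
  choose c c' hc hc' hcc' using fun b i ↦
    H b i (χ b) (hχ b) ((hχU b).trans (iInter_subset _ i))
  have hX := FormLeading.sum B fun b _ ↦ FormLeading.sum Finset.univ fun i _ ↦ hc b i
  have hYP := FormLeading.sum B fun b _ ↦ FormLeading.sum Finset.univ fun i _ ↦ hc' b i
  have hN : ∀ y : Y, ∃ Φ ∈ IsManifold.maximalAtlas 𝓘(ℂ, Fin n → ℂ) ω Y, y ∈ Φ.source ∧
      ∀ y' ∈ Φ.source, y' ∈ residualDivisor d D (kappa D α) j → ∃ a, Φ y' a = 0 := fun y ↦ by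
    obtain ⟨i, hi⟩ := P.exists_mem_source (j y)
    have h1 := P.isAdapted_sliceChart hj hjE hn hi
    refine ⟨_, h1.1, hi, fun y' hy' hyD ↦ ?_⟩
    obtain ⟨a, -, ha⟩ := (h1.2 y' hy').1 hyD
    exact ⟨a, ha⟩
  have hX' : FormLeading (fun x ↦ h.len x (s x)) (topWedge hkl α ξ) (kappa D α)
      (∑ b ∈ B, ∑ i, c b i) := by
    convert! hX using 1
    funext x
    have h1 : ∑ i, P.ρ i x = 1 := by
      rw [← finsum_eq_sum_of_fintype]
      exact P.ρ.sum_eq_one (mem_univ x)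
    simp only [← Finset.sum_smul, ← Complex.ofReal_sum, ← Finset.mul_sum, h1, mul_one, hsum,
      Complex.ofReal_one, one_smul]
  obtain ⟨σ, hσ, hθσ⟩ := hθ.exists_eq
  have hσL : FormLeading (fun y ↦ g.len y (t y)) σ 0 0 := by
    rcases hσ with rfl | ⟨m, hm, γ, hγ, rfl⟩
    · exact formLeading_zero _ _
    · refine formLeading_extDerivForm hm hγ fun y ↦ ?_
      obtain ⟨i, hi⟩ := P.exists_mem_source (j y)
      have h1 := P.isAdapted_sliceChart hj hjE hn hi
      obtain ⟨I, v, -, hv, hw⟩ := h1.exists_weight (x := y) hi ht htD g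
      exact ⟨_, h1.1, hi, I, v, hv, hw⟩
  have hYθ : FormLeading (fun y ↦ g.len y (t y)) θ 0 (∑ b ∈ B, ∑ i, c' b i) := by
    have h1 := (hYP.add hσL).congr (η' := θ) hN fun y hy ↦ by
      rw [hθσ y hy, ← P.sum_residueForm hj hjE hn B hχ hsum hy]
    rwa [add_zero] at h1
  have hpole := P.kappaAt_eq_zero_and_orderAt_eq_one hα hξ hs hsD h hn hj hjE ht htD hθ
  have hκ : kappa (residualDivisor d D (kappa D α) j) θ = 0 := by
    rw [kappa, iSup_congr fun y ↦ (hpole y).1, ciSup_const]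
  have ho1 : orderMax (residualDivisor d D (kappa D α) j) θ t = 1 := by
    rw [orderMax, iSup_congr fun y ↦ (hpole y).2, ciSup_const]
  refine ⟨_, ∑ b ∈ B, ∑ i, c' b i, hX'.hasCanonicalValue, ?_, ?_⟩
  · have h1 := FormLeading.hasCanonicalValue (D := residualDivisor d D (kappa D α) j)
      (hkl := Nat.add_zero (2 * n)) (α := θ) (ξ := oneForm) (s := t) (h := g)
      (by rw [hκ, topWedge_oneForm]; exact hYθ)
    rwa [ho1, Nat.cast_one, one_mul] at h1
  · simp only [Finset.mul_sum, hcc']
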